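/- Let $\mathbb{F}_q$ be a finite field with $q$ elements, $q$ odd, let $\overline{\mathbb{F}}_q$ be an algebraic closure, and let $F$ be the Frobenius map $[a:b:c]\mapsto[a^q:b^q:c^q]$ of $\mathbb{P}^2(\overline{\mathbb{F}}_q)$. An ordered septuple $(P_1,\dots,P_7)$ of points of $\mathbb{P}^2(\overline{\mathbb{F}}_q)$ is in general position if no line passes through three of the points and no (possibly singular) conic passes through six of them. Let $\mathcal{P}^2_7$ be the set of septuples in general position modulo $\mathrm{PGL}_3(\overline{\mathbb{F}}_q)$. For $\sigma\in S_7$ let $F\sigma$ act on septuples by $(P_i)_i\mapsto (F P_{\sigma(i)})_i$, so that a septuple is fixed by $F\sigma$ if and only if $F P_i=P_{\sigma^{-1}(i)}$ for all $i$, and let it act on $\mathcal{P}^2_7$ by the induced map. Let $\lambda$ be the cycle type of $\sigma$ (a partition of $7$). Then the number of septuples in general position fixed by $F\sigma$ is finite, and this number divided by $|\mathrm{PGL}_3(\mathbb{F}_q)|$ equals $f_\lambda(q)$; likewise the set of fixed points of $F\sigma$ on $\mathcal{P}^2_7$ is finite with exactly $f_\lambda(q)$ elements. Here $f_\lambda$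 is the following monic polynomial of degree $6$: \begin{align*} [7]&: q^6+q^3\\ [6,1]&: q^6-2q^3+1\\ [5,2]&: q^6-q^2\\ [5,1^2]&: q^6-q^2\\ [4,3]&: q^6-q^5-2q^4+q^3+q^2\\ [4,2,1]&: q^6-q^5-2q^4+q^3-2q^2+3\\ [4,1^3]&: q^6-q^5-2q^4+q^3-2q^2+3\\ [3^2,1]&: q^6-2q^5-2q^4-8q^3+16q^2+10q+21\\ [3,2^2]&: q^6-q^5-2q^4+3q^3+q^2-2q\\ [3,2,1^2]&: q^6-3q^5+5q^3-q^2-2q\\ [3,1^4]&: q^6-5q^5+10q^4-5q^3-11q^2+10q\\ [2^3,1]&: q^6-3q^5-6q^4+19q^3+6q^2-24q+7\\ [2^2,1^3]&: q^6-7q^5+10q^4+15q^3-26q^2-8q+15\\ [2,1^5]&: q^6-15q^5+90q^4-265q^3+374q^2-200q+15\\ [1^7]&: q^6-35q^5+490q^4-3485q^3+13174q^2-24920q+18375 \end{align*} -/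

import Mathlib

open scoped LinearAlgebra.Projectivization MatrixGroups

namespace PlaneSeptuples

section Geometry

variable (K : Type*) [Field K]

/-- The set of `K`-points of the projective plane. -/
abbrev Plane : Type _ := ℙ K (Fin 3 → K)

/-- Ordered septuples of points of the projective plane. -/
abbrev Septuple : Type _ := Fin 7 → Plane K

variable {K}

/-- The plane curve `f = 0` passes through `P`: the form `f` vanishes at all homogeneous
coordinate vectors of `P`. -/
def PassesThrough (f : MvPolynomial (Fin 3) K) (P : Plane K) : Prop :=
  ∀ v ∈ P.submodule, MvPolynomial.eval v f = 0

/-- Some plane curve of degree `d` (possibly singular or reducible) passes through all points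
`T i` with `i ∈ S`. -/
def LieOnCurve (d : ℕ) (T : Septuple K) (S : Finset (Fin 7)) : Prop :=
  ∃ f : MvPolynomial (Fin 3) K, f ≠ 0 ∧ f.IsHomogeneous d ∧ ∀ i ∈ S, PassesThrough f (T i)

/-- General position: no line passes through three of the points, no conic through six. -/
def InGeneralPosition (T : Septuple K) : Prop :=
  (∀ S : Finset (Fin 7), S.card = 3 → ¬ LieOnCurve 1 T S) ∧
    (∀ S : Finset (Fin 7), S.card = 6 → ¬ LieOnCurve 2 T S)

variable (K) in
/-- Septuples of points modulo the diagonal action of `PGL(3)`. -/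
abbrev SeptupleClass : Type _ := MulAction.orbitRel.Quotient PGL(3, K) (Septuple K)

variable (K) in
/-- The `K`-points of the space of septuples in general position up to projective equivalence. -/
def moduliSpace : Set (SeptupleClass K) :=
  {x | ∃ T : Septuple K, InGeneralPosition T ∧ x = Quotient.mk _ T}

end Geometry

section Frobenius

variable (F : Type*) [Field F] [Fintype F] {K : Type*} [Field K] [Algebra F K]

/-- The map `(a, b, c) ↦ (a ^ q, b ^ q, c ^ q)`, where `q` is the number of elements of `F`. -/
def frobeniusVec :
    (Fin 3 → K) →ₛₗ[(FiniteField.frobeniusAlgHom F K : K →+* K)] (Fin 3 → K) where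
  toFun v i := v i ^ Fintype.card F
  map_add' v w := by
    funext i
    exact map_add (FiniteField.frobeniusAlgHom F K) (v i) (w i)
  map_smul' a v := by
    funext i
    exact mul_pow a (v i) _

theorem frobeniusVec_injective : Function.Injective (frobeniusVec F (K := K)) := by
  intro v w h
  funext i
  exact (FiniteField.frobeniusAlgHom F K : K →+* K).injective (congrFun h i)

/-- The Frobenius endomorphism `[a : b : c] ↦ [a ^ q : b ^ q : c ^ q]` of the plane. -/
def frobenius : Plane K → Plane K :=
  Projectivization.map (frobeniusVec F) (frobeniusVec_injective F)

/-- The action of `F ∘ σ` on septuples, for a permutation `σ`. A septuple is fixed if and only if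
`frobenius F (T i) = T (σ⁻¹ i)` for all `i`. -/
def frobeniusPerm (σ : Equiv.Perm (Fin 7)) (T : Septuple K) : Septuple K :=
  fun i => frobenius F (T (σ i))

theorem frobenius_smul (g : PGL(3, K)) :
    ∃ h : PGL(3, K), ∀ P : Plane K, frobenius F (g • P) = h • frobenius F P := by
  induction g using Matrix.ProjGenLinGroup.induction_on with
  | mk g =>
    refine ⟨Matrix.ProjGenLinGroup.mk (Matrix.GeneralLinearGroup.map
      (FiniteField.frobeniusAlgHom F K : K →+* K) g), fun P => ?_⟩
    induction P using Projectivization.ind with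
    | h v hv =>
      have key : frobeniusVec F (g • v) = Matrix.GeneralLinearGroup.map
          (FiniteField.frobeniusAlgHom F K : K →+* K) g • frobeniusVec F v := by
        funext i
        change (FiniteField.frobeniusAlgHom F K : K →+* K) ((g.1.mulVec v) i) = _
        rw [RingHom.map_mulVec]
        rfl
      simp only [frobenius, Projectivization.PGL.mk_smul_mk, Projectivization.map_mk, key]

/-- The map induced by `F ∘ σ` on septuples modulo `PGL(3)`. -/
def frobeniusPermClass (σ : Equiv.Perm (Fin 7)) : SeptupleClass K → SeptupleClass K :=
  Quotient.map (frobeniusPerm F σ) (by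
    rintro _ T ⟨g, rfl⟩
    obtain ⟨h, hh⟩ := frobenius_smul F g
    exact ⟨h, funext fun i => (hh (T (σ i))).symm⟩)

variable (K) in
/-- The septuples in general position fixed by `F ∘ σ`. -/
def fixedSeptuples (σ : Equiv.Perm (Fin 7)) : Set (Septuple K) :=
  {T | InGeneralPosition T ∧ frobeniusPerm F σ T = T}

variable (K) in
/-- The points of the space of septuples in general position up to projective equivalence that
are fixed by `F ∘ σ`. -/
def fixedClasses (σ : Equiv.Perm (Fin 7)) : Set (SeptupleClass K) :=
  {x | x ∈ moduliSpace K ∧ frobeniusPermClass F σ x = x}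

end Frobenius

open Polynomial in
/-- The fifteen cycle types of permutations of seven letters (fixed points included as parts `1`),
each with its polynomial. -/
noncomputable def pointCountTable : List (Multiset ℕ × ℤ[X]) :=
  [({7}, X ^ 6 + X ^ 3),
   ({6, 1}, X ^ 6 - 2 * X ^ 3 + 1),
   ({5, 2}, X ^ 6 - X ^ 2),
   ({5, 1, 1}, X ^ 6 - X ^ 2),
   ({4, 3}, X ^ 6 - X ^ 5 - 2 * X ^ 4 + X ^ 3 + X ^ 2),
   ({4, 2, 1}, X ^ 6 - X ^ 5 - 2 * X ^ 4 + X ^ 3 - 2 * X ^ 2 + 3),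
   ({4, 1, 1, 1}, X ^ 6 - X ^ 5 - 2 * X ^ 4 + X ^ 3 - 2 * X ^ 2 + 3),
   ({3, 3, 1}, X ^ 6 - 2 * X ^ 5 - 2 * X ^ 4 - 8 * X ^ 3 + 16 * X ^ 2 + 10 * X + 21),
   ({3, 2, 2}, X ^ 6 - X ^ 5 - 2 * X ^ 4 + 3 * X ^ 3 + X ^ 2 - 2 * X),
   ({3, 2, 1, 1}, X ^ 6 - 3 * X ^ 5 + 5 * X ^ 3 - X ^ 2 - 2 * X),
   ({3, 1, 1, 1, 1}, X ^ 6 - 5 * X ^ 5 + 10 * X ^ 4 - 5 * X ^ 3 - 11 * X ^ 2 + 10 * X),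
   ({2, 2, 2, 1}, X ^ 6 - 3 * X ^ 5 - 6 * X ^ 4 + 19 * X ^ 3 + 6 * X ^ 2 - 24 * X + 7),
   ({2, 2, 1, 1, 1}, X ^ 6 - 7 * X ^ 5 + 10 * X ^ 4 + 15 * X ^ 3 - 26 * X ^ 2 - 8 * X + 15),
   ({2, 1, 1, 1, 1, 1},
      X ^ 6 - 15 * X ^ 5 + 90 * X ^ 4 - 265 * X ^ 3 + 374 * X ^ 2 - 200 * X + 15),
   ({1, 1, 1, 1, 1, 1, 1},
      X ^ 6 - 35 * X ^ 5 + 490 * X ^ 4 - 3485 * X ^ 3 + 13174 * X ^ 2 - 24920 * X + 18375)]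

end PlaneSeptuples

/-!
Fixed classes are counted by fixed septuples. If the class of `T` is fixed, then `F ∘ σ` maps `T` to
`g • T` for some collineation `g`, and Lang's theorem (`exists_map_mul_eq`) lets `T` be replaced by a
projectively equivalent septuple that is itself fixed. A collineation fixing four points in general
position is trivial (`eq_one_of_smul_eq`), so two fixed septuples in one class differ by a unique
collineation, which commutes with Frobenius and therefore has coefficients in `F`
(`exists_map_algebraMap_eq`). Hence every fixed class contains exactly `|PGL(3, F)|` fixed septuples
(`ncard_fixedSeptuples_eq`), and it remains to count these.

A septuple is in general position if it is an arc (its points are distinct and no three are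
collinear) and no smooth conic contains six of its points (`inGeneralPosition_iff`). It is fixed by
`F ∘ σ` if Frobenius acts on it as `σ⁻¹`. The counting uses only incidence, the numbers of fixed
points and lines of the powers of Frobenius, the absence of Fano configurations, and the basic
properties of conics; these are recorded as `FrobeniusPlane` and `ConicSystem`. The counts depend
only on the cycle type, which is represented by the permutation `rot l` for a list `l` of cycle
lengths.

The number `arcCount` of arcs permuted in a given way is found by adding one cycle at a time. A new
fixed point has to avoid the secants of the arc. The fixed points on the secants are counted by
inclusion and exclusion (`two_mul_ncard_onSecant`); the secants through a point outside an arc of at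
most six points are pairwise disjoint pairs of points, so at most three of them meet there. A new
conjugate pair or triple is treated as a fixed point of the square or the cube of Frobenius. A
single orbit is an arc unless it lies on a fixed line or, for six points, its halves do
(`orbit_arc_iff`, `orbit_arc_six_iff`); an orbit of seven points could otherwise only form a Fano
plane. Two orbits of length three form an arc if neither meets the triangle of the other
(`ncard_cubic_pairs`).

From six points to seven, the inclusion and exclusion needs a correction for the partitions of the
six indices into three pairs (synthemes) whose joining lines are concurrent, each with a sign
determined by the action of Frobenius on the three pairs (`sum_concurrencySign`). The septuples with
exactly six points on a conic are subtracted next: the seventh point is then fixed by Frobenius, and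
the same correction, for sextuples on conics, counts the admissible positions of this point
(`goodCount_eq`, `goodCount_addCycle_one`). There are `q ^ 5 - q ^ 2` smooth conics fixed by
Frobenius (`ncard_rational`), and each of them has `q ^ d + 1` points fixed by the `d`-th power of
Frobenius, which gives the number of sextuples and septuples on conics.

Sextuples with three given concurrent joining lines are counted in coordinates. The lines are spanned
by a vector `o` and vectors `w 0`, `w 1`, `w 2` with sum zero, chosen compatibly with Frobenius
(`IsFrame`, `exists_isFrame`), so that the six points are `w b + u j • o` for six scalars `u j`. Three
points on different lines are collinear if and only if their scalars add up to zero
(`IsFrame.arc_point_iff`), and the six points lie on a conic if and only if the sum of all scalars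
vanishes (`IsFrame.onConic_point_iff`). If the scalars of the first two pairs have
differences `α + β` and `α - β`, then, after a shift, the two scalars of the third pair only have to avoid
`±α` and `±β` and to be distinct (`transverseCount_eq`). The resulting `TransverseCounts` are combined
over all synthemes in `concSums_of_transverseCounts`, and `exists_goodCount_eq` assembles the table.
-/

namespace PlaneSeptuples

open Function Finset
open Equiv (Perm)

/-! ### Counting in fibres -/

section Counting

variable {α β : Type*}

theorem ncard_eq_sum_fiber {A : Set α} {B : Set β} (hA : A.Finite) (hB : B.Finite) (f : α → β)
    (hf : ∀ a ∈ A, f a ∈ B) :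
    (A.ncard : ℤ) = ∑ b ∈ hB.toFinset, ({a ∈ A | f a = b}.ncard : ℤ) := by
  classical
  rw [Set.ncard_eq_toFinset_card A hA,
    card_eq_sum_card_fiberwise (f := f) (t := hB.toFinset) (by
      intro a ha
      simpa using hf a (by simpa using ha))]
  push_cast
  refine sum_congr rfl fun b _ => ?_
  rw [← Set.ncard_coe_finset]
  congr 2
  ext a
  simp

theorem ncard_eq_mul_of_fiber {A : Set α} {B : Set β} (hA : A.Finite) (hB : B.Finite) (f : α → β)
    (hf : ∀ a ∈ A, f a ∈ B) {k : ℤ} (hk : ∀ b ∈ B, ({a ∈ A | f a = b}.ncard : ℤ) = k) :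
    (A.ncard : ℤ) = B.ncard * k := by
  rw [ncard_eq_sum_fiber hA hB f hf, sum_congr rfl (fun b hb => hk b (by simpa using hb)),
    sum_const, Set.ncard_eq_toFinset_card B hB, nsmul_eq_mul]

theorem ncard_add_ncard_not {A : Set α} (hA : A.Finite) (p : α → Prop) :
    (({a ∈ A | p a}.ncard : ℤ)) + {a ∈ A | ¬ p a}.ncard = A.ncard := by
  have h : A = {a ∈ A | p a} ∪ {a ∈ A | ¬ p a} := by
    ext a
    by_cases h : p a <;> simp [h]
  conv_rhs => rw [h]
  rw [Set.ncard_union_eq (Set.disjoint_left.2 fun a h1 h2 => h2.2 h1.2)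
    (hA.subset fun a ha => ha.1) (hA.subset fun a ha => ha.1)]
  push_cast
  ring

end Counting

/-! ### Twisted tuples -/

section Twisted

variable {X ι κ : Type*}

/-- Tuples on which the self-map `φ` acts as the permutation `ρ` of the indices. -/
def Twisted (φ : X → X) (ρ : Perm ι) : Set (ι → X) :=
  {T | ∀ i, φ (T i) = T (ρ i)}

theorem Twisted.iterate {φ : X → X} {ρ : Perm ι} {T : ι → X} (hT : T ∈ Twisted φ ρ) (n : ℕ)
    (i : ι) : φ^[n] (T i) = T (ρ^[n] i) := by
  induction n generalizing i with
  | zero => rfl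
  | succ n ih => rw [iterate_succ_apply, iterate_succ_apply, hT i, ih]

theorem Twisted.iterate_mem {φ : X → X} {ρ : Perm ι} {T : ι → X} (hT : T ∈ Twisted φ ρ)
    (n : ℕ) : T ∈ Twisted (φ^[n]) (ρ ^ n) := fun i => by
  rw [Twisted.iterate hT, Equiv.Perm.iterate_eq_pow]

theorem Twisted.finite [Finite ι] {φ : X → X} (hφ : ∀ d, 0 < d → {x | φ^[d] x = x}.Finite)
    (ρ : Perm ι) : (Twisted φ ρ).Finite := by
  refine (Set.Finite.pi' fun _ : ι => hφ (orderOf ρ) (orderOf_pos ρ)).subset fun T hT i => ?_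
  show φ^[orderOf ρ] (T i) = T i
  rw [Twisted.iterate hT, Equiv.Perm.iterate_eq_pow, pow_orderOf_eq_one, Equiv.Perm.one_apply]

theorem Twisted.comp_mem_iff {φ : X → X} {ρ : Perm ι} {ρ' : Perm κ} (e : ι ≃ κ)
    (he : ∀ i, e (ρ i) = ρ' (e i)) {T : κ → X} : T ∘ e ∈ Twisted φ ρ ↔ T ∈ Twisted φ ρ' := by
  constructor
  · intro h k
    have := h (e.symm k)
    simpa [he] using this
  · intro h i
    simpa [he] using h (e i)

/-- Relabelling the indices does not change the number of twisted tuples. -/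
theorem Twisted.ncard_congr {φ : X → X} {ρ : Perm ι} {ρ' : Perm κ} (e : ι ≃ κ)
    (he : ∀ i, e (ρ i) = ρ' (e i)) (p : (ι → X) → Prop) (p' : (κ → X) → Prop)
    (hp : ∀ T, p (T ∘ e) ↔ p' T) :
    {T ∈ Twisted φ ρ | p T}.ncard = {T ∈ Twisted φ ρ' | p' T}.ncard := by
  symm
  refine Set.ncard_congr (fun T _ => T ∘ e) ?_ ?_ ?_
  · rintro T ⟨h1, h2⟩
    exact ⟨(Twisted.comp_mem_iff e he).2 h1, (hp T).2 h2⟩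
  · intro S T _ _ h
    exact e.surjective.injective_comp_right h
  · rintro T ⟨h1, h2⟩
    have h3 : (T ∘ e.symm) ∘ e = T := by
      funext i
      simp
    refine ⟨T ∘ e.symm, ⟨(Twisted.comp_mem_iff e he).1 (by rwa [h3]), (hp _).1 (by rwa [h3])⟩, h3⟩

/-- The tuple `T` extended by the orbit `x, φ x, …` of `x`. -/
def extend (φ : X → X) (d : ℕ) (x : X) (T : ι → X) : Fin d ⊕ ι → X :=
  Sum.elim (fun k => φ^[k] x) T

/-- The permutation `ρ` extended by a cycle of length `d`. -/
def addCycle (d : ℕ) (ρ : Perm ι) : Perm (Fin d ⊕ ι) :=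
  Equiv.sumCongr (finRotate d) ρ

theorem iterate_finRotate {φ : X → X} {n : ℕ} {x : X} (hx : φ^[n + 1] x = x) (k : Fin (n + 1)) :
    φ (φ^[(k : ℕ)] x) = φ^[(finRotate (n + 1) k : ℕ)] x := by
  rw [← iterate_succ_apply' φ]
  rcases eq_or_ne k (Fin.last n) with rfl | hk
  · simp [hx]
  · rw [coe_finRotate_of_ne_last hk]

theorem extend_mem_twisted {φ : X → X} {ρ : Perm ι} {n : ℕ} {x : X} {T : ι → X}
    (hx : φ^[n + 1] x = x) (hT : T ∈ Twisted φ ρ) :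
    extend φ (n + 1) x T ∈ Twisted φ (addCycle (n + 1) ρ) := by
  rintro (k | i)
  · exact iterate_finRotate hx k
  · exact hT i

theorem exists_eq_extend {φ : X → X} {ρ : Perm ι} {n : ℕ} {S : Fin (n + 1) ⊕ ι → X}
    (hS : S ∈ Twisted φ (addCycle (n + 1) ρ)) :
    φ^[n + 1] (S (.inl 0)) = S (.inl 0) ∧ S ∘ Sum.inr ∈ Twisted φ ρ ∧
      extend φ (n + 1) (S (.inl 0)) (S ∘ Sum.inr) = S := by
  have key : ∀ k (hk : k < n + 1), φ^[k] (S (.inl 0)) = S (.inl ⟨k, hk⟩) := by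
    intro k
    induction k with
    | zero => intro _; rfl
    | succ k ih =>
      intro hk
      rw [iterate_succ_apply', ih (by omega), hS]
      show S (.inl (finRotate (n + 1) ⟨k, by omega⟩)) = _
      congr 2
      rw [finRotate_of_lt (by omega)]
  refine ⟨?_, fun i => hS (.inr i), ?_⟩
  · rw [iterate_succ_apply', key n (by omega), hS]
    show S (.inl (finRotate (n + 1) (Fin.last n))) = _
    rw [finRotate_last]
  · funext j
    rcases j with k | i
    · exact key k k.2
    · rfl

/-- Twisted tuples for a permutation with a distinguished cycle of length `n + 1` consist of a
twisted tuple on the other indices and a point `x` with `φ ^ (n + 1) x = x`. -/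
theorem ncard_twisted_addCycle [Finite ι] {φ : X → X}
    (hφ : ∀ d, 0 < d → {x | φ^[d] x = x}.Finite)
    (ρ : Perm ι) (n : ℕ) (p : (ι → X) → Prop) (p' : (Fin (n + 1) ⊕ ι → X) → Prop)
    (hp : ∀ x T, φ^[n + 1] x = x → T ∈ Twisted φ ρ → p' (extend φ (n + 1) x T) → p T)
    (hfin : {T ∈ Twisted φ ρ | p T}.Finite) :
    ({S ∈ Twisted φ (addCycle (n + 1) ρ) | p' S}.ncard : ℤ) =
      ∑ T ∈ hfin.toFinset, ({x | φ^[n + 1] x = x ∧ p' (extend φ (n + 1) x T)}.ncard : ℤ) := by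
  rw [ncard_eq_sum_fiber ((Twisted.finite hφ _).subset fun T hT => hT.1) hfin (fun S => S ∘ Sum.inr)]
  · refine sum_congr rfl fun T hT => ?_
    have hT' : T ∈ Twisted φ ρ ∧ p T := by simpa using hT
    congr 1
    symm
    refine Set.ncard_congr (fun x _ => extend φ (n + 1) x T) ?_ ?_ ?_
    · rintro x ⟨h1, h2⟩
      exact ⟨⟨extend_mem_twisted h1 hT'.1, h2⟩, rfl⟩
    · intro x y _ _ h
      exact congrFun h (.inl 0)
    · rintro S ⟨⟨h1, h2⟩, rfl⟩
      obtain ⟨h3, h4, h5⟩ := exists_eq_extend h1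
      exact ⟨_, ⟨h3, by rwa [h5]⟩, h5⟩
  · rintro S ⟨h1, h2⟩
    obtain ⟨h3, h4, h5⟩ := exists_eq_extend h1
    exact ⟨h4, hp _ _ h3 h4 (by rwa [h5])⟩

theorem ncard_twisted_addCycle_const [Finite ι] {φ : X → X}
    (hφ : ∀ d, 0 < d → {x | φ^[d] x = x}.Finite)
    (ρ : Perm ι) (n : ℕ) (p : (ι → X) → Prop) (p' : (Fin (n + 1) ⊕ ι → X) → Prop)
    (hp : ∀ x T, φ^[n + 1] x = x → T ∈ Twisted φ ρ → p' (extend φ (n + 1) x T) → p T) {k : ℤ}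
    (hk : ∀ T ∈ Twisted φ ρ, p T →
      ({x | φ^[n + 1] x = x ∧ p' (extend φ (n + 1) x T)}.ncard : ℤ) = k) :
    ({S ∈ Twisted φ (addCycle (n + 1) ρ) | p' S}.ncard : ℤ) =
      {T ∈ Twisted φ ρ | p T}.ncard * k := by
  have hfin : {T ∈ Twisted φ ρ | p T}.Finite := (Twisted.finite hφ _).subset fun T hT => hT.1
  rw [ncard_twisted_addCycle hφ ρ n p p' hp hfin,
    sum_congr rfl (fun T hT => hk T (by simpa using (hfin.mem_toFinset.1 hT).1)
      (by simpa using (hfin.mem_toFinset.1 hT).2)),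
    sum_const, Set.ncard_eq_toFinset_card _ hfin, nsmul_eq_mul]

/-- The first `d` and the remaining indices among those of a list with head `d`. -/
def blockEquiv (d : ℕ) (l : List ℕ) : Fin d ⊕ Fin l.sum ≃ Fin (d :: l).sum :=
  finSumFinEquiv.trans (finCongr List.sum_cons.symm)

/-- The permutation of `Fin l.sum` that rotates consecutive blocks of lengths given by `l`. -/
def rot : (l : List ℕ) → Perm (Fin l.sum)
  | [] => 1
  | d :: l => (blockEquiv d l).permCongr (addCycle d (rot l))

theorem rot_cons_apply (d : ℕ) (l : List ℕ) (i : Fin d ⊕ Fin l.sum) :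
    blockEquiv d l (addCycle d (rot l) i) = rot (d :: l) (blockEquiv d l i) := by
  exact ((Equiv.permCongr_apply (blockEquiv d l) (addCycle d (rot l)) _).trans
    (by rw [Equiv.symm_apply_apply])).symm

end Twisted

/-! ### Points of given period and twisted tuples of distinct points -/

section Period

variable {X ι : Type*}

/-- The point `x` has exact period `d` under `φ`. -/
def ExactPeriod (φ : X → X) (d : ℕ) (x : X) : Prop :=
  φ^[d] x = x ∧ ∀ k < d, 0 < k → φ^[k] x ≠ x

instance [DecidableEq X] (φ : X → X) (d : ℕ) (x : X) : Decidable (ExactPeriod φ d x) :=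
  inferInstanceAs (Decidable (_ ∧ _))

theorem ExactPeriod.iterate_inj {φ : X → X} {d : ℕ} {x : X} (h : ExactPeriod φ d x)
    {a b : ℕ} (ha : a < d) (hb : b < d) (hab : φ^[a] x = φ^[b] x) : a = b := by
  wlog hlt : a < b generalizing a b with H
  · rcases Nat.lt_or_ge b a with h' | h'
    · exact (H hb ha hab.symm h').symm
    · omega
  exfalso
  refine h.2 (d - b + a) (by omega) (by omega) ?_
  rw [iterate_add_apply, hab, ← iterate_add_apply,
    show d - b + b = d by omega, h.1]

theorem ExactPeriod.iterate {φ : X → X} {d : ℕ} {x : X} (h : ExactPeriod φ d x) (k : ℕ) :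
    ExactPeriod φ d (φ^[k] x) := by
  refine ⟨by rw [← iterate_add_apply, add_comm, iterate_add_apply, h.1], ?_⟩
  intro m hm hm0 hx
  have hd : 0 < d := by omega
  have h1 : φ^[d * (k + 1)] x = x := by
    rw [iterate_mul]
    exact iterate_fixed h.1 _
  refine h.2 m hm hm0 ?_
  have h2 : φ^[d * (k + 1) - k] (φ^[m] (φ^[k] x)) = φ^[m] x := by
    rw [← iterate_add_apply, ← iterate_add_apply,
      show d * (k + 1) - k + m + k = m + d * (k + 1) by
        have : k ≤ d * (k + 1) := by nlinarith
        omega, iterate_add_apply, h1]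
  rw [← h2, hx, ← iterate_add_apply,
    show d * (k + 1) - k + k = d * (k + 1) by
      have : k ≤ d * (k + 1) := by nlinarith
      omega, h1]

theorem exactPeriod_comp_iff {φ : X → X} {ρ : Perm ι} {T : ι → X} (hT : T ∈ Twisted φ ρ)
    (hinj : Injective T) (d : ℕ) (i : ι) :
    ExactPeriod φ d (T i) ↔ ExactPeriod ρ d i := by
  simp only [ExactPeriod, Twisted.iterate hT, hinj.eq_iff, ne_eq]

/-- A tuple extended by the orbit of `x` consists of distinct points iff the tuple does, the period
of `x` is the length of the orbit, and `x` is not in the tuple. -/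
theorem extend_injective_iff {φ : X → X} {ρ : Perm ι} {n : ℕ} {x : X} {T : ι → X}
    (hx : φ^[n + 1] x = x) (hT : T ∈ Twisted φ ρ) :
    Injective (extend φ (n + 1) x T) ↔
      Injective T ∧ ExactPeriod φ (n + 1) x ∧ x ∉ Set.range T := by
  constructor
  · intro h
    refine ⟨fun i j hij => Sum.inr_injective (h hij), ⟨hx, fun k hk hk0 hkx => ?_⟩, ?_⟩
    · have := @h (.inl ⟨k, hk⟩) (.inl 0) (by simpa [extend] using hkx)
      simp only [Sum.inl.injEq, Fin.ext_iff, Fin.val_zero] at this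
      omega
    · rintro ⟨i, hi⟩
      have := @h (.inl 0) (.inr i) (by simpa [extend] using hi.symm)
      simp at this
  · rintro ⟨h1, h2, h3⟩
    have h4 : ∀ (k : Fin (n + 1)) i, φ^[k] x ≠ T i := by
      intro k i hki
      refine h3 ⟨ρ^[n + 1 - k] i, ?_⟩
      rw [← Twisted.iterate hT, ← hki, ← iterate_add_apply,
        show n + 1 - (k : ℕ) + k = n + 1 by omega, hx]
    rintro (a | i) (b | j) hab
    · have := h2.iterate_inj a.2 b.2 hab
      exact congrArg _ (Fin.ext this)
    · exact absurd hab (h4 a j)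
    · exact absurd hab.symm (h4 b i)
    · exact congrArg _ (h1 hab)

/-- The number of twisted tuples of distinct points for `rot l`, where `m d` is the number of
points of exact period `d`. -/
def confCount (m : ℕ → ℤ) : List ℕ → ℤ
  | [] => 1
  | d :: l => confCount m l * (m d - d * l.count d)

theorem card_exactPeriod_addCycle [Fintype ι] [DecidableEq ι] (ρ : Perm ι) (n d : ℕ)
    (hd : 0 < d) :
    (univ.filter (ExactPeriod (addCycle (n + 1) ρ) d)).card =
      (if n + 1 = d then d else 0) + (univ.filter (ExactPeriod ρ d)).card := by
  have h1 : ∀ k i, (addCycle (n + 1) ρ)^[k] (.inr i) = .inr (ρ^[k] i) := by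
    intro k
    induction k with
    | zero => intro i; rfl
    | succ k ih => intro i; rw [iterate_succ_apply, iterate_succ_apply, ← ih]; rfl
  have h1' : ∀ k i, (addCycle (n + 1) ρ)^[k] (.inl i) = .inl ((finRotate (n + 1))^[k] i) := by
    intro k
    induction k with
    | zero => intro i; rfl
    | succ k ih => intro i; rw [iterate_succ_apply, iterate_succ_apply, ← ih]; rfl
  have h2 : ∀ (k : ℕ) (i : Fin (n + 1)), (((finRotate (n + 1))^[k] i : Fin (n + 1)) : ℕ) =
      (i + k) % (n + 1) := by
    intro k i
    induction k with
    | zero => simp [Nat.mod_eq_of_lt i.2]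
    | succ k ih =>
      rw [iterate_succ_apply', finRotate_apply, Fin.val_add, ih]
      simp [← add_assoc]
  have h3 : ∀ (k : ℕ) (i : Fin (n + 1)), (finRotate (n + 1))^[k] i = i ↔ n + 1 ∣ k := by
    intro k i
    rw [Fin.ext_iff, h2]
    conv_lhs => rhs; rw [← Nat.mod_eq_of_lt i.2]
    rw [← Nat.ModEq, ← Nat.modEq_zero_iff_dvd]
    constructor
    · intro h; exact Nat.ModEq.add_left_cancel' (i : ℕ) (by simpa using h)
    · intro h; simpa using Nat.ModEq.add_left (i : ℕ) h
  have h4 : ∀ i : Fin (n + 1), ExactPeriod (addCycle (n + 1) ρ) d (.inl i) ↔ n + 1 = d := by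
    intro i
    simp only [ExactPeriod, h1', Sum.inl.injEq, h3, ne_eq]
    constructor
    · rintro ⟨ha, hb⟩
      by_contra hne
      exact hb (n + 1) (lt_of_le_of_ne (Nat.le_of_dvd hd ha) hne) (by omega) dvd_rfl
    · rintro rfl
      exact ⟨dvd_rfl, fun k hk hk0 hd => absurd (Nat.le_of_dvd hk0 hd) (by omega)⟩
  have h5 : ∀ i : ι, ExactPeriod (addCycle (n + 1) ρ) d (.inr i) ↔ ExactPeriod ρ d i := by
    intro i
    simp only [ExactPeriod, h1, Sum.inr.injEq, ne_eq]
  simp only [card_filter, Fintype.sum_sum_type, h4, h5]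
  congr 1
  by_cases h : n + 1 = d
  · simp [h]
  · simp [h]

theorem card_exactPeriod_rot (l : List ℕ) (hl : ∀ d ∈ l, 0 < d) (d : ℕ) (hd : 0 < d) :
    (univ.filter (ExactPeriod (rot l) d)).card = d * l.count d := by
  induction l with
  | nil => exact (Nat.le_zero.1 (card_le_univ _)).trans (by simp)
  | cons e l ih =>
    obtain ⟨n, rfl⟩ : ∃ n, e = n + 1 := ⟨e - 1, by have := hl e (by simp); omega⟩
    have h1 := card_exactPeriod_addCycle (rot l) n d hd
    rw [ih (fun d hd => hl d (by simp [hd]))] at h1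
    have h2 : (univ.filter (ExactPeriod (rot ((n + 1) :: l)) d)).card =
        (univ.filter (ExactPeriod (addCycle (n + 1) (rot l)) d)).card := by
      symm
      refine card_equiv (blockEquiv _ _) fun i => ?_
      have h3 : ∀ k, (rot ((n + 1) :: l))^[k] (blockEquiv _ _ i) =
          blockEquiv _ _ ((addCycle (n + 1) (rot l))^[k] i) := by
        intro k
        induction k with
        | zero => rfl
        | succ k ih => rw [iterate_succ_apply', iterate_succ_apply', ih,
            rot_cons_apply]
      simp only [mem_filter, mem_univ, true_and, ExactPeriod, h3, ne_eq,
        EmbeddingLike.apply_eq_iff_eq]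
    rw [h2, h1, List.count_cons]
    by_cases h : n + 1 = d
    · simp [h]; ring
    · simp [h]

/-- The number of twisted tuples of distinct points for the permutation `rot l` depends only on
the numbers of points of given exact period. -/
theorem ncard_twisted_injective {φ : X → X} (hφ : ∀ d, 0 < d → {x | φ^[d] x = x}.Finite)
    (m : ℕ → ℤ) (l : List ℕ) (hl : ∀ d ∈ l, 0 < d)
    (hm : ∀ d ∈ l, ({x | ExactPeriod φ d x}.ncard : ℤ) = m d) :
    ({T ∈ Twisted φ (rot l) | Injective T}.ncard : ℤ) = confCount m l := by
  induction l with
  | nil =>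
    have : {T ∈ Twisted φ (rot []) | Injective T} = Set.univ := by
      refine Set.eq_univ_of_forall fun T => ⟨fun i => Fin.elim0 i, fun i => Fin.elim0 i⟩
    rw [this, Set.ncard_univ, confCount, show Nat.card (Fin ([] : List ℕ).sum → X) = 1 from
      Nat.card_unique (α := Fin 0 → X)]
    rfl
  | cons e l ih =>
    obtain ⟨n, rfl⟩ : ∃ n, e = n + 1 := ⟨e - 1, by have := hl e (by simp); omega⟩
    have hl' : ∀ d ∈ l, 0 < d := fun d hd => hl d (by simp [hd])
    rw [← Twisted.ncard_congr (φ := φ) (blockEquiv _ _) (rot_cons_apply (n + 1) l)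
      (fun S => Injective S) (fun S => Injective S)
      (fun T => (blockEquiv _ _).injective_comp T),
      ncard_twisted_addCycle_const hφ (rot l) n (fun T => Injective T) _
        (fun x T hx hT h => ((extend_injective_iff hx hT).1 h).1)
        (k := m (n + 1) - ((n + 1 : ℕ) : ℤ) * l.count (n + 1)),
      ih hl' (fun d hd => hm d (by simp [hd])), confCount]
    intro T hT hinj
    have h1 : {x | ExactPeriod φ (n + 1) x} =
        {x | φ^[n + 1] x = x ∧ Injective (extend φ (n + 1) x T)} ∪
          T '' {i | ExactPeriod (rot l) (n + 1) i} := by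
      ext x
      simp only [Set.mem_ofPred_eq, Set.mem_union, Set.mem_image]
      constructor
      · intro hx
        by_cases h : x ∈ Set.range T
        · obtain ⟨i, rfl⟩ := h
          exact .inr ⟨i, (exactPeriod_comp_iff hT hinj _ _).1 hx, rfl⟩
        · exact .inl ⟨hx.1, (extend_injective_iff hx.1 hT).2 ⟨hinj, hx, h⟩⟩
      · rintro (⟨h1, h2⟩ | ⟨i, hi, rfl⟩)
        · exact ((extend_injective_iff h1 hT).1 h2).2.1
        · exact (exactPeriod_comp_iff hT hinj _ _).2 hi
    have h2 := hm (n + 1) (by simp)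
    rw [h1, Set.ncard_union_eq _ ((hφ (n + 1) (by omega)).subset fun x hx => hx.1) (Set.toFinite _),
      Set.ncard_image_of_injective _ hinj] at h2
    · have h3 := card_exactPeriod_rot l hl' (n + 1) (by omega)
      rw [← Set.ncard_coe_finset] at h3
      simp only [coe_filter, mem_univ, true_and] at h3
      rw [h3] at h2
      push_cast at h2 ⊢
      linarith
    · refine Set.disjoint_left.2 ?_
      rintro x ⟨h1, h2⟩ ⟨i, hi, rfl⟩
      exact ((extend_injective_iff h1 hT).1 h2).2.2 ⟨i, rfl⟩

theorem exactPeriod_iff_minimalPeriod {φ : X → X} {d : ℕ} (hd : 0 < d) {x : X} :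
    ExactPeriod φ d x ↔ minimalPeriod φ x = d := by
  constructor
  · rintro ⟨h1, h2⟩
    have h3 : IsPeriodicPt φ d x := h1
    by_contra hne
    have h4 := h3.minimalPeriod_pos hd
    have h5 := lt_of_le_of_ne (h3.minimalPeriod_le hd) hne
    exact h2 _ h5 h4 (isPeriodicPt_minimalPeriod φ x)
  · rintro rfl
    refine ⟨isPeriodicPt_minimalPeriod φ x, fun k hk hk0 h => ?_⟩
    exact absurd (IsPeriodicPt.minimalPeriod_le hk0 h) (by omega)

theorem ncard_fixed_eq_sum_exactPeriod {φ : X → X} {p : X → Prop} {n : ℕ} (hn : 0 < n)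
    (hfin : {x | φ^[n] x = x ∧ p x}.Finite) :
    ({x | φ^[n] x = x ∧ p x}.ncard : ℤ) =
      ∑ d ∈ n.divisors, ({x | ExactPeriod φ d x ∧ p x}.ncard : ℤ) := by
  have hB : (↑n.divisors : Set ℕ).Finite := n.divisors.finite_toSet
  rw [ncard_eq_sum_fiber hfin hB (minimalPeriod φ)]
  · rw [finite_toSet_toFinset]
    refine sum_congr rfl fun d hd => ?_
    have hd0 : 0 < d := Nat.pos_of_mem_divisors hd
    congr 2
    ext x
    simp only [Set.mem_ofPred_eq, exactPeriod_iff_minimalPeriod hd0]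
    constructor
    · rintro ⟨⟨-, h1⟩, h2⟩
      exact ⟨h2, h1⟩
    · rintro ⟨rfl, h1⟩
      exact ⟨⟨(isPeriodicPt_minimalPeriod φ x).trans_dvd (Nat.dvd_of_mem_divisors hd),
        h1⟩, rfl⟩
  · rintro x ⟨h1, -⟩
    simp only [mem_coe, Nat.mem_divisors]
    exact ⟨IsPeriodicPt.minimalPeriod_dvd h1, hn.ne'⟩

/-- Möbius inversion for `n ≤ 7`: the number of points of exact period `n`, if `f d` is the number
of fixed points of the `d`-th iterate. -/
def exactCount (f : ℕ → ℤ) : ℕ → ℤ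
  | 1 => f 1
  | 4 => f 4 - f 2
  | 6 => f 6 - f 3 - f 2 + f 1
  | n => f n - f 1

theorem ncard_exactPeriod {φ : X → X} {p : X → Prop} {f : ℕ → ℤ}
    (hfin : ∀ d, 0 < d → {x | φ^[d] x = x ∧ p x}.Finite)
    (hf : ∀ d, 0 < d → ({x | φ^[d] x = x ∧ p x}.ncard : ℤ) = f d) {n : ℕ} (h0 : 0 < n)
    (h7 : n ≤ 7) :
    ({x | ExactPeriod φ n x ∧ p x}.ncard : ℤ) = exactCount f n := by
  have key := fun n (hn : 0 < n) => (hf n hn).symm.trans (ncard_fixed_eq_sum_exactPeriod hn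
    (hfin n hn))
  have h1 := key 1 (by norm_num)
  have h2 := key 2 (by norm_num)
  have h3 := key 3 (by norm_num)
  have h4 := key 4 (by norm_num)
  have h5 := key 5 (by norm_num)
  have h6 := key 6 (by norm_num)
  have h7 := key 7 (by norm_num)
  rw [show Nat.divisors 1 = {1} by decide] at h1
  rw [show Nat.divisors 2 = {1, 2} by decide] at h2
  rw [show Nat.divisors 3 = {1, 3} by decide] at h3
  rw [show Nat.divisors 4 = {1, 2, 4} by decide] at h4
  rw [show Nat.divisors 5 = {1, 5} by decide] at h5
  rw [show Nat.divisors 6 = {1, 2, 3, 6} by decide] at h6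
  rw [show Nat.divisors 7 = {1, 7} by decide] at h7
  simp +decide only [sum_insert, sum_singleton, mem_insert,
    mem_singleton] at h1 h2 h3 h4 h5 h6 h7
  interval_cases n <;> simp only [exactCount] <;> linarith

end Period

/-! ### Projective planes with a Frobenius collineation -/

/-- A projective plane, given by points, lines and incidence, with a collineation whose powers
have as many fixed points and lines as the powers of the `q`-Frobenius, and in which the diagonal
points of a quadrangle are never collinear. -/
structure FrobeniusPlane (P L : Type*) where
  inc : P → L → Prop
  join : P → P → L
  inc_join_left : ∀ {a b}, a ≠ b → inc a (join a b)
  inc_join_right : ∀ {a b}, a ≠ b → inc b (join a b)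
  meet : L → L → P
  inc_meet_left : ∀ {l m}, l ≠ m → inc (meet l m) l
  inc_meet_right : ∀ {l m}, l ≠ m → inc (meet l m) m
  eq_or_eq : ∀ {a b l m}, inc a l → inc b l → inc a m → inc b m → a = b ∨ l = m
  frob : P → P
  frobL : L → L
  frob_injective : Injective frob
  frobL_injective : Injective frobL
  inc_frob : ∀ {a l}, inc (frob a) (frobL l) ↔ inc a l
  q : ℕ
  two_le : 2 ≤ q
  ncard_points : ∀ d, 0 < d → {a | frob^[d] a = a}.ncard = q ^ (2 * d) + q ^ d + 1
  ncard_lines : ∀ d, 0 < d → {l | frobL^[d] l = l}.ncard = q ^ (2 * d) + q ^ d + 1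
  ncard_points_on : ∀ d, 0 < d → ∀ l, frobL^[d] l = l →
    {a | frob^[d] a = a ∧ inc a l}.ncard = q ^ d + 1
  ncard_lines_on : ∀ d, 0 < d → ∀ a, frob^[d] a = a →
    {l | frobL^[d] l = l ∧ inc a l}.ncard = q ^ d + 1
  fano : ∀ (T : Fin 4 → P), Injective T →
    (∀ l i j k, i ≠ j → i ≠ k → j ≠ k → inc (T i) l → inc (T j) l → ¬ inc (T k) l) →
    ∀ (x : Fin 3 → P) (l : Fin 3 → L) (m : Fin 3 → L) (n : L),
      (∀ i : Fin 3, inc (T 0) (l i) ∧ inc (T i.succ) (l i) ∧ inc (x i) (l i)) →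
      (∀ i j : Fin 3, i ≠ j → inc (T j.succ) (m i)) → (∀ i, inc (x i) (m i)) →
      ¬ ∀ i, inc (x i) n

namespace FrobeniusPlane

variable {P L : Type*} (π : FrobeniusPlane P L)

theorem line_eq {a b : P} {l m : L} (hab : a ≠ b) (h1 : π.inc a l) (h2 : π.inc b l)
    (h3 : π.inc a m) (h4 : π.inc b m) : l = m :=
  (π.eq_or_eq h1 h2 h3 h4).resolve_left hab

theorem point_eq {a b : P} {l m : L} (hlm : l ≠ m) (h1 : π.inc a l) (h2 : π.inc b l)
    (h3 : π.inc a m) (h4 : π.inc b m) : a = b :=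
  (π.eq_or_eq h1 h2 h3 h4).resolve_right hlm

theorem inc_iterate (d : ℕ) {a : P} {l : L} :
    π.inc (π.frob^[d] a) (π.frobL^[d] l) ↔ π.inc a l := by
  induction d generalizing a l with
  | zero => rfl
  | succ d ih => rw [iterate_succ_apply, iterate_succ_apply, ih, π.inc_frob]

/-- The same plane with a power of the Frobenius collineation. -/
def pow (d : ℕ) (hd : 0 < d) : FrobeniusPlane P L :=
  { π with
    frob := π.frob^[d]
    frobL := π.frobL^[d]
    frob_injective := π.frob_injective.iterate d
    frobL_injective := π.frobL_injective.iterate d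
    inc_frob := π.inc_iterate d
    q := π.q ^ d
    two_le := π.two_le.trans (Nat.le_self_pow hd.ne' _)
    ncard_points := fun e he => by
      rw [← iterate_mul, π.ncard_points _ (Nat.mul_pos hd he), ← pow_mul, ← pow_mul,
        Nat.mul_left_comm]
    ncard_lines := fun e he => by
      rw [← iterate_mul, π.ncard_lines _ (Nat.mul_pos hd he), ← pow_mul, ← pow_mul,
        Nat.mul_left_comm]
    ncard_points_on := fun e he l hl => by
      rw [← iterate_mul] at hl ⊢
      rw [π.ncard_points_on _ (Nat.mul_pos hd he) l hl, ← pow_mul]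
    ncard_lines_on := fun e he l hl => by
      rw [← iterate_mul] at hl ⊢
      rw [π.ncard_lines_on _ (Nat.mul_pos hd he) l hl, ← pow_mul] }

theorem finite_points (d : ℕ) (hd : 0 < d) : {a | π.frob^[d] a = a}.Finite :=
  Set.finite_of_ncard_ne_zero (by rw [π.ncard_points d hd]; omega)

theorem finite_lines (d : ℕ) (hd : 0 < d) : {a | π.frobL^[d] a = a}.Finite :=
  Set.finite_of_ncard_ne_zero (by rw [π.ncard_lines d hd]; omega)

/-- The points of the tuple are distinct and no three of them are collinear. -/
def Arc {ι : Type*} (T : ι → P) : Prop :=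
  Injective T ∧ ∀ l i j k, i ≠ j → i ≠ k → j ≠ k →
    π.inc (T i) l → π.inc (T j) l → ¬ π.inc (T k) l

/-- The point `a` lies on a line through two of the points `T i`. -/
def OnSecant {ι : Type*} (T : ι → P) (a : P) : Prop :=
  ∃ i j l, i ≠ j ∧ π.inc a l ∧ π.inc (T i) l ∧ π.inc (T j) l

/-- The point `a` is collinear with the points `T i` for `i ∈ d`. -/
def OnLineOf {ι : Type*} (T : ι → P) (a : P) (d : Finset ι) : Prop :=
  ∃ l, π.inc a l ∧ ∀ i ∈ d, π.inc (T i) l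

end FrobeniusPlane

/-! ### Counting points on the secants of an arc -/

section SecantNumbers

variable {ι : Type*} [Fintype ι] [DecidableEq ι]

/-- The image of a set of indices under a permutation. -/
abbrev mapSet (ρ : Perm ι) (d : Finset ι) : Finset ι := d.map ρ.toEmbedding

variable (ι) in
/-- The two-element sets of indices. -/
abbrev duads : Finset (Finset ι) := univ.powersetCard 2

/-- Twice the number of fixed points of a `q`-Frobenius on the union of the secants of an arc
permuted according to `ρ`, apart from a correction for triples of concurrent secants. -/
def secantCount (ρ : Perm ι) (q : ℤ) : ℤ :=
  2 * (univ.filter fun i => ρ i = i).card +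
    2 * ∑ d ∈ (duads ι).filter fun d => mapSet ρ d = d, (q + 1 - (d.filter fun i => ρ i = i).card) -
    (((duads ι).filter fun d => mapSet ρ d = d).offDiag.filter
      fun e => Disjoint e.1 e.2).card +
    ((duads ι).filter fun d => mapSet ρ d ≠ d ∧ mapSet ρ (mapSet ρ d) = d ∧
      Disjoint d (mapSet ρ d)).card

end SecantNumbers

/-- The sign attached to three concurrent secants that are permuted by Frobenius: `-1` for a
transposition, `1` for an even permutation, and `0` if there are not three secants. -/
def concurrencySign {Δ : Type*} [DecidableEq Δ] (D : Finset Δ) (r : Δ → Δ) : ℤ :=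
  if D.card = 3 then (if (D.filter fun d => r d = d).card = 1 then -1 else 1) else 0

/-- For a permutation of a nonempty set with at most three elements, the alternating sum of the
traces on the exterior powers of the permutation representation vanishes. -/
theorem two_mul_card_fixed_add {Δ : Type*} [DecidableEq Δ] (D : Finset Δ) (r : Δ → Δ)
    (hr : ∀ d ∈ D, r d ∈ D) (hinj : Set.InjOn r D) (h0 : D.Nonempty) (h3 : D.card ≤ 3) :
    2 * ((D.filter fun d => r d = d).card : ℤ) - (D.filter fun d => r d = d).offDiag.card +
      (D.filter fun d => r d ≠ d ∧ r (r d) = d).card + 2 * concurrencySign D r = 2 := by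
  have h1 : 0 < D.card := h0.card_pos
  have hcases : D.card = 1 ∨ D.card = 2 ∨ D.card = 3 := by omega
  rcases hcases with h | h | h
  · obtain ⟨x, rfl⟩ := card_eq_one.1 h
    have hx : r x = x := by simpa using hr x (by simp)
    simp [concurrencySign, filter_singleton, hx]
  · obtain ⟨x, y, hxy, rfl⟩ := card_eq_two.1 h
    have hx := hr x (by simp)
    have hy := hr y (by simp)
    have hne : r x ≠ r y := fun h => hxy (hinj (by simp) (by simp) h)
    simp only [mem_insert, mem_singleton] at hx hy
    rcases hx with hx | hx <;> rcases hy with hy | hy <;> rw [hx, hy] at hne <;>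
      first
      | exact absurd rfl hne
      | simp [concurrencySign, filter_insert, filter_singleton, hx, hy, hxy, hxy.symm,
          offDiag_card]
  · obtain ⟨x, y, z, hxy, hxz, hyz, rfl⟩ := card_eq_three.1 h
    have hx := hr x (by simp)
    have hy := hr y (by simp)
    have hz := hr z (by simp)
    have hne : r x ≠ r y := fun h => hxy (hinj (by simp) (by simp) h)
    have hne' : r x ≠ r z := fun h => hxz (hinj (by simp) (by simp) h)
    have hne'' : r y ≠ r z := fun h => hyz (hinj (by simp) (by simp) h)
    simp only [mem_insert, mem_singleton] at hx hy hz
    rcases hx with hx | hx | hx <;> rcases hy with hy | hy | hy <;> rw [hx, hy] at hne <;>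
      first
      | exact absurd rfl hne
      | (rcases hz with hz | hz | hz <;> rw [hx, hz] at hne' <;> rw [hy, hz] at hne'' <;>
          first
          | exact absurd rfl hne'
          | exact absurd rfl hne''
          | simp [concurrencySign, filter_insert, filter_singleton, hx, hy, hz, hxy,
              hxy.symm, hxz, hxz.symm, hyz, hyz.symm, offDiag_card])

namespace FrobeniusPlane

variable {P L ι : Type*} (π : FrobeniusPlane P L)

theorem onLineOf_mapSet {ρ : Perm ι} {T : ι → P} (hT : T ∈ Twisted π.frob ρ) {a : P}
    {d : Finset ι} (h : π.OnLineOf T a d) : π.OnLineOf T (π.frob a) (mapSet ρ d) := by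
  obtain ⟨l, h1, h2⟩ := h
  refine ⟨π.frobL l, π.inc_frob.2 h1, fun i hi => ?_⟩
  obtain ⟨j, hj, rfl⟩ := mem_map.1 hi
  rw [Equiv.coe_toEmbedding, ← hT j]
  exact π.inc_frob.2 (h2 j hj)

theorem eq_or_disjoint_of_onLineOf [DecidableEq ι] {T : ι → P} (hT : π.Arc T) {a : P}
    (ha : a ∉ Set.range T) {d e : Finset ι} (hd : d.card = 2) (he : e.card = 2)
    (h1 : π.OnLineOf T a d) (h2 : π.OnLineOf T a e) : d = e ∨ Disjoint d e := by
  by_contra! hcon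
  obtain ⟨hne, hdis⟩ := hcon
  obtain ⟨i, hid, hie⟩ := not_disjoint_iff.1 hdis
  obtain ⟨l, hl, hl'⟩ := h1
  obtain ⟨m, hm, hm'⟩ := h2
  have hai : a ≠ T i := fun h => ha ⟨i, h.symm⟩
  obtain rfl := π.line_eq hai hl (hl' i hid) hm (hm' i hie)
  obtain ⟨j, hj, hjd⟩ : ∃ j ∈ e, j ∉ d := by
    by_contra! h
    exact hne (eq_of_subset_of_card_le h (by omega)).symm
  obtain ⟨x, y, hxy, rfl⟩ := card_eq_two.1 hd
  simp only [mem_insert, mem_singleton, not_or] at hjd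
  exact hT.2 l x y j hxy (Ne.symm hjd.1) (Ne.symm hjd.2) (hl' x (by simp)) (hl' y (by simp))
    (hm' j hj)

/-- The number of fixed points on the secants of a twisted arc of at most six points. Each fixed
point outside the arc lies on a set of pairwise disjoint secants permuted by Frobenius, and
`two_mul_card_fixed_add` is applied to this set. -/
theorem two_mul_ncard_onSecant [Fintype ι] [DecidableEq ι] {ρ : Perm ι} {T : ι → P}
    (hT : T ∈ Twisted π.frob ρ) (hA : π.Arc T) (h2 : 2 ≤ Fintype.card ι) (h6 : Fintype.card ι ≤ 6)
    (R : Finset P) (hR : ∀ a, a ∈ R ↔ π.frob a = a ∧ a ∉ Set.range T)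
    (D : P → Finset (Finset ι)) (hD : ∀ a d, d ∈ D a ↔ d ∈ duads ι ∧ π.OnLineOf T a d) :
    2 * ({a | π.frob a = a ∧ π.OnSecant T a}.ncard : ℤ) =
      secantCount ρ π.q + 2 * ∑ a ∈ R, concurrencySign (D a) (mapSet ρ) := by
  classical
  have hι : Nonempty ι := Fintype.card_pos_iff.1 (by omega)
  have : Nonempty L := ⟨π.join (T hι.some) (T hι.some)⟩
  have hcard : ∀ {d : Finset ι}, d ∈ duads ι ↔ d.card = 2 := by
    intro d; simp [mem_powersetCard]
  have hmapcard : ∀ {d : Finset ι}, d ∈ duads ι → mapSet ρ d ∈ duads ι := by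
    intro d hd
    rw [hcard] at hd ⊢
    rw [card_map, hd]
  have hmapinj : Injective (mapSet ρ) := map_injective _
  -- the secant attached to a duad
  have hline : ∀ d : Finset ι, d ∈ duads ι → ∃ l, (∀ i ∈ d, π.inc (T i) l) ∧
      ∀ m, (∀ i ∈ d, π.inc (T i) m) → m = l := by
    intro d hd
    obtain ⟨x, y, hxy, rfl⟩ := card_eq_two.1 (hcard.1 hd)
    have hne : T x ≠ T y := fun h => hxy (hA.1 h)
    refine ⟨π.join (T x) (T y), ?_, fun m hm => π.line_eq hne (hm x (by simp)) (hm y (by simp))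
      (π.inc_join_left hne) (π.inc_join_right hne)⟩
    intro i hi
    simp only [mem_insert, mem_singleton] at hi
    rcases hi with rfl | rfl
    exacts [π.inc_join_left hne, π.inc_join_right hne]
  choose! ln hln hln' using hline
  have hon : ∀ {a : P} {d : Finset ι}, d ∈ duads ι → (π.OnLineOf T a d ↔ π.inc a (ln d)) := by
    intro a d hd
    constructor
    · rintro ⟨l, h1, h2⟩
      rwa [← hln' d hd l h2]
    · exact fun h => ⟨ln d, h, hln d hd⟩
  have hnotin : ∀ {i : ι} {d : Finset ι}, d ∈ duads ι → i ∉ d → ¬ π.inc (T i) (ln d) := by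
    intro i d hd hi
    obtain ⟨x, y, hxy, rfl⟩ := card_eq_two.1 (hcard.1 hd)
    simp only [mem_insert, mem_singleton, not_or] at hi
    exact hA.2 _ x y i hxy (Ne.symm hi.1) (Ne.symm hi.2) (hln _ hd x (by simp))
      (hln _ hd y (by simp))
  have hlnne : ∀ {d e : Finset ι}, d ∈ duads ι → e ∈ duads ι → d ≠ e → ln d ≠ ln e := by
    intro d e hd he hne h
    obtain ⟨j, hj, hjd⟩ : ∃ j ∈ e, j ∉ d := by
      by_contra! h
      exact hne (eq_of_subset_of_card_le h
        (by rw [hcard.1 hd, hcard.1 he])).symm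
    exact hnotin hd hjd (h ▸ hln e he j hj)
  have hlnfrob : ∀ {d : Finset ι}, d ∈ duads ι → π.frobL (ln d) = ln (mapSet ρ d) := by
    intro d hd
    refine hln' _ (hmapcard hd) _ fun i hi => ?_
    obtain ⟨j, hj, rfl⟩ := mem_map.1 hi
    rw [Equiv.coe_toEmbedding, ← hT j]
    exact π.inc_frob.2 (hln d hd j hj)
  have hRfix : ∀ {a}, a ∈ R → π.frob a = a := fun h => ((hR _).1 h).1
  have hDcard : ∀ {a d}, d ∈ D a → d.card = 2 := fun h => hcard.1 ((hD _ _).1 h).1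
  have hDmap : ∀ {a}, a ∈ R → ∀ d ∈ D a, mapSet ρ d ∈ D a := by
    intro a ha d hd
    obtain ⟨h1, h2⟩ := (hD a d).1 hd
    refine (hD _ _).2 ⟨hmapcard h1, ?_⟩
    have := π.onLineOf_mapSet hT h2
    rwa [hRfix ha] at this
  have hDdis : ∀ {a}, a ∈ R → ∀ d ∈ D a, ∀ e ∈ D a, d ≠ e → Disjoint d e := by
    intro a ha d hd e he hne
    exact (π.eq_or_disjoint_of_onLineOf hA ((hR a).1 ha).2 (hDcard hd) (hDcard he)
      ((hD _ _).1 hd).2 ((hD _ _).1 he).2).resolve_left hne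
  have hD3 : ∀ {a}, a ∈ R → (D a).card ≤ 3 := by
    intro a ha
    have h1 : ((D a).biUnion id).card = ∑ d ∈ D a, (id d).card :=
      card_biUnion fun d hd e he hne => hDdis ha d hd e he hne
    rw [sum_congr rfl (fun d hd => (hDcard hd : (id d).card = 2)), sum_const,
      smul_eq_mul] at h1
    have h3 := card_le_univ ((D a).biUnion id)
    omega
  -- the points of the arc and the other points are counted separately
  have hsplit : ({a | π.frob a = a ∧ π.OnSecant T a}.ncard : ℤ) =
      (univ.filter fun i => ρ i = i).card + (R.filter fun a => (D a).Nonempty).card := by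
    have h1 : {a | π.frob a = a ∧ π.OnSecant T a} =
        ↑(((univ.filter fun i => ρ i = i).image T) ∪ R.filter fun a => (D a).Nonempty) := by
      ext a
      simp only [coe_union, coe_image, coe_filter, mem_univ, true_and,
        Set.mem_union, Set.mem_image, Set.mem_ofPred_eq, hR]
      constructor
      · rintro ⟨h1, i, j, l, hij, ha, hi, hj⟩
        by_cases h : a ∈ Set.range T
        · obtain ⟨k, rfl⟩ := h
          left
          exact ⟨k, hA.1 ((hT k).symm.trans h1), rfl⟩
        · right
          refine ⟨⟨h1, h⟩, {i, j}, (hD _ _).2 ⟨hcard.2 (card_pair hij), l, ha, ?_⟩⟩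
          intro k hk
          simp only [mem_insert, mem_singleton] at hk
          rcases hk with rfl | rfl <;> assumption
      · rintro (⟨k, hk, rfl⟩ | ⟨⟨h1, h2⟩, d, hd⟩)
        · obtain ⟨j, hj⟩ : ∃ j, k ≠ j := by
            have : Nontrivial ι := Fintype.one_lt_card_iff_nontrivial.1 (by omega)
            obtain ⟨j, hj⟩ := exists_ne k
            exact ⟨j, hj.symm⟩
          have hne : T k ≠ T j := fun h => hj (hA.1 h)
          exact ⟨by rw [hT k, hk], k, j, _, hj, π.inc_join_left hne, π.inc_join_left hne,
            π.inc_join_right hne⟩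
        · obtain ⟨hd1, l, hl, hl'⟩ := (hD _ _).1 hd
          obtain ⟨x, y, hxy, rfl⟩ := card_eq_two.1 (hcard.1 hd1)
          exact ⟨h1, x, y, l, hxy, hl, hl' x (by simp), hl' y (by simp)⟩
    rw [h1, Set.ncard_coe_finset, card_union_of_disjoint, card_image_of_injective _ hA.1]
    · push_cast; rfl
    · refine disjoint_left.2 fun a h1 h2 => ?_
      obtain ⟨i, -, rfl⟩ := mem_image.1 h1
      exact ((hR _).1 (mem_filter.1 h2).1).2 ⟨i, rfl⟩
  have hpoint : ∀ a ∈ R, 2 * (if (D a).Nonempty then (1 : ℤ) else 0) =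
      2 * (((D a).filter fun d => mapSet ρ d = d).card : ℤ) -
        ((D a).filter fun d => mapSet ρ d = d).offDiag.card +
        ((D a).filter fun d => mapSet ρ d ≠ d ∧ mapSet ρ (mapSet ρ d) = d).card +
        2 * concurrencySign (D a) (mapSet ρ) := by
    intro a ha
    split_ifs with h
    · rw [two_mul_card_fixed_add (D a) (mapSet ρ) (hDmap ha) hmapinj.injOn h (hD3 ha)]; rfl
    · rw [not_nonempty_iff_eq_empty.1 h]
      simp [concurrencySign]
  -- exchange of the two summations
  have hswap : ∀ (p : Finset ι → Prop) [DecidablePred p], ∑ a ∈ R, (((D a).filter p).card : ℤ) =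
      ∑ d ∈ (duads ι).filter p, ((R.filter fun a => π.OnLineOf T a d).card : ℤ) := by
    intro p _
    have := sum_card_bipartiteAbove_eq_sum_card_bipartiteBelow (s := R)
      (t := (duads ι).filter p) (fun a d => π.OnLineOf T a d)
    rw [← Nat.cast_sum, ← Nat.cast_sum, Nat.cast_inj]
    refine Eq.trans (sum_congr rfl fun a ha => ?_) this
    congr 1
    ext d
    simp only [mem_filter, hD, mem_bipartiteAbove]
    tauto
  have hswap2 : ∑ a ∈ R, (((D a).filter fun d => mapSet ρ d = d).offDiag.card : ℤ) =
      ∑ e ∈ ((duads ι).filter fun d => mapSet ρ d = d).offDiag,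
        ((R.filter fun a => π.OnLineOf T a e.1 ∧ π.OnLineOf T a e.2).card : ℤ) := by
    have := sum_card_bipartiteAbove_eq_sum_card_bipartiteBelow (s := R)
      (t := ((duads ι).filter fun d => mapSet ρ d = d).offDiag)
      (fun a e => π.OnLineOf T a e.1 ∧ π.OnLineOf T a e.2)
    rw [← Nat.cast_sum, ← Nat.cast_sum, Nat.cast_inj]
    refine Eq.trans (sum_congr rfl fun a ha => ?_) this
    congr 1
    ext d
    simp only [mem_filter, hD, mem_bipartiteAbove, mem_offDiag]
    tauto
  -- fixed points on a fixed secant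
  have hV1 : ∀ d ∈ (duads ι).filter fun d => mapSet ρ d = d,
      ((R.filter fun a => π.OnLineOf T a d).card : ℤ) =
        π.q + 1 - (d.filter fun i => ρ i = i).card := by
    intro d hd
    obtain ⟨hd1, hd2⟩ := mem_filter.1 hd
    have h1 := π.ncard_points_on 1 one_pos (ln d) (by
      rw [iterate_one, hlnfrob hd1, hd2])
    have h2 : {a | π.frob^[1] a = a ∧ π.inc a (ln d)} =
        ↑((R.filter fun a => π.OnLineOf T a d) ∪ (d.filter fun i => ρ i = i).image T) := by
      ext a
      simp only [iterate_one, coe_union, coe_image, coe_filter,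
        Set.mem_union, Set.mem_image, Set.mem_ofPred_eq, hR, hon hd1]
      constructor
      · rintro ⟨h1, h2⟩
        by_cases h : a ∈ Set.range T
        · obtain ⟨i, rfl⟩ := h
          refine .inr ⟨i, ⟨?_, hA.1 ((hT i).symm.trans h1)⟩, rfl⟩
          by_contra hi
          exact hnotin hd1 hi h2
        · exact .inl ⟨⟨h1, h⟩, h2⟩
      · rintro (⟨⟨h1, h⟩, h2⟩ | ⟨i, ⟨hi, hi'⟩, rfl⟩)
        · exact ⟨h1, h2⟩
        · exact ⟨by rw [hT i, hi'], hln d hd1 i hi⟩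
    rw [h2, Set.ncard_coe_finset, card_union_of_disjoint,
      card_image_of_injective _ hA.1, pow_one] at h1
    · zify at h1
      linarith
    · refine disjoint_left.2 fun a h1 h2 => ?_
      obtain ⟨i, -, rfl⟩ := mem_image.1 h2
      exact ((hR _).1 (mem_filter.1 h1).1).2 ⟨i, rfl⟩
  -- two distinct secants, fixed or exchanged, have one fixed point in common
  have hV2 : ∀ d ∈ duads ι, ∀ e ∈ duads ι, d ≠ e →
      (mapSet ρ d = d ∧ mapSet ρ e = e ∨ mapSet ρ d = e ∧ mapSet ρ e = d) →
      (R.filter fun a => π.OnLineOf T a d ∧ π.OnLineOf T a e).card =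
        if Disjoint d e then 1 else 0 := by
    intro d hd e he hne hde
    have hl := hlnne hd he hne
    split_ifs with hdis
    · rw [card_eq_one]
      refine ⟨π.meet (ln d) (ln e), ?_⟩
      ext a
      simp only [mem_filter, hon hd, hon he, mem_singleton]
      constructor
      · rintro ⟨-, h1, h2⟩
        exact π.point_eq hl h1 (π.inc_meet_left hl) h2 (π.inc_meet_right hl)
      · rintro rfl
        refine ⟨(hR _).2 ⟨?_, ?_⟩, π.inc_meet_left hl, π.inc_meet_right hl⟩
        · have h1 := π.inc_frob.2 (π.inc_meet_left hl)
          have h2 := π.inc_frob.2 (π.inc_meet_right hl)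
          rw [hlnfrob hd] at h1
          rw [hlnfrob he] at h2
          rcases hde with ⟨hd', he'⟩ | ⟨hd', he'⟩
          · rw [hd'] at h1
            rw [he'] at h2
            exact π.point_eq hl h1 (π.inc_meet_left hl) h2 (π.inc_meet_right hl)
          · rw [hd'] at h1
            rw [he'] at h2
            exact π.point_eq hl h2 (π.inc_meet_left hl) h1 (π.inc_meet_right hl)
        · rintro ⟨i, hi⟩
          have h1 : i ∈ d := by
            by_contra h
            exact hnotin hd h (hi ▸ π.inc_meet_left hl)
          have h2 : i ∈ e := by
            by_contra h
            exact hnotin he h (hi ▸ π.inc_meet_right hl)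
          exact disjoint_left.1 hdis h1 h2
    · rw [card_eq_zero, filter_eq_empty_iff]
      rintro a ha ⟨h1, h2⟩
      exact hdis ((π.eq_or_disjoint_of_onLineOf hA ((hR a).1 ha).2 (hcard.1 hd) (hcard.1 he)
        h1 h2).resolve_left hne)
  have hV3 : ∀ d ∈ (duads ι).filter fun d => mapSet ρ d ≠ d ∧ mapSet ρ (mapSet ρ d) = d,
      ((R.filter fun a => π.OnLineOf T a d).card : ℤ) =
        if Disjoint d (mapSet ρ d) then 1 else 0 := by
    intro d hd
    obtain ⟨hd1, hd2, hd3⟩ := mem_filter.1 hd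
    have h1 := hV2 d hd1 _ (hmapcard hd1) (Ne.symm hd2) (.inr ⟨rfl, hd3⟩)
    have h2 : (R.filter fun a => π.OnLineOf T a d) =
        R.filter fun a => π.OnLineOf T a d ∧ π.OnLineOf T a (mapSet ρ d) := by
      refine filter_congr fun a ha => ⟨fun h => ⟨h, ?_⟩, fun h => h.1⟩
      have := π.onLineOf_mapSet hT h
      rwa [hRfix ha] at this
    rw [h2, h1]
    push_cast
    rfl
  have hV2' : ∀ e ∈ ((duads ι).filter fun d => mapSet ρ d = d).offDiag,
      ((R.filter fun a => π.OnLineOf T a e.1 ∧ π.OnLineOf T a e.2).card : ℤ) =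
        if Disjoint e.1 e.2 then 1 else 0 := by
    intro e he
    simp only [mem_offDiag, mem_filter] at he
    rw [hV2 e.1 he.1.1 e.2 he.2.1.1 he.2.2 (.inl ⟨he.1.2, he.2.1.2⟩)]
    push_cast
    rfl
  have hsum : ((R.filter fun a => (D a).Nonempty).card : ℤ) =
      ∑ a ∈ R, if (D a).Nonempty then (1 : ℤ) else 0 := by
    rw [sum_boole]
  rw [hsplit, mul_add, hsum,
    mul_sum (f := fun a => if (D a).Nonempty then (1 : ℤ) else 0), sum_congr rfl hpoint, sum_add_distrib, sum_add_distrib,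
    sum_sub_distrib, ← mul_sum, ← mul_sum, hswap, hswap2, hswap,
    sum_congr rfl hV1, sum_congr rfl hV2', sum_congr rfl hV3, secantCount,
    sum_boole, sum_boole, filter_filter]
  simp only [and_assoc]
  ring

end FrobeniusPlane

/-! ### Adding cycles of length one and two to an arc -/

namespace FrobeniusPlane

variable {P L ι κ : Type*} (π : FrobeniusPlane P L)

/-- The number of arcs on which Frobenius acts as the permutation `ρ`. -/
noncomputable def arcCount (ρ : Perm ι) : ℤ := {T ∈ Twisted π.frob ρ | π.Arc T}.ncard

theorem arc_comp_iff (e : ι ≃ κ) (T : κ → P) : π.Arc (T ∘ e) ↔ π.Arc T := by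
  constructor
  · rintro ⟨h1, h2⟩
    refine ⟨fun a b h => ?_, fun l i j k hij hik hjk hi hj hk => ?_⟩
    · have := @h1 (e.symm a) (e.symm b) (by simpa using h)
      exact e.symm.injective this
    · exact h2 l (e.symm i) (e.symm j) (e.symm k) (by simpa) (by simpa) (by simpa)
        (by simpa) (by simpa) (by simpa)
  · rintro ⟨h1, h2⟩
    exact ⟨h1.comp e.injective, fun l i j k hij hik hjk => h2 l _ _ _ (by simpa) (by simpa)
      (by simpa)⟩

theorem arcCount_congr {ρ : Perm ι} {ρ' : Perm κ} (e : ι ≃ κ)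
    (he : ∀ i, e (ρ i) = ρ' (e i)) : π.arcCount ρ = π.arcCount ρ' :=
  congrArg Nat.cast (Twisted.ncard_congr e he _ _ (π.arc_comp_iff e))

theorem arcCount_rot_cons (d : ℕ) (l : List ℕ) :
    π.arcCount (rot (d :: l)) = π.arcCount (addCycle d (rot l)) :=
  (π.arcCount_congr (blockEquiv d l) (rot_cons_apply d l)).symm

theorem onSecant_frob_iff {ρ : Perm ι} {T : ι → P} (hT : T ∈ Twisted π.frob ρ)
    (hinj : Injective T) {a : P} : π.OnSecant T (π.frob a) ↔ π.OnSecant T a := by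
  constructor
  · rintro ⟨i, j, l, hij, ha, hi, hj⟩
    obtain ⟨i, rfl⟩ := ρ.surjective i
    obtain ⟨j, rfl⟩ := ρ.surjective j
    rw [← hT] at hi hj
    have hne : T i ≠ T j := fun h => hij (congrArg ρ (hinj h))
    have h1 := π.inc_frob.2 (π.inc_join_left hne)
    have h2 := π.inc_frob.2 (π.inc_join_right hne)
    have hl := π.line_eq (π.frob_injective.ne hne) hi hj h1 h2
    exact ⟨i, j, _, fun h => hij (congrArg ρ h), π.inc_frob.1 (hl ▸ ha), π.inc_join_left hne,
      π.inc_join_right hne⟩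
  · rintro ⟨i, j, l, hij, ha, hi, hj⟩
    exact ⟨ρ i, ρ j, π.frobL l, fun h => hij (ρ.injective h), π.inc_frob.2 ha,
      hT i ▸ π.inc_frob.2 hi, hT j ▸ π.inc_frob.2 hj⟩

theorem onSecant_iterate_iff {ρ : Perm ι} {T : ι → P} (hT : T ∈ Twisted π.frob ρ)
    (hinj : Injective T) {a : P} (n : ℕ) :
    π.OnSecant T (π.frob^[n] a) ↔ π.OnSecant T a := by
  induction n with
  | zero => rfl
  | succ n ih => rw [iterate_succ_apply', π.onSecant_frob_iff hT hinj, ih]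

theorem onSecant_of_mem_range [Fintype ι] (h2 : 2 ≤ Fintype.card ι) {T : ι → P}
    (hinj : Injective T) (k : ι) : π.OnSecant T (T k) := by
  have : Nontrivial ι := Fintype.one_lt_card_iff_nontrivial.1 h2
  obtain ⟨j, hj⟩ := exists_ne k
  have hne : T k ≠ T j := fun h => hj (hinj h).symm
  exact ⟨k, j, _, hj.symm, π.inc_join_left hne, π.inc_join_left hne, π.inc_join_right hne⟩

/-- When the extension of a tuple by an orbit is an arc. -/
theorem arc_extend_iff [Fintype ι] (h2 : 2 ≤ Fintype.card ι) {ρ : Perm ι} {n : ℕ} {x : P}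
    {T : ι → P} (hT : T ∈ Twisted π.frob ρ) :
    π.Arc (extend π.frob (n + 1) x T) ↔ π.Arc T ∧
      π.Arc (fun k : Fin (n + 1) => π.frob^[k] x) ∧ ¬ π.OnSecant T x ∧
      ∀ a b : Fin (n + 1), a ≠ b → ∀ i l, π.inc (π.frob^[a] x) l → π.inc (π.frob^[b] x) l →
        ¬ π.inc (T i) l := by
  constructor
  · rintro ⟨h1, h3⟩
    refine ⟨⟨h1.comp Sum.inr_injective, fun l i j k hij hik hjk => ?_⟩,
      ⟨h1.comp Sum.inl_injective, fun l i j k hij hik hjk => ?_⟩, ?_, fun a b hab i l => ?_⟩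
    · exact h3 l (.inr i) (.inr j) (.inr k) (by simpa) (by simpa) (by simpa)
    · exact h3 l (.inl i) (.inl j) (.inl k) (by simpa) (by simpa) (by simpa)
    · rintro ⟨i, j, l, hij, hl, hi, hj⟩
      exact h3 l (.inl 0) (.inr i) (.inr j) (by simp) (by simp) (by simpa) hl hi hj
    · exact h3 l (.inl a) (.inl b) (.inr i) (by simpa) (by simp) (by simp)
  · rintro ⟨h1, h3, h4, h5⟩
    have h6 : ∀ k : Fin (n + 1), ¬ π.OnSecant T (π.frob^[k] x) := fun k =>
      (π.onSecant_iterate_iff hT h1.1 k).not.2 h4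
    have h7 : ∀ (k : Fin (n + 1)) i, π.frob^[k] x ≠ T i := fun k i h =>
      h6 k (h ▸ π.onSecant_of_mem_range h2 h1.1 i)
    refine ⟨?_, ?_⟩
    · rintro (a | i) (b | j) hab
      · exact congrArg _ (h3.1 hab)
      · exact absurd hab (h7 a j)
      · exact absurd hab.symm (h7 b i)
      · exact congrArg _ (h1.1 hab)
    · rintro l (i | i) (j | j) (k | k) hij hik hjk hi hj hk
      · exact h3.2 l i j k (by simpa using hij) (by simpa using hik) (by simpa using hjk) hi hj hk
      · exact h5 i j (by simpa using hij) k l hi hj hk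
      · exact h5 i k (by simpa using hik) j l hi hk hj
      · exact h6 i ⟨j, k, l, by simpa using hjk, hi, hj, hk⟩
      · exact h5 j k (by simpa using hjk) i l hj hk hi
      · exact h6 j ⟨i, k, l, by simpa using hik, hj, hi, hk⟩
      · exact h6 k ⟨i, j, l, by simpa using hij, hk, hi, hj⟩
      · exact h1.2 l i j k (by simpa using hij) (by simpa using hik) (by simpa using hjk) hi hj hk

/-- Fixed points on the secants of an arc of at most five points, where no three secants without
common vertices exist. -/
theorem two_mul_ncard_onSecant_of_le_five [Fintype ι] [DecidableEq ι] {ρ : Perm ι} {T : ι → P}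
    (hT : T ∈ Twisted π.frob ρ) (hA : π.Arc T) (h2 : 2 ≤ Fintype.card ι)
    (h5 : Fintype.card ι ≤ 5) :
    2 * ({a | π.frob a = a ∧ π.OnSecant T a}.ncard : ℤ) = secantCount ρ π.q := by
  classical
  have hfin : {a | π.frob a = a ∧ a ∉ Set.range T}.Finite :=
    (π.finite_points 1 one_pos).subset fun a ha => ha.1
  rw [π.two_mul_ncard_onSecant hT hA h2 (by omega) hfin.toFinset (by simp)
    (fun a => (duads ι).filter (π.OnLineOf T a)) (by simp), sum_eq_zero, mul_zero, add_zero]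
  intro a ha
  rw [concurrencySign, if_neg]
  intro h3
  have ha' : a ∉ Set.range T := ((hfin.mem_toFinset).1 ha).2
  have h1 : (((duads ι).filter (π.OnLineOf T a)).biUnion id).card =
      ∑ d ∈ (duads ι).filter (π.OnLineOf T a), (id d).card := by
    refine card_biUnion fun d hd e he hne => ?_
    obtain ⟨hd1, hd2⟩ := mem_filter.1 hd
    obtain ⟨he1, he2⟩ := mem_filter.1 he
    exact (π.eq_or_disjoint_of_onLineOf hA ha' (mem_powersetCard.1 hd1).2
      (mem_powersetCard.1 he1).2 hd2 he2).resolve_left hne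
  rw [sum_congr rfl (fun d hd =>
    ((mem_powersetCard.1 (mem_filter.1 hd).1).2 : (id d).card = 2)),
    sum_const, smul_eq_mul, h3] at h1
  have h4 := card_le_univ (((duads ι).filter (π.OnLineOf T a)).biUnion id)
  omega

theorem ncard_fixed_not (p : P → Prop) (d : ℕ) (hd : 0 < d) :
    ({a | π.frob^[d] a = a ∧ ¬ p a}.ncard : ℤ) =
      π.q ^ (2 * d) + π.q ^ d + 1 - {a | π.frob^[d] a = a ∧ p a}.ncard := by
  have h := ncard_add_ncard_not (π.finite_points d hd) p
  have h1 := π.ncard_points d hd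
  rw [h1] at h
  push_cast at h
  simp only [Set.mem_ofPred_eq] at h
  linarith

theorem arc_of_subsingleton {κ : Type*} [Subsingleton κ] (T : κ → P) : π.Arc T :=
  ⟨injective_of_subsingleton T, fun _ i j _ hij => absurd (Subsingleton.elim i j) hij⟩

theorem two_mul_arcCount_addCycle [Fintype ι] (ρ : Perm ι) (h2 : 2 ≤ Fintype.card ι) (n : ℕ)
    {c : ℤ} (hc : ∀ T ∈ Twisted π.frob ρ, π.Arc T →
      2 * ({x | π.frob^[n + 1] x = x ∧ π.Arc (extend π.frob (n + 1) x T)}.ncard : ℤ) = c) :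
    2 * π.arcCount (addCycle (n + 1) ρ) = π.arcCount ρ * c := by
  have hfin : {T ∈ Twisted π.frob ρ | π.Arc T}.Finite :=
    (Twisted.finite π.finite_points ρ).subset fun T hT => hT.1
  rw [arcCount, ncard_twisted_addCycle π.finite_points ρ n π.Arc π.Arc
    (fun x T _ hT h => ((π.arc_extend_iff h2 hT).1 h).1) hfin, mul_sum,
    sum_congr rfl (fun T hT => hc T ((hfin.mem_toFinset).1 hT).1
      ((hfin.mem_toFinset).1 hT).2), sum_const, nsmul_eq_mul, arcCount,
    Set.ncard_eq_toFinset_card _ hfin]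

/-- Adding a fixed point to an arc of at most five points. -/
theorem two_mul_arcCount_addCycle_one [Fintype ι] [DecidableEq ι] (ρ : Perm ι)
    (h2 : 2 ≤ Fintype.card ι) (h5 : Fintype.card ι ≤ 5) :
    2 * π.arcCount (addCycle 1 ρ) =
      π.arcCount ρ * (2 * (π.q ^ 2 + π.q + 1) - secantCount ρ π.q) := by
  refine π.two_mul_arcCount_addCycle ρ h2 0 fun T hT hA => ?_
  have h1 : {x | π.frob^[0 + 1] x = x ∧ π.Arc (extend π.frob (0 + 1) x T)} =
      {x | π.frob^[1] x = x ∧ ¬ π.OnSecant T x} := by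
    ext x
    refine and_congr_right fun hx => ?_
    rw [π.arc_extend_iff h2 hT]
    refine ⟨fun h => h.2.2.1, fun h => ⟨hA, ?_, h, fun a b hab => ?_⟩⟩
    · exact @arc_of_subsingleton P L π (Fin 1) _ _
    · exact absurd (@Subsingleton.elim (Fin 1) _ a b) hab
  have h3 := π.two_mul_ncard_onSecant_of_le_five hT hA h2 h5
  rw [h1, π.ncard_fixed_not _ 1 one_pos, ← h3]
  simp only [iterate_one]
  ring

/-- If `ρ` has no fixed point, then a line joining two conjugate points that meets a twisted arc in
one point is a secant of it. -/
theorem onSecant_of_conjugate {ρ : Perm ι} {T : ι → P} (hT : T ∈ Twisted π.frob ρ) {i : ι}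
    {n : ℕ} (hi : (ρ ^ n) i ≠ i) {x : P} {l : L} (hl : π.frobL^[n] l = l) (hx : π.inc x l)
    (hi' : π.inc (T i) l) : π.OnSecant T x := by
  refine ⟨i, (ρ ^ n) i, l, hi.symm, hx, hi', ?_⟩
  rw [← Equiv.Perm.iterate_eq_pow, ← Twisted.iterate hT]
  have := (π.inc_iterate n).2 hi'
  rwa [hl] at this

/-- Adding a pair of conjugate points to an arc of at most five points, none of which is fixed. -/
theorem two_mul_arcCount_addCycle_two [Fintype ι] [DecidableEq ι] (ρ : Perm ι)
    (hρ : ∀ i, ρ i ≠ i) (h2 : 2 ≤ Fintype.card ι) (h5 : Fintype.card ι ≤ 5) :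
    2 * π.arcCount (addCycle 2 ρ) =
      π.arcCount ρ * (2 * (π.q ^ 4 - π.q) - secantCount (ρ ^ 2) (π.q ^ 2) +
        secantCount ρ π.q) := by
  refine π.two_mul_arcCount_addCycle ρ h2 1 fun T hT hA => ?_
  have h1 : {x | π.frob^[1 + 1] x = x ∧ π.Arc (extend π.frob (1 + 1) x T)} =
      {x | (π.frob^[2] x = x ∧ ¬ π.OnSecant T x) ∧ ¬ π.frob x = x} := by
    ext x
    show π.frob^[2] x = x ∧ _ ↔ _
    rw [Set.mem_ofPred_eq, and_assoc]
    refine and_congr_right fun hx => ?_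
    rw [π.arc_extend_iff h2 hT]
    constructor
    · rintro ⟨-, h, h', -⟩
      refine ⟨h', fun hfx => ?_⟩
      have := @h.1 0 1 hfx.symm
      simp at this
    · rintro ⟨h, h'⟩
      refine ⟨hA, ⟨?_, ?_⟩, h, ?_⟩
      · intro a b
        fin_cases a <;> fin_cases b <;> simp [h', Ne.symm h']
      · intro l i j k
        fin_cases i <;> fin_cases j <;> fin_cases k <;> simp
      · have key : ∀ i l, π.inc x l → π.inc (π.frob x) l → ¬ π.inc (T i) l := by
          intro i l hl hl' hi
          have hx2 : π.frob (π.frob x) = x := hx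
          have hl2 : π.frobL l = l := by
            have ha := π.inc_frob.2 hl
            have hb := π.inc_frob.2 hl'
            rw [hx2] at hb
            exact π.line_eq (Ne.symm h') hb ha hl hl'
          exact h (π.onSecant_of_conjugate hT (n := 1) (hρ i) hl2 hl hi)
        intro a b hab i l ha hb
        fin_cases a <;> fin_cases b
        · exact absurd rfl hab
        · exact key i l ha hb
        · exact key i l hb ha
        · exact absurd rfl hab
  have h3 := π.two_mul_ncard_onSecant_of_le_five hT hA h2 h5
  have h4 := (π.pow 2 two_pos).two_mul_ncard_onSecant_of_le_five (T := T)
    (Twisted.iterate_mem hT 2) hA h2 h5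
  have h5 := π.ncard_fixed_not (π.OnSecant T) 1 one_pos
  have h6 := π.ncard_fixed_not (π.OnSecant T) 2 two_pos
  have h7 := ncard_add_ncard_not (A := {x | π.frob^[2] x = x ∧ ¬ π.OnSecant T x})
    ((π.finite_points 2 two_pos).subset fun x hx => hx.1) (fun x => π.frob x = x)
  have h8 : {x | x ∈ {x | π.frob^[2] x = x ∧ ¬ π.OnSecant T x} ∧ π.frob x = x} =
      {x | π.frob^[1] x = x ∧ ¬ π.OnSecant T x} := by
    ext x
    constructor
    · rintro ⟨⟨-, h⟩, h'⟩
      exact ⟨h', h⟩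
    · rintro ⟨h', h⟩
      have h'' : π.frob x = x := h'
      exact ⟨⟨by show π.frob (π.frob x) = x; rw [h'', h''], h⟩, h''⟩
  rw [h8] at h7
  have h9 : ((π.pow 2 two_pos).q : ℤ) = (π.q : ℤ) ^ 2 := by
    show ((π.q ^ 2 : ℕ) : ℤ) = _
    push_cast
    rfl
  rw [h9] at h4
  have h10 : {a | (π.pow 2 two_pos).frob a = a ∧ (π.pow 2 two_pos).OnSecant T a} =
      {a | π.frob^[2] a = a ∧ π.OnSecant T a} := rfl
  rw [h10] at h4
  rw [h1]
  simp only [iterate_one, Set.mem_ofPred_eq, Nat.reduceMul, pow_one] at h3 h4 h5 h6 h7 ⊢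
  linarith

end FrobeniusPlane

/-! ### Arcs consisting of one orbit -/

theorem eq_univ_of_translates_three : ∀ S : Finset (Fin 3), 3 ≤ S.card → S = univ := by
  decide +kernel

theorem eq_univ_of_translates_five : ∀ S : Finset (Fin 5), 3 ≤ S.card →
    (∀ m, 2 ≤ (S ∩ S.image (· + m)).card → S.image (· + m) = S) → S = univ := by
  decide +kernel

theorem image_add_two_of_translates_six : ∀ S : Finset (Fin 6), 3 ≤ S.card →
    (∀ m, 2 ≤ (S ∩ S.image (· + m)).card → S.image (· + m) = S) → S.image (· + 2) = S := by
  decide +kernel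

/-- The sets of at least three residues modulo `7` that share at most one element with each
different translate: the whole set and the lines of the two cyclic Fano planes. -/
theorem eq_univ_or_fano_of_translates_seven : ∀ S : Finset (Fin 7), 3 ≤ S.card →
    (∀ m, 2 ≤ (S ∩ S.image (· + m)).card → S.image (· + m) = S) → S = univ ∨
      ∃ s, S = {s, s + 1, s + 3} ∨ S = {-s, -(s + 1), -(s + 3)} := by
  decide +kernel

namespace FrobeniusPlane

variable {P L : Type*} (π : FrobeniusPlane P L)

/-- The plane contains no Fano subplane. -/
theorem false_of_fano (C : Fin 7 → P) (hC : Injective C) (ln : Fin 7 → L)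
    (h : ∀ m z, π.inc (C z) (ln m) ↔ z = m ∨ z = m + 1 ∨ z = m + 3) : False := by
  have hpair : ∀ (a b m : Fin 7) (l : L), π.inc (C a) l → π.inc (C b) l → π.inc (C a) (ln m) →
      π.inc (C b) (ln m) → a ≠ b → l = ln m := fun a b m l h1 h2 h3 h4 hne =>
    π.line_eq (hC.ne hne) h1 h2 h3 h4
  refine π.fano (C ∘ ![2, 4, 5, 6]) (hC.comp (by decide)) ?_ (C ∘ ![1, 3, 0]) (ln ∘ ![1, 2, 6])
    (ln ∘ ![5, 3, 4]) (ln 0) ?_ ?_ ?_ ?_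
  · intro l i j k hij hik hjk hi hj hk
    have key : ∀ i j k : Fin 4, i ≠ j → i ≠ k → j ≠ k →
        ∃ m : Fin 7, ((![2, 4, 5, 6] : Fin 4 → Fin 7) i = m ∨ (![2, 4, 5, 6] : Fin 4 → Fin 7) i = m + 1
          ∨ (![2, 4, 5, 6] : Fin 4 → Fin 7) i = m + 3) ∧
        ((![2, 4, 5, 6] : Fin 4 → Fin 7) j = m ∨ (![2, 4, 5, 6] : Fin 4 → Fin 7) j = m + 1
          ∨ (![2, 4, 5, 6] : Fin 4 → Fin 7) j = m + 3) ∧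
        (![2, 4, 5, 6] : Fin 4 → Fin 7) i ≠ (![2, 4, 5, 6] : Fin 4 → Fin 7) j ∧
        ¬ ((![2, 4, 5, 6] : Fin 4 → Fin 7) k = m ∨ (![2, 4, 5, 6] : Fin 4 → Fin 7) k = m + 1
          ∨ (![2, 4, 5, 6] : Fin 4 → Fin 7) k = m + 3) := by decide
    obtain ⟨m, h1, h2, h3, h4⟩ := key i j k hij hik hjk
    have := hpair _ _ m l hi hj ((h m _).2 h1) ((h m _).2 h2) h3
    subst this
    exact h4 ((h m _).1 hk)
  · intro i
    fin_cases i <;> simp only [comp_apply, h] <;> decide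
  · intro i j hij
    fin_cases i <;> fin_cases j <;> first
      | exact absurd rfl hij
      | (simp only [comp_apply, h]; decide)
  · intro i
    fin_cases i <;> simp only [comp_apply, h] <;> decide
  · intro i
    fin_cases i <;> simp only [comp_apply, h] <;> decide

/-- For a line through at least three points of an orbit, the set of indices of these points is
equal to each of its translates that it meets at least twice. -/
theorem exists_index_set {n : ℕ} {x : P} (hx : ExactPeriod π.frob (n + 1) x) (l : L) :
    ∃ S : Finset (Fin (n + 1)), (∀ z, z ∈ S ↔ π.inc (π.frob^[z] x) l) ∧
      (∀ m z : Fin (n + 1), z ∈ S.image (· + m) ↔ π.inc (π.frob^[z] x) (π.frobL^[m] l)) ∧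
      (∀ m, 2 ≤ (S ∩ S.image (· + m)).card → π.frobL^[m] l = l) ∧
      (∀ m, 2 ≤ (S ∩ S.image (· + m)).card → S.image (· + m) = S) := by
  classical
  have hinj : ∀ a b : Fin (n + 1), π.frob^[a] x = π.frob^[b] x → a = b :=
    fun a b h => Fin.ext (hx.iterate_inj a.2 b.2 h)
  have hadd : ∀ m z : Fin (n + 1), π.frob^[(z + m : Fin (n + 1))] x = π.frob^[m] (π.frob^[z] x) := by
    intro m z
    rw [← iterate_add_apply, Fin.val_add]
    conv_rhs => rw [add_comm, ← Nat.mod_add_div (z + m : ℕ) (n + 1), iterate_add_apply,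
      iterate_mul, iterate_fixed hx.1]
  have h1 : ∀ z, z ∈ univ.filter (fun z : Fin (n + 1) => π.inc (π.frob^[z] x) l) ↔
      π.inc (π.frob^[z] x) l := by simp
  have h2 : ∀ m z : Fin (n + 1), z ∈ (univ.filter
      (fun z : Fin (n + 1) => π.inc (π.frob^[z] x) l)).image (· + m) ↔
        π.inc (π.frob^[z] x) (π.frobL^[m] l) := by
    intro m z
    rw [mem_image]
    constructor
    · rintro ⟨w, hw, rfl⟩
      rw [hadd, π.inc_iterate]
      exact (h1 w).1 hw
    · intro h
      refine ⟨z - m, (h1 _).2 ?_, sub_add_cancel z m⟩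
      rw [← π.inc_iterate m, ← hadd, sub_add_cancel]
      exact h
  have h3 : ∀ m : Fin (n + 1), 2 ≤ (univ.filter (fun z : Fin (n + 1) => π.inc (π.frob^[z] x) l) ∩
      (univ.filter (fun z : Fin (n + 1) => π.inc (π.frob^[z] x) l)).image (· + m)).card →
      π.frobL^[m] l = l := by
    intro m hm
    obtain ⟨a, ha, b, hb, hab⟩ := one_lt_card.1 hm
    rw [mem_inter] at ha hb
    exact π.line_eq (fun h => hab (hinj a b h)) ((h2 m a).1 ha.2) ((h2 m b).1 hb.2)
      ((h1 a).1 ha.1) ((h1 b).1 hb.1)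
  refine ⟨_, h1, h2, h3, fun m hm => ?_⟩
  ext z
  rw [h2, h1, h3 m hm]

theorem orbit_injective {n : ℕ} {x : P} (hx : ExactPeriod π.frob (n + 1) x) :
    Injective fun k : Fin (n + 1) => π.frob^[k] x :=
  fun a b h => Fin.ext (hx.iterate_inj a.2 b.2 h)

/-- An orbit of exact period `n` is an arc iff it is not contained in a fixed line, provided that
sets of residues modulo `n` with the property of `exists_index_set` are trivial. -/
theorem orbit_arc_iff {n : ℕ} (hn : 3 ≤ n + 1)
    (hS : ∀ (x : P) (l : L), ExactPeriod π.frob (n + 1) x → ∀ S : Finset (Fin (n + 1)),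
      (∀ z, z ∈ S ↔ π.inc (π.frob^[z] x) l) → 3 ≤ S.card →
      (∀ m, 2 ≤ (S ∩ S.image (· + m)).card → S.image (· + m) = S) → S = univ) {x : P} :
    (π.frob^[n + 1] x = x ∧ π.Arc (fun k : Fin (n + 1) => π.frob^[k] x)) ↔
      ExactPeriod π.frob (n + 1) x ∧ ¬ ∃ l, π.frobL l = l ∧ π.inc x l := by
  constructor
  · rintro ⟨hx, h1, h2⟩
    refine ⟨⟨hx, fun k hk hk0 h => ?_⟩, ?_⟩
    · have := @h1 ⟨k, hk⟩ 0 h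
      simp only [Fin.ext_iff, Fin.val_zero] at this
      omega
    · rintro ⟨l, hl, hxl⟩
      have key : ∀ k, π.inc (π.frob^[k] x) l := by
        intro k
        have := (π.inc_iterate k).2 hxl
        rwa [iterate_fixed hl] at this
      exact h2 l ⟨0, by omega⟩ ⟨1, by omega⟩ ⟨2, by omega⟩ (by simp) (by simp) (by simp)
        (key _) (key _) (key _)
  · rintro ⟨hx, h⟩
    refine ⟨hx.1, π.orbit_injective hx, fun l i j k hij hik hjk hi hj hk => h ⟨l, ?_⟩⟩
    obtain ⟨S, h1, h2, h3, h4⟩ := π.exists_index_set hx l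
    have hcard : 3 ≤ S.card := by
      have hsub : ({i, j, k} : Finset (Fin (n + 1))) ⊆ S := by
        intro z hz
        simp only [mem_insert, mem_singleton] at hz
        rcases hz with rfl | rfl | rfl
        exacts [(h1 _).2 hi, (h1 _).2 hj, (h1 _).2 hk]
      have := card_le_card hsub
      rwa [card_eq_three.2 ⟨i, j, k, hij, hik, hjk, rfl⟩] at this
    have hu := hS x l hx S h1 hcard h4
    subst hu
    have himg : (univ : Finset (Fin (n + 1))).image (· + ⟨1, by omega⟩) = univ :=
      image_univ_of_surjective (add_right_surjective _)
    have h5 := h3 ⟨1, by omega⟩ (by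
      rw [himg, inter_self]
      omega)
    exact ⟨h5, (h1 0).1 (mem_univ _)⟩

/-- Points of exact period `n` on a line fixed by Frobenius. -/
theorem ncard_exactPeriod_on_fixed {l : L} (hl : π.frobL l = l) {n : ℕ} (h0 : 0 < n) (h7 : n ≤ 7) :
    ({x | ExactPeriod π.frob n x ∧ π.inc x l}.ncard : ℤ) =
      exactCount (fun d => (π.q : ℤ) ^ d + 1) n := by
  refine ncard_exactPeriod (fun d hd => (π.finite_points d hd).subset fun x hx => hx.1)
    (fun d hd => ?_) h0 h7
  rw [π.ncard_points_on d hd l (iterate_fixed hl d)]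
  push_cast
  rfl

theorem ncard_exactPeriod_points {n : ℕ} (h0 : 0 < n) (h7 : n ≤ 7) :
    ({x | ExactPeriod π.frob n x}.ncard : ℤ) =
      exactCount (fun d => (π.q : ℤ) ^ (2 * d) + (π.q : ℤ) ^ d + 1) n := by
  have := ncard_exactPeriod (φ := π.frob) (p := fun _ => True)
    (f := fun d => (π.q : ℤ) ^ (2 * d) + (π.q : ℤ) ^ d + 1)
    (fun d hd => (π.finite_points d hd).subset fun x hx => hx.1)
    (fun d hd => by
      simp only [and_true]
      rw [π.ncard_points d hd]
      push_cast
      rfl) h0 h7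
  simpa only [and_true] using this

theorem finite_exactPeriod {n : ℕ} (h0 : 0 < n) : {x | ExactPeriod π.frob n x}.Finite :=
  (π.finite_points n h0).subset fun _ hx => hx.1

/-- Points of exact period `n` on some line fixed by Frobenius. -/
theorem ncard_exactPeriod_on_some_fixed {n : ℕ} (h0 : 2 ≤ n) (h7 : n ≤ 7) :
    ({x | ExactPeriod π.frob n x ∧ ∃ l, π.frobL l = l ∧ π.inc x l}.ncard : ℤ) =
      (π.q ^ 2 + π.q + 1) * exactCount (fun d => (π.q : ℤ) ^ d + 1) n := by
  have hne : ∀ x, ExactPeriod π.frob n x → π.frob x ≠ x := fun x hx => hx.2 1 (by omega) one_pos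
  have hjoin : ∀ x l, ExactPeriod π.frob n x → π.frobL l = l → π.inc x l →
      π.join x (π.frob x) = l := by
    intro x l hx hl hxl
    have := π.inc_frob.2 hxl
    rw [hl] at this
    exact π.line_eq (hne x hx).symm (π.inc_join_left (hne x hx).symm)
      (π.inc_join_right (hne x hx).symm) hxl this
  have hB := π.finite_lines 1 one_pos
  have hBc := π.ncard_lines 1 one_pos
  rw [ncard_eq_mul_of_fiber ((π.finite_exactPeriod (by omega)).subset fun _ hx => hx.1) hB
    (fun x => π.join x (π.frob x)) ?_ (k := exactCount (fun d => (π.q : ℤ) ^ d + 1) n), hBc]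
  · push_cast
    ring
  · intro l hl
    have hl' : π.frobL l = l := hl
    rw [← π.ncard_exactPeriod_on_fixed hl' (by omega) h7]
    congr 2
    ext x
    constructor
    · rintro ⟨⟨h1, m, hm, hxm⟩, rfl⟩
      exact ⟨h1, by simpa only [hjoin x m h1 hm hxm] using hxm⟩
    · rintro ⟨h1, h2⟩
      exact ⟨⟨h1, l, hl', h2⟩, hjoin x l h1 hl' h2⟩
  · rintro x ⟨h1, l, hl, hxl⟩
    show π.frobL (π.join x (π.frob x)) = _
    rw [hjoin x l h1 hl hxl, hl]

theorem ncard_exactPeriod_not_on_fixed {n : ℕ} (h0 : 2 ≤ n) (h7 : n ≤ 7) :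
    ({x | ExactPeriod π.frob n x ∧ ¬ ∃ l, π.frobL l = l ∧ π.inc x l}.ncard : ℤ) =
      exactCount (fun d => (π.q : ℤ) ^ (2 * d) + (π.q : ℤ) ^ d + 1) n -
        (π.q ^ 2 + π.q + 1) * exactCount (fun d => (π.q : ℤ) ^ d + 1) n := by
  rw [← π.ncard_exactPeriod_points (by omega) h7, ← π.ncard_exactPeriod_on_some_fixed h0 h7]
  have := ncard_add_ncard_not (π.finite_exactPeriod (n := n) (by omega))
    (fun x => ∃ l, π.frobL l = l ∧ π.inc x l)
  simp only [Set.mem_ofPred_eq] at this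
  linarith

theorem arcCount_rot_singleton (n : ℕ) :
    π.arcCount (rot [n + 1]) =
      {x | π.frob^[n + 1] x = x ∧ π.Arc (fun k : Fin (n + 1) => π.frob^[k] x)}.ncard := by
  have hT0 : ∀ T : Fin ([] : List ℕ).sum → P, T ∈ Twisted π.frob (rot []) :=
    fun T i => Fin.elim0 i
  rw [arcCount_rot_cons, arcCount, Nat.cast_inj]
  symm
  refine Set.ncard_congr (fun x _ => extend π.frob (n + 1) x (fun i => Fin.elim0 i)) ?_ ?_ ?_
  · rintro x ⟨h1, h2⟩
    refine ⟨extend_mem_twisted h1 (hT0 _), ?_⟩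
    have : IsEmpty (Fin ([] : List ℕ).sum) := inferInstanceAs (IsEmpty (Fin 0))
    exact (π.arc_comp_iff (Equiv.sumEmpty (Fin (n + 1)) (Fin ([] : List ℕ).sum)).symm _).1 h2
  · intro x y _ _ h
    exact congrFun h (.inl 0)
  · rintro S ⟨h1, h2⟩
    obtain ⟨h3, -, h5⟩ := exists_eq_extend h1
    refine ⟨S (.inl 0), ⟨h3, ?_⟩, ?_⟩
    · rw [← h5] at h2
      exact ⟨h2.1.comp Sum.inl_injective, fun l i j k hij hik hjk =>
        h2.2 l (.inl i) (.inl j) (.inl k) (by simpa) (by simpa) (by simpa)⟩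
    · conv_rhs => rw [← h5]
      congr 1
      exact Subsingleton.elim (α := Fin 0 → P) _ _

/-- If no line contains at least three points of an orbit of length `n + 1` without containing all of
them, then the orbits that are arcs are those not contained in a line, necessarily a fixed one. -/
theorem arcCount_rot_singleton_of_trivial {n : ℕ} (hn : 3 ≤ n + 1) (h7 : n + 1 ≤ 7)
    (hS : ∀ (x : P) (l : L), ExactPeriod π.frob (n + 1) x → ∀ S : Finset (Fin (n + 1)),
      (∀ z, z ∈ S ↔ π.inc (π.frob^[z] x) l) → 3 ≤ S.card →
      (∀ m, 2 ≤ (S ∩ S.image (· + m)).card → S.image (· + m) = S) → S = univ) :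
    π.arcCount (rot [n + 1]) =
      exactCount (fun d => (π.q : ℤ) ^ (2 * d) + (π.q : ℤ) ^ d + 1) (n + 1) -
        (π.q ^ 2 + π.q + 1) * exactCount (fun d => (π.q : ℤ) ^ d + 1) (n + 1) := by
  rw [arcCount_rot_singleton, ← π.ncard_exactPeriod_not_on_fixed (by omega) h7]
  congr 2
  ext x
  exact π.orbit_arc_iff hn hS

theorem arcCount_three : π.arcCount (rot [3]) =
    (π.q : ℤ) ^ 3 * (π.q - 1) ^ 2 * (π.q + 1) := by
  rw [π.arcCount_rot_singleton_of_trivial (n := 2) (by norm_num) (by norm_num)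
    (fun x l _ S _ h3 _ => eq_univ_of_translates_three S h3)]
  simp only [exactCount]
  ring

theorem arcCount_five : π.arcCount (rot [5]) =
    (π.q : ℤ) ^ 3 * (π.q ^ 3 - 1) * (π.q ^ 4 - 1) := by
  rw [π.arcCount_rot_singleton_of_trivial (n := 4) (by norm_num) (by norm_num)
    (fun x l _ S _ h3 h4 => eq_univ_of_translates_five S h3 h4)]
  simp only [exactCount]
  ring

/-- The two exceptional index sets for orbits of length seven would form a Fano plane. -/
theorem arcCount_seven : π.arcCount (rot [7]) =
    (π.q : ℤ) ^ 14 - π.q ^ 9 - π.q ^ 8 + π.q ^ 3 := by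
  rw [π.arcCount_rot_singleton_of_trivial (n := 6) (by norm_num) (by norm_num)]
  · simp only [exactCount]
    ring
  · intro x l hx S h1 h3 h4
    rcases eq_univ_or_fano_of_translates_seven S h3 h4 with h | ⟨s, h | h⟩
    · exact h
    · exfalso
      obtain ⟨S', h1', h2', -, -⟩ := π.exists_index_set hx l
      obtain rfl : S' = S := by ext z; rw [h1, h1']
      refine π.false_of_fano (fun z => π.frob^[z] x) (π.orbit_injective hx)
        (fun m => π.frobL^[(m - s : Fin 7)] l) fun m z => ?_
      rw [← h2', h]
      clear h h1 h1' h2' h3 h4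
      revert s m z
      decide +kernel
    · exfalso
      obtain ⟨S', h1', h2', -, -⟩ := π.exists_index_set hx l
      obtain rfl : S' = S := by ext z; rw [h1, h1']
      refine π.false_of_fano (fun z => π.frob^[(-z : Fin 7)] x)
        ((π.orbit_injective hx).comp neg_injective)
        (fun m => π.frobL^[(s - m : Fin 7)] l) fun m z => ?_
      rw [← h2', h]
      clear h h1 h1' h2' h3 h4
      revert s m z
      decide +kernel

end FrobeniusPlane

/-! ### Arcs of one orbit of length six, and adding cycles of length three -/

section SecantData

variable {ι : Type*} [Fintype ι] [DecidableEq ι]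

/-- The numbers entering `secantCount`: fixed indices, fixed duads, fixed indices in fixed duads,
ordered pairs of disjoint fixed duads, and duads exchanged with a disjoint one. -/
def secantData (ρ : Perm ι) : ℕ × ℕ × ℕ × ℕ × ℕ :=
  ((univ.filter fun i => ρ i = i).card,
    ((duads ι).filter fun d => mapSet ρ d = d).card,
    ∑ d ∈ (duads ι).filter fun d => mapSet ρ d = d, (d.filter fun i => ρ i = i).card,
    (((duads ι).filter fun d => mapSet ρ d = d).offDiag.filter
      fun e => Disjoint e.1 e.2).card,
    ((duads ι).filter fun d => mapSet ρ d ≠ d ∧ mapSet ρ (mapSet ρ d) = d ∧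
      Disjoint d (mapSet ρ d)).card)

theorem secantCount_of_data {ρ : Perm ι} {a b c d e : ℕ} (h : secantData ρ = (a, b, c, d, e))
    (q : ℤ) : secantCount ρ q = 2 * a + 2 * (b * (q + 1) - c) - d + e := by
  simp only [secantData, Prod.mk.injEq] at h
  obtain ⟨h1, h2, h3, h4, h5⟩ := h
  rw [secantCount, sum_sub_distrib, sum_const, h1, h2, ← Nat.cast_sum, h3, h4, h5]
  simp

end SecantData

namespace FrobeniusPlane

variable {P L : Type*} (π : FrobeniusPlane P L)

theorem exactPeriod_iterate_two_iff {X : Type*} {φ : X → X} {x : X} :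
    ExactPeriod φ^[2] 3 x ↔ ExactPeriod φ 6 x ∨ ExactPeriod φ 3 x := by
  constructor
  · rintro ⟨h1, h2⟩
    have h6 : φ^[6] x = x := h1
    have n2 : φ^[2] x ≠ x := h2 1 (by norm_num) (by norm_num)
    have n4 : φ^[4] x ≠ x := h2 2 (by norm_num) (by norm_num)
    have n1 : φ x ≠ x := fun h => n2 (by show φ (φ x) = x; rw [h, h])
    by_cases h3 : φ^[3] x = x
    · refine .inr ⟨h3, fun k hk hk0 => ?_⟩
      interval_cases k
      exacts [n1, n2]
    · refine .inl ⟨h6, fun k hk hk0 => ?_⟩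
      interval_cases k
      · exact n1
      · exact n2
      · exact h3
      · exact n4
      · intro h
        have : φ (φ^[5] x) = x := h6
        rw [h] at this
        exact n1 this
  · rintro (⟨h1, h2⟩ | ⟨h1, h2⟩)
    · refine ⟨h1, fun k hk hk0 => ?_⟩
      interval_cases k
      exacts [h2 2 (by norm_num) (by norm_num), h2 4 (by norm_num) (by norm_num)]
    · have h3 : φ^[3] x = x := h1
      refine ⟨?_, fun k hk hk0 => ?_⟩
      · show φ^[3] (φ^[3] x) = x
        rw [h3, h3]
      interval_cases k
      · exact h2 2 (by norm_num) (by norm_num)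
      · show φ (φ^[3] x) ≠ x
        rw [h3]
        exact h2 1 (by norm_num) (by norm_num)

/-- An orbit of exact period six is an arc iff its two halves are not collinear. -/
theorem orbit_arc_six_iff {x : P} :
    (π.frob^[6] x = x ∧ π.Arc (fun k : Fin 6 => π.frob^[k] x)) ↔
      ExactPeriod π.frob 6 x ∧ ¬ ∃ l, π.frobL^[2] l = l ∧ π.inc x l := by
  constructor
  · rintro ⟨hx, h1, h2⟩
    refine ⟨⟨hx, fun k hk hk0 h => ?_⟩, ?_⟩
    · have := @h1 ⟨k, hk⟩ 0 h
      simp only [Fin.ext_iff, Fin.val_zero] at this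
      omega
    · rintro ⟨l, hl, hxl⟩
      have h3 : π.inc (π.frob^[2] x) l := by
        have := (π.inc_iterate 2).2 hxl
        rwa [hl] at this
      have h4 : π.inc (π.frob^[4] x) l := by
        have := (π.inc_iterate 2).2 h3
        rwa [hl] at this
      exact h2 l 0 2 4 (by decide) (by decide) (by decide) hxl h3 h4
  · rintro ⟨hx, h⟩
    refine ⟨hx.1, π.orbit_injective hx, fun l i j k hij hik hjk hi hj hk => h ?_⟩
    obtain ⟨S, h1, h2, h3, h4⟩ := π.exists_index_set hx l
    have hcard : 3 ≤ S.card := by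
      have hsub : ({i, j, k} : Finset (Fin 6)) ⊆ S := by
        intro z hz
        simp only [mem_insert, mem_singleton] at hz
        rcases hz with rfl | rfl | rfl
        exacts [(h1 _).2 hi, (h1 _).2 hj, (h1 _).2 hk]
      have := card_le_card hsub
      rwa [card_eq_three.2 ⟨i, j, k, hij, hik, hjk, rfl⟩] at this
    have h5 : π.frobL^[2] l = l := h3 2 (by
      rw [image_add_two_of_translates_six S hcard h4, inter_self]
      omega)
    refine ⟨π.frobL^[6 - i] l, ?_, ?_⟩
    · rw [← iterate_add_apply, add_comm, iterate_add_apply, h5]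
    · have := (π.inc_iterate (6 - i)).2 hi
      rwa [← iterate_add_apply, Nat.sub_add_cancel i.2.le, hx.1] at this

/-- The points of exact period six, minus those for which the orbit under the square of Frobenius is
contained in a line. -/
theorem arcCount_six : π.arcCount (rot [6]) =
    (π.q : ℤ) ^ 12 + π.q ^ 6 + 1 - (π.q ^ 4 + π.q ^ 2 + 1) - (π.q ^ 6 + π.q ^ 3 + 1) +
      (π.q ^ 2 + π.q + 1) - ((π.q ^ 4 + π.q ^ 2 + 1) * (π.q ^ 6 - π.q ^ 2) -
        (π.q ^ 2 + π.q + 1) * (π.q ^ 3 - π.q)) := by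
  have h1 := (π.pow 2 two_pos).ncard_exactPeriod_on_some_fixed (n := 3) (by norm_num) (by norm_num)
  have h2 := π.ncard_exactPeriod_on_some_fixed (n := 3) (by norm_num) (by norm_num)
  have h3 := π.ncard_exactPeriod_points (n := 6) (by norm_num) (by norm_num)
  have h4 := ncard_add_ncard_not (π.finite_exactPeriod (n := 6) (by norm_num))
    (fun x => ∃ l, π.frobL^[2] l = l ∧ π.inc x l)
  have hfin : {x | ExactPeriod (π.pow 2 two_pos).frob 3 x ∧
      ∃ l, (π.pow 2 two_pos).frobL l = l ∧ (π.pow 2 two_pos).inc x l}.Finite :=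
    ((π.pow 2 two_pos).finite_exactPeriod (n := 3) (by norm_num)).subset fun x hx => hx.1
  have h5 := ncard_add_ncard_not hfin (fun x => ExactPeriod π.frob 6 x)
  have h6 : {x | x ∈ {x | ExactPeriod (π.pow 2 two_pos).frob 3 x ∧
      ∃ l, (π.pow 2 two_pos).frobL l = l ∧ (π.pow 2 two_pos).inc x l} ∧ ExactPeriod π.frob 6 x} =
      {x | x ∈ {x | ExactPeriod π.frob 6 x} ∧ ∃ l, π.frobL^[2] l = l ∧ π.inc x l} := by
    ext x
    constructor
    · rintro ⟨⟨-, h⟩, h'⟩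
      exact ⟨h', h⟩
    · rintro ⟨h', h⟩
      exact ⟨⟨exactPeriod_iterate_two_iff.2 (.inl h'), h⟩, h'⟩
  have h7 : {x | x ∈ {x | ExactPeriod (π.pow 2 two_pos).frob 3 x ∧
      ∃ l, (π.pow 2 two_pos).frobL l = l ∧ (π.pow 2 two_pos).inc x l} ∧ ¬ ExactPeriod π.frob 6 x} =
      {x | ExactPeriod π.frob 3 x ∧ ∃ l, π.frobL l = l ∧ π.inc x l} := by
    ext x
    constructor
    · rintro ⟨⟨h, l, hl, hxl⟩, h'⟩
      have h3 := (exactPeriod_iterate_two_iff.1 h).resolve_left h'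
      refine ⟨h3, l, ?_, hxl⟩
      have e2 : π.frobL^[2] l = l := hl
      have i2 := (π.inc_iterate 2).2 hxl
      rw [e2] at i2
      have i4 := (π.inc_iterate 2).2 i2
      rw [e2] at i4
      have i1 : π.inc (π.frob x) l := by
        have : π.frob^[2] (π.frob^[2] x) = π.frob (π.frob^[3] x) := rfl
        rwa [this, h3.1] at i4
      have hne : π.frob x ≠ x := h3.2 1 (by norm_num) one_pos
      exact π.line_eq (π.frob_injective.ne hne) (π.inc_frob.2 i1) (π.inc_frob.2 hxl) i2 i1
    · rintro ⟨h, l, hl, hxl⟩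
      refine ⟨⟨exactPeriod_iterate_two_iff.2 (.inr h), l, ?_, hxl⟩, fun h' => ?_⟩
      · show π.frobL (π.frobL l) = l
        rw [hl, hl]
      · exact h'.2 3 (by norm_num) (by norm_num) h.1
  rw [h6, h7] at h5
  have h9 : ((π.pow 2 two_pos).q : ℤ) = (π.q : ℤ) ^ 2 := by
    show ((π.q ^ 2 : ℕ) : ℤ) = _
    push_cast
    rfl
  rw [h9] at h1
  rw [h1, h2] at h5
  rw [h3] at h4
  rw [arcCount_rot_singleton, Set.ext fun x => π.orbit_arc_six_iff (x := x)]
  simp only [exactCount, Set.mem_ofPred_eq] at h4 h5 ⊢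
  linear_combination h4 - h5

/-- A condition under which no secant of an arc permuted by `ρ` contains a noncollinear orbit of
length three. It holds for a cycle of length four and for a product of two transpositions. -/
theorem arcCount_addCycle_three {ι : Type*} [Fintype ι] (ρ : Perm ι)
    (h2 : 2 ≤ Fintype.card ι) (hρ : ∀ i, (ρ ^ 3) i ≠ i)
    (hρ' : ∀ i j, i ≠ j → ((ρ ^ 3) i = ρ i ∧ (ρ ^ 3) j = ρ j) ∨
      ((ρ ^ 3) i = ρ j ∧ (ρ ^ 3) j = ρ i) ∨ ((ρ ^ 3) i = j ∧ (ρ ^ 3) j ≠ i) ∨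
      ((ρ ^ 3) j = i ∧ (ρ ^ 3) i ≠ j)) :
    π.arcCount (addCycle 3 ρ) = π.arcCount ρ * π.arcCount (rot [3]) := by
  suffices h : 2 * π.arcCount (addCycle 3 ρ) = π.arcCount ρ * (2 * π.arcCount (rot [3])) by
    linarith
  refine π.two_mul_arcCount_addCycle ρ h2 2 fun T hT hA => ?_
  rw [arcCount_rot_singleton]
  congr 3
  ext x
  refine and_congr_right fun hx => ?_
  rw [π.arc_extend_iff h2 hT]
  refine ⟨fun h => h.2.1, fun h => ?_⟩
  have hx3 : π.frob^[3] x = x := hx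
  have key : ∀ i j l, i ≠ j → (ρ ^ 3) i = j → (ρ ^ 3) j ≠ i → π.inc x l → π.inc (T i) l →
      π.inc (T j) l → False := by
    intro i j l hij h3 h4 hxl hi hj
    have hxj : x ≠ T j := by
      intro hj'
      have := Twisted.iterate hT 3 j
      rw [Equiv.Perm.iterate_eq_pow, ← hj', hx3, hj'] at this
      exact hρ j (hA.1 this).symm
    have h5 := (π.inc_iterate 3).2 hxl
    have h6 := (π.inc_iterate 3).2 hi
    have h7 := (π.inc_iterate 3).2 hj
    rw [hx3] at h5
    rw [Twisted.iterate hT, Equiv.Perm.iterate_eq_pow, h3] at h6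
    rw [Twisted.iterate hT, Equiv.Perm.iterate_eq_pow, π.line_eq hxj h5 h6 hxl hj] at h7
    exact hA.2 l i j _ hij h4.symm (hρ j).symm hi hj h7
  have hns : ¬ π.OnSecant T x := by
    rintro ⟨i, j, l, hij, hxl, hi, hj⟩
    have h31 : π.frobL^[3] l = π.frobL l → False := by
      intro he
      have he2 : π.frobL^[2] l = l := π.frobL_injective he
      have i2 := (π.inc_iterate 2).2 hxl
      rw [he2] at i2
      have i4 := (π.inc_iterate 2).2 i2
      rw [he2] at i4
      have : π.frob^[2] (π.frob^[2] x) = π.frob (π.frob^[3] x) := rfl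
      rw [this, hx3] at i4
      exact h.2 l 0 1 2 (by decide) (by decide) (by decide) hxl i4 i2
    have hne : T (ρ i) ≠ T (ρ j) := fun h => hij (ρ.injective (hA.1 h))
    have i1 := π.inc_frob.2 hi
    have j1 := π.inc_frob.2 hj
    have i3 := (π.inc_iterate 3).2 hi
    have j3 := (π.inc_iterate 3).2 hj
    rw [hT] at i1 j1
    rw [Twisted.iterate hT, Equiv.Perm.iterate_eq_pow] at i3 j3
    rcases hρ' i j hij with ⟨h3, h4⟩ | ⟨h3, h4⟩ | ⟨h3, h4⟩ | ⟨h3, h4⟩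
    · rw [h3] at i3
      rw [h4] at j3
      exact h31 (π.line_eq hne i3 j3 i1 j1)
    · rw [h3] at i3
      rw [h4] at j3
      exact h31 (π.line_eq hne j3 i3 i1 j1)
    · exact key i j l hij h3 h4 hxl hi hj
    · exact key j i l hij.symm h3 h4 hxl hj hi
  refine ⟨hA, h, hns, fun a b hab i l ha hb hi => ?_⟩
  have hl : π.frobL^[3] l = l := by
    have ha' := (π.inc_iterate 3).2 ha
    have hb' := (π.inc_iterate 3).2 hb
    rw [← iterate_add_apply, add_comm, iterate_add_apply, hx3] at ha' hb'
    exact π.line_eq (h.1.ne hab) ha' hb' ha hb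
  exact hns ((π.onSecant_iterate_iff hT hA.1 a).1 (π.onSecant_of_conjugate hT (hρ i) hl ha hi))

end FrobeniusPlane

/-! ### Pairs of orbits of length three -/

namespace FrobeniusPlane

variable {P L : Type*} (π : FrobeniusPlane P L)

/-- The points with three conjugates that are not collinear. -/
def cubicPoints : Set P := {x | π.frob^[3] x = x ∧ π.Arc (fun k : Fin 3 => π.frob^[k] x)}

theorem finite_cubicPoints : π.cubicPoints.Finite :=
  (π.finite_points 3 (by norm_num)).subset fun _ hx => hx.1

theorem ncard_cubicPoints : (π.cubicPoints.ncard : ℤ) = (π.q : ℤ) ^ 3 * (π.q - 1) ^ 2 * (π.q + 1) := by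
  rw [← π.arcCount_three, arcCount_rot_singleton]
  rfl

theorem not_inc_of_cubic {x : P} (hx : x ∈ π.cubicPoints) {l : L} (hl : π.frobL l = l) :
    ¬ π.inc x l := fun h => by
  have key : ∀ k, π.inc (π.frob^[k] x) l := by
    intro k
    have := (π.inc_iterate k).2 h
    rwa [iterate_fixed hl] at this
  exact hx.2.2 l 0 1 2 (by decide) (by decide) (by decide) (key 0) (key 1) (key 2)

theorem mem_cubicPoints_iff {x : P} :
    x ∈ π.cubicPoints ↔ π.frob^[3] x = x ∧ ¬ ∃ l, π.frobL l = l ∧ π.inc x l := by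
  constructor
  · intro h
    exact ⟨h.1, fun ⟨l, hl, hxl⟩ => π.not_inc_of_cubic h hl hxl⟩
  · rintro ⟨h1, h2⟩
    refine (π.orbit_arc_iff (n := 2) (by norm_num)
      (fun x l _ S _ h3 _ => eq_univ_of_translates_three S h3)).2 ⟨⟨h1, ?_⟩, h2⟩
    have hx : π.frob x ≠ x := by
      intro hx
      have h3 := π.ncard_lines_on 1 one_pos x hx
      have h4 : {l | π.frobL^[1] l = l ∧ π.inc x l}.Nonempty := by
        by_contra h
        rw [Set.not_nonempty_iff_eq_empty.1 h, Set.ncard_empty] at h3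
        omega
      obtain ⟨l, hl⟩ := h4
      exact h2 ⟨l, hl⟩
    intro k hk hk0
    interval_cases k
    · exact hx
    · intro h
      have h5 : π.frob (π.frob^[2] x) = x := h1
      rw [h] at h5
      exact hx h5

theorem iterate_mem_cubicPoints {x : P} (hx : x ∈ π.cubicPoints) (k : ℕ) :
    π.frob^[k] x ∈ π.cubicPoints := by
  rw [mem_cubicPoints_iff] at hx ⊢
  refine ⟨by rw [← iterate_add_apply, add_comm, iterate_add_apply, hx.1], ?_⟩
  rintro ⟨l, hl, hxl⟩
  rw [← iterate_fixed hl k, π.inc_iterate] at hxl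
  exact hx.2 ⟨l, hl, hxl⟩

theorem orbit_mem_twisted {n : ℕ} {x : P} (hx : π.frob^[n + 1] x = x) :
    (fun k : Fin (n + 1) => π.frob^[k] x) ∈ Twisted π.frob (finRotate (n + 1)) :=
  fun k => iterate_finRotate hx k

/-- The point `y` lies on a side of the triangle formed by `x` and its conjugates. -/
def OnTriangle (x y : P) : Prop := π.OnSecant (fun k : Fin 3 => π.frob^[k] x) y

/-- Up to conjugation, `y` lies on the side of the triangle opposite to `x`. -/
theorem onTriangle_iff {x y : P} (hx : x ∈ π.cubicPoints) :
    π.OnTriangle x y ↔ ∃ k < 3, ∃ l, π.inc (π.frob^[k] y) l ∧ π.inc (π.frob x) l ∧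
      π.inc (π.frob^[2] x) l := by
  have h3 : ∀ m, π.frob^[m + 3] x = π.frob^[m] x := fun m => by
    rw [iterate_add_apply, hx.1]
  constructor
  · rintro ⟨i, j, l, hij, hy, hi, hj⟩
    wlog hlt : i < j generalizing i j with H
    · exact H j i hij.symm hj hi (lt_of_le_of_ne (not_lt.1 hlt) hij.symm)
    fin_cases i <;> fin_cases j <;> simp only [Fin.mk_lt_mk] at hlt <;> first
      | omega
      | skip
    · exact ⟨1, by norm_num, π.frobL l, π.inc_frob.2 hy, π.inc_frob.2 hi, π.inc_frob.2 hj⟩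
    · refine ⟨2, by norm_num, π.frobL^[2] l, (π.inc_iterate 2).2 hy, ?_, (π.inc_iterate 2).2 hi⟩
      have h4 : π.inc (π.frob^[1 + 3] x) (π.frobL^[2] l) := (π.inc_iterate 2).2 hj
      rwa [h3 1] at h4
    · exact ⟨0, by norm_num, l, hy, hi, hj⟩
  · rintro ⟨k, -, l, hy, h1, h2⟩
    exact (π.onSecant_iterate_iff (π.orbit_mem_twisted hx.1) hx.2.1 k).1
      ⟨1, 2, l, by decide, hy, h1, h2⟩

/-- Two noncollinear orbits of length three, each on the sides of the triangle of the other, are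
equal. -/
theorem mem_orbit_of_onTriangle {x y : P} (hx : x ∈ π.cubicPoints) (hy : y ∈ π.cubicPoints)
    (h1 : π.OnTriangle x y) (h2 : π.OnTriangle y x) : ∃ k < 3, π.frob^[k] x = y := by
  have hmod : ∀ {z : P}, z ∈ π.cubicPoints → ∀ m, π.frob^[m + 3] z = π.frob^[m] z := fun hz m => by
    rw [iterate_add_apply, hz.1]
  obtain ⟨k, hk, l, hyl, h1l, h2l⟩ := (π.onTriangle_iff hx).1 h1
  -- the second point is replaced by a conjugate
  suffices h : ∃ e, π.frob^[e] x = π.frob^[k] y by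
    obtain ⟨e, he⟩ := h
    have h5 : π.frob^[3 - k + e] x = y := by
      rw [iterate_add_apply, he, ← iterate_add_apply,
        Nat.sub_add_cancel hk.le, hy.1]
    refine ⟨(3 - k + e) % 3, Nat.mod_lt _ (by norm_num), ?_⟩
    rw [← h5]
    conv_rhs => rw [← Nat.mod_add_div (3 - k + e) 3, iterate_add_apply,
      iterate_mul, iterate_fixed hx.1]
  have hy' := π.iterate_mem_cubicPoints hy k
  have h2' : π.OnTriangle (π.frob^[k] y) x := by
    obtain ⟨e, he, m, hm, hm1, hm2⟩ := (π.onTriangle_iff hy).1 h2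
    refine (π.onSecant_iterate_iff (π.orbit_mem_twisted hy'.1) hy'.2.1 (k + e)).1
      ⟨1, 2, π.frobL^[k] m, by decide, ?_, ?_, ?_⟩
    · rw [iterate_add_apply, π.inc_iterate]
      exact hm
    · show π.inc (π.frob^[1] (π.frob^[k] y)) _
      rw [← iterate_add_apply, add_comm, iterate_add_apply, π.inc_iterate]
      exact hm1
    · show π.inc (π.frob^[2] (π.frob^[k] y)) _
      rw [← iterate_add_apply, add_comm, iterate_add_apply, π.inc_iterate]
      exact hm2
  clear h1 h2 hy
  generalize π.frob^[k] y = y at *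
  obtain ⟨e, he, m, hm, hm1, hm2⟩ := (π.onTriangle_iff hy').1 h2'
  by_contra hcon
  push Not at hcon
  have hx3 : π.frob (π.frob^[2] x) = x := hx.1
  have hy3 : π.frob (π.frob^[2] y) = y := hy'.1
  have hxne : ∀ n : L, π.inc x n → π.inc (π.frob x) n → ¬ π.inc (π.frob^[2] x) n :=
    fun n => hx.2.2 n 0 1 2 (by decide) (by decide) (by decide)
  have a1 := π.inc_frob.2 hyl
  have a2 := π.inc_frob.2 h1l
  have a3 := π.inc_frob.2 h2l
  rw [hx3] at a3
  have b1 := π.inc_frob.2 a1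
  have b2 := π.inc_frob.2 a2
  have b3 := π.inc_frob.2 a3
  have hb2 : π.frob (π.frob (π.frob x)) = x := hx.1
  rw [hb2] at b2
  have m1 := π.inc_frob.2 hm
  have m11 := π.inc_frob.2 hm1
  have m12 := π.inc_frob.2 hm2
  rw [hy3] at m12
  have m2 := π.inc_frob.2 m1
  have m21 := π.inc_frob.2 m11
  have m22 := π.inc_frob.2 m12
  have hm21 : π.frob (π.frob (π.frob y)) = y := hy'.1
  rw [hm21] at m21
  have hl1 : l ≠ π.frobL l := fun h => hxne l (by rw [h]; exact a3) h1l h2l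
  have hl2 : l ≠ π.frobL (π.frobL l) := fun h => hxne l (by rw [h]; exact b2) h1l h2l
  interval_cases e
  · rcases π.eq_or_eq m12 m1 hyl h1l with h | h
    · exact hcon 1 h.symm
    · rw [h] at m21 m2
      exact hcon 2 (π.point_eq hl1 h2l hyl m2 m21)
  · rcases π.eq_or_eq m12 m1 hyl h2l with h | h
    · exact hcon 2 h.symm
    · rw [h] at m21
      exact hcon 2 (π.point_eq hl1 h2l hyl a2 m21)
  · have m2' : π.inc (π.frob x) (π.frobL (π.frobL m)) := by
      have : π.frob (π.frob (π.frob^[2] x)) = π.frob x := by rw [hx3]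
      rwa [this] at m2
    rcases π.eq_or_eq m21 m2' hyl h1l with h | h
    · exact hcon 1 h.symm
    · have m3 := π.inc_frob.2 m22
      have m3' := π.inc_frob.2 m2'
      have m4' := π.inc_frob.2 m21
      rw [h] at m3 m3' m4'
      have m5 := π.inc_frob.2 m4'
      have m6 := π.inc_frob.2 m3
      rw [hm21] at m6
      exact hcon 1 (π.point_eq hl2 h1l hyl b3 m6)

/-- The sides of the triangle formed by `x` and its conjugates contain no fixed point. -/
theorem frob_ne_of_onTriangle {x y : P} (hx : x ∈ π.cubicPoints) (h : π.OnTriangle x y) :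
    π.frob y ≠ y := by
  intro hy
  have h1 := π.two_mul_ncard_onSecant_of_le_five (π.orbit_mem_twisted hx.1) hx.2 (by simp) (by simp)
  rw [secantCount_of_data (a := 0) (b := 0) (c := 0) (d := 0) (e := 0) (by decide +kernel)] at h1
  simp only [Nat.cast_zero, zero_mul, mul_zero, sub_zero, add_zero, mul_eq_zero, OfNat.ofNat_ne_zero,
    false_or, Nat.cast_eq_zero] at h1
  rw [Set.ncard_eq_zero ((π.finite_points 1 one_pos).subset fun a ha => ha.1)] at h1
  exact Set.eq_empty_iff_forall_notMem.1 h1 y ⟨hy, h⟩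

/-- Each side carries `q ^ 3 + 1` points fixed by the cube of Frobenius. Of these points, those with
collinear orbits are the intersections of the sides with the fixed lines. -/
theorem ncard_onTriangle {x : P} (hx : x ∈ π.cubicPoints) :
    ({y | y ∈ π.cubicPoints ∧ π.OnTriangle x y}.ncard : ℤ) =
      3 * π.q ^ 3 - 3 * (π.q ^ 2 + π.q + 1) := by
  have hfin : {y | π.frob^[3] y = y ∧ π.OnTriangle x y}.Finite :=
    (π.finite_points 3 (by norm_num)).subset fun a ha => ha.1
  have hx1 : π.frob x ≠ x := fun h => by
    have := @hx.2.1 1 0 h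
    simp at this
  have h1 : ({y | π.frob^[3] y = y ∧ π.OnTriangle x y}.ncard : ℤ) = 3 * π.q ^ 3 := by
    have h1 := (π.pow 3 (by norm_num)).two_mul_ncard_onSecant_of_le_five (ρ := 1)
      (T := fun k : Fin 3 => π.frob^[k] x) (fun k => by
        show π.frob^[3] (π.frob^[k] x) = _
        rw [← iterate_add_apply, add_comm, iterate_add_apply, hx.1]
        rfl) hx.2 (by simp) (by simp)
    rw [secantCount_of_data (a := 3) (b := 3) (c := 6) (d := 0) (e := 0) (by decide +kernel)] at h1
    have h2 : {a | (π.pow 3 (by norm_num)).frob a = a ∧ (π.pow 3 (by norm_num)).OnSecant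
        (fun k : Fin 3 => π.frob^[k] x) a} = {y | π.frob^[3] y = y ∧ π.OnTriangle x y} := rfl
    have h9 : ((π.pow 3 (by norm_num)).q : ℤ) = (π.q : ℤ) ^ 3 := by
      show ((π.q ^ 3 : ℕ) : ℤ) = _
      push_cast
      rfl
    rw [h2, h9] at h1
    push_cast at h1
    linarith
  have h2 := ncard_add_ncard_not hfin (fun y => ∃ l, π.frobL l = l ∧ π.inc y l)
  have h3 : {y | y ∈ {y | π.frob^[3] y = y ∧ π.OnTriangle x y} ∧
      ¬ ∃ l, π.frobL l = l ∧ π.inc y l} = {y | y ∈ π.cubicPoints ∧ π.OnTriangle x y} := by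
    ext y
    simp only [Set.mem_ofPred_eq, mem_cubicPoints_iff]
    tauto
  have hjoin : ∀ {y l}, π.OnTriangle x y → π.frobL l = l → π.inc y l →
      π.join y (π.frob y) = l := by
    intro y l hy hl hyl
    have hne := (π.frob_ne_of_onTriangle hx hy).symm
    have := π.inc_frob.2 hyl
    rw [hl] at this
    exact π.line_eq hne (π.inc_join_left hne) (π.inc_join_right hne) hyl this
  have h4 : ({y | y ∈ {y | π.frob^[3] y = y ∧ π.OnTriangle x y} ∧
      ∃ l, π.frobL l = l ∧ π.inc y l}.ncard : ℤ) = (π.q ^ 2 + π.q + 1) * 3 := by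
    have hB := π.ncard_lines 1 one_pos
    rw [ncard_eq_mul_of_fiber (hfin.subset fun y hy => hy.1) (π.finite_lines 1 one_pos)
      (fun y => π.join y (π.frob y)) (k := 3), hB]
    · push_cast
      ring
    · rintro y ⟨⟨-, hy⟩, l, hl, hyl⟩
      show π.frobL (π.join y (π.frob y)) = _
      rw [hjoin hy hl hyl, hl]
    · intro l hl
      have hl' : π.frobL l = l := hl
      have hl3 : π.frobL^[3] l = l := iterate_fixed hl' 3
      -- the three points of the fixed line are conjugate to its intersection with one side
      set s := π.join x (π.frob x) with hs
      have hs0 : π.inc x s := π.inc_join_left hx1.symm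
      have hs1 : π.inc (π.frob x) s := π.inc_join_right hx1.symm
      have hls : l ≠ s := fun h => π.not_inc_of_cubic hx hl' (h ▸ hs0)
      have hs3 : π.frobL^[3] s = s := by
        have h5 := (π.inc_iterate 3).2 hs0
        have h6 : π.inc (π.frob^[3] (π.frob^[1] x)) (π.frobL^[3] s) := (π.inc_iterate 3).2 hs1
        rw [(π.iterate_mem_cubicPoints hx 1).1] at h6
        rw [hx.1] at h5
        exact π.line_eq hx1.symm h5 h6 hs0 hs1
      set y := π.meet l s with hy
      have hyl : π.inc y l := π.inc_meet_left hls
      have hys : π.inc y s := π.inc_meet_right hls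
      have hon : π.OnTriangle x y := ⟨0, 1, s, by decide, hys, hs0, hs1⟩
      have hy3 : π.frob^[3] y = y := by
        have h5 := (π.inc_iterate 3).2 hyl
        have h6 := (π.inc_iterate 3).2 hys
        rw [hl3] at h5
        rw [hs3] at h6
        exact π.point_eq hls h5 hyl h6 hys
      have hy1 : π.frob y ≠ y := π.frob_ne_of_onTriangle hx hon
      have hset : {a | a ∈ {y | y ∈ {y | π.frob^[3] y = y ∧ π.OnTriangle x y} ∧
          ∃ l, π.frobL l = l ∧ π.inc y l} ∧ π.join a (π.frob a) = l} =
          ↑(({y, π.frob y, π.frob^[2] y} : Set P)) := by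
        have hmem : ∀ k, π.frob^[3] (π.frob^[k] y) = π.frob^[k] y ∧ π.OnTriangle x (π.frob^[k] y) ∧
            π.inc (π.frob^[k] y) l := by
          intro k
          refine ⟨by rw [← iterate_add_apply, add_comm, iterate_add_apply, hy3],
            (π.onSecant_iterate_iff (π.orbit_mem_twisted hx.1) hx.2.1 k).2 hon, ?_⟩
          have := (π.inc_iterate k).2 hyl
          rwa [iterate_fixed hl'] at this
        ext z
        simp only [Set.mem_ofPred_eq, Set.mem_insert_iff, Set.mem_singleton_iff]
        constructor
        · rintro ⟨⟨⟨hz3, hz⟩, m, hm, hzm⟩, hzl⟩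
          obtain rfl : m = l := by rw [← hzl, hjoin hz hm hzm]
          obtain ⟨k, hk, n, hn, hn1, hn2⟩ := (π.onTriangle_iff hx).1 hz
          have hkl : π.inc (π.frob^[k] z) m := by
            have := (π.inc_iterate k).2 hzm
            rwa [iterate_fixed hl'] at this
          have hsn : π.frobL s = n := π.line_eq (π.frob_injective.ne hx1.symm)
            (π.inc_frob.2 hs0) (π.inc_frob.2 hs1) hn1 hn2
          have hln : m ≠ n := by
            rintro rfl
            exact hls (π.frobL_injective (hl'.trans hsn.symm))
          have h5 : π.frob^[k] z = π.frob y := by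
            refine π.point_eq hln hkl ?_ hn ?_
            · have := π.inc_frob.2 hyl
              rwa [hl'] at this
            · rw [← hsn]
              exact π.inc_frob.2 hys
          interval_cases k
          · exact .inr (.inl h5)
          · exact .inl (π.frob_injective h5)
          · have h6 := congrArg π.frob h5
            have h7 : π.frob (π.frob^[2] z) = z := hz3
            rw [h7] at h6
            exact .inr (.inr h6)
        · rintro (rfl | rfl | rfl)
          · exact ⟨⟨⟨(hmem 0).1, (hmem 0).2.1⟩, l, hl', (hmem 0).2.2⟩,
              hjoin (hmem 0).2.1 hl' (hmem 0).2.2⟩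
          · exact ⟨⟨⟨(hmem 1).1, (hmem 1).2.1⟩, l, hl', (hmem 1).2.2⟩,
              hjoin (hmem 1).2.1 hl' (hmem 1).2.2⟩
          · exact ⟨⟨⟨(hmem 2).1, (hmem 2).2.1⟩, l, hl', (hmem 2).2.2⟩,
              hjoin (hmem 2).2.1 hl' (hmem 2).2.2⟩
      rw [hset, Set.ncard_eq_three.2 ⟨_, _, _, hy1.symm, ?_, ?_, rfl⟩]
      · rfl
      · intro h
        have h7 : π.frob (π.frob^[2] y) = y := hy3
        rw [← h] at h7
        exact hy1 h7
      · exact fun h => hy1 (π.frob_injective h).symm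
  rw [h3, h4, h1] at h2
  linarith

theorem ncard_pairs {α β : Type*} {A : Set α} {B : Set β} (hA : A.Finite) (hB : B.Finite)
    (r : α → β → Prop) {k : ℤ} (hk : ∀ x ∈ A, ({y | y ∈ B ∧ r x y}.ncard : ℤ) = k) :
    ({p | p ∈ A ×ˢ B ∧ r p.1 p.2}.ncard : ℤ) = A.ncard * k := by
  refine ncard_eq_mul_of_fiber ((hA.prod hB).subset fun p hp => hp.1) hA Prod.fst
    (fun p hp => hp.1.1) fun x hx => ?_
  rw [← hk x hx]
  congr 1
  symm
  refine Set.ncard_congr (fun y _ => (x, y)) ?_ ?_ ?_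
  · exact fun y hy => ⟨⟨⟨hx, hy.1⟩, hy.2⟩, rfl⟩
  · exact fun y z _ _ h => congrArg Prod.snd h
  · rintro ⟨_, y⟩ ⟨⟨⟨-, h1⟩, h2⟩, rfl⟩
    exact ⟨y, ⟨h1, h2⟩, rfl⟩

/-- Inclusion and exclusion: if both points lie on the triangle of the other one, they are conjugate. -/
theorem ncard_cubic_pairs :
    ({p | p ∈ π.cubicPoints ×ˢ π.cubicPoints ∧ ¬ π.OnTriangle p.1 p.2 ∧
      ¬ π.OnTriangle p.2 p.1}.ncard : ℤ) =
      π.q ^ 3 * (π.q ^ 3 - 1) * (π.q ^ 2 - 1) * (π.q ^ 4 - 2 * π.q ^ 3 - 3 * π.q + 9) := by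
  have hX := π.finite_cubicPoints
  have hXX := hX.prod hX
  have h1 := ncard_pairs hX hX π.OnTriangle fun x hx => π.ncard_onTriangle hx
  have h2 : {p | p ∈ π.cubicPoints ×ˢ π.cubicPoints ∧ π.OnTriangle p.2 p.1}.ncard =
      {p | p ∈ π.cubicPoints ×ˢ π.cubicPoints ∧ π.OnTriangle p.1 p.2}.ncard := by
    rw [← Set.ncard_image_of_injective _ Prod.swap_injective]
    congr 1
    ext ⟨x, y⟩
    simp only [Set.mem_image, Prod.exists, Set.mem_ofPred_eq, Set.mem_prod, Prod.swap_prod_mk,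
      Prod.mk.injEq]
    constructor
    · rintro ⟨a, b, h, rfl, rfl⟩
      tauto
    · exact fun h => ⟨y, x, by tauto, rfl, rfl⟩
  have h3 : ({p | p ∈ π.cubicPoints ×ˢ π.cubicPoints ∧
      (π.OnTriangle p.1 p.2 ∧ π.OnTriangle p.2 p.1)}.ncard : ℤ) = π.cubicPoints.ncard * 3 := by
    refine ncard_pairs hX hX (fun x y => π.OnTriangle x y ∧ π.OnTriangle y x) fun x hx => ?_
    classical
    have h4 : {y | y ∈ π.cubicPoints ∧ π.OnTriangle x y ∧ π.OnTriangle y x} =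
        ↑(univ.image fun k : Fin 3 => π.frob^[k] x : Finset P) := by
      ext y
      simp only [coe_image, coe_univ, Set.image_univ, Set.mem_range]
      constructor
      · rintro ⟨hy, h1, h2⟩
        obtain ⟨k, hk, h⟩ := π.mem_orbit_of_onTriangle hx hy h1 h2
        exact ⟨⟨k, hk⟩, h⟩
      · rintro ⟨k, rfl⟩
        have hx' := π.iterate_mem_cubicPoints hx k
        refine ⟨hx', (π.onSecant_iterate_iff (π.orbit_mem_twisted hx.1) hx.2.1 k).2
          (π.onSecant_of_mem_range (by simp) hx.2.1 0), ?_⟩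
        refine (π.onSecant_iterate_iff (π.orbit_mem_twisted hx'.1) hx'.2.1 k).1
          (π.onSecant_of_mem_range (by simp) hx'.2.1 0)
    rw [h4, Set.ncard_coe_finset, card_image_of_injective _ hx.2.1]
    rfl
  have h4 := ncard_add_ncard_not hXX (fun p => π.OnTriangle p.1 p.2)
  have h5 := ncard_add_ncard_not (A := {p | p ∈ π.cubicPoints ×ˢ π.cubicPoints ∧
    ¬ π.OnTriangle p.1 p.2}) (hXX.subset fun p hp => hp.1) (fun p => π.OnTriangle p.2 p.1)
  have h6 := ncard_add_ncard_not (A := {p | p ∈ π.cubicPoints ×ˢ π.cubicPoints ∧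
    π.OnTriangle p.2 p.1}) (hXX.subset fun p hp => hp.1) (fun p => π.OnTriangle p.1 p.2)
  have h7 : {p | p ∈ {p | p ∈ π.cubicPoints ×ˢ π.cubicPoints ∧ π.OnTriangle p.2 p.1} ∧
      ¬ π.OnTriangle p.1 p.2} = {p | p ∈ {p | p ∈ π.cubicPoints ×ˢ π.cubicPoints ∧
      ¬ π.OnTriangle p.1 p.2} ∧ π.OnTriangle p.2 p.1} := by
    ext p
    simp only [Set.mem_ofPred_eq]
    tauto
  have h8 : {p | p ∈ {p | p ∈ π.cubicPoints ×ˢ π.cubicPoints ∧ π.OnTriangle p.2 p.1} ∧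
      π.OnTriangle p.1 p.2} = {p | p ∈ π.cubicPoints ×ˢ π.cubicPoints ∧
      (π.OnTriangle p.1 p.2 ∧ π.OnTriangle p.2 p.1)} := by
    ext p
    simp only [Set.mem_ofPred_eq]
    tauto
  have h9 : {p | p ∈ {p | p ∈ π.cubicPoints ×ˢ π.cubicPoints ∧ ¬ π.OnTriangle p.1 p.2} ∧
      ¬ π.OnTriangle p.2 p.1} = {p | p ∈ π.cubicPoints ×ˢ π.cubicPoints ∧
      ¬ π.OnTriangle p.1 p.2 ∧ ¬ π.OnTriangle p.2 p.1} := by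
    ext p
    simp only [Set.mem_ofPred_eq]
    tauto
  rw [h7, h8, h3, h2, h1] at h6
  rw [h9] at h5
  rw [h1, Set.ncard_prod] at h4
  push_cast at h4
  have hc := π.ncard_cubicPoints
  rw [hc] at h4 h6
  linear_combination h4 + h5 - h6

theorem arcCount_three_three : π.arcCount (rot [3, 3]) =
    π.q ^ 3 * (π.q ^ 3 - 1) * (π.q ^ 2 - 1) * (π.q ^ 4 - 2 * π.q ^ 3 - 3 * π.q + 9) := by
  have h := π.arcCount_congr (ρ := addCycle 3 (finRotate 3)) (ρ' := rot [3, 3])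
    (finSumFinEquiv : Fin 3 ⊕ Fin 3 ≃ Fin 6) (by decide +kernel)
  rw [← π.ncard_cubic_pairs, ← h, arcCount, Nat.cast_inj]
  symm
  have hiff : ∀ x y, π.frob^[3] x = x → π.frob^[3] y = y →
      (π.Arc (extend π.frob 3 x fun k : Fin 3 => π.frob^[k] y) ↔ (x, y) ∈ {p |
        p ∈ π.cubicPoints ×ˢ π.cubicPoints ∧ ¬ π.OnTriangle p.1 p.2 ∧ ¬ π.OnTriangle p.2 p.1}) := by
    intro x y hx hy
    rw [π.arc_extend_iff (by simp) (π.orbit_mem_twisted hy)]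
    constructor
    · rintro ⟨h1, h2, h3, h4⟩
      refine ⟨⟨⟨hx, h2⟩, hy, h1⟩, ?_, h3⟩
      rintro ⟨a, b, l, hab, hl, ha, hb⟩
      exact h4 a b hab 0 l ha hb hl
    · rintro ⟨⟨⟨-, h2⟩, -, h1⟩, h4, h3⟩
      refine ⟨h1, h2, h3, fun a b hab i l ha hb hi => h4 ?_⟩
      exact (π.onSecant_iterate_iff (π.orbit_mem_twisted hx) h2.1 i).1 ⟨a, b, l, hab, hi, ha, hb⟩
  refine Set.ncard_congr (fun p _ => extend π.frob 3 p.1 fun k : Fin 3 => π.frob^[k] p.2) ?_ ?_ ?_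
  · rintro ⟨x, y⟩ h
    exact ⟨extend_mem_twisted h.1.1.1 (π.orbit_mem_twisted h.1.2.1),
      (hiff x y h.1.1.1 h.1.2.1).2 h⟩
  · rintro ⟨x, y⟩ ⟨x', y'⟩ _ _ h
    exact Prod.ext (congrFun h (.inl 0)) (congrFun h (.inr 0))
  · rintro S ⟨hS, hA⟩
    obtain ⟨h1, h2, h3⟩ := exists_eq_extend hS
    have h4 : S ∘ Sum.inr = fun k : Fin 3 => π.frob^[k] (S (.inr 0)) := by
      funext k
      have e1 : π.frob (S (.inr 0)) = S (.inr 1) := h2 0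
      have e2 : π.frob (S (.inr 1)) = S (.inr 2) := h2 1
      fin_cases k
      · rfl
      · exact e1.symm
      · show S (.inr 2) = π.frob (π.frob _)
        rw [e1, e2]
    have h5 : π.frob^[3] (S (.inr 0)) = S (.inr 0) := by
      have e1 : π.frob (S (.inr 0)) = S (.inr 1) := h2 0
      have e2 : π.frob (S (.inr 1)) = S (.inr 2) := h2 1
      have e3 : π.frob (S (.inr 2)) = S (.inr 0) := h2 2
      show π.frob (π.frob (π.frob _)) = _
      rw [e1, e2, e3]
    rw [h4] at h3
    refine ⟨(S (.inl 0), S (.inr 0)), (hiff _ _ h1 h5).1 ?_, h3⟩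
    rwa [h3]

end FrobeniusPlane

/-! ### Adding a fixed point to an arc of six points -/

section Synthemes

variable {ι : Type*} [Fintype ι] [DecidableEq ι]

/-- The sets of three disjoint pairs of indices that are preserved by `ρ`. -/
def synthemes (ρ : Perm ι) : Finset (Finset (Finset ι)) :=
  ((duads ι).powersetCard 3).filter fun E =>
    (∀ d ∈ E, mapSet ρ d ∈ E) ∧ ∀ d ∈ E, ∀ e ∈ E, d ≠ e → Disjoint d e

end Synthemes

namespace FrobeniusPlane

variable {P L ι : Type*} (π : FrobeniusPlane P L)

/-- The lines joining the pairs of points of `T` with indices in the members of `E` have a common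
point. -/
def Concurrent (T : ι → P) (E : Finset (Finset ι)) : Prop := ∃ a, ∀ d ∈ E, π.OnLineOf T a d

theorem line_eq_of_arc {T : ι → P} (hT : π.Arc T) {d : Finset ι} (hd : d.card = 2) {l m : L}
    (hl : ∀ i ∈ d, π.inc (T i) l) (hm : ∀ i ∈ d, π.inc (T i) m) : l = m := by
  classical
  obtain ⟨x, y, hxy, rfl⟩ := card_eq_two.1 hd
  exact π.line_eq (hT.1.ne hxy) (hl x (by simp)) (hl y (by simp)) (hm x (by simp)) (hm y (by simp))

theorem not_onLineOf_self {T : ι → P} (hT : π.Arc T) {d : Finset ι} (hd : d.card = 2) {j : ι}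
    (hj : j ∉ d) : ¬ π.OnLineOf T (T j) d := by
  classical
  rintro ⟨l, h1, h2⟩
  obtain ⟨x, y, hxy, rfl⟩ := card_eq_two.1 hd
  simp only [mem_insert, mem_singleton, not_or] at hj
  exact hT.2 l x y j hxy (Ne.symm hj.1) (Ne.symm hj.2) (h2 x (by simp)) (h2 y (by simp)) h1

theorem eq_of_onLineOf {T : ι → P} (hT : π.Arc T) {d e : Finset ι} (hd : d.card = 2)
    (he : e.card = 2) (hde : Disjoint d e) {a b : P} (h1 : π.OnLineOf T a d)
    (h2 : π.OnLineOf T a e) (h3 : π.OnLineOf T b d) (h4 : π.OnLineOf T b e) : a = b := by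
  obtain ⟨l, hal, hl⟩ := h1
  obtain ⟨m, ham, hm⟩ := h2
  obtain ⟨l', hbl, hl'⟩ := h3
  obtain ⟨m', hbm, hm'⟩ := h4
  obtain rfl := π.line_eq_of_arc hT hd hl hl'
  obtain rfl := π.line_eq_of_arc hT he hm hm'
  refine π.point_eq ?_ hal hbl ham hbm
  rintro rfl
  obtain ⟨j, hj⟩ : e.Nonempty := card_pos.1 (by omega)
  exact π.not_onLineOf_self hT hd (disjoint_right.1 hde hj) ⟨l, hm j hj, hl⟩

/-- Three secants of an arc of six points that meet outside the arc use all six points. A fixed point on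
three secants therefore corresponds to a syntheme preserved by `ρ` with concurrent joining lines. -/
theorem sum_concurrencySign [Fintype ι] [DecidableEq ι] {ρ : Perm ι} {T : ι → P}
    (hT : T ∈ Twisted π.frob ρ) (hA : π.Arc T) (h6 : Fintype.card ι = 6)
    (R : Finset P) (hR : ∀ a, a ∈ R ↔ π.frob a = a ∧ a ∉ Set.range T)
    (D : P → Finset (Finset ι)) (hD : ∀ a d, d ∈ D a ↔ d ∈ duads ι ∧ π.OnLineOf T a d)
    [DecidablePred (π.Concurrent T)] :
    ∑ a ∈ R, concurrencySign (D a) (mapSet ρ) =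
      ∑ E ∈ synthemes ρ, concurrencySign E (mapSet ρ) * if π.Concurrent T E then 1 else 0 := by
  have hcard : ∀ {d : Finset ι}, d ∈ duads ι ↔ d.card = 2 := by
    intro d; simp [mem_powersetCard]
  have hsyn : ∀ {a}, a ∈ R → (D a).card = 3 → D a ∈ synthemes ρ := by
    intro a ha h3
    obtain ⟨h1, h2⟩ := (hR a).1 ha
    simp only [synthemes, mem_filter, mem_powersetCard]
    refine ⟨⟨fun d hd => ((hD a d).1 hd).1, h3⟩, fun d hd => ?_, fun d hd e he hne => ?_⟩
    · obtain ⟨h4, h5⟩ := (hD a d).1 hd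
      refine (hD _ _).2 ⟨hcard.2 (by rw [card_map, hcard.1 h4]), ?_⟩
      have := π.onLineOf_mapSet hT h5
      rwa [h1] at this
    · exact (π.eq_or_disjoint_of_onLineOf hA h2 (hcard.1 ((hD a d).1 hd).1)
        (hcard.1 ((hD a e).1 he).1) ((hD a d).1 hd).2 ((hD a e).1 he).2).resolve_left hne
  have h1 : ∀ a ∈ R, concurrencySign (D a) (mapSet ρ) =
      ∑ E ∈ synthemes ρ, if D a = E then concurrencySign E (mapSet ρ) else 0 := by
    intro a ha
    rw [sum_ite_eq]
    split_ifs with h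
    · rfl
    · rw [concurrencySign, if_neg fun h3 => h (hsyn ha h3)]
  rw [sum_congr rfl h1, sum_comm]
  refine sum_congr rfl fun E hE => ?_
  rw [← sum_filter, sum_const, nsmul_eq_mul, mul_comm]
  congr 1
  simp only [synthemes, mem_filter, mem_powersetCard] at hE
  obtain ⟨⟨hE1, hE2⟩, hE3, hE4⟩ := hE
  obtain ⟨d, e, f, hde, hdf, hef, hEd⟩ := card_eq_three.1 hE2
  have hdE : d ∈ E := by simp [hEd]
  have heE : e ∈ E := by simp [hEd]
  have hdis := hE4 d hdE e heE hde
  have huniq : ∀ {a b}, (∀ d ∈ E, π.OnLineOf T a d) → (∀ d ∈ E, π.OnLineOf T b d) → a = b :=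
    fun ha hb => π.eq_of_onLineOf hA (hcard.1 (hE1 hdE)) (hcard.1 (hE1 heE)) hdis
      (ha d hdE) (ha e heE) (hb d hdE) (hb e heE)
  have hcover : ∀ i, ∃ d ∈ E, i ∈ d := by
    have h1 : (E.biUnion id).card = ∑ d ∈ E, (id d).card :=
      card_biUnion fun d hd e he hne => hE4 d hd e he hne
    rw [sum_congr rfl (fun d hd => (hcard.1 (hE1 hd) : (id d).card = 2)), sum_const,
      smul_eq_mul, hE2] at h1
    have h2 : E.biUnion id = univ := eq_univ_of_card _ (by omega)
    intro i
    have := mem_univ i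
    rw [← h2, mem_biUnion] at this
    exact this
  split_ifs with hc
  · obtain ⟨a, ha⟩ := hc
    have hrange : a ∉ Set.range T := by
      rintro ⟨j, rfl⟩
      by_cases hj : j ∈ d
      · exact π.not_onLineOf_self hA (hcard.1 (hE1 heE)) (disjoint_left.1 hdis hj) (ha e heE)
      · exact π.not_onLineOf_self hA (hcard.1 (hE1 hdE)) hj (ha d hdE)
    -- The common point is unique and the syntheme is preserved, so the point is fixed.
    have hfix : π.frob a = a := by
      refine huniq (fun d hd => ?_) ha
      obtain ⟨e, he, rfl⟩ := surj_on_of_inj_on_of_card_le (s := E) (t := E)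
        (fun d _ => mapSet ρ d) hE3 (fun d e _ _ h => map_injective _ h) le_rfl d hd
      exact π.onLineOf_mapSet hT (ha e he)
    have hDa : D a = E := by
      ext d'
      refine ⟨fun hd' => ?_, fun hd' => (hD _ _).2 ⟨hE1 hd', ha d' hd'⟩⟩
      obtain ⟨h1, h2⟩ := (hD _ _).1 hd'
      obtain ⟨i, hi⟩ : d'.Nonempty := card_pos.1 (by rw [hcard.1 h1]; norm_num)
      obtain ⟨e', he', hie'⟩ := hcover i
      rcases π.eq_or_disjoint_of_onLineOf hA hrange (hcard.1 h1) (hcard.1 (hE1 he')) h2 (ha e' he')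
        with h | h
      · rwa [h]
      · exact absurd hie' (disjoint_left.1 h hi)
    have : R.filter (fun a => D a = E) = {a} := by
      ext b
      simp only [mem_filter, mem_singleton]
      constructor
      · rintro ⟨-, hb⟩
        refine huniq (fun d hd => ?_) ha
        rw [← hb] at hd
        exact ((hD _ _).1 hd).2
      · rintro rfl
        exact ⟨(hR _).2 ⟨hfix, hrange⟩, hDa⟩
    rw [this]
    rfl
  · rw [Nat.cast_eq_zero, card_eq_zero, filter_eq_empty_iff]
    intro a _ ha
    refine hc ⟨a, fun d hd => ?_⟩
    rw [← ha] at hd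
    exact ((hD _ _).1 hd).2

/-- The number of arcs permuted by Frobenius according to `ρ`, with the property `C`, and with
concurrent lines joining the pairs of points given by `E`. -/
noncomputable def concCount (ρ : Perm ι) (C : (ι → P) → Prop) (E : Finset (Finset ι)) : ℤ :=
  {T ∈ Twisted π.frob ρ | (π.Arc T ∧ C T) ∧ π.Concurrent T E}.ncard

/-- Adding a fixed point to arcs of six points with some property. -/
theorem two_mul_ncard_addCycle_one_of_six [Fintype ι] [DecidableEq ι] (ρ : Perm ι)
    (h6 : Fintype.card ι = 6) (C : (ι → P) → Prop) :
    2 * ({S ∈ Twisted π.frob (addCycle 1 ρ) | π.Arc S ∧ C (S ∘ Sum.inr)}.ncard : ℤ) =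
      {T ∈ Twisted π.frob ρ | π.Arc T ∧ C T}.ncard *
        (2 * (π.q ^ 2 + π.q + 1) - secantCount ρ π.q) -
      2 * ∑ E ∈ synthemes ρ, concurrencySign E (mapSet ρ) * π.concCount ρ C E := by
  classical
  have hfin : {T ∈ Twisted π.frob ρ | π.Arc T ∧ C T}.Finite :=
    (Twisted.finite π.finite_points ρ).subset fun T hT => hT.1
  have hpoint : ∀ T ∈ hfin.toFinset,
      2 * ({x | π.frob^[0 + 1] x = x ∧ π.Arc (extend π.frob (0 + 1) x T) ∧
        C (extend π.frob (0 + 1) x T ∘ Sum.inr)}.ncard : ℤ) =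
      (2 * (π.q ^ 2 + π.q + 1) - secantCount ρ π.q) -
        2 * ∑ E ∈ synthemes ρ, concurrencySign E (mapSet ρ) *
          if π.Concurrent T E then 1 else 0 := by
    intro T hT'
    obtain ⟨hT, hA, hC⟩ := hfin.mem_toFinset.1 hT'
    have h1 : {x | π.frob^[0 + 1] x = x ∧ π.Arc (extend π.frob (0 + 1) x T) ∧
        C (extend π.frob (0 + 1) x T ∘ Sum.inr)} =
        {x | π.frob^[1] x = x ∧ ¬ π.OnSecant T x} := by
      ext x
      refine and_congr_right fun hx => ?_
      rw [π.arc_extend_iff (by omega) hT]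
      refine ⟨fun h => h.1.2.2.1, fun h => ⟨⟨hA, ?_, h, fun a b hab => ?_⟩, hC⟩⟩
      · exact @arc_of_subsingleton P L π (Fin 1) _ _
      · exact absurd (@Subsingleton.elim (Fin 1) _ a b) hab
    have hR : {a | π.frob a = a ∧ a ∉ Set.range T}.Finite :=
      (π.finite_points 1 one_pos).subset fun a ha => ha.1
    have h3 := π.two_mul_ncard_onSecant hT hA (by omega) h6.le hR.toFinset (by simp)
      (fun a => (duads ι).filter (π.OnLineOf T a)) (by simp)
    rw [π.sum_concurrencySign hT hA h6 hR.toFinset (by simp)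
      (fun a => (duads ι).filter (π.OnLineOf T a)) (by simp)] at h3
    rw [h1, π.ncard_fixed_not _ 1 one_pos]
    simp only [iterate_one, mul_one, pow_one]
    linarith
  rw [ncard_twisted_addCycle π.finite_points ρ 0 (fun T => π.Arc T ∧ C T)
    (fun S => π.Arc S ∧ C (S ∘ Sum.inr))
    (fun x T _ hT h => ⟨((π.arc_extend_iff (by omega) hT).1 h.1).1, h.2⟩) hfin, mul_sum,
    sum_congr rfl hpoint, sum_sub_distrib, sum_const, nsmul_eq_mul,
    ← Set.ncard_eq_toFinset_card _ hfin, ← mul_sum, sum_comm]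
  congr 2
  refine sum_congr rfl fun E _ => ?_
  rw [← mul_sum, sum_boole, concCount]
  congr 2
  rw [← Set.ncard_coe_finset]
  congr 1
  ext T
  simp only [coe_filter, Set.Finite.mem_toFinset, Set.mem_ofPred_eq]
  tauto

end FrobeniusPlane

/-- `ncard_twisted_injective` for tuples in a set preserved by `φ`. -/
theorem ncard_twisted_injective_mem {X : Type*} {φ : X → X} {C : Set X} (hC : ∀ x ∈ C, φ x ∈ C)
    (hφ : ∀ d, 0 < d → {x | φ^[d] x = x ∧ x ∈ C}.Finite)
    (m : ℕ → ℤ) (l : List ℕ) (hl : ∀ d ∈ l, 0 < d)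
    (hm : ∀ d ∈ l, ({x | ExactPeriod φ d x ∧ x ∈ C}.ncard : ℤ) = m d) :
    ({T ∈ Twisted φ (rot l) | Injective T ∧ ∀ i, T i ∈ C}.ncard : ℤ) = confCount m l := by
  set ψ : C → C := fun x => ⟨φ x, hC x x.2⟩ with hψ
  have hit : ∀ (n : ℕ) (x : C), ((ψ^[n] x : C) : X) = φ^[n] x := by
    intro n x
    induction n with
    | zero => rfl
    | succ n ih => rw [iterate_succ_apply', iterate_succ_apply', ← ih]
  have h1 := ncard_twisted_injective (φ := ψ) (fun d hd => by
    refine Set.Finite.of_finite_image ((hφ d hd).subset ?_) Subtype.val_injective.injOn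
    rintro _ ⟨x, hx, rfl⟩
    exact ⟨by rw [← hit, show ψ^[d] x = x from hx], x.2⟩) m l hl (fun d hd => by
      rw [← hm d hd, Nat.cast_inj, ← Set.ncard_image_of_injective _ Subtype.val_injective]
      congr 1
      ext x
      simp only [Set.mem_image, Set.mem_ofPred_eq, ExactPeriod]
      constructor
      · rintro ⟨y, ⟨h1, h2⟩, rfl⟩
        refine ⟨⟨by rw [← hit, h1], fun k hk hk0 h => h2 k hk hk0 (Subtype.ext ?_)⟩, y.2⟩
        rw [hit, h]
      · rintro ⟨⟨h1, h2⟩, h3⟩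
        refine ⟨⟨x, h3⟩, ⟨Subtype.ext (by rw [hit, h1]), fun k hk hk0 h => h2 k hk hk0 ?_⟩, rfl⟩
        rw [← hit k ⟨x, h3⟩, h])
  rw [← h1, Nat.cast_inj]
  symm
  refine Set.ncard_congr (fun T _ i => (T i : X)) ?_ ?_ ?_
  · rintro T ⟨h1, h2⟩
    exact ⟨fun i => congrArg Subtype.val (h1 i), Subtype.val_injective.comp h2, fun i => (T i).2⟩
  · intro T T' _ _ h
    exact funext fun i => Subtype.ext (congrFun h i)
  · rintro T ⟨h1, h2, h3⟩
    exact ⟨fun i => ⟨T i, h3 i⟩, ⟨fun i => Subtype.ext (h1 i),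
      fun i j h => h2 (congrArg Subtype.val h)⟩, rfl⟩

/-! ### Conics -/

/-- A family of sets of points behaving like the smooth conics over an algebraically closed
field. -/
structure ConicSystem {P L : Type*} (π : FrobeniusPlane P L) where
  conics : Set (Set P)
  frob_image : ∀ C ∈ conics, π.frob '' C ∈ conics
  exists_of_arc : ∀ T : Fin 5 → P, π.Arc T → ∃ C ∈ conics, ∀ i, T i ∈ C
  eq_of_mem : ∀ C ∈ conics, ∀ C' ∈ conics, ∀ T : Fin 5 → P, Injective T →
    (∀ i, T i ∈ C) → (∀ i, T i ∈ C') → C = C'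
  not_collinear : ∀ C ∈ conics, ∀ a ∈ C, ∀ b ∈ C, ∀ c ∈ C, a ≠ b → a ≠ c → b ≠ c → ∀ l,
    π.inc a l → π.inc b l → ¬ π.inc c l
  exists_inc : ∀ C ∈ conics, ∀ l, ∃ a ∈ C, π.inc a l
  tangent : ∀ C ∈ conics, ∀ a ∈ C, ∃ l, (π.inc a l ∧ ∀ b ∈ C, π.inc b l → b = a) ∧
    ∀ m, (π.inc a m ∧ ∀ b ∈ C, π.inc b m → b = a) → m = l

/-- The line `l` meets the set `C` in the single point `a`. -/
def FrobeniusPlane.TangentAt {P L : Type*} (π : FrobeniusPlane P L) (C : Set P) (a : P) (l : L) :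
    Prop :=
  π.inc a l ∧ ∀ b ∈ C, π.inc b l → b = a

namespace ConicSystem

variable {P L : Type*} {π : FrobeniusPlane P L} (Γ : ConicSystem π)

theorem iterate_image (d : ℕ) {C : Set P} (hC : C ∈ Γ.conics) : π.frob^[d] '' C ∈ Γ.conics := by
  induction d with
  | zero => simpa using hC
  | succ d ih =>
    rw [iterate_succ', Set.image_comp]
    exact Γ.frob_image _ ih

/-- The same conics, for a power of the Frobenius collineation. -/
def pow (d : ℕ) (hd : 0 < d) : ConicSystem (π.pow d hd) :=
  { Γ with frob_image := fun _ hC => Γ.iterate_image d hC }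

/-- The conics mapped to themselves by Frobenius. -/
def rational : Set (Set P) := {C | C ∈ Γ.conics ∧ π.frob '' C = C}

variable {Γ} {C : Set P}

theorem frob_mem_iff (hC : C ∈ Γ.rational) {a : P} : π.frob a ∈ C ↔ a ∈ C := by
  conv_lhs => rw [← hC.2]
  exact π.frob_injective.mem_set_image

theorem iterate_mem (hC : C ∈ Γ.rational) {a : P} (ha : a ∈ C) (n : ℕ) : π.frob^[n] a ∈ C := by
  induction n with
  | zero => exact ha
  | succ n ih =>
    rw [iterate_succ_apply', frob_mem_iff hC]
    exact ih

theorem mem_rational_pow (hC : C ∈ Γ.rational) (d : ℕ) (hd : 0 < d) :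
    C ∈ (Γ.pow d hd).rational := by
  refine ⟨hC.1, ?_⟩
  show π.frob^[d] '' C = C
  induction d with
  | zero => omega
  | succ d ih =>
    rcases Nat.eq_zero_or_pos d with rfl | hd'
    · exact hC.2
    · rw [iterate_succ', Set.image_comp, ih hd', hC.2]

theorem tangentAt_frob (hC : C ∈ Γ.rational) {a : P} {l : L} (h : π.TangentAt C a l) :
    π.TangentAt C (π.frob a) (π.frobL l) := by
  refine ⟨π.inc_frob.2 h.1, fun b hb hbl => ?_⟩
  rw [← hC.2] at hb
  obtain ⟨b, hb, rfl⟩ := hb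
  rw [h.2 b hb (π.inc_frob.1 hbl)]

/-- A conic that has a fixed point has as many fixed points as there are fixed lines through this
point. -/
theorem ncard_fixed_of_mem (hC : C ∈ Γ.rational) {a : P} (ha : a ∈ C) (hfa : π.frob a = a) :
    {b | b ∈ C ∧ π.frob b = b}.ncard = π.q + 1 := by
  classical
  obtain ⟨t, ht, ht'⟩ := Γ.tangent C hC.1 a ha
  have htf : π.frobL t = t := ht' _ (by
    have := tangentAt_frob hC ht
    rwa [hfa] at this)
  rw [← pow_one π.q, ← π.ncard_lines_on 1 one_pos a hfa]
  refine Set.ncard_congr (fun b _ => if b = a then t else π.join a b) ?_ ?_ ?_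
  · rintro b ⟨hb, hfb⟩
    show π.frobL _ = _ ∧ _
    by_cases h : b = a
    · simp only [h, if_true]
      exact ⟨htf, ht.1⟩
    · simp only [h, if_false]
      have hab : a ≠ b := Ne.symm h
      refine ⟨?_, π.inc_join_left hab⟩
      have h1 := π.inc_frob.2 (π.inc_join_left hab)
      have h2 := π.inc_frob.2 (π.inc_join_right hab)
      rw [hfa] at h1
      rw [hfb] at h2
      exact π.line_eq hab h1 h2 (π.inc_join_left hab) (π.inc_join_right hab)
  · rintro b c ⟨hb, -⟩ ⟨hc, -⟩ h
    have key : ∀ {b c}, b ∈ C → b ≠ a → c ∈ C → c ≠ a → π.join a b = π.join a c → b = c := by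
      intro b c hb hba hc hca h
      by_contra hbc
      exact Γ.not_collinear C hC.1 a ha b hb c hc hba.symm hca.symm hbc _
        (π.inc_join_left hba.symm) (π.inc_join_right hba.symm) (h ▸ π.inc_join_right hca.symm)
    have key' : ∀ {b}, b ∈ C → b ≠ a → t ≠ π.join a b := by
      rintro b hb hba h
      refine hba (ht.2 b hb ?_)
      rw [h]
      exact π.inc_join_right hba.symm
    by_cases hba : b = a <;> by_cases hca : c = a
    · rw [hba, hca]
    · simp only [hba, hca, if_true, if_false] at h
      exact absurd h (key' hc hca)
    · simp only [hba, hca, if_true, if_false] at h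
      exact absurd h.symm (key' hb hba)
    · simp only [hba, hca, if_false] at h
      exact key hb hba hc hca h
  · rintro l ⟨hl, hal⟩
    have hl' : π.frobL l = l := hl
    by_cases h : π.TangentAt C a l
    · exact ⟨a, ⟨ha, hfa⟩, by simp [ht' l h]⟩
    · have h' : ∃ b ∈ C, π.inc b l ∧ b ≠ a := by
        by_contra! h'
        exact h ⟨hal, h'⟩
      obtain ⟨b, hb, hbl, hba⟩ := h'
      have hfbl := π.inc_frob.2 hbl
      rw [hl'] at hfbl
      have hfba : π.frob b ≠ a := fun h => hba (π.frob_injective (h.trans hfa.symm))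
      refine ⟨b, ⟨hb, ?_⟩, ?_⟩
      · by_contra hne
        exact Γ.not_collinear C hC.1 a ha b hb _ ((frob_mem_iff hC).2 hb) hba.symm hfba.symm
          (Ne.symm hne) l hal hbl hfbl
      · simp only [hba, if_false]
        exact π.line_eq hba.symm (π.inc_join_left hba.symm) (π.inc_join_right hba.symm) hal hbl

theorem iterate_two_of_inc (hC : C ∈ Γ.rational) {a : P} (ha : a ∈ C) {l : L} (hl : π.frobL l = l)
    (hal : π.inc a l) : π.frob^[2] a = a := by
  have h1 := π.inc_frob.2 hal
  rw [hl] at h1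
  have h2 := π.inc_frob.2 h1
  rw [hl] at h2
  have m1 := (frob_mem_iff hC).2 ha
  have m2 := (frob_mem_iff hC).2 m1
  show π.frob (π.frob a) = a
  by_cases e1 : a = π.frob a
  · rw [← e1, ← e1]
  by_contra e2
  exact Γ.not_collinear C hC.1 a ha _ m1 _ m2 e1 (Ne.symm e2) (π.frob_injective.ne e1) l hal h1 h2

/-- The number of fixed points of a conic. It follows from the number of fixed lines, since such a
line is a tangent at a fixed point, or meets the conic in two points fixed by the square of
Frobenius. -/
theorem ncard_fixed (hC : C ∈ Γ.rational) : {b | b ∈ C ∧ π.frob b = b}.ncard = π.q + 1 := by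
  have hq := π.two_le
  have hlines := π.ncard_lines 1 one_pos
  have hlfin := π.finite_lines 1 one_pos
  have hne : {l | π.frobL^[1] l = l}.Nonempty := by
    by_contra h
    rw [Set.not_nonempty_iff_eq_empty.1 h, Set.ncard_empty] at hlines
    omega
  obtain ⟨l, hl⟩ := hne
  have : Nonempty L := ⟨l⟩
  have hN2 : {b | b ∈ C ∧ π.frob^[2] b = b}.ncard = π.q ^ 2 + 1 := by
    obtain ⟨a, ha, hal⟩ := Γ.exists_inc C hC.1 l
    exact ncard_fixed_of_mem (mem_rational_pow hC 2 two_pos) ha (iterate_two_of_inc hC ha hl hal)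
  have hfin2 : {b | b ∈ C ∧ π.frob^[2] b = b}.Finite :=
    (π.finite_points 2 two_pos).subset fun b hb => hb.2
  have hfin1 : {b | b ∈ C ∧ π.frob b = b}.Finite :=
    (π.finite_points 1 one_pos).subset fun b hb => hb.2
  choose! t ht ht' using Γ.tangent C hC.1
  have htf : ∀ b, b ∈ C → π.frob b = b → π.frobL (t b) = t b := fun b hb hfb => by
    refine ht' b hb _ ?_
    have := tangentAt_frob hC (ht b hb)
    rwa [hfb] at this
  have htanfix : ∀ {b l}, b ∈ C → π.frobL l = l → π.TangentAt C b l → π.frob b = b := by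
    intro b l hb hl h
    have h1 := π.inc_frob.2 h.1
    rw [hl] at h1
    exact h.2 _ ((frob_mem_iff hC).2 hb) h1
  -- fixed lines that are tangents
  have hT : {l | l ∈ {l | π.frobL^[1] l = l} ∧ ∃ b ∈ C, π.TangentAt C b l}.ncard =
      {b | b ∈ C ∧ π.frob b = b}.ncard := by
    symm
    refine Set.ncard_congr (fun b _ => t b) ?_ ?_ ?_
    · rintro b ⟨hb, hfb⟩
      exact ⟨htf b hb hfb, b, hb, ht b hb⟩
    · rintro b c ⟨hb, hfb⟩ ⟨hc, hfc⟩ h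
      exact (ht c hc).2 b hb (h ▸ (ht b hb).1)
    · rintro l ⟨hl, b, hb, h⟩
      exact ⟨b, ⟨hb, htanfix hb hl h⟩, (ht' b hb l h).symm⟩
  have hT' := ncard_add_ncard_not hlfin (fun l => ∃ b ∈ C, π.TangentAt C b l)
  -- flags of a point of the conic and a fixed line
  set Fl : Set (P × L) := {f | (f.1 ∈ C ∧ π.frob^[2] f.1 = f.1) ∧ π.frobL f.2 = f.2 ∧
    π.inc f.1 f.2} with hFl
  have hFlfin : Fl.Finite := (hfin2.prod hlfin).subset fun f hf => ⟨hf.1, hf.2.1⟩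
  have h1 := ncard_add_ncard_not hFlfin (fun f => π.TangentAt C f.1 f.2)
  have h2 := ncard_add_ncard_not hFlfin (fun f => π.frob f.1 = f.1)
  have h3 := ncard_add_ncard_not hfin2 (fun b => π.frob b = b)
  have h4 : {b | b ∈ {b | b ∈ C ∧ π.frob^[2] b = b} ∧ π.frob b = b} =
      {b | b ∈ C ∧ π.frob b = b} := by
    ext b
    constructor
    · rintro ⟨⟨h1, -⟩, h2⟩
      exact ⟨h1, h2⟩
    · rintro ⟨h1, h2⟩
      refine ⟨⟨h1, ?_⟩, h2⟩
      show π.frob (π.frob b) = b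
      rw [h2, h2]
  have e1 : ({f | f ∈ Fl ∧ π.TangentAt C f.1 f.2}.ncard : ℤ) =
      {b | b ∈ C ∧ π.frob b = b}.ncard * 1 := by
    refine ncard_eq_mul_of_fiber (hFlfin.subset fun f hf => hf.1) hfin1 Prod.fst
      (fun f hf => ⟨hf.1.1.1, htanfix hf.1.1.1 hf.1.2.1 hf.2⟩) fun b hb => ?_
    have : {f | f ∈ {f | f ∈ Fl ∧ π.TangentAt C f.1 f.2} ∧ f.1 = b} = {(b, t b)} := by
      ext ⟨c, l⟩
      simp only [Set.mem_ofPred_eq, Set.mem_singleton_iff, Prod.mk.injEq]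
      constructor
      · rintro ⟨⟨h1, h2⟩, rfl⟩
        exact ⟨rfl, ht' c h1.1.1 l h2⟩
      · rintro ⟨rfl, rfl⟩
        refine ⟨⟨⟨⟨hb.1, ?_⟩, htf c hb.1 hb.2, (ht c hb.1).1⟩, ht c hb.1⟩, rfl⟩
        show π.frob (π.frob c) = c
        rw [hb.2, hb.2]
    rw [this, Set.ncard_singleton]
    rfl
  have e2 : ({f | f ∈ Fl ∧ ¬ π.TangentAt C f.1 f.2}.ncard : ℤ) =
      {l | l ∈ {l | π.frobL^[1] l = l} ∧ ¬ ∃ b ∈ C, π.TangentAt C b l}.ncard * 2 := by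
    refine ncard_eq_mul_of_fiber (hFlfin.subset fun f hf => hf.1) (hlfin.subset fun l hl => hl.1)
      Prod.snd ?_ ?_
    · rintro ⟨b, l⟩ ⟨⟨⟨h1, h2⟩, h3, h4⟩, h5⟩
      refine ⟨h3, ?_⟩
      rintro ⟨c, hc, h6⟩
      obtain rfl : b = c := h6.2 b h1 h4
      exact h5 h6
    · rintro l ⟨hl, hl'⟩
      obtain ⟨a, ha, hal⟩ := Γ.exists_inc C hC.1 l
      have h' : ∃ b ∈ C, π.inc b l ∧ b ≠ a := by
        by_contra! h'
        exact hl' ⟨a, ha, hal, h'⟩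
      obtain ⟨b, hb, hbl, hba⟩ := h'
      have : {f | f ∈ {f | f ∈ Fl ∧ ¬ π.TangentAt C f.1 f.2} ∧ f.2 = l} = {(a, l), (b, l)} := by
        ext ⟨c, m⟩
        simp only [Set.mem_ofPred_eq, Set.mem_insert_iff, Set.mem_singleton_iff, Prod.mk.injEq]
        constructor
        · rintro ⟨⟨⟨⟨h1, h2⟩, h3, h4⟩, h5⟩, rfl⟩
          by_contra! hne
          exact Γ.not_collinear C hC.1 a ha b hb c h1 hba.symm (fun h => hne.1 h.symm rfl)
            (fun h => hne.2 h.symm rfl) m hal hbl h4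
        · rintro (⟨rfl, rfl⟩ | ⟨rfl, rfl⟩)
          · exact ⟨⟨⟨⟨ha, iterate_two_of_inc hC ha hl hal⟩, hl, hal⟩, fun h => hl' ⟨_, ha, h⟩⟩, rfl⟩
          · exact ⟨⟨⟨⟨hb, iterate_two_of_inc hC hb hl hbl⟩, hl, hbl⟩, fun h => hl' ⟨_, hb, h⟩⟩, rfl⟩
      rw [this, Set.ncard_pair (fun h => hba (congrArg Prod.fst h).symm)]
      rfl
  have e3 : ({f | f ∈ Fl ∧ π.frob f.1 = f.1}.ncard : ℤ) =
      {b | b ∈ C ∧ π.frob b = b}.ncard * (π.q + 1) := by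
    refine ncard_eq_mul_of_fiber (hFlfin.subset fun f hf => hf.1) hfin1 Prod.fst
      (fun f hf => ⟨hf.1.1.1, hf.2⟩) fun b hb => ?_
    have h5 := π.ncard_lines_on 1 one_pos b hb.2
    rw [pow_one] at h5
    have h6 : {f | f ∈ {f | f ∈ Fl ∧ π.frob f.1 = f.1} ∧ f.1 = b}.ncard =
        {l | π.frobL^[1] l = l ∧ π.inc b l}.ncard := by
      symm
      refine Set.ncard_congr (fun l _ => (b, l)) ?_ ?_ ?_
      · rintro l ⟨h1, h2⟩
        refine ⟨⟨⟨⟨hb.1, ?_⟩, h1, h2⟩, hb.2⟩, rfl⟩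
        show π.frob (π.frob b) = b
        rw [hb.2, hb.2]
      · exact fun l m _ _ h => congrArg Prod.snd h
      · rintro ⟨c, l⟩ ⟨⟨h1, h2⟩, rfl⟩
        exact ⟨l, h1.2, rfl⟩
    rw [h6, h5]
    push_cast
    rfl
  have e4 : ({f | f ∈ Fl ∧ ¬ π.frob f.1 = f.1}.ncard : ℤ) =
      {b | b ∈ {b | b ∈ C ∧ π.frob^[2] b = b} ∧ ¬ π.frob b = b}.ncard * 1 := by
    refine ncard_eq_mul_of_fiber (hFlfin.subset fun f hf => hf.1)
      (hfin2.subset fun f hf => hf.1) Prod.fst ?_ fun b hb => ?_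
    · rintro f ⟨hf, hf'⟩
      exact ⟨hf.1, hf'⟩
    obtain ⟨⟨hb1, hb2⟩, hb3⟩ := hb
    have hb2' : π.frob (π.frob b) = b := hb2
    have hne : b ≠ π.frob b := Ne.symm hb3
    have : {f | f ∈ {f | f ∈ Fl ∧ ¬ π.frob f.1 = f.1} ∧ f.1 = b} = {(b, π.join b (π.frob b))} := by
      ext ⟨c, l⟩
      simp only [Set.mem_ofPred_eq, Set.mem_singleton_iff, Prod.mk.injEq]
      constructor
      · rintro ⟨⟨⟨h1, h2, h3⟩, h4⟩, rfl⟩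
        have h5 := π.inc_frob.2 h3
        simp only [h2] at h5
        exact ⟨rfl, π.line_eq hne h3 h5 (π.inc_join_left hne) (π.inc_join_right hne)⟩
      · rintro ⟨rfl, rfl⟩
        refine ⟨⟨⟨⟨hb1, hb2⟩, ?_, π.inc_join_left hne⟩, hb3⟩, rfl⟩
        have h5 := π.inc_frob.2 (π.inc_join_left hne)
        have h6 := π.inc_frob.2 (π.inc_join_right hne)
        rw [hb2'] at h6
        exact π.line_eq hne h6 h5 (π.inc_join_left hne) (π.inc_join_right hne)
    rw [this, Set.ncard_singleton]
    rfl
  rw [hT, hlines] at hT'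
  rw [e1, e2] at h1
  rw [e3, e4] at h2
  rw [h4, hN2] at h3
  push_cast at hT' h3
  zify
  have hq' : (0 : ℤ) < π.q + 1 := by omega
  refine mul_right_cancel₀ hq'.ne' ?_
  linear_combination h2 - h1 - h3 + 2 * hT'

theorem ncard_fixed_iterate (hC : C ∈ Γ.rational) (d : ℕ) (hd : 0 < d) :
    {b | π.frob^[d] b = b ∧ b ∈ C}.ncard = π.q ^ d + 1 := by
  have h := ncard_fixed (mem_rational_pow hC d hd)
  have h1 : {b | b ∈ C ∧ (π.pow d hd).frob b = b} = {b | π.frob^[d] b = b ∧ b ∈ C} := by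
    ext b
    exact and_comm
  rw [h1] at h
  exact h

/-- The number of twisted tuples of distinct points on a conic over the field with `q` elements. -/
def conicConfCount (q : ℤ) (l : List ℕ) : ℤ := confCount (exactCount fun d => q ^ d + 1) l

theorem ncard_twisted_on_conic (hC : C ∈ Γ.rational) (l : List ℕ) (hl : ∀ d ∈ l, 0 < d ∧ d ≤ 7) :
    ({T ∈ Twisted π.frob (rot l) | Injective T ∧ ∀ i, T i ∈ C}.ncard : ℤ) =
      conicConfCount π.q l := by
  refine ncard_twisted_injective_mem (fun x hx => (frob_mem_iff hC).2 hx)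
    (fun d hd => (π.finite_points d hd).subset fun x hx => hx.1) _ l (fun d hd => (hl d hd).1)
    fun d hd => ?_
  refine ncard_exactPeriod (fun e he => (π.finite_points e he).subset fun x hx => hx.1)
    (fun e he => ?_) (hl d hd).1 (hl d hd).2
  rw [ncard_fixed_iterate hC e he]
  push_cast
  rfl

theorem arc_of_mem {ι : Type*} {T : ι → P} (hC : C ∈ Γ.conics) (hinj : Injective T)
    (hT : ∀ i, T i ∈ C) : π.Arc T :=
  ⟨hinj, fun l i j k hij hik hjk => Γ.not_collinear C hC _ (hT i) _ (hT j) _ (hT k)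
    (hinj.ne hij) (hinj.ne hik) (hinj.ne hjk) l⟩

variable (Γ) in
/-- All points of the tuple lie on one of the conics. -/
def OnConic {ι : Type*} (T : ι → P) : Prop := ∃ C ∈ Γ.conics, ∀ i, T i ∈ C

theorem eq_of_injective {ι : Type*} {C' : Set P} (hC : C ∈ Γ.conics) (hC' : C' ∈ Γ.conics)
    (f : Fin 5 ↪ ι) {T : ι → P} (hinj : Injective T) (h : ∀ i, T i ∈ C)
    (h' : ∀ i, T i ∈ C') : C = C' :=
  Γ.eq_of_mem C hC C' hC' (T ∘ f) (hinj.comp f.injective) (fun _ => h _) (fun _ => h' _)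

theorem rational_of_twisted {ι : Type*} (f : Fin 5 ↪ ι) {ρ : Perm ι} {T : ι → P}
    (hT : T ∈ Twisted π.frob ρ) (hinj : Injective T) (hC : C ∈ Γ.conics)
    (h : ∀ i, T i ∈ C) : C ∈ Γ.rational := by
  refine ⟨hC, eq_of_injective (Γ.frob_image C hC) hC f hinj (fun i => ?_) h⟩
  obtain ⟨j, rfl⟩ := ρ.surjective i
  exact ⟨T j, h j, hT j⟩

theorem conicConfCount_five_pos : 0 < conicConfCount π.q [5] := by
  have hq : (2 : ℤ) ≤ π.q := by exact_mod_cast π.two_le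
  have : conicConfCount π.q [5] = (π.q : ℤ) ^ 5 - π.q := by
    simp [conicConfCount, confCount, exactCount]
  rw [this]
  have h4 : (1 : ℤ) < (π.q : ℤ) ^ 4 := one_lt_pow₀ (by omega) (by norm_num)
  nlinarith

variable (Γ) in
theorem finite_rational : Γ.rational.Finite := by
  have hfin : {T ∈ Twisted π.frob (rot [5]) | π.Arc T}.Finite :=
    (Twisted.finite π.finite_points _).subset fun T hT => hT.1
  refine ((Set.Finite.biUnion hfin
    (t := fun T => {C | C ∈ Γ.conics ∧ ∀ i : Fin 5, T i ∈ C}) fun T hT => ?_)).subset fun C hC => ?_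
  · refine Set.Subsingleton.finite fun C hC C' hC' => ?_
    exact Γ.eq_of_mem C hC.1 C' hC'.1 T hT.2.1 hC.2 hC'.2
  · have h1 := ncard_twisted_on_conic hC [5] (by simp)
    have h2 : {T ∈ Twisted π.frob (rot [5]) | Injective T ∧ ∀ i, T i ∈ C}.Nonempty := by
      by_contra h
      rw [Set.not_nonempty_iff_eq_empty.1 h, Set.ncard_empty] at h1
      have := conicConfCount_five_pos (π := π)
      rw [← h1] at this
      simp at this
    obtain ⟨T, hT, hinj, hTC⟩ := h2
    exact Set.mem_biUnion (x := T) ⟨hT, arc_of_mem hC.1 hinj hTC⟩ ⟨hC.1, hTC⟩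

/-- The number of twisted tuples of at least five distinct points on a conic. -/
theorem ncard_arc_onConic (l : List ℕ) (hl : ∀ d ∈ l, 0 < d ∧ d ≤ 7) (f : Fin 5 ↪ Fin l.sum) :
    ({T ∈ Twisted π.frob (rot l) | π.Arc T ∧ Γ.OnConic T}.ncard : ℤ) =
      Γ.rational.ncard * conicConfCount π.q l := by
  have hne : Nonempty P := by
    have h := π.ncard_points 1 one_pos
    by_contra h'
    rw [not_nonempty_iff] at h'
    rw [Set.eq_empty_of_isEmpty {a | π.frob^[1] a = a}, Set.ncard_empty] at h
    omega
  classical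
  have key : ∀ T : Fin l.sum → P, ∃ C, T ∈ Twisted π.frob (rot l) → π.Arc T → Γ.OnConic T →
      C ∈ Γ.rational ∧ ∀ i, T i ∈ C := by
    intro T
    by_cases h : T ∈ Twisted π.frob (rot l) ∧ π.Arc T ∧ Γ.OnConic T
    · obtain ⟨h1, h2, C, hC, h3⟩ := h
      exact ⟨C, fun _ _ _ => ⟨rational_of_twisted f h1 h2.1 hC h3, h3⟩⟩
    · exact ⟨∅, fun h1 h2 h3 => absurd ⟨h1, h2, h3⟩ h⟩
  -- `c T` is the conic through the points of `T`; it is fixed by Frobenius, being unique.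
  choose c hc using key
  refine ncard_eq_mul_of_fiber ((Twisted.finite π.finite_points _).subset fun T hT => hT.1)
    Γ.finite_rational c (fun T hT => (hc T hT.1 hT.2.1 hT.2.2).1) fun C hC => ?_
  rw [← ncard_twisted_on_conic hC l hl]
  congr 2
  ext T
  constructor
  · rintro ⟨⟨h1, h2, h3⟩, rfl⟩
    exact ⟨h1, h2.1, (hc T h1 h2 h3).2⟩
  · rintro ⟨h1, h2, h3⟩
    have h4 := arc_of_mem hC.1 h2 h3
    have h5 : Γ.OnConic T := ⟨C, hC.1, h3⟩
    obtain ⟨h6, h7⟩ := hc T h1 h4 h5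
    exact ⟨⟨h1, h4, h5⟩, eq_of_injective h6.1 hC.1 f h2 h7 h3⟩

variable (Γ) in
/-- The number of conics, found by counting orbits of five points. -/
theorem ncard_rational : (Γ.rational.ncard : ℤ) = (π.q : ℤ) ^ 2 * (π.q ^ 3 - 1) := by
  have h1 := ncard_arc_onConic (Γ := Γ) [5] (by simp) (Embedding.refl _)
  have h2 : {T ∈ Twisted π.frob (rot [5]) | π.Arc T ∧ Γ.OnConic T} =
      {T ∈ Twisted π.frob (rot [5]) | π.Arc T} := by
    ext T
    exact ⟨fun h => ⟨h.1, h.2.1⟩, fun h => ⟨h.1, h.2, Γ.exists_of_arc T h.2⟩⟩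
  have h3 := π.arcCount_five
  rw [FrobeniusPlane.arcCount] at h3
  rw [h2, h3] at h1
  have h4 := conicConfCount_five_pos (π := π)
  refine mul_right_cancel₀ h4.ne' ?_
  rw [← h1]
  simp only [conicConfCount, confCount, exactCount, List.count_nil]
  push_cast
  ring

end ConicSystem

/-! ### Seven points, no six of them on a conic -/

namespace ConicSystem

variable {P L ι κ : Type*} {π : FrobeniusPlane P L} (Γ : ConicSystem π)

/-- All points of the tuple except possibly the one with index `k` lie on a conic. -/
def OnConicExcept (T : ι → P) (k : ι) : Prop := ∃ C ∈ Γ.conics, ∀ i, i ≠ k → T i ∈ C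

/-- The number of arcs permuted by Frobenius according to `ρ`, with no conic through all points but
one. -/
noncomputable def goodCount (ρ : Perm ι) : ℤ :=
  {T ∈ Twisted π.frob ρ | π.Arc T ∧ ∀ k, ¬ Γ.OnConicExcept T k}.ncard

theorem onConic_comp_iff (e : ι ≃ κ) (T : κ → P) : Γ.OnConic (T ∘ e) ↔ Γ.OnConic T := by
  refine exists_congr fun C => and_congr_right fun _ => ⟨fun h i => ?_, fun h i => h _⟩
  have := h (e.symm i)
  rwa [comp_apply, e.apply_symm_apply] at this

theorem onConicExcept_comp_iff (e : ι ≃ κ) (T : κ → P) (k : ι) :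
    Γ.OnConicExcept (T ∘ e) k ↔ Γ.OnConicExcept T (e k) := by
  refine exists_congr fun C => and_congr_right fun _ => ⟨fun h i hi => ?_, fun h i hi => ?_⟩
  · have := h (e.symm i) (fun h => hi (by rw [← h, e.apply_symm_apply]))
    rwa [comp_apply, e.apply_symm_apply] at this
  · exact h _ (e.injective.ne hi)

theorem goodCount_congr {ρ : Perm ι} {ρ' : Perm κ} (e : ι ≃ κ)
    (he : ∀ i, e (ρ i) = ρ' (e i)) : Γ.goodCount ρ = Γ.goodCount ρ' := by
  refine congrArg Nat.cast (Twisted.ncard_congr e he _ _ fun T => ?_)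
  rw [π.arc_comp_iff]
  simp only [onConicExcept_comp_iff]
  exact and_congr_right fun _ => e.forall_congr_left.trans (by simp)

theorem onConicExcept_map {ρ : Perm ι} {T : ι → P} (hT : T ∈ Twisted π.frob ρ) {k : ι}
    (h : Γ.OnConicExcept T k) : Γ.OnConicExcept T (ρ k) := by
  obtain ⟨C, hC, h⟩ := h
  refine ⟨_, Γ.frob_image C hC, fun i hi => ?_⟩
  obtain ⟨j, rfl⟩ := ρ.surjective i
  exact ⟨T j, h j fun h => hi (congrArg ρ h), hT j⟩

/-- The index `k` of a septuple plays the same role as any other fixed index. -/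
theorem ncard_onConicExcept_eq [DecidableEq ι] {ρ : Perm ι} {k k' : ι} (hk : ρ k = k) (hk' : ρ k' = k') :
    {T ∈ Twisted π.frob ρ | π.Arc T ∧ Γ.OnConicExcept T k}.ncard =
      {T ∈ Twisted π.frob ρ | π.Arc T ∧ Γ.OnConicExcept T k'}.ncard := by
  refine Twisted.ncard_congr (Equiv.swap k k') (fun i => ?_) _ _ fun T => ?_
  · by_cases h1 : i = k
    · rw [h1, hk, Equiv.swap_apply_left, hk']
    · by_cases h2 : i = k'
      · rw [h2, hk', Equiv.swap_apply_right, hk]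
      · rw [Equiv.swap_apply_of_ne_of_ne h1 h2, Equiv.swap_apply_of_ne_of_ne]
        · exact fun h => h1 (ρ.injective (h.trans hk.symm))
        · exact fun h => h2 (ρ.injective (h.trans hk'.symm))
  · rw [π.arc_comp_iff, onConicExcept_comp_iff, Equiv.swap_apply_left]

theorem onConicExcept_inl_iff (S : Fin 1 ⊕ ι → P) :
    Γ.OnConicExcept S (.inl 0) ↔ Γ.OnConic (S ∘ Sum.inr) := by
  refine exists_congr fun C => and_congr_right fun _ => ⟨fun h i => h _ (by simp), ?_⟩
  rintro h (j | i) hi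
  · exact absurd (congrArg Sum.inl (Subsingleton.elim (α := Fin 1) j 0)) hi
  · exact h i

variable [Fintype ι] [DecidableEq ι]

theorem onConic_of_onConicExcept (h7 : Fintype.card ι = 7) {T : ι → P}
    (hinj : Injective T) {k k' : ι} (hk : k ≠ k') (h : Γ.OnConicExcept T k)
    (h' : Γ.OnConicExcept T k') : Γ.OnConic T := by
  obtain ⟨C, hC, h1⟩ := h
  obtain ⟨C', hC', h2⟩ := h'
  have hcard : Fintype.card {i // i ∉ ({k, k'} : Finset ι)} = 5 := by
    rw [Fintype.card_subtype, filter_notMem_eq_sdiff, card_univ_sdiff,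
      card_pair hk, h7]
  have e := Fintype.equivFinOfCardEq hcard
  have hmem : ∀ i : Fin 5, (e.symm i : ι) ≠ k ∧ (e.symm i : ι) ≠ k' := fun i => by
    have := (e.symm i).2
    simp only [mem_insert, mem_singleton, not_or] at this
    exact this
  obtain rfl : C = C' := Γ.eq_of_mem C hC C' hC' (fun i => T (e.symm i))
    (hinj.comp (Subtype.val_injective.comp e.symm.injective)) (fun i => h1 _ (hmem i).1)
    (fun i => h2 _ (hmem i).2)
  refine ⟨C, hC, fun i => ?_⟩
  by_cases hi : i = k
  · exact h2 i (fun h => hk (hi.symm.trans h))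
  · exact h1 i hi

/-- A septuple with six points on a conic has all points on the conic, or the remaining point is
unique and therefore fixed by Frobenius. -/
theorem goodCount_eq (h7 : Fintype.card ι = 7) (ρ : Perm ι) :
    Γ.goodCount ρ = π.arcCount ρ - {T ∈ Twisted π.frob ρ | π.Arc T ∧ Γ.OnConic T}.ncard -
      ∑ k with ρ k = k, (({T ∈ Twisted π.frob ρ | π.Arc T ∧ Γ.OnConicExcept T k}.ncard : ℤ) -
        {T ∈ Twisted π.frob ρ | π.Arc T ∧ Γ.OnConic T}.ncard) := by
  classical
  have hfin : {T ∈ Twisted π.frob ρ | π.Arc T}.Finite :=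
    (Twisted.finite π.finite_points _).subset fun T hT => hT.1
  have hι : Nonempty ι := Fintype.card_pos_iff.1 (by omega)
  have hall : ∀ {T : ι → P} (k), Γ.OnConic T → Γ.OnConicExcept T k :=
    fun k ⟨C, hC, h⟩ => ⟨C, hC, fun i _ => h i⟩
  have h1 := ncard_add_ncard_not hfin (fun T => ∀ k, ¬ Γ.OnConicExcept T k)
  have hfin2 : {T | T ∈ {T ∈ Twisted π.frob ρ | π.Arc T} ∧ ¬ ∀ k, ¬ Γ.OnConicExcept T k}.Finite :=
    hfin.subset fun T hT => hT.1
  have h2 := ncard_add_ncard_not hfin2 (fun T => Γ.OnConic T)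
  have e1 : {T | T ∈ {T | T ∈ {T ∈ Twisted π.frob ρ | π.Arc T} ∧ ¬ ∀ k, ¬ Γ.OnConicExcept T k} ∧
      Γ.OnConic T} = {T ∈ Twisted π.frob ρ | π.Arc T ∧ Γ.OnConic T} := by
    ext T
    constructor
    · rintro ⟨⟨⟨h1, h2⟩, h3⟩, h4⟩
      exact ⟨h1, h2, h4⟩
    · rintro ⟨h1, h2, h4⟩
      exact ⟨⟨⟨h1, h2⟩, fun h => h hι.some (hall _ h4)⟩, h4⟩
  have e2 : {T | T ∈ {T ∈ Twisted π.frob ρ | π.Arc T} ∧ ∀ k, ¬ Γ.OnConicExcept T k} =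
      {T ∈ Twisted π.frob ρ | π.Arc T ∧ ∀ k, ¬ Γ.OnConicExcept T k} := by
    ext T
    exact and_assoc
  rw [e1] at h2
  rw [e2] at h1
  have hfin3 : {T | T ∈ {T | T ∈ {T ∈ Twisted π.frob ρ | π.Arc T} ∧
      ¬ ∀ k, ¬ Γ.OnConicExcept T k} ∧ ¬ Γ.OnConic T}.Finite := hfin2.subset fun T hT => hT.1
  have key : ∀ T : ι → P, ∃ k, (¬ ∀ k, ¬ Γ.OnConicExcept T k) → Γ.OnConicExcept T k := by
    intro T
    by_cases h : ∀ k, ¬ Γ.OnConicExcept T k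
    · exact ⟨hι.some, fun h' => absurd h h'⟩
    · push Not at h
      obtain ⟨k, hk⟩ := h
      exact ⟨k, fun _ => hk⟩
  -- `c T` is the index of the exceptional point, unique if the seven points are not on a conic.
  choose c hc using key
  have h3 := ncard_eq_sum_fiber hfin3 (B := ↑(univ.filter fun k => ρ k = k))
    (finite_toSet _) c (by
      rintro T ⟨⟨⟨h1, h2⟩, h3⟩, h4⟩
      simp only [coe_filter, mem_univ, true_and, Set.mem_ofPred_eq]
      by_contra hne
      exact h4 (Γ.onConic_of_onConicExcept h7 h2.1 hne (Γ.onConicExcept_map h1 (hc T h3)) (hc T h3)))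
  rw [finite_toSet_toFinset] at h3
  have h4 : ∀ k ∈ univ.filter fun k => ρ k = k,
      ({T | T ∈ {T | T ∈ {T | T ∈ {T ∈ Twisted π.frob ρ | π.Arc T} ∧
        ¬ ∀ k, ¬ Γ.OnConicExcept T k} ∧ ¬ Γ.OnConic T} ∧ c T = k}.ncard : ℤ) =
      ({T ∈ Twisted π.frob ρ | π.Arc T ∧ Γ.OnConicExcept T k}.ncard : ℤ) -
        {T ∈ Twisted π.frob ρ | π.Arc T ∧ Γ.OnConic T}.ncard := by
    intro k _
    have h5 := ncard_add_ncard_not (A := {T ∈ Twisted π.frob ρ | π.Arc T ∧ Γ.OnConicExcept T k})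
      (hfin.subset fun T hT => ⟨hT.1, hT.2.1⟩) (fun T => Γ.OnConic T)
    have e3 : {T | T ∈ {T ∈ Twisted π.frob ρ | π.Arc T ∧ Γ.OnConicExcept T k} ∧ Γ.OnConic T} =
        {T ∈ Twisted π.frob ρ | π.Arc T ∧ Γ.OnConic T} := by
      ext T
      constructor
      · rintro ⟨⟨h1, h2, h3⟩, h4⟩
        exact ⟨h1, h2, h4⟩
      · rintro ⟨h1, h2, h4⟩
        exact ⟨⟨h1, h2, hall _ h4⟩, h4⟩
    have e4 : {T | T ∈ {T ∈ Twisted π.frob ρ | π.Arc T ∧ Γ.OnConicExcept T k} ∧ ¬ Γ.OnConic T} =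
        {T | T ∈ {T | T ∈ {T | T ∈ {T ∈ Twisted π.frob ρ | π.Arc T} ∧
        ¬ ∀ k, ¬ Γ.OnConicExcept T k} ∧ ¬ Γ.OnConic T} ∧ c T = k} := by
      ext T
      constructor
      · rintro ⟨⟨h1, h2, h3⟩, h4⟩
        have h5 : ¬ ∀ k, ¬ Γ.OnConicExcept T k := fun h => h k h3
        refine ⟨⟨⟨⟨h1, h2⟩, h5⟩, h4⟩, ?_⟩
        by_contra hne
        exact h4 (Γ.onConic_of_onConicExcept h7 h2.1 hne (hc T h5) h3)
      · rintro ⟨⟨⟨⟨h1, h2⟩, h3⟩, h4⟩, rfl⟩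
        exact ⟨⟨h1, h2, hc T h3⟩, h4⟩
    rw [e3, e4] at h5
    linarith
  rw [sum_congr rfl h4] at h3
  rw [goodCount, FrobeniusPlane.arcCount]
  linarith

/-- The sum of the numbers of arcs of six points with three concurrent secants that are permuted
by Frobenius, with signs. -/
noncomputable def _root_.PlaneSeptuples.FrobeniusPlane.concSum (π : FrobeniusPlane P L)
    (ρ : Perm ι) (C : (ι → P) → Prop) : ℤ :=
  ∑ E ∈ synthemes ρ, concurrencySign E (mapSet ρ) * π.concCount ρ C E

/-- Septuples with a fixed point. -/
theorem goodCount_addCycle_one (h6 : Fintype.card ι = 6) (ρ : Perm ι) {c6 c7 : ℤ} {n : ℕ}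
    (hn : (univ.filter fun i => ρ i = i).card = n)
    (h1 : ({T ∈ Twisted π.frob ρ | π.Arc T ∧ Γ.OnConic T}.ncard : ℤ) = c6)
    (h2 : ({T ∈ Twisted π.frob (addCycle 1 ρ) | π.Arc T ∧ Γ.OnConic T}.ncard : ℤ) = c7) :
    2 * Γ.goodCount (addCycle 1 ρ) =
      π.arcCount ρ * (2 * (π.q ^ 2 + π.q + 1) - secantCount ρ π.q) - 2 * π.concSum ρ (fun _ => True)
        - 2 * c7 - (n + 1) * (c6 * (2 * (π.q ^ 2 + π.q + 1) - secantCount ρ π.q) -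
          2 * π.concSum ρ Γ.OnConic - 2 * c7) := by
  have hfix : addCycle 1 ρ (.inl 0) = .inl 0 := rfl
  have hcard : ((univ.filter fun k => addCycle 1 ρ k = k).card : ℤ) = n + 1 := by
    have : (univ.filter fun k => addCycle 1 ρ k = k) =
        insert (.inl 0) ((univ.filter fun i => ρ i = i).map Embedding.inr) := by
      ext k
      rcases k with j | i
      · have : j = 0 := Subsingleton.elim _ _
        subst this
        simp [hfix]
      · simp [addCycle]
    rw [this, card_insert_of_notMem (by simp), card_map, hn]
    push_cast
    rfl
  have h3 := π.two_mul_ncard_addCycle_one_of_six ρ h6 (fun _ => True)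
  have h4 := π.two_mul_ncard_addCycle_one_of_six ρ h6 Γ.OnConic
  simp only [← onConicExcept_inl_iff, and_true] at h3 h4
  have h5 := Γ.goodCount_eq (by simp [h6]) (addCycle 1 ρ)
  rw [h2, sum_congr rfl (fun k hk => by
    rw [Γ.ncard_onConicExcept_eq (k' := .inl 0) (mem_filter.1 hk).2 hfix]),
    sum_const, nsmul_eq_mul, hcard] at h5
  rw [h1] at h4
  simp only [FrobeniusPlane.concSum]
  simp only [FrobeniusPlane.arcCount] at h5 ⊢
  linear_combination 2 * h5 + h3 - (n + 1) * h4

end ConicSystem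

/-! ### Additive polynomials -/

section Additive

variable (F : Type*) {K : Type*} [Field F] [Fintype F] [Field K] [Algebra F K]

theorem natCast_card_eq_zero : ((Fintype.card F : ℕ) : K) = 0 := by
  rw [← map_natCast (algebraMap F K), FiniteField.cast_card_eq_zero, map_zero]

/-- The iterate of the Frobenius endomorphism `z ↦ z ^ q` of `K` as a ring homomorphism. -/
noncomputable def frobHom (d : ℕ) : K →+* K :=
  ((FiniteField.frobeniusAlgHom F K : K →ₐ[F] K) ^ d : K →ₐ[F] K)

theorem frobHom_apply (d : ℕ) (z : K) : frobHom F d z = z ^ Fintype.card F ^ d := by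
  show ((FiniteField.frobeniusAlgHom F K) ^ d) z = _
  induction d with
  | zero => simp
  | succ d ih =>
    rw [pow_succ', AlgHom.mul_apply, ih, pow_succ, pow_mul]
    rfl

open Polynomial in
/-- An additive polynomial with nonzero linear term has only simple roots. -/
theorem ncard_additive_eq [IsAlgClosed K] (d : ℕ) (hd : 0 < d) (a : ℕ → K) (ha : a 0 ≠ 0) (c : K) :
    {z : K | z ^ Fintype.card F ^ d + ∑ i ∈ range d, a i * z ^ Fintype.card F ^ i =
      c}.ncard = Fintype.card F ^ d := by
  classical
  set q := Fintype.card F with hq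
  have hq1 : 1 < q := Fintype.one_lt_card
  have hq0 : ((q : ℕ) : K) = 0 := natCast_card_eq_zero F
  set r : K[X] := ∑ i ∈ range d, C (a i) * X ^ q ^ i - C c with hr
  have hdeg : r.degree < (q ^ d : ℕ) := by
    refine (degree_sub_le _ _).trans_lt (max_lt ?_ ?_)
    · refine (degree_sum_le _ _).trans_lt ((Finset.sup_lt_iff (by
        exact WithBot.bot_lt_coe _)).2 fun i hi => ?_)
      refine (degree_C_mul_X_pow_le _ _).trans_lt ?_
      exact_mod_cast Nat.pow_lt_pow_right hq1 (mem_range.1 hi)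
    · refine degree_C_le.trans_lt ?_
      exact_mod_cast (pow_pos (by omega) d : 0 < q ^ d)
  set p : K[X] := X ^ q ^ d + r with hp
  have hmonic : p.Monic := monic_X_pow_add hdeg
  have hnat : p.natDegree = q ^ d := by
    rw [hp, natDegree_add_eq_left_of_degree_lt (by rwa [degree_X_pow]), natDegree_X_pow]
  have hder : derivative p = C (a 0) := by
    have h1 : ∀ i, 0 < i → ((q ^ i : ℕ) : K) = 0 := fun i hi => by
      rw [Nat.cast_pow, hq0, zero_pow hi.ne']
    rw [hp, hr, derivative_add, derivative_sub, derivative_C, sub_zero, derivative_X_pow, h1 d hd,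
      C_0, zero_mul, zero_add, derivative_sum, sum_eq_single 0]
    · simp
    · intro i _ hi
      rw [derivative_C_mul, derivative_X_pow, h1 i (Nat.pos_of_ne_zero hi)]
      simp
    · intro h
      exact absurd (mem_range.2 hd) h
  have hsep : p.Separable := by
    rw [Polynomial.Separable, hder]
    exact isCoprime_one_right.of_isCoprime_of_dvd_right
      ((isUnit_C.2 (isUnit_iff_ne_zero.2 ha)).dvd)
  have hcard := card_rootSet_eq_natDegree (K := K) hsep (IsAlgClosed.splits_domain _)
  rw [hnat, ← Nat.card_eq_fintype_card, Nat.card_coe_set_eq] at hcard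
  refine Eq.trans ?_ hcard
  congr 1
  ext z
  rw [mem_rootSet_of_ne hmonic.ne_zero]
  simp [hp, hr, aeval_def, eval₂_finsetSum, ← add_sub_assoc, sub_eq_zero]

theorem ncard_frobHom_fixed [IsAlgClosed K] (d : ℕ) (hd : 0 < d) :
    {z : K | frobHom F d z = z}.ncard = Fintype.card F ^ d := by
  rw [← ncard_additive_eq F d hd (fun i => if i = 0 then -1 else 0) (by simp) (0 : K)]
  congr 1
  ext z
  rw [Set.mem_ofPred_eq, Set.mem_ofPred_eq, frobHom_apply, sum_eq_single 0]
  · simp [← sub_eq_add_neg, sub_eq_zero]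
  · intro i _ hi
    simp [hi]
  · intro h
    exact absurd (mem_range.2 hd) h

end Additive

/-! ### The projective plane over an algebraic closure of a finite field -/

section Vectors

variable {K : Type*} [Field K]

open Projectivization Matrix

theorem linearIndependent_iff_dotProduct (v : Fin 3 → Fin 3 → K) :
    LinearIndependent K v ↔ ∀ w, (∀ i, v i ⬝ᵥ w = 0) → w = 0 := by
  rw [show LinearIndependent K v ↔ IsUnit (Matrix.of v) from
    Matrix.linearIndependent_rows_iff_isUnit (A := Matrix.of v), Matrix.isUnit_iff_isUnit_det,
    isUnit_iff_ne_zero, ne_eq, ← Matrix.exists_mulVec_eq_zero_iff]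
  push Not
  constructor
  · intro h w hw
    by_contra hne
    exact h w hne (funext hw)
  · intro h w hne hw
    exact hne (h w (congrFun hw))

theorem exists_eq_of_linearIndependent {v : Fin 3 → Fin 3 → K} (hv : LinearIndependent K v)
    (x : Fin 3 → K) : ∃ c : Fin 3 → K, x = c 0 • v 0 + c 1 • v 1 + c 2 • v 2 := by
  have hspan : ⊤ ≤ Submodule.span K (Set.range v) :=
    (hv.span_eq_top_of_card_eq_finrank (by simp)).ge
  have hx : x ∈ Submodule.span K (Set.range v) := hspan trivial
  obtain ⟨c, rfl⟩ := (Submodule.mem_span_range_iff_exists_fun K).1 hx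
  exact ⟨c, by rw [Fin.sum_univ_three]⟩

/-- The equation satisfied by a line through a diagonal point of a quadrangle. -/
theorem dotProduct_diagonal {t₁ t₂ t₃ : Fin 3 → K}
    (ht : LinearIndependent K ![t₁, t₂, t₃]) {a b c : K}
    {l m n x : Fin 3 → K} (hl : l ≠ 0) (hm : m ≠ 0) (hx : x ≠ 0)
    (hl0 : (a • t₁ + b • t₂ + c • t₃) ⬝ᵥ l = 0) (hl1 : t₁ ⬝ᵥ l = 0) (hlx : x ⬝ᵥ l = 0)
    (hm2 : t₂ ⬝ᵥ m = 0) (hm3 : t₃ ⬝ᵥ m = 0) (hmx : x ⬝ᵥ m = 0) (hn : x ⬝ᵥ n = 0) :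
    b * (t₂ ⬝ᵥ n) + c * (t₃ ⬝ᵥ n) = 0 := by
  obtain ⟨e, rfl⟩ := exists_eq_of_linearIndependent ht x
  simp only [cons_val_zero, cons_val_one, Matrix.cons_val] at hx hlx hmx hn
  rw [linearIndependent_iff_dotProduct] at ht
  simp only [add_dotProduct, smul_dotProduct, smul_eq_mul, hl1, hm2, hm3, mul_zero, zero_add,
    add_zero] at hl0 hlx hmx hn
  have h1 : e 0 = 0 := by
    rcases mul_eq_zero.1 hmx with h | h
    · exact h
    · exact absurd (ht m fun i => by fin_cases i <;> simp [h, hm2, hm3]) hm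
  rw [h1, zero_mul, zero_add] at hn
  have h2 : b * e 2 = c * e 1 := by
    by_contra hne
    have e2 : (b * e 2 - c * e 1) * (t₂ ⬝ᵥ l) = 0 := by linear_combination e 2 * hl0 - c * hlx
    have e3 : (b * e 2 - c * e 1) * (t₃ ⬝ᵥ l) = 0 := by linear_combination b * hlx - e 1 * hl0
    have hne' : b * e 2 - c * e 1 ≠ 0 := sub_ne_zero.2 hne
    have h3 := (mul_eq_zero.1 e2).resolve_left hne'
    have h4 := (mul_eq_zero.1 e3).resolve_left hne'
    exact hl (ht l fun i => by fin_cases i <;> simp [h3, h4, hl1])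
  by_cases h3 : e 1 = 0
  · by_cases h4 : e 2 = 0
    · simp [h1, h3, h4] at hx
    · refine (mul_eq_zero.1 (?_ : e 2 * _ = 0)).resolve_left h4
      linear_combination c * hn + (t₂ ⬝ᵥ n) * h2
  · refine (mul_eq_zero.1 (?_ : e 1 * _ = 0)).resolve_left h3
    linear_combination b * hn - (t₃ ⬝ᵥ n) * h2

end Vectors

section FixedVectors

variable (F : Type*) {K : Type*} [Field F] [Fintype F] [Field K] [Algebra F K]

open Projectivization Matrix

theorem frobeniusVec_iterate (d : ℕ) (v : Fin 3 → K) :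
    (frobeniusVec F)^[d] v = fun i => frobHom F d (v i) := by
  induction d with
  | zero => simp [frobHom]
  | succ d ih =>
    rw [iterate_succ_apply', ih]
    funext i
    show frobHom F d (v i) ^ Fintype.card F = _
    rw [frobHom_apply, frobHom_apply, ← pow_mul, ← pow_succ]

theorem frobeniusVec_iterate_ne_zero (d : ℕ) {v : Fin 3 → K} (hv : v ≠ 0) :
    (frobeniusVec F)^[d] v ≠ 0 := by
  induction d with
  | zero => exact hv
  | succ d ih =>
    rw [iterate_succ_apply']
    intro h
    exact ih (frobeniusVec_injective F (h.trans (map_zero _).symm))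

theorem frobenius_iterate_mk (d : ℕ) {v : Fin 3 → K} (hv : v ≠ 0) :
    (frobenius F)^[d] (mk K v hv) =
      mk K ((frobeniusVec F)^[d] v) (frobeniusVec_iterate_ne_zero F d hv) := by
  induction d with
  | zero => rfl
  | succ d ih =>
    rw [iterate_succ_apply', ih, frobenius, map_mk]
    simp only [iterate_succ_apply']

/-- A fixed point of the plane is represented by a fixed vector. -/
theorem exists_fixed_rep {d : ℕ} {a : Plane K} (ha : (frobenius F)^[d] a = a) :
    ∃ v hv, a = mk K v hv ∧ ∀ i, frobHom F d (v i) = v i := by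
  induction a using Projectivization.ind with
  | h v hv =>
    obtain ⟨i, hi⟩ := ne_iff.1 hv
    have hi' : v i ≠ 0 := hi
    have hv' : (v i)⁻¹ • v ≠ 0 := smul_ne_zero (inv_ne_zero hi') hv
    refine ⟨(v i)⁻¹ • v, hv', ?_, fun j => ?_⟩
    · rw [mk_eq_mk_iff']
      exact ⟨v i, by rw [smul_smul, mul_inv_cancel₀ hi', one_smul]⟩
    · rw [frobenius_iterate_mk, mk_eq_mk_iff'] at ha
      obtain ⟨c, hc⟩ := ha
      rw [frobeniusVec_iterate] at hc
      have h1 := congrFun hc i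
      have h2 := congrFun hc j
      simp only [Pi.smul_apply, smul_eq_mul] at h1 h2 ⊢
      have hc0 : c ≠ 0 := by
        rintro rfl
        rw [zero_mul] at h1
        exact hi' ((map_eq_zero _).1 h1.symm)
      rw [map_mul, map_inv₀, ← h1, ← h2]
      field_simp

theorem mk_fixed {d : ℕ} {v : Fin 3 → K} (hv : v ≠ 0) (h : ∀ i, frobHom F d (v i) = v i) :
    (frobenius F)^[d] (mk K v hv) = mk K v hv := by
  rw [frobenius_iterate_mk]
  congr 1
  rw [frobeniusVec_iterate]
  exact funext h

/-- If a condition on points is given by a linear condition on vectors, the number of fixed points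
follows from the number of fixed vectors. -/
theorem ncard_fixed_points_of_vectors [IsAlgClosed K] (d : ℕ) (hd : 0 < d) (p : Plane K → Prop)
    (p' : (Fin 3 → K) → Prop) (hp : ∀ v hv, p (mk K v hv) ↔ p' v) (h0 : p' 0) {n : ℕ}
    (hn : {v : Fin 3 → K | (∀ i, frobHom F d (v i) = v i) ∧ p' v}.ncard = n) (hn0 : 0 < n) :
    ((n : ℤ) - 1) = {a | (frobenius F)^[d] a = a ∧ p a}.ncard * ((Fintype.card F : ℤ) ^ d - 1) := by
  classical
  have hk := ncard_frobHom_fixed F (K := K) d hd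
  have hkpos : 0 < Fintype.card F ^ d := pow_pos Fintype.card_pos d
  have hkfin : {z : K | frobHom F d z = z}.Finite := Set.finite_of_ncard_pos (by omega)
  have hfin : {v : Fin 3 → K | (∀ i, frobHom F d (v i) = v i) ∧ p' v}.Finite :=
    Set.finite_of_ncard_pos (by omega)
  have hfin' : {v : Fin 3 → K | ((∀ i, frobHom F d (v i) = v i) ∧ p' v) ∧ v ≠ 0}.Finite :=
    hfin.subset fun v hv => hv.1
  have h1 := Set.ncard_sdiff_singleton_of_mem (s := {v : Fin 3 → K | (∀ i, frobHom F d (v i) = v i) ∧ p' v})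
    (a := 0) ⟨fun i => by simp, h0⟩
  rw [hn] at h1
  have h2 : {v : Fin 3 → K | (∀ i, frobHom F d (v i) = v i) ∧ p' v} \ {0} =
      {v : Fin 3 → K | ((∀ i, frobHom F d (v i) = v i) ∧ p' v) ∧ v ≠ 0} := rfl
  rw [h2] at h1
  set f : (Fin 3 → K) → Plane K := fun v => if hv : v ≠ 0 then mk K v hv else
    mk K 1 one_ne_zero with hf
  have hfv : ∀ {v} (hv : v ≠ 0), f v = mk K v hv := fun hv => dif_pos hv
  have hAimg : {a | (frobenius F)^[d] a = a ∧ p a} ⊆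
      f '' {v : Fin 3 → K | ((∀ i, frobHom F d (v i) = v i) ∧ p' v) ∧ v ≠ 0} := by
    rintro a ⟨ha, hpa⟩
    obtain ⟨v, hv, rfl, h⟩ := exists_fixed_rep F ha
    exact ⟨v, ⟨⟨h, (hp v hv).1 hpa⟩, hv⟩, hfv hv⟩
  have key := ncard_eq_mul_of_fiber hfin' ((hfin'.image f).subset hAimg) f
    (k := (Fintype.card F : ℤ) ^ d - 1) (by
      rintro v ⟨⟨h1, h2⟩, hv⟩
      rw [hfv hv]
      exact ⟨mk_fixed F hv h1, (hp v hv).2 h2⟩) (by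
      rintro a ⟨ha, hpa⟩
      obtain ⟨v, hv, rfl, h⟩ := exists_fixed_rep F ha
      have h3 := Set.ncard_sdiff_singleton_of_mem (s := {z : K | frobHom F d z = z}) (a := 0)
        (map_zero _)
      rw [hk] at h3
      have h4 : ({z : K | frobHom F d z = z} \ {0}).ncard =
          {w | w ∈ {v : Fin 3 → K | ((∀ i, frobHom F d (v i) = v i) ∧ p' v) ∧ v ≠ 0} ∧
            f w = mk K v hv}.ncard := by
        refine Set.ncard_congr (fun z _ => z • v) ?_ ?_ ?_
        · rintro z ⟨hz, hz0⟩
          have hz0' : z ≠ 0 := hz0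
          have hz' : frobHom F d z = z := hz
          have hne : z • v ≠ 0 := smul_ne_zero hz0' hv
          have hmk : mk K (z • v) hne = mk K v hv := by
            rw [mk_eq_mk_iff']
            exact ⟨z, rfl⟩
          refine ⟨⟨⟨fun i => ?_, ?_⟩, hne⟩, by rw [hfv hne, hmk]⟩
          · rw [Pi.smul_apply, smul_eq_mul, map_mul, hz', h]
          · rw [← hp _ hne, hmk]
            exact hpa
        · intro z z' _ _ hzz
          exact smul_left_injective K hv hzz
        · rintro w ⟨⟨⟨h5, h6⟩, hw⟩, h7⟩
          rw [hfv hw, mk_eq_mk_iff'] at h7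
          obtain ⟨c, hc⟩ := h7
          obtain ⟨i, hi⟩ := ne_iff.1 hv
          have hi' : v i ≠ 0 := hi
          refine ⟨c, ⟨?_, ?_⟩, hc⟩
          · have h8 := h5 i
            rw [← hc, Pi.smul_apply, smul_eq_mul, map_mul, h] at h8
            exact mul_right_cancel₀ hi' h8
          · rintro rfl
            exact hw (by rw [← hc, zero_smul])
      rw [← h4, h3]
      push_cast [Nat.one_le_iff_ne_zero.2 hkpos.ne']
      rfl)
  rw [← key, h1]
  push_cast [Nat.one_le_iff_ne_zero.2 hn0.ne']
  rfl

theorem ncard_fixed_vectors [IsAlgClosed K] (d : ℕ) (hd : 0 < d) :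
    {v : Fin 3 → K | ∀ i, frobHom F d (v i) = v i}.ncard = (Fintype.card F ^ d) ^ 3 := by
  have hk := ncard_frobHom_fixed F (K := K) d hd
  have h1 : {v : Fin 3 → K | ∀ i, frobHom F d (v i) = v i} =
      Set.pi Set.univ fun _ : Fin 3 => {z : K | frobHom F d z = z} := by
    ext v
    simp
  rw [h1, ← Nat.card_coe_set_eq, Nat.card_congr (Equiv.Set.univPi _), Nat.card_pi]
  simp [hk]

theorem ncard_fixed_vectors_orthogonal [IsAlgClosed K] (d : ℕ) (hd : 0 < d) {w : Fin 3 → K}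
    (hw : w ≠ 0) (hfw : ∀ i, frobHom F d (w i) = w i) :
    {v : Fin 3 → K | (∀ i, frobHom F d (v i) = v i) ∧ v ⬝ᵥ w = 0}.ncard =
      (Fintype.card F ^ d) ^ 2 := by
  have hk := ncard_frobHom_fixed F (K := K) d hd
  have hv := ncard_fixed_vectors F (K := K) d hd
  have hkpos : 0 < Fintype.card F ^ d := pow_pos Fintype.card_pos d
  have hkfin : {z : K | frobHom F d z = z}.Finite := Set.finite_of_ncard_pos (by omega)
  have hvfin : {v : Fin 3 → K | ∀ i, frobHom F d (v i) = v i}.Finite :=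
    Set.finite_of_ncard_pos (by rw [hv]; positivity)
  obtain ⟨i, hi⟩ := ne_iff.1 hw
  have hi' : w i ≠ 0 := hi
  have key := ncard_eq_mul_of_fiber hvfin hkfin (fun v => v ⬝ᵥ w)
    (k := {v : Fin 3 → K | (∀ i, frobHom F d (v i) = v i) ∧ v ⬝ᵥ w = 0}.ncard) (by
      intro v hv
      show frobHom F d _ = _
      rw [RingHom.map_dotProduct]
      congr 1
      · exact funext hv
      · exact funext hfw) (by
      intro z hz
      have hz' : frobHom F d z = z := hz
      congr 1
      -- translation by a multiple of a coordinate vector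
      have hs : ∀ j, frobHom F d ((Pi.single i (z / w i) : Fin 3 → K) j) =
          (Pi.single i (z / w i) : Fin 3 → K) j := by
        intro j
        by_cases hj : j = i
        · subst hj
          rw [Pi.single_eq_same, map_div₀, hz', hfw]
        · rw [Pi.single_eq_of_ne hj, map_zero]
      have hs' : Pi.single i (z / w i) ⬝ᵥ w = z := by
        rw [single_dotProduct, div_mul_cancel₀ _ hi']
      refine Set.ncard_congr (fun v _ => v - Pi.single i (z / w i)) ?_ ?_ ?_
      · rintro v ⟨h1, h2⟩
        refine ⟨fun j => ?_, ?_⟩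
        · rw [Pi.sub_apply, map_sub, h1 j, hs]
        · have h2' : v ⬝ᵥ w = z := h2
          rw [sub_dotProduct, h2', hs', sub_self]
      · intro v v' _ _ h
        exact sub_left_injective h
      · rintro v ⟨h1, h2⟩
        refine ⟨v + Pi.single i (z / w i), ⟨fun j => ?_, ?_⟩, by simp⟩
        · rw [Pi.add_apply, map_add, h1 j, hs]
        · show (v + Pi.single i (z / w i)) ⬝ᵥ w = z
          rw [add_dotProduct, h2, hs', zero_add])
  rw [hv, hk] at key
  have h3 : (Fintype.card F ^ d) ^ 3 = Fintype.card F ^ d *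
    {v : Fin 3 → K | (∀ i, frobHom F d (v i) = v i) ∧ v ⬝ᵥ w = 0}.ncard := by exact_mod_cast key
  exact Nat.eq_of_mul_eq_mul_left hkpos (by rw [← h3]; ring)

theorem frobeniusVec_ne_zero {v : Fin 3 → K} (hv : v ≠ 0) : frobeniusVec F v ≠ 0 :=
  frobeniusVec_iterate_ne_zero F 1 hv

theorem frobenius_mk {v : Fin 3 → K} (hv : v ≠ 0) : frobenius F (mk K v hv) =
    mk K (frobeniusVec F v) (frobeniusVec_ne_zero F hv) := rfl

theorem orthogonal_frobenius {a l : Plane K} :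
    (frobenius F a).orthogonal (frobenius F l) ↔ a.orthogonal l := by
  induction a using Projectivization.ind with
  | h v hv =>
    induction l using Projectivization.ind with
    | h w hw =>
      rw [frobenius_mk, frobenius_mk, orthogonal_mk, orthogonal_mk]
      have h : frobeniusVec F v ⬝ᵥ frobeniusVec F w =
          (FiniteField.frobeniusAlgHom F K : K →+* K) (v ⬝ᵥ w) :=
        (RingHom.map_dotProduct (FiniteField.frobeniusAlgHom F K : K →+* K) v w).symm
      rw [h, map_eq_zero]

theorem frobenius_injective : Injective (frobenius F (K := K)) := by
  intro a b hab
  induction a using Projectivization.ind with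
  | h v hv =>
    induction b using Projectivization.ind with
    | h w hw =>
      rw [frobenius_mk, frobenius_mk, mk_eq_mk_iff_crossProduct_eq_zero] at hab
      rw [mk_eq_mk_iff_crossProduct_eq_zero]
      refine frobeniusVec_injective F (Eq.trans ?_ (map_zero _).symm)
      rw [← hab]
      funext i
      have h : ∀ u i, frobeniusVec F u i = FiniteField.frobeniusAlgHom F K (u i) := fun _ _ => rfl
      fin_cases i <;> simp [cross_apply, h, -FiniteField.frobeniusAlgHom_apply]

variable (K) in
theorem ncard_frobenius_fixed [IsAlgClosed K] (d : ℕ) (hd : 0 < d) :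
    {a : Plane K | (frobenius F)^[d] a = a}.ncard =
      Fintype.card F ^ (2 * d) + Fintype.card F ^ d + 1 := by
  have h := ncard_fixed_points_of_vectors F (K := K) d hd (fun _ => True) (fun _ => True)
    (fun _ _ => Iff.rfl) trivial (n := (Fintype.card F ^ d) ^ 3)
    (by simpa using ncard_fixed_vectors F (K := K) d hd) (by have := Fintype.card_pos (α := F); positivity)
  simp only [and_true] at h
  have hq : (1 : ℤ) < (Fintype.card F : ℤ) ^ d :=
    one_lt_pow₀ (by exact_mod_cast Fintype.one_lt_card) hd.ne'
  zify
  refine mul_right_cancel₀ (sub_ne_zero.2 hq.ne') ?_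
  rw [← h]
  push_cast
  ring

theorem ncard_frobenius_fixed_orthogonal [IsAlgClosed K] (d : ℕ) (hd : 0 < d) (l : Plane K)
    (hl : (frobenius F)^[d] l = l) :
    {a : Plane K | (frobenius F)^[d] a = a ∧ a.orthogonal l}.ncard = Fintype.card F ^ d + 1 := by
  obtain ⟨w, hw, rfl, hfw⟩ := exists_fixed_rep F hl
  have h := ncard_fixed_points_of_vectors F (K := K) d hd (fun a => a.orthogonal (mk K w hw))
    (fun v => v ⬝ᵥ w = 0) (fun _ _ => Iff.rfl) (zero_dotProduct w)
    (ncard_fixed_vectors_orthogonal F d hd hw hfw) (by have := Fintype.card_pos (α := F); positivity)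
  have hq : (1 : ℤ) < (Fintype.card F : ℤ) ^ d :=
    one_lt_pow₀ (by exact_mod_cast Fintype.one_lt_card) hd.ne'
  zify
  refine mul_right_cancel₀ (sub_ne_zero.2 hq.ne') ?_
  rw [← h]
  push_cast
  ring

end FixedVectors

section Plane

open Projectivization Matrix

/-- The diagonal points of a quadrangle are not collinear if the characteristic is not two. -/
theorem diagonal_not_collinear {K : Type*} [Field K] (h2 : (2 : K) ≠ 0) (T : Fin 4 → Plane K)
    (hT : ∀ (l : Plane K) i j k, i ≠ j → i ≠ k → j ≠ k → (T i).orthogonal l → (T j).orthogonal l →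
      ¬ (T k).orthogonal l)
    (x l m : Fin 3 → Plane K) (n : Plane K)
    (hl : ∀ i : Fin 3, (T 0).orthogonal (l i) ∧ (T i.succ).orthogonal (l i) ∧
      (x i).orthogonal (l i))
    (hm : ∀ i j : Fin 3, i ≠ j → (T j.succ).orthogonal (m i)) (hx : ∀ i, (x i).orthogonal (m i)) :
    ¬ ∀ i, (x i).orthogonal n := by
  intro hn
  have hrep : ∀ {a b : Plane K}, a.orthogonal b ↔ a.rep ⬝ᵥ b.rep = 0 := fun {a b} => by
    conv_lhs => rw [← mk_rep a, ← mk_rep b, orthogonal_mk]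
  have hli : ∀ i j k, i ≠ j → i ≠ k → j ≠ k →
      LinearIndependent K ![(T i).rep, (T j).rep, (T k).rep] := by
    intro i j k hij hik hjk
    rw [linearIndependent_iff_dotProduct]
    intro w hw
    by_contra hw0
    have key : ∀ i, (T i).rep ⬝ᵥ w = 0 → (T i).orthogonal (mk K w hw0) := fun i h => by
      conv_lhs => rw [← mk_rep (T i)]
      rwa [orthogonal_mk]
    exact hT (mk K w hw0) i j k hij hik hjk (key i (hw 0)) (key j (hw 1)) (key k (hw 2))
  obtain ⟨c, hc⟩ := exists_eq_of_linearIndependent (hli 1 2 3 (by decide) (by decide) (by decide))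
    (T 0).rep
  simp only [cons_val_zero, cons_val_one, Matrix.cons_val] at hc
  have hc0 : ∀ i, c i ≠ 0 := by
    have key : ∀ (i j k : Fin 4) (w : Fin 3 → K), i ≠ j → i ≠ k → j ≠ k → w ≠ 0 →
        (T i).rep ⬝ᵥ w = 0 → (T j).rep ⬝ᵥ w = 0 → (T k).rep ⬝ᵥ w = 0 → False := by
      intro i j k w hij hik hjk hw hi hj hk
      exact hw ((linearIndependent_iff_dotProduct _).1 (hli i j k hij hik hjk) w fun e => by
        fin_cases e <;> assumption)
    have hex : ∀ a b : Fin 3 → K, ∃ w : Fin 3 → K, w ≠ 0 ∧ a ⬝ᵥ w = 0 ∧ b ⬝ᵥ w = 0 := by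
      intro a b
      have : (Matrix.of ![a, b, a]).det = 0 := by
        rw [det_fin_three]
        simp
        ring
      obtain ⟨w, hw, h⟩ := exists_mulVec_eq_zero_iff.2 this
      exact ⟨w, hw, congrFun h 0, congrFun h 1⟩
    intro i hi
    fin_cases i
    · obtain ⟨w, hw, h1, h2⟩ := hex (T 2).rep (T 3).rep
      refine key 0 2 3 w (by decide) (by decide) (by decide) hw ?_ h1 h2
      simp only [Fin.zero_eta] at hi
      rw [hc]
      simp [h1, h2, hi]
    · obtain ⟨w, hw, h1, h2⟩ := hex (T 1).rep (T 3).rep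
      refine key 0 1 3 w (by decide) (by decide) (by decide) hw ?_ h1 h2
      simp only [Fin.mk_one] at hi
      rw [hc]
      simp [h1, h2, hi]
    · obtain ⟨w, hw, h1, h2⟩ := hex (T 1).rep (T 2).rep
      refine key 0 1 2 w (by decide) (by decide) (by decide) hw ?_ h1 h2
      simp only [Fin.reduceFinMk] at hi
      rw [hc]
      simp [h1, h2, hi]
  simp only [hrep] at hl hm hx hn
  rw [hc] at hl
  have r : ∀ a : Plane K, a.rep ≠ 0 := fun a => a.rep_nonzero
  have e0 := dotProduct_diagonal (hli 1 2 3 (by decide) (by decide) (by decide)) (r _) (r _) (r _)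
    (hl 0).1 (hl 0).2.1 (hl 0).2.2 (hm 0 1 (by decide)) (hm 0 2 (by decide)) (hx 0) (hn 0)
  have e1 := dotProduct_diagonal (a := c 1) (b := c 0) (c := c 2)
    (hli 2 1 3 (by decide) (by decide) (by decide)) (r _) (r _) (r _)
    (by rw [add_comm (c 1 • _)]; exact (hl 1).1) (hl 1).2.1 (hl 1).2.2 (hm 1 0 (by decide))
    (hm 1 2 (by decide)) (hx 1) (hn 1)
  have e2 := dotProduct_diagonal (a := c 2) (b := c 0) (c := c 1)
    (hli 3 1 2 (by decide) (by decide) (by decide)) (r _) (r _) (r _)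
    (by rw [add_assoc, add_comm]; exact (hl 2).1) (hl 2).2.1 (hl 2).2.2 (hm 2 0 (by decide))
    (hm 2 1 (by decide)) (hx 2) (hn 2)
  have f1 : 2 * c 0 * ((T 1).rep ⬝ᵥ n.rep) = 0 := by linear_combination e1 + e2 - e0
  have f2 : 2 * c 1 * ((T 2).rep ⬝ᵥ n.rep) = 0 := by linear_combination e0 + e2 - e1
  have f3 : 2 * c 2 * ((T 3).rep ⬝ᵥ n.rep) = 0 := by linear_combination e0 + e1 - e2
  refine r n ((linearIndependent_iff_dotProduct _).1
    (hli 1 2 3 (by decide) (by decide) (by decide)) n.rep fun i => ?_)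
  fin_cases i
  · exact (mul_eq_zero.1 f1).resolve_left (mul_ne_zero h2 (hc0 0))
  · exact (mul_eq_zero.1 f2).resolve_left (mul_ne_zero h2 (hc0 1))
  · exact (mul_eq_zero.1 f3).resolve_left (mul_ne_zero h2 (hc0 2))

theorem two_ne_zero_of_odd {F : Type*} (K : Type*) [Field F] [Fintype F] [Field K] [Algebra F K]
    (hodd : Odd (Fintype.card F)) : (2 : K) ≠ 0 := by
  intro h
  obtain ⟨k, hk⟩ := hodd
  have h1 := natCast_card_eq_zero F (K := K)
  rw [hk] at h1
  push_cast at h1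
  rw [h, zero_mul, zero_add] at h1
  exact one_ne_zero h1

open Classical in
/-- The projective plane over an algebraic closure of a finite field of odd order, with lines
given by their dual coordinates. -/
noncomputable def projectivePlane (F K : Type*) [Field F] [Fintype F] [Field K] [Algebra F K]
    [IsAlgClosed K] (hodd : Odd (Fintype.card F)) : FrobeniusPlane (Plane K) (Plane K) where
  inc := orthogonal
  join := cross
  inc_join_left := orthogonal_cross_left
  inc_join_right := orthogonal_cross_right
  meet := cross
  inc_meet_left := cross_orthogonal_left
  inc_meet_right := cross_orthogonal_right
  eq_or_eq := fun h1 h2 h3 h4 => Configuration.ofField.eq_or_eq_of_orthogonal h1 h2 h3 h4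
  frob := frobenius F
  frobL := frobenius F
  frob_injective := frobenius_injective F
  frobL_injective := frobenius_injective F
  inc_frob := orthogonal_frobenius F
  q := Fintype.card F
  two_le := Fintype.one_lt_card
  ncard_points := ncard_frobenius_fixed F K
  ncard_lines := ncard_frobenius_fixed F K
  ncard_points_on := ncard_frobenius_fixed_orthogonal F
  ncard_lines_on := fun d hd a ha => by
    simp only [orthogonal_comm (v := a)]
    exact ncard_frobenius_fixed_orthogonal F d hd a ha
  fano := fun T _ hT x l m n hl hm hx =>
    diagonal_not_collinear (two_ne_zero_of_odd K hodd) T hT x l m n hl hm hx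

end Plane

/-! ### Quadratic forms and conics -/

section Quadratic

variable {K : Type*} [Field K]

open Projectivization Matrix

/-- The ternary quadratic form with coefficients `c`. -/
def quad (c : Fin 6 → K) (v : Fin 3 → K) : K :=
  c 0 * v 0 ^ 2 + c 1 * v 1 ^ 2 + c 2 * v 2 ^ 2 + c 3 * (v 0 * v 1) + c 4 * (v 0 * v 2) +
    c 5 * (v 1 * v 2)

/-- The coefficients of the linear form given by the polar form of `quad c` at `v`. -/
def quadPolar (c : Fin 6 → K) (v : Fin 3 → K) : Fin 3 → K :=
  ![2 * c 0 * v 0 + c 3 * v 1 + c 4 * v 2, 2 * c 1 * v 1 + c 3 * v 0 + c 5 * v 2,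
    2 * c 2 * v 2 + c 4 * v 0 + c 5 * v 1]

theorem quad_combination (c : Fin 6 → K) (s t : K) (v w : Fin 3 → K) :
    quad c (s • v + t • w) = s ^ 2 * quad c v + s * t * (w ⬝ᵥ quadPolar c v) + t ^ 2 * quad c w := by
  simp [quad, quadPolar, dotProduct, Fin.sum_univ_three]
  ring

theorem dotProduct_quadPolar_comm (c : Fin 6 → K) (v w : Fin 3 → K) :
    w ⬝ᵥ quadPolar c v = v ⬝ᵥ quadPolar c w := by
  simp [quadPolar, dotProduct, Fin.sum_univ_three]
  ring

theorem dotProduct_quadPolar_self (c : Fin 6 → K) (v : Fin 3 → K) :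
    v ⬝ᵥ quadPolar c v = 2 * quad c v := by
  simp [quad, quadPolar, dotProduct, Fin.sum_univ_three]
  ring

theorem quad_smul (c : Fin 6 → K) (s : K) (v : Fin 3 → K) : quad c (s • v) = s ^ 2 * quad c v := by
  simp [quad]
  ring

theorem quad_smul_left (c : Fin 6 → K) (s : K) (v : Fin 3 → K) :
    quad (s • c) v = s * quad c v := by
  simp [quad]
  ring

theorem quad_add_left (c d : Fin 6 → K) (v : Fin 3 → K) :
    quad (c + d) v = quad c v + quad d v := by
  simp [quad]
  ring

/-- The coefficients of the product of two linear forms. -/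
def quadMul (f g : Fin 3 → K) : Fin 6 → K :=
  ![f 0 * g 0, f 1 * g 1, f 2 * g 2, f 0 * g 1 + f 1 * g 0, f 0 * g 2 + f 2 * g 0,
    f 1 * g 2 + f 2 * g 1]

theorem quad_quadMul (f g v : Fin 3 → K) : quad (quadMul f g) v = (v ⬝ᵥ f) * (v ⬝ᵥ g) := by
  simp [quad, quadMul, dotProduct, Fin.sum_univ_three]
  ring

theorem eq_zero_of_quad {c : Fin 6 → K} (h : ∀ v, quad c v = 0) : c = 0 := by
  have h0 : c 0 = 0 := by simpa [quad] using h ![1, 0, 0]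
  have h1 : c 1 = 0 := by simpa [quad] using h ![0, 1, 0]
  have h2 : c 2 = 0 := by simpa [quad] using h ![0, 0, 1]
  have h3 : c 3 = 0 := by simpa [quad, h0, h1] using h ![1, 1, 0]
  have h4 : c 4 = 0 := by simpa [quad, h0, h2] using h ![1, 0, 1]
  have h5 : c 5 = 0 := by simpa [quad, h1, h2] using h ![0, 1, 1]
  funext i
  fin_cases i <;> assumption

theorem exists_dotProduct_eq_one {w : Fin 3 → K} (hw : w ≠ 0) : ∃ x, x ⬝ᵥ w = 1 := by
  obtain ⟨i, hi⟩ := ne_iff.1 hw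
  exact ⟨Pi.single i (w i)⁻¹, by rw [single_dotProduct, inv_mul_cancel₀ hi]⟩

/-- A quadratic form that vanishes on a line is a product of linear forms. -/
theorem exists_eq_mul_of_vanish {c : Fin 6 → K} {w : Fin 3 → K} (hw : w ≠ 0)
    (h : ∀ v, v ⬝ᵥ w = 0 → quad c v = 0) : ∃ g, ∀ v, quad c v = (v ⬝ᵥ w) * (v ⬝ᵥ g) := by
  obtain ⟨x, hx⟩ := exists_dotProduct_eq_one hw
  refine ⟨quadPolar c x - quad c x • w, fun v => ?_⟩
  have h1 : quad c ((1 : K) • v + (-(v ⬝ᵥ w)) • x) = 0 := h _ (by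
    simp [add_dotProduct, hx])
  rw [quad_combination] at h1
  rw [dotProduct_sub, dotProduct_smul, smul_eq_mul, ← dotProduct_quadPolar_comm]
  linear_combination h1

/-- The vectors of a line are the combinations of two of them. -/
theorem exists_eq_combination {u v w : Fin 3 → K} (hw : w ≠ 0) (huv : LinearIndependent K ![u, v])
    (hu : u ⬝ᵥ w = 0) (hv : v ⬝ᵥ w = 0) {y : Fin 3 → K} (hy : y ⬝ᵥ w = 0) :
    ∃ s t : K, y = s • u + t • v := by
  obtain ⟨x, hx⟩ := exists_dotProduct_eq_one hw
  have hli : LinearIndependent K ![u, v, x] := by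
    rw [LinearIndependent.pair_iff] at huv
    rw [Fintype.linearIndependent_iff]
    intro c hc
    simp only [Fin.sum_univ_three, cons_val_zero, cons_val_one, Matrix.cons_val] at hc
    have h1 := congrArg (· ⬝ᵥ w) hc
    simp only [add_dotProduct, smul_dotProduct, hu, hv, hx, smul_eq_mul, mul_zero, zero_add, mul_one,
      zero_dotProduct] at h1
    rw [h1, zero_smul, add_zero] at hc
    obtain ⟨h2, h3⟩ := huv _ _ hc
    intro i
    fin_cases i <;> assumption
  obtain ⟨c, rfl⟩ := exists_eq_of_linearIndependent hli y
  simp only [cons_val_zero, cons_val_one, Matrix.cons_val, add_dotProduct, smul_dotProduct, hu, hv, hx,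
    smul_eq_mul, mul_zero, zero_add, mul_one] at hy ⊢
  exact ⟨c 0, c 1, by rw [hy, zero_smul, add_zero]⟩

theorem exists_pair_on_line {w : Fin 3 → K} (hw : w ≠ 0) :
    ∃ u v, LinearIndependent K ![u, v] ∧ u ⬝ᵥ w = 0 ∧ v ⬝ᵥ w = 0 := by
  obtain ⟨i, hi⟩ := ne_iff.1 hw
  have hi' : w i ≠ 0 := hi
  have key : ∀ u v : Fin 3 → K, crossProduct u v ≠ 0 → LinearIndependent K ![u, v] :=
    fun u v h => crossProduct_ne_zero_iff_linearIndependent.1 h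
  fin_cases i
  · refine ⟨![-w 1, w 0, 0], ![-w 2, 0, w 0], key _ _ (ne_iff.2 ⟨0, ?_⟩), ?_, ?_⟩
    · simpa [cross_apply] using hi'
    · simp [dotProduct, Fin.sum_univ_three]; ring
    · simp [dotProduct, Fin.sum_univ_three]; ring
  · refine ⟨![w 1, -w 0, 0], ![0, -w 2, w 1], key _ _ (ne_iff.2 ⟨1, ?_⟩), ?_, ?_⟩
    · simpa [cross_apply] using hi'
    · simp [dotProduct, Fin.sum_univ_three]; ring
    · simp [dotProduct, Fin.sum_univ_three]; ring
  · refine ⟨![w 2, 0, -w 0], ![0, w 2, -w 1], key _ _ (ne_iff.2 ⟨2, ?_⟩), ?_, ?_⟩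
    · simpa [cross_apply] using hi'
    · simp [dotProduct, Fin.sum_univ_three]; ring
    · simp [dotProduct, Fin.sum_univ_three]; ring

theorem linearIndependent_of_ne {u v : Fin 3 → K} (hu : u ≠ 0) (hv : v ≠ 0)
    (h : mk K u hu ≠ mk K v hv) : LinearIndependent K ![u, v] := by
  rw [ne_eq, mk_eq_mk_iff_crossProduct_eq_zero] at h
  exact crossProduct_ne_zero_iff_linearIndependent.1 h

theorem mk_ne_of_linearIndependent {u v : Fin 3 → K} (hu : u ≠ 0) (hv : v ≠ 0)
    (h : LinearIndependent K ![u, v]) : mk K u hu ≠ mk K v hv := by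
  rw [ne_eq, mk_eq_mk_iff_crossProduct_eq_zero]
  exact crossProduct_ne_zero_iff_linearIndependent.2 h

/-- The points where a quadratic form vanishes. -/
def zeroSet (c : Fin 6 → K) : Set (Plane K) := {a | quad c a.rep = 0}

theorem mk_mem_zeroSet {c : Fin 6 → K} {v : Fin 3 → K} (hv : v ≠ 0) :
    mk K v hv ∈ zeroSet c ↔ quad c v = 0 := by
  obtain ⟨a, ha⟩ := exists_smul_eq_mk_rep K v hv
  show quad c _ = 0 ↔ _
  rw [← ha, show a • v = (a : K) • v from rfl, quad_smul, mul_eq_zero, pow_eq_zero_iff two_ne_zero]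
  exact or_iff_right a.ne_zero

/-- The zero set of the form contains a line. -/
def ContainsLine (c : Fin 6 → K) : Prop := ∃ l : Plane K, ∀ a, a.orthogonal l → a ∈ zeroSet c

theorem containsLine_of_vanish {c : Fin 6 → K} {w : Fin 3 → K} (hw : w ≠ 0)
    (h : ∀ v, v ⬝ᵥ w = 0 → quad c v = 0) : ContainsLine c := by
  refine ⟨mk K w hw, fun a ha => ?_⟩
  induction a using Projectivization.ind with
  | h v hv => exact (mk_mem_zeroSet hv).2 (h v ((orthogonal_mk hv hw).1 ha))

theorem exists_orthogonal (u v : Fin 3 → K) : ∃ w, w ≠ 0 ∧ u ⬝ᵥ w = 0 ∧ v ⬝ᵥ w = 0 := by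
  have : (Matrix.of ![u, v, u]).det = 0 := by
    rw [det_fin_three]
    simp
    ring
  obtain ⟨w, hw, h⟩ := exists_mulVec_eq_zero_iff.2 this
  exact ⟨w, hw, congrFun h 0, congrFun h 1⟩

/-- A form that vanishes at two points that are orthogonal for its polar form vanishes on the line
joining them. -/
theorem containsLine_of_polar_eq_zero {c : Fin 6 → K} {u v : Fin 3 → K}
    (huv : LinearIndependent K ![u, v]) (hu : quad c u = 0) (hv : quad c v = 0)
    (h : v ⬝ᵥ quadPolar c u = 0) : ContainsLine c := by
  obtain ⟨w, hw, h1, h2⟩ := exists_orthogonal u v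
  refine containsLine_of_vanish hw fun y hy => ?_
  obtain ⟨s, t, rfl⟩ := exists_eq_combination hw huv h1 h2 hy
  rw [quad_combination, hu, hv, h]
  ring

theorem exists_rep (a : Plane K) : ∃ v, ∃ hv : v ≠ 0, a = mk K v hv :=
  ⟨a.rep, a.rep_nonzero, (mk_rep a).symm⟩

theorem zeroSet_not_collinear {c : Fin 6 → K} (hc : ¬ ContainsLine c) {a b d l : Plane K}
    (ha : a ∈ zeroSet c) (hb : b ∈ zeroSet c) (hd : d ∈ zeroSet c) (hab : a ≠ b) (had : a ≠ d)
    (hbd : b ≠ d) (hal : a.orthogonal l) (hbl : b.orthogonal l) : ¬ d.orthogonal l := by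
  intro hdl
  obtain ⟨u, hu, rfl⟩ := exists_rep a
  obtain ⟨v, hv, rfl⟩ := exists_rep b
  obtain ⟨y, hy, rfl⟩ := exists_rep d
  obtain ⟨w, hw, rfl⟩ := exists_rep l
  rw [orthogonal_mk] at hal hbl hdl
  rw [mk_mem_zeroSet] at ha hb hd
  have huv := linearIndependent_of_ne hu hv hab
  obtain ⟨s, t, rfl⟩ := exists_eq_combination hw huv hal hbl hdl
  rw [quad_combination, ha, hb, mul_zero, mul_zero, zero_add, add_zero, mul_eq_zero,
    mul_eq_zero] at hd
  rcases hd with (rfl | rfl) | h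
  · exact hbd ((mk_eq_mk_iff' K _ _ _ _).2 ⟨t⁻¹, by
      have ht : t ≠ 0 := by rintro rfl; simp at hy
      rw [zero_smul, zero_add, smul_smul, inv_mul_cancel₀ ht, one_smul]⟩)
  · exact had ((mk_eq_mk_iff' K _ _ _ _).2 ⟨s⁻¹, by
      have ht : s ≠ 0 := by rintro rfl; simp at hy
      rw [zero_smul, add_zero, smul_smul, inv_mul_cancel₀ ht, one_smul]⟩)
  · exact hc (containsLine_of_polar_eq_zero huv ha hb h)

theorem exists_binary_zero [IsAlgClosed K] (a b c : K) :
    ∃ s t : K, (s ≠ 0 ∨ t ≠ 0) ∧ s ^ 2 * a + s * t * b + t ^ 2 * c = 0 := by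
  by_cases ha : a = 0
  · exact ⟨1, 0, .inl one_ne_zero, by simp [ha]⟩
  · obtain ⟨s, hs⟩ := IsAlgClosed.exists_root
      (Polynomial.C a * Polynomial.X ^ 2 + Polynomial.C b * Polynomial.X + Polynomial.C c)
      (by rw [Polynomial.degree_quadratic ha]; norm_num)
    refine ⟨s, 1, .inr one_ne_zero, ?_⟩
    simp [Polynomial.IsRoot] at hs
    linear_combination hs

theorem exists_mem_zeroSet_orthogonal [IsAlgClosed K] (c : Fin 6 → K) (l : Plane K) :
    ∃ a ∈ zeroSet c, a.orthogonal l := by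
  obtain ⟨w, hw, rfl⟩ := exists_rep l
  obtain ⟨u, v, huv, hu, hv⟩ := exists_pair_on_line hw
  obtain ⟨s, t, hst, h⟩ := exists_binary_zero (quad c u) (v ⬝ᵥ quadPolar c u) (quad c v)
  have hne : s • u + t • v ≠ 0 := fun h0 => by
    obtain ⟨h1, h2⟩ := LinearIndependent.pair_iff.1 huv s t h0
    rcases hst with h | h
    exacts [h h1, h h2]
  refine ⟨mk K _ hne, (mk_mem_zeroSet hne).2 (by rw [quad_combination, h]), ?_⟩
  rw [orthogonal_mk, add_dotProduct, smul_dotProduct, smul_dotProduct, hu, hv]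
  simp

/-- The tangent at a point of a smooth conic is unique: it is given by the polar form, and any other line
through the point meets the conic again. -/
theorem zeroSet_tangent [IsAlgClosed K] {c : Fin 6 → K} (hc : ¬ ContainsLine c) {a : Plane K}
    (ha : a ∈ zeroSet c) : ∃ l : Plane K, (a.orthogonal l ∧ ∀ b ∈ zeroSet c, b.orthogonal l → b = a) ∧
      ∀ m : Plane K, (a.orthogonal m ∧ ∀ b ∈ zeroSet c, b.orthogonal m → b = a) → m = l := by
  obtain ⟨x, hx, rfl⟩ := exists_rep a
  have hqx := (mk_mem_zeroSet hx).1 ha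
  have hp : quadPolar c x ≠ 0 := by
    intro hp
    obtain ⟨l, hl⟩ := exists_not_self_orthogonal (mk K x hx)
    obtain ⟨b, hb, hbl⟩ := exists_mem_zeroSet_orthogonal c l
    obtain ⟨y, hy, rfl⟩ := exists_rep b
    refine hc (containsLine_of_polar_eq_zero (linearIndependent_of_ne hx hy ?_) hqx
      ((mk_mem_zeroSet hy).1 hb) (by rw [hp, dotProduct_zero]))
    intro h
    exact hl (h ▸ hbl)
  have hxp : x ⬝ᵥ quadPolar c x = 0 := by rw [dotProduct_quadPolar_self, hqx, mul_zero]
  refine ⟨mk K _ hp, ⟨(orthogonal_mk hx hp).2 hxp, fun b hb hbl => ?_⟩, fun m hm => ?_⟩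
  · obtain ⟨y, hy, rfl⟩ := exists_rep b
    by_contra hne
    exact hc (containsLine_of_polar_eq_zero (linearIndependent_of_ne hx hy (Ne.symm hne)) hqx
      ((mk_mem_zeroSet hy).1 hb) ((orthogonal_mk hy hp).1 hbl))
  · obtain ⟨hxm, hm⟩ := hm
    obtain ⟨w, hw, rfl⟩ := exists_rep m
    rw [orthogonal_mk] at hxm
    have hex : ∃ v, LinearIndependent K ![x, v] ∧ v ⬝ᵥ w = 0 := by
      obtain ⟨u, v, huv, hu, hv⟩ := exists_pair_on_line hw
      have hu0 : u ≠ 0 := huv.ne_zero 0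
      have hv0 : v ≠ 0 := huv.ne_zero 1
      by_cases h : mk K x hx = mk K u hu0
      · exact ⟨v, linearIndependent_of_ne hx hv0 (h ▸ mk_ne_of_linearIndependent hu0 hv0 huv), hv⟩
      · exact ⟨u, linearIndependent_of_ne hx hu0 h, hu⟩
    obtain ⟨v, hxv, hv⟩ := hex
    have hv0 : v ≠ 0 := hxv.ne_zero 1
    have hpol : v ⬝ᵥ quadPolar c x = 0 := by
      by_contra hpol
      -- the second intersection of the line with the conic
      have hli : LinearIndependent K ![x, (-quad c v) • x + (v ⬝ᵥ quadPolar c x) • v] := by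
        rw [LinearIndependent.pair_iff] at hxv ⊢
        intro s t hst
        obtain ⟨h1, h2⟩ := hxv (s - t * quad c v) (t * (v ⬝ᵥ quadPolar c x)) (by
          rw [← hst, smul_add, smul_smul, smul_smul, ← add_assoc, ← add_smul]
          congr 2
          ring)
        have ht : t = 0 := (mul_eq_zero.1 h2).resolve_right hpol
        rw [ht] at h1
        exact ⟨by simpa using h1, ht⟩
      have hne := hli.ne_zero 1
      refine mk_ne_of_linearIndependent hx hne hli (hm _ ((mk_mem_zeroSet hne).2 ?_) ?_).symm
      · show quad c ((-quad c v) • x + (v ⬝ᵥ quadPolar c x) • v) = 0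
        rw [quad_combination, hqx]
        ring
      · refine (orthogonal_mk hne hw).2 ?_
        show ((-quad c v) • x + (v ⬝ᵥ quadPolar c x) • v) ⬝ᵥ w = 0
        rw [add_dotProduct, smul_dotProduct, smul_dotProduct, hxm, hv]
        simp
    exact (Configuration.ofField.eq_or_eq_of_orthogonal ((orthogonal_mk hx hw).2 hxm)
      ((orthogonal_mk hv0 hw).2 hv) ((orthogonal_mk hx hp).2 hxp)
      ((orthogonal_mk hv0 hp).2 hpol)).resolve_left (mk_ne_of_linearIndependent hx hv0 hxv)

end Quadratic

section ConicsOfPlane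

open Projectivization Matrix

variable {K : Type*} [Field K]

theorem exists_eq_mul_of_containsLine {c : Fin 6 → K} (h : ContainsLine c) :
    ∃ w ≠ 0, ∃ g, ∀ v, quad c v = (v ⬝ᵥ w) * (v ⬝ᵥ g) := by
  obtain ⟨l, hl⟩ := h
  obtain ⟨w, hw, rfl⟩ := exists_rep l
  refine ⟨w, hw, exists_eq_mul_of_vanish hw fun v hv => ?_⟩
  by_cases hv0 : v = 0
  · subst hv0
    simp [quad]
  · exact (mk_mem_zeroSet hv0).1 (hl _ ((orthogonal_mk hv0 hw).2 hv))

/-- A nonzero quadratic form vanishing on a `5`-arc is not a product of linear forms. -/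
theorem not_containsLine_of_arc {c : Fin 6 → K} (hc : c ≠ 0) {T : Fin 5 → Plane K}
    (hT : ∀ (l : Plane K) i j k, i ≠ j → i ≠ k → j ≠ k → (T i).orthogonal l →
      (T j).orthogonal l → ¬ (T k).orthogonal l) (h : ∀ i, T i ∈ zeroSet c) :
    ¬ ContainsLine c := by
  classical
  intro hl
  obtain ⟨w, hw, g, hg⟩ := exists_eq_mul_of_containsLine hl
  have hg0 : g ≠ 0 := by
    rintro rfl
    exact hc (eq_zero_of_quad fun v => by rw [hg, dotProduct_zero, mul_zero])
  have key : ∀ i, (T i).orthogonal (mk K w hw) ∨ (T i).orthogonal (mk K g hg0) := by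
    intro i
    obtain ⟨v, hv, hvi⟩ := exists_rep (T i)
    have h1 := h i
    rw [hvi, mk_mem_zeroSet, hg, mul_eq_zero] at h1
    rwa [hvi, orthogonal_mk, orthogonal_mk]
  have pig : ∀ f : Fin 5 → Bool, ∃ i j k, i ≠ j ∧ i ≠ k ∧ j ≠ k ∧ f i = f j ∧ f i = f k := by
    decide +kernel
  obtain ⟨i, j, k, hij, hik, hjk, h1, h2⟩ :=
    pig fun i => decide ((T i).orthogonal (mk K w hw))
  by_cases hi : (T i).orthogonal (mk K w hw)
  · exact hT _ i j k hij hik hjk hi (by simpa [hi] using h1) (by simpa [hi] using h2)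
  · exact hT _ i j k hij hik hjk ((key i).resolve_left hi)
      ((key j).resolve_left (by simpa [hi] using h1))
      ((key k).resolve_left (by simpa [hi] using h2))

theorem quad_add_ne_zero {c : Fin 6 → K} (hc : ¬ ContainsLine c) {u v : Fin 3 → K}
    (huv : LinearIndependent K ![u, v]) (hu : quad c u = 0) (hv : quad c v = 0) :
    quad c ((1 : K) • u + (1 : K) • v) ≠ 0 := by
  intro h
  rw [quad_combination, hu, hv] at h
  exact hc (containsLine_of_polar_eq_zero huv hu hv (by linear_combination h))

/-- Two smooth conics with five common points are equal: a form of the pencil vanishes at a further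
point of a chord, hence is a product of linear forms, hence is zero. -/
theorem zeroSet_eq_of_mem {c c' : Fin 6 → K} (hc : ¬ ContainsLine c) (hc' : ¬ ContainsLine c')
    {T : Fin 5 → Plane K} (hT : Injective T) (h : ∀ i, T i ∈ zeroSet c)
    (h' : ∀ i, T i ∈ zeroSet c') : zeroSet c = zeroSet c' := by
  have hrep := fun i => exists_rep (T i)
  choose v hv hvT using hrep
  have h1 : ∀ i, quad c (v i) = 0 := fun i => by
    have := h i
    rwa [hvT, mk_mem_zeroSet] at this
  have h2 : ∀ i, quad c' (v i) = 0 := fun i => by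
    have := h' i
    rwa [hvT, mk_mem_zeroSet] at this
  have huv : LinearIndependent K ![v 0, v 1] := linearIndependent_of_ne (hv 0) (hv 1) (by
    rw [← hvT, ← hvT]
    exact hT.ne (by decide))
  have hy := quad_add_ne_zero hc huv (h1 0) (h1 1)
  have hy' := quad_add_ne_zero hc' huv (h2 0) (h2 1)
  set y := (1 : K) • v 0 + (1 : K) • v 1 with hydef
  have hb : ∀ x, quad (quad c' y • c + (-quad c y) • c') x =
      quad c' y * quad c x - quad c y * quad c' x := fun x => by
    rw [quad_add_left, quad_smul_left, quad_smul_left]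
    ring
  have hb0 : ∀ i, quad (quad c' y • c + (-quad c y) • c') (v i) = 0 := fun i => by
    rw [hb, h1, h2, mul_zero, mul_zero, sub_zero]
  obtain ⟨w, hw, hw0, hw1⟩ := exists_orthogonal (v 0) (v 1)
  have hvan : ∀ x, x ⬝ᵥ w = 0 → quad (quad c' y • c + (-quad c y) • c') x = 0 := by
    intro x hx
    obtain ⟨s, t, rfl⟩ := exists_eq_combination hw huv hw0 hw1 hx
    have h3 := hb y
    rw [mul_comm, sub_self] at h3
    nth_rewrite 3 [hydef] at h3
    rw [quad_combination, hb0, hb0] at h3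
    rw [quad_combination, hb0, hb0]
    linear_combination s * t * h3
  obtain ⟨g, hg⟩ := exists_eq_mul_of_vanish hw hvan
  have hg3 : ∀ i, i ≠ 0 → i ≠ 1 → v i ⬝ᵥ g = 0 := by
    intro i hi0 hi1
    have h3 := hg (v i)
    rw [hb0, eq_comm, mul_eq_zero] at h3
    refine h3.resolve_left fun h4 => ?_
    have o : ∀ j, v j ⬝ᵥ w = 0 → (T j).orthogonal (mk K w hw) := fun j hj => by
      rw [hvT j, orthogonal_mk]
      exact hj
    exact zeroSet_not_collinear hc (h 0) (h 1) (h i) (hT.ne (by decide)) (hT.ne hi0.symm)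
      (hT.ne hi1.symm) (o 0 hw0) (o 1 hw1) (o i h4)
  have hg0 : g = 0 := by
    by_contra hg0
    have o : ∀ j, j ≠ 0 → j ≠ 1 → (T j).orthogonal (mk K g hg0) := fun j hj hj' => by
      rw [hvT j, orthogonal_mk]
      exact hg3 j hj hj'
    exact zeroSet_not_collinear hc (h 2) (h 3) (h 4) (hT.ne (by decide)) (hT.ne (by decide))
      (hT.ne (by decide)) (o 2 (by decide) (by decide)) (o 3 (by decide) (by decide))
      (o 4 (by decide) (by decide))
  ext a
  obtain ⟨x, hx, rfl⟩ := exists_rep a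
  rw [mk_mem_zeroSet, mk_mem_zeroSet]
  have h3 := hg x
  rw [hb, hg0, dotProduct_zero, mul_zero, sub_eq_zero] at h3
  constructor
  · intro h4
    rw [h4, mul_zero, eq_comm, mul_eq_zero] at h3
    exact h3.resolve_left hy
  · intro h4
    rw [h4, mul_zero, mul_eq_zero] at h3
    exact h3.resolve_left hy'

/-- Five points lie on a conic. -/
theorem exists_mem_zeroSet (T : Fin 5 → Plane K) : ∃ c : Fin 6 → K, c ≠ 0 ∧ ∀ i, T i ∈ zeroSet c := by
  let r : (Fin 3 → K) → Fin 6 → K := fun v =>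
    ![v 0 ^ 2, v 1 ^ 2, v 2 ^ 2, v 0 * v 1, v 0 * v 2, v 1 * v 2]
  let f : Fin 6 → Fin 5 := ![0, 1, 2, 3, 4, 4]
  have h : (Matrix.of fun i => r (T (f i)).rep).det = 0 :=
    det_zero_of_row_eq (i := 4) (j := 5) (by decide) rfl
  obtain ⟨c, hc, h⟩ := exists_mulVec_eq_zero_iff.2 h
  refine ⟨c, hc, fun i => ?_⟩
  have hf : ∀ i, ∃ j, f j = i := by decide
  obtain ⟨j, rfl⟩ := hf i
  have h1 := congrFun h j
  show quad c _ = 0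
  rw [← show (0 : Fin 6 → K) j = 0 from rfl, ← h1]
  show _ = r (T (f j)).rep ⬝ᵥ c
  simp only [quad, r, dotProduct, Fin.sum_univ_six, Matrix.cons_val]
  ring

variable (F : Type*) [Field F] [Fintype F] [Algebra F K]

theorem quad_frobeniusVec (c : Fin 6 → K) (v : Fin 3 → K) :
    quad (fun i => frobHom F 1 (c i)) (frobeniusVec F v) = frobHom F 1 (quad c v) := by
  have h : ∀ i, frobeniusVec F v i = frobHom F 1 (v i) := fun i => by
    rw [frobHom_apply, pow_one]; rfl
  simp only [quad, h, map_add, map_mul, map_pow]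

theorem frobenius_surjective [IsAlgClosed K] : Surjective (frobenius F (K := K)) := by
  intro b
  obtain ⟨w, hw, rfl⟩ := exists_rep b
  have h := fun i => IsAlgClosed.exists_pow_nat_eq (w i) (Fintype.card_pos (α := F))
  choose v hv using h
  have hv0 : v ≠ 0 := by
    rintro rfl
    refine hw (funext fun i => ?_)
    rw [← hv i, Pi.zero_apply, zero_pow Fintype.card_ne_zero]
  refine ⟨mk K v hv0, ?_⟩
  rw [frobenius_mk]
  congr 1
  exact funext hv

theorem frobenius_mem_zeroSet {c : Fin 6 → K} {a : Plane K} :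
    frobenius F a ∈ zeroSet (fun i => frobHom F 1 (c i)) ↔ a ∈ zeroSet c := by
  obtain ⟨v, hv, rfl⟩ := exists_rep a
  rw [frobenius_mk, mk_mem_zeroSet, mk_mem_zeroSet, quad_frobeniusVec, map_eq_zero]

variable (K) in
/-- The smooth conics of the plane. -/
noncomputable def planeConics [IsAlgClosed K] (hodd : Odd (Fintype.card F)) :
    ConicSystem (projectivePlane F K hodd) where
  conics := {C | ∃ c : Fin 6 → K, C = zeroSet c ∧ ¬ ContainsLine c}
  frob_image := by
    rintro _ ⟨c, rfl, hc⟩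
    refine ⟨fun i => frobHom F 1 (c i), ?_, fun ⟨l, hl⟩ => ?_⟩
    · ext b
      obtain ⟨a, rfl⟩ := frobenius_surjective F b
      rw [frobenius_mem_zeroSet]
      exact (frobenius_injective F).mem_set_image
    · obtain ⟨l, rfl⟩ := frobenius_surjective F l
      exact hc ⟨l, fun a ha => (frobenius_mem_zeroSet F).1 (hl _ ((orthogonal_frobenius F).2 ha))⟩
  exists_of_arc := fun T hT => by
    obtain ⟨c, hc, h⟩ := exists_mem_zeroSet T
    exact ⟨_, ⟨c, rfl, not_containsLine_of_arc hc hT.2 h⟩, h⟩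
  eq_of_mem := by
    rintro _ ⟨c, rfl, hc⟩ _ ⟨c', rfl, hc'⟩ T hT h h'
    exact zeroSet_eq_of_mem hc hc' hT h h'
  not_collinear := by
    rintro _ ⟨c, rfl, hc⟩ a ha b hb d hd hab had hbd l hal hbl
    exact zeroSet_not_collinear hc ha hb hd hab had hbd hal hbl
  exists_inc := by
    rintro _ ⟨c, rfl, hc⟩ l
    exact exists_mem_zeroSet_orthogonal c l
  tangent := by
    rintro _ ⟨c, rfl, hc⟩ a ha
    exact zeroSet_tangent hc ha

end ConicsOfPlane

/-! ### General position in terms of lines and smooth conics -/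

section GeneralPosition

open Projectivization Matrix MvPolynomial

variable {K : Type*} [Field K]

theorem passesThrough_mk {f : MvPolynomial (Fin 3) K} {d : ℕ} (hf : f.IsHomogeneous d)
    {v : Fin 3 → K} (hv : v ≠ 0) : PassesThrough f (mk K v hv) ↔ eval v f = 0 := by
  unfold PassesThrough
  rw [submodule_mk]
  refine ⟨fun h => h v (Submodule.mem_span_singleton_self v), fun h w hw => ?_⟩
  obtain ⟨t, rfl⟩ := Submodule.mem_span_singleton.1 hw
  have h1 : eval (t • v) f = t ^ d * eval v f := by
    rw [eval_eq', eval_eq', mul_sum]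
    refine sum_congr rfl fun m hm => ?_
    have h2 := hf (mem_support_iff.1 hm)
    rw [Finsupp.weight_apply, Finsupp.sum_fintype _ _ (by simp)] at h2
    simp only [Pi.one_apply, smul_eq_mul, mul_one, Fin.sum_univ_three] at h2
    rw [← h2]
    simp only [Fin.prod_univ_three, Pi.smul_apply, smul_eq_mul]
    ring
  rw [h1, h, mul_zero]

theorem eval_eq_of_exponents {f : MvPolynomial (Fin 3) K} {d n : ℕ} (hf : f.IsHomogeneous d)
    (e : Fin n → Fin 3 → ℕ) (he : Injective e)
    (h : ∀ a b c : ℕ, a + b + c = d → ∃ j, e j = ![a, b, c]) (v : Fin 3 → K) :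
    eval v f = ∑ j, coeff (Finsupp.equivFunOnFinite.symm (e j)) f * ∏ i, v i ^ e j i := by
  classical
  rw [eval_eq']
  refine Eq.trans ?_ (sum_map univ
    ⟨fun j => Finsupp.equivFunOnFinite.symm (e j), Finsupp.equivFunOnFinite.symm.injective.comp he⟩
    fun m => coeff m f * ∏ i, v i ^ m i)
  refine sum_subset (fun m hm => ?_) fun m _ hm => ?_
  · have h2 := hf (mem_support_iff.1 hm)
    rw [Finsupp.weight_apply, Finsupp.sum_fintype _ _ (by simp)] at h2
    simp only [Pi.one_apply, smul_eq_mul, mul_one, Fin.sum_univ_three] at h2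
    obtain ⟨j, hj⟩ := h _ _ _ h2
    refine mem_map.2 ⟨j, mem_univ _, ?_⟩
    show Finsupp.equivFunOnFinite.symm (e j) = m
    rw [Equiv.symm_apply_eq, hj]
    funext i
    fin_cases i <;> rfl
  · rw [notMem_support_iff.1 hm, zero_mul]

theorem lieOnCurve_one_iff [Infinite K] {T : Septuple K} {S : Finset (Fin 7)} :
    LieOnCurve 1 T S ↔ ∃ l : Plane K, ∀ i ∈ S, (T i).orthogonal l := by
  constructor
  · rintro ⟨f, hf, hd, h⟩
    have key := eval_eq_of_exponents hd (![![1, 0, 0], ![0, 1, 0], ![0, 0, 1]] : Fin 3 → Fin 3 → ℕ)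
      (by decide) (by
        intro a b c habc
        have : (a = 1 ∧ b = 0 ∧ c = 0) ∨ (a = 0 ∧ b = 1 ∧ c = 0) ∨ (a = 0 ∧ b = 0 ∧ c = 1) := by
          omega
        rcases this with ⟨rfl, rfl, rfl⟩ | ⟨rfl, rfl, rfl⟩ | ⟨rfl, rfl, rfl⟩
        exacts [⟨0, rfl⟩, ⟨1, rfl⟩, ⟨2, rfl⟩])
    set w : Fin 3 → K := fun j => coeff (Finsupp.equivFunOnFinite.symm
      ((![![1, 0, 0], ![0, 1, 0], ![0, 0, 1]] : Fin 3 → Fin 3 → ℕ) j)) f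
    have key' : ∀ v, eval v f = v ⬝ᵥ w := fun v => by
      rw [key]
      simp [Fin.sum_univ_three, Fin.prod_univ_three, dotProduct, w, mul_comm]
    have hw : w ≠ 0 := fun h0 => hf (MvPolynomial.funext fun v => by
      rw [key', h0, dotProduct_zero, map_zero])
    refine ⟨mk K w hw, fun i hi => ?_⟩
    obtain ⟨v, hv, hvi⟩ := exists_rep (T i)
    have := h i hi
    rw [hvi, passesThrough_mk hd] at this
    rw [hvi, orthogonal_mk, ← key', this]
  · rintro ⟨l, hl⟩
    obtain ⟨w, hw, rfl⟩ := exists_rep l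
    have hd : (∑ j, C (w j) * X j : MvPolynomial (Fin 3) K).IsHomogeneous 1 :=
      IsHomogeneous.sum _ _ _ fun j _ => by
        simpa using (isHomogeneous_C (Fin 3) (w j)).mul (isHomogeneous_X K j)
    have hev : ∀ v, eval v (∑ j, C (w j) * X j : MvPolynomial (Fin 3) K) = v ⬝ᵥ w := fun v => by
      simp [dotProduct, mul_comm]
    refine ⟨_, fun h0 => hw (funext fun j => ?_), hd, fun i hi => ?_⟩
    · have := hev (Pi.single j 1)
      rw [h0, map_zero, single_one_dotProduct] at this
      exact this.symm
    · obtain ⟨v, hv, hvi⟩ := exists_rep (T i)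
      have := hl i hi
      rw [hvi, orthogonal_mk] at this
      rw [hvi, passesThrough_mk hd, hev, this]

/-- Forms of degree two are quadratic forms with six coefficients. -/
theorem lieOnCurve_two_iff [Infinite K] {T : Septuple K} {S : Finset (Fin 7)} :
    LieOnCurve 2 T S ↔ ∃ c : Fin 6 → K, c ≠ 0 ∧ ∀ i ∈ S, T i ∈ zeroSet c := by
  constructor
  · rintro ⟨f, hf, hd, h⟩
    have key := eval_eq_of_exponents hd (![![2, 0, 0], ![0, 2, 0], ![0, 0, 2], ![1, 1, 0],
      ![1, 0, 1], ![0, 1, 1]] : Fin 6 → Fin 3 → ℕ) (by decide) (by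
        intro a b c habc
        have : (a = 2 ∧ b = 0 ∧ c = 0) ∨ (a = 0 ∧ b = 2 ∧ c = 0) ∨ (a = 0 ∧ b = 0 ∧ c = 2) ∨
            (a = 1 ∧ b = 1 ∧ c = 0) ∨ (a = 1 ∧ b = 0 ∧ c = 1) ∨ (a = 0 ∧ b = 1 ∧ c = 1) := by
          omega
        rcases this with ⟨rfl, rfl, rfl⟩ | ⟨rfl, rfl, rfl⟩ | ⟨rfl, rfl, rfl⟩ | ⟨rfl, rfl, rfl⟩ |
          ⟨rfl, rfl, rfl⟩ | ⟨rfl, rfl, rfl⟩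
        exacts [⟨0, rfl⟩, ⟨1, rfl⟩, ⟨2, rfl⟩, ⟨3, rfl⟩, ⟨4, rfl⟩, ⟨5, rfl⟩])
    set c : Fin 6 → K := fun j => coeff (Finsupp.equivFunOnFinite.symm
      ((![![2, 0, 0], ![0, 2, 0], ![0, 0, 2], ![1, 1, 0], ![1, 0, 1], ![0, 1, 1]] :
        Fin 6 → Fin 3 → ℕ) j)) f
    have key' : ∀ v, eval v f = quad c v := fun v => by
      rw [key]
      simp [Fin.sum_univ_six, Fin.prod_univ_three, quad, c]
    have hc : c ≠ 0 := fun h0 => hf (MvPolynomial.funext fun v => by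
      rw [key', h0, map_zero]
      simp [quad])
    refine ⟨c, hc, fun i hi => ?_⟩
    obtain ⟨v, hv, hvi⟩ := exists_rep (T i)
    have := h i hi
    rw [hvi, passesThrough_mk hd] at this
    rw [hvi, mk_mem_zeroSet, ← key', this]
  · rintro ⟨c, hc, h⟩
    have hX : ∀ (a : K) (i j : Fin 3),
        (C a * (X i * X j) : MvPolynomial (Fin 3) K).IsHomogeneous 2 := fun a i j => by
      simpa using (isHomogeneous_C (Fin 3) a).mul ((isHomogeneous_X K i).mul (isHomogeneous_X K j))
    have hd := (((((hX (c 0) 0 0).add (hX (c 1) 1 1)).add (hX (c 2) 2 2)).add (hX (c 3) 0 1)).add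
      (hX (c 4) 0 2)).add (hX (c 5) 1 2)
    have hev : ∀ v, eval v (C (c 0) * (X 0 * X 0) + C (c 1) * (X 1 * X 1) + C (c 2) * (X 2 * X 2) +
        C (c 3) * (X 0 * X 1) + C (c 4) * (X 0 * X 2) + C (c 5) * (X 1 * X 2) :
          MvPolynomial (Fin 3) K) = quad c v := fun v => by
      simp [quad, pow_two]
    refine ⟨_, fun h0 => hc (eq_zero_of_quad fun v => ?_), hd, fun i hi => ?_⟩
    · rw [← hev, h0, map_zero]
    · obtain ⟨v, hv, hvi⟩ := exists_rep (T i)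
      have := h i hi
      rw [hvi, mk_mem_zeroSet] at this
      rw [hvi, passesThrough_mk hd, hev, this]

variable (F : Type*) [Field F] [Fintype F] [Algebra F K]

theorem frobeniusPerm_eq_iff (σ : Perm (Fin 7)) {T : Septuple K} :
    frobeniusPerm F σ T = T ↔ T ∈ Twisted (frobenius F) σ⁻¹ := by
  constructor
  · intro h i
    have := congrFun h (σ⁻¹ i)
    rw [← this]
    simp [frobeniusPerm]
  · intro h
    funext i
    have := h (σ i)
    simpa [frobeniusPerm] using this

variable [IsAlgClosed K]

/-- The degenerate conics need not be considered: they do not contain five points of an arc. -/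
theorem inGeneralPosition_iff (hodd : Odd (Fintype.card F)) {T : Septuple K} :
    InGeneralPosition T ↔ (projectivePlane F K hodd).Arc T ∧
      ∀ k, ¬ (planeConics K F hodd).OnConicExcept T k := by
  classical
  have : Infinite K := IsAlgClosed.instInfinite
  have hline : (∀ S : Finset (Fin 7), S.card = 3 → ¬ LieOnCurve 1 T S) ↔
      (projectivePlane F K hodd).Arc T := by
    simp only [lieOnCurve_one_iff]
    constructor
    · intro h
      have h3 : ∀ (l : Plane K) i j k, i ≠ j → i ≠ k → j ≠ k → (T i).orthogonal l →
          (T j).orthogonal l → ¬ (T k).orthogonal l := by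
        intro l i j k hij hik hjk hi hj hk
        refine h {i, j, k} (card_eq_three.2 ⟨i, j, k, hij, hik, hjk, rfl⟩) ⟨l, ?_⟩
        simp [hi, hj, hk]
      refine ⟨fun i j hij => ?_, h3⟩
      by_contra hne
      -- If two of the points coincide, then the line joining them to a further point contains three points.
      have hk : ∀ i j : Fin 7, ∃ k, i ≠ k ∧ j ≠ k := by decide
      obtain ⟨k, hik, hjk⟩ := hk i j
      obtain ⟨u, hu, hui⟩ := exists_rep (T i)
      obtain ⟨v, hv, hvk⟩ := exists_rep (T k)
      obtain ⟨w, hw, h1, h2⟩ := exists_orthogonal u v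
      have hi : (T i).orthogonal (mk K w hw) := by rw [hui, orthogonal_mk]; exact h1
      exact h3 (mk K w hw) i j k hne hik hjk hi (hij ▸ hi) (by rw [hvk, orthogonal_mk]; exact h2)
    · rintro ⟨-, h⟩ S hS ⟨l, hl⟩
      obtain ⟨i, j, k, hij, hik, hjk, rfl⟩ := card_eq_three.1 hS
      exact h l i j k hij hik hjk (hl i (by simp)) (hl j (by simp)) (hl k (by simp))
  unfold InGeneralPosition
  rw [hline]
  refine and_congr_right fun harc => ?_
  simp only [lieOnCurve_two_iff]
  constructor
  · rintro h k ⟨_, ⟨c, rfl, hc⟩, hT⟩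
    refine h (univ.erase k) (by simp) ⟨c, ?_, fun i hi => hT i (ne_of_mem_erase hi)⟩
    rintro rfl
    exact hc ⟨T 0, fun a _ => by simp [zeroSet, quad]⟩
  · rintro h S hS ⟨c, hc, hT⟩
    have hcompl : Sᶜ.card = 1 := by rw [card_compl, hS]; rfl
    obtain ⟨k, hk⟩ := card_eq_one.1 hcompl
    have hmem : ∀ i, i ≠ k → i ∈ S := fun i hi => by
      by_contra h
      have := mem_compl.2 h
      rw [hk, mem_singleton] at this
      exact hi this
    -- Five of the six points on the conic form an arc, so the conic is smooth.
    have hex : ∀ k : Fin 7, ∃ f : Fin 5 → Fin 7, Injective f ∧ ∀ i, f i ≠ k := by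
      intro k
      refine ⟨fun i => k.succAbove (Fin.castSucc i), fun a b hab => ?_, fun i => k.succAbove_ne _⟩
      exact Fin.castSucc_injective _ (k.succAbove_right_injective hab)
    obtain ⟨f, hf, hfk⟩ := hex k
    refine h k ⟨_, ⟨c, rfl, ?_⟩, fun i hi => hT i (hmem i hi)⟩
    exact not_containsLine_of_arc hc (T := T ∘ f) (fun l i j m hij him hjm =>
      harc.2 l _ _ _ (hf.ne hij) (hf.ne him) (hf.ne hjm)) fun i => hT _ (hmem _ (hfk i))

/-- The inverse appears since `T` is fixed by `F ∘ σ` if and only if Frobenius maps `T i` to `T (σ⁻¹ i)`. -/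
theorem fixedSeptuples_eq (hodd : Odd (Fintype.card F)) (σ : Perm (Fin 7)) :
    fixedSeptuples F K σ = {T ∈ Twisted (projectivePlane F K hodd).frob σ⁻¹ |
      (projectivePlane F K hodd).Arc T ∧ ∀ k, ¬ (planeConics K F hodd).OnConicExcept T k} := by
  ext T
  show InGeneralPosition T ∧ frobeniusPerm F σ T = T ↔ _
  rw [inGeneralPosition_iff F hodd, frobeniusPerm_eq_iff, and_comm]
  rfl

theorem ncard_fixedSeptuples (hodd : Odd (Fintype.card F)) (σ : Perm (Fin 7)) :
    ((fixedSeptuples F K σ).ncard : ℤ) = (planeConics K F hodd).goodCount σ⁻¹ := by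
  rw [fixedSeptuples_eq F hodd]
  rfl

theorem finite_fixedSeptuples (hodd : Odd (Fintype.card F)) (σ : Perm (Fin 7)) :
    (fixedSeptuples F K σ).Finite := by
  rw [fixedSeptuples_eq F hodd]
  exact (Twisted.finite (projectivePlane F K hodd).finite_points _).subset fun T hT => hT.1

end GeneralPosition

/-! ### Sextuples of scalars with nonvanishing transversal sums -/

section Transverse

variable {K : Type*} [Field K]

/-- The block of an index, for the partition `{0, 1}, {2, 3}, {4, 5}` of the indices. -/
def block : Fin 6 → Fin 3 := ![0, 0, 1, 1, 2, 2]

/-- The entries of a block are distinct, and the sum of three entries from the three blocks does not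
vanish. -/
def IsTransverse (u : Fin 6 → K) : Prop :=
  (∀ i j, i ≠ j → block i = block j → u i ≠ u j) ∧
    ∀ i j k, block i = 0 → block j = 1 → block k = 2 → u i + u j + u k ≠ 0

theorem isTransverse_iff {u : Fin 6 → K} : IsTransverse u ↔ (u 0 ≠ u 1 ∧ u 2 ≠ u 3 ∧ u 4 ≠ u 5) ∧
    (u 0 + u 2 + u 4 ≠ 0 ∧ u 0 + u 3 + u 4 ≠ 0 ∧ u 1 + u 2 + u 4 ≠ 0 ∧ u 1 + u 3 + u 4 ≠ 0) ∧
    (u 0 + u 2 + u 5 ≠ 0 ∧ u 0 + u 3 + u 5 ≠ 0 ∧ u 1 + u 2 + u 5 ≠ 0 ∧ u 1 + u 3 + u 5 ≠ 0) := by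
  simp only [IsTransverse, Fin.forall_fin_succ, block]
  simp
  tauto

/-- The sextuple with differences `α + β` and `α - β` in the first two blocks and with centred third
block `x`, `y`: the sums of an entry of the
first block and an entry of the second one are `u₀ + u₂ + α` plus one of `±α`, `±β`. -/
def sextupleOf (u₀ u₂ α β x y : K) : Fin 6 → K :=
  ![u₀, u₀ + α + β, u₂, u₂ + α - β, x - (u₀ + u₂ + α), y - (u₀ + u₂ + α)]

theorem sum_sextupleOf (u₀ u₂ α β x y : K) : ∑ j, sextupleOf u₀ u₂ α β x y j = x + y := by
  simp [sextupleOf, Fin.sum_univ_six]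
  ring

/-- The four sums of an entry of the first and an entry of the second block differ from `u₀ + u₂ + α` by
`α`, `-α`, `β` and `-β`, up to order. -/
theorem isTransverse_sextupleOf (u₀ u₂ α β x y : K) : IsTransverse (sextupleOf u₀ u₂ α β x y) ↔
    (α + β ≠ 0 ∧ α - β ≠ 0) ∧ x ≠ y ∧ x ∉ ({α, -α, β, -β} : Set K) ∧
      y ∉ ({α, -α, β, -β} : Set K) := by
  rw [isTransverse_iff]
  simp only [sextupleOf, Matrix.cons_val, Set.mem_insert_iff, Set.mem_singleton_iff]
  have e1 : u₀ = u₀ + α + β ↔ α + β = 0 := by grind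
  have e2 : u₂ = u₂ + α - β ↔ α - β = 0 := by grind
  have e3 : ∀ x, u₀ + u₂ + (x - (u₀ + u₂ + α)) = 0 ↔ x = α := by grind
  have e4 : ∀ x, u₀ + (u₂ + α - β) + (x - (u₀ + u₂ + α)) = 0 ↔ x = β := by grind
  have e5 : ∀ x, u₀ + α + β + u₂ + (x - (u₀ + u₂ + α)) = 0 ↔ x = -β := by grind
  have e6 : ∀ x, u₀ + α + β + (u₂ + α - β) + (x - (u₀ + u₂ + α)) = 0 ↔ x = -α := by grind
  have e7 : x - (u₀ + u₂ + α) = y - (u₀ + u₂ + α) ↔ x = y := by grind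
  simp only [ne_eq, e1, e2, e3, e4, e5, e6, e7]
  tauto

theorem exists_eq_sextupleOf (h2 : (2 : K) ≠ 0) (u : Fin 6 → K) :
    ∃ u₀ u₂ α β x y, u = sextupleOf u₀ u₂ α β x y := by
  refine ⟨u 0, u 2, (u 1 + u 3 - u 0 - u 2) / 2, (u 1 - u 0 - u 3 + u 2) / 2,
    u 4 + (u 0 + u 1 + u 2 + u 3) / 2, u 5 + (u 0 + u 1 + u 2 + u 3) / 2, ?_⟩
  funext j
  fin_cases j <;> simp [sextupleOf] <;> field_simp <;> ring

theorem sextupleOf_injective (h2 : (2 : K) ≠ 0) {u₀ u₂ α β x y u₀' u₂' α' β' x' y' : K}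
    (h : sextupleOf u₀ u₂ α β x y = sextupleOf u₀' u₂' α' β' x' y') :
    (u₀ = u₀' ∧ u₂ = u₂') ∧ (α = α' ∧ β = β') ∧ x = x' ∧ y = y' := by
  have h0 := congrFun h 0
  have h1 := congrFun h 1
  have h3 := congrFun h 2
  have h4 := congrFun h 3
  have h5 := congrFun h 4
  have h6 := congrFun h 5
  simp only [sextupleOf, Matrix.cons_val] at h0 h1 h3 h4 h5 h6
  grind

end Transverse

section Counting

theorem ncard_prod_eq {K : Type*} {s t : Set K} {m n : ℕ} (hs : s.ncard = m) (ht : t.ncard = n) :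
    {z : K × K | z.1 ∈ s ∧ z.2 ∈ t}.ncard = m * n := by
  rw [← hs, ← ht, ← Set.ncard_prod]
  rfl


variable (F : Type*) {K : Type*} [Field F] [Fintype F] [Field K] [Algebra F K]

local notation "φ" => frobHom F 1

/-- The number of transverse sextuples permuted by Frobenius according to `ρ` whose sum satisfies
`p`. -/
noncomputable def transverseCount (ρ : Perm (Fin 6)) (p : K → Prop) : ℤ :=
  {u ∈ Twisted (φ : K → K) ρ | IsTransverse u ∧ p (∑ j, u j)}.ncard

theorem frobHom_one_iterate (d : ℕ) (z : K) : φ^[d] z = frobHom F d z := by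
  induction d with
  | zero => simp [frobHom]
  | succ d ih => rw [iterate_succ_apply', ih, frobHom_apply, frobHom_apply, frobHom_apply,
      ← pow_mul, pow_one, pow_succ]

variable [IsAlgClosed K]

theorem finite_frobHom_fixed (d : ℕ) (hd : 0 < d) : {z : K | φ^[d] z = z}.Finite := by
  simp only [frobHom_one_iterate]
  refine Set.finite_of_ncard_pos ?_
  rw [ncard_frobHom_fixed F d hd]
  exact pow_pos Fintype.card_pos d

theorem ncard_frobHom_eq (d : ℕ) (hd : 0 < d) (a : ℕ → K) (ha : a 0 ≠ 0) (c : K) :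
    {z : K | φ^[d] z + ∑ i ∈ range d, a i * φ^[i] z = c}.ncard =
      Fintype.card F ^ d := by
  simp only [frobHom_one_iterate, frobHom_apply]
  exact ncard_additive_eq F d hd a ha c

theorem ncard_frobHom_add (a : K) (ha : a ≠ 0) (c : K) :
    {z : K | φ z + a * z = c}.ncard = Fintype.card F := by
  have := ncard_frobHom_eq F (K := K) 1 one_pos (fun _ => a) ha c
  simpa using this

theorem ncard_frobHom_eq_add (c : K) : {z : K | φ z = z + c}.ncard = Fintype.card F := by
  rw [← ncard_frobHom_add F (-1 : K) (by simp) c]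
  congr 1
  ext z
  simp only [Set.mem_ofPred_eq]
  grind

theorem ncard_frobHom_eq_neg : {z : K | φ z = -z}.ncard = Fintype.card F := by
  rw [← ncard_frobHom_add F (1 : K) (by simp) 0]
  congr 1
  ext z
  simp only [Set.mem_ofPred_eq]
  grind

theorem ncard_frobHom_frobHom_eq (a : K) (ha : a ≠ 0) (c : K) :
    {z : K | φ (φ z) = a * z + c}.ncard = Fintype.card F ^ 2 := by
  rw [← ncard_frobHom_eq F (K := K) 2 two_pos (fun i => if i = 0 then -a else 0) (by simpa) c]
  congr 1
  ext z
  simp only [Set.mem_ofPred_eq, sum_range_succ, sum_range_zero]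
  simp
  grind

open Classical in
/-- The count of transverse sextuples in terms of the parameters `α`, `β` and the centred third
block `x`, `y`. -/
theorem transverseCount_eq (h2 : (2 : K) ≠ 0) (ρ : Perm (Fin 6)) (p : K → Prop)
    (Z : K → K → K × K → Prop) (M E : K → K → Prop)
    (h : ∀ u₀ u₂ α β x y, sextupleOf u₀ u₂ α β x y ∈ Twisted (φ : K → K) ρ ↔
      Z α β (u₀, u₂) ∧ M α β ∧ E x y)
    (hZ : ∀ α β, M α β → {z | Z α β z}.ncard = Fintype.card F ^ 2)
    (hM : ∀ α β, M α β → φ^[4] α = α ∧ φ^[4] β = β)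
    {n₀ n₁ n₂ k₀ k₁ k₂ : ℤ}
    (hn₀ : {z : K × K | M z.1 z.2 ∧ (z.1 + z.2 ≠ 0 ∧ z.1 - z.2 ≠ 0) ∧ z.1 = 0}.ncard = n₀)
    (hn₁ : {z : K × K | M z.1 z.2 ∧ (z.1 + z.2 ≠ 0 ∧ z.1 - z.2 ≠ 0) ∧ z.1 ≠ 0 ∧ z.2 = 0}.ncard = n₁)
    (hn₂ : {z : K × K | M z.1 z.2 ∧ (z.1 + z.2 ≠ 0 ∧ z.1 - z.2 ≠ 0) ∧ z.1 ≠ 0 ∧ z.2 ≠ 0}.ncard = n₂)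
    (hk : ∀ α β, M α β → α + β ≠ 0 → α - β ≠ 0 → ({z : K × K | E z.1 z.2 ∧ z.1 ≠ z.2 ∧
      (z.1 ∉ ({α, -α, β, -β} : Set K) ∧ z.2 ∉ ({α, -α, β, -β} : Set K)) ∧
        p (z.1 + z.2)}.ncard : ℤ) = if α = 0 then k₀ else if β = 0 then k₁ else k₂) :
    transverseCount F ρ p = (Fintype.card F : ℤ) ^ 2 * (n₀ * k₀ + n₁ * k₁ + n₂ * k₂) := by
  set U := {u ∈ Twisted (φ : K → K) ρ | IsTransverse u ∧ p (∑ j, u j)} with hU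
  set R := {z : (K × K) × K × K | (M z.1.1 z.1.2 ∧ z.1.1 + z.1.2 ≠ 0 ∧ z.1.1 - z.1.2 ≠ 0) ∧
    E z.2.1 z.2.2 ∧ z.2.1 ≠ z.2.2 ∧ (z.2.1 ∉ ({z.1.1, -z.1.1, z.1.2, -z.1.2} : Set K) ∧
      z.2.2 ∉ ({z.1.1, -z.1.1, z.1.2, -z.1.2} : Set K)) ∧ p (z.2.1 + z.2.2)} with hR
  have hUfin : U.Finite := (Twisted.finite (finite_frobHom_fixed F) _).subset fun u hu => hu.1
  have hmem : ∀ u₀ u₂ α β x y, sextupleOf u₀ u₂ α β x y ∈ U ↔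
      Z α β (u₀, u₂) ∧ ((α, β), x, y) ∈ R := by
    intro u₀ u₂ α β x y
    simp only [hU, hR, Set.mem_ofPred_eq]
    rw [h, isTransverse_sextupleOf, sum_sextupleOf]
    tauto
  have hex : ∃ g : (Fin 6 → K) → (K × K) × K × K,
      ∀ u₀ u₂ α β x y, g (sextupleOf u₀ u₂ α β x y) = ((α, β), x, y) := by
    have h1 := exists_eq_sextupleOf h2 (K := K)
    choose a b c d e f hu using h1
    refine ⟨fun u => ((c u, d u), e u, f u), fun u₀ u₂ α β x y => ?_⟩
    obtain ⟨-, ⟨h3, h4⟩, h5, h6⟩ := sextupleOf_injective h2 (hu (sextupleOf u₀ u₂ α β x y))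
    simp only [← h3, ← h4, ← h5, ← h6]
  obtain ⟨g, hg⟩ := hex
  have hfib : ∀ r ∈ R, {u ∈ U | g u = r}.ncard = Fintype.card F ^ 2 := by
    rintro ⟨⟨α, β⟩, x, y⟩ hr
    rw [← hZ α β hr.1.1]
    symm
    refine Set.ncard_congr (fun z _ => sextupleOf z.1 z.2 α β x y) ?_ ?_ ?_
    · rintro ⟨u₀, u₂⟩ hz
      exact ⟨(hmem _ _ _ _ _ _).2 ⟨hz, hr⟩, hg _ _ _ _ _ _⟩
    · rintro ⟨a, b⟩ ⟨c, d⟩ _ _ h3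
      obtain ⟨⟨h4, h5⟩, -⟩ := sextupleOf_injective h2 h3
      exact Prod.ext h4 h5
    · rintro u ⟨hu, hgu⟩
      obtain ⟨a, b, c, d, e, f, rfl⟩ := exists_eq_sextupleOf h2 u
      rw [hg] at hgu
      obtain ⟨⟨rfl, rfl⟩, rfl, rfl⟩ : (c = α ∧ d = β) ∧ e = x ∧ f = y := by simpa using hgu
      exact ⟨(a, b), ((hmem _ _ _ _ _ _).1 hu).1, rfl⟩
  have hmaps : ∀ u ∈ U, g u ∈ R := by
    intro u hu
    obtain ⟨a, b, c, d, e, f, rfl⟩ := exists_eq_sextupleOf h2 u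
    rw [hg]
    exact ((hmem _ _ _ _ _ _).1 hu).2
  have hRfin : R.Finite := by
    refine (hUfin.image g).subset fun r hr => ?_
    have h3 : {u ∈ U | g u = r}.ncard ≠ 0 := by
      rw [hfib r hr]
      exact pow_ne_zero _ Fintype.card_ne_zero
    obtain ⟨u, hu, hgu⟩ := Set.nonempty_of_ncard_ne_zero h3
    exact ⟨u, hu, hgu⟩
  have h1 := ncard_eq_mul_of_fiber hUfin hRfin g hmaps (k := (Fintype.card F : ℤ) ^ 2)
    fun r hr => by rw [hfib r hr]; push_cast; rfl
  have hcl : ∀ (c : K → K → Prop) (k : ℤ), (∀ α β, c α β → M α β → α + β ≠ 0 → α - β ≠ 0 →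
      (if α = 0 then k₀ else if β = 0 then k₁ else k₂) = k) →
      ({z | z ∈ R ∧ c z.1.1 z.1.2}.ncard : ℤ) =
        {z : K × K | M z.1 z.2 ∧ (z.1 + z.2 ≠ 0 ∧ z.1 - z.2 ≠ 0) ∧ c z.1 z.2}.ncard * k := by
    intro c k hck
    refine ncard_eq_mul_of_fiber (hRfin.subset fun z hz => hz.1) ?_ Prod.fst ?_ ?_
    · refine (((finite_frobHom_fixed F (K := K) 4 (by norm_num)).prod
        (finite_frobHom_fixed F (K := K) 4 (by norm_num)))).subset ?_
      rintro ⟨α, β⟩ ⟨h3, -⟩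
      exact hM α β h3
    · rintro z ⟨hz, hc⟩
      exact ⟨hz.1.1, hz.1.2, hc⟩
    · rintro ⟨α, β⟩ ⟨h3, h4, h5⟩
      rw [← hck α β h5 h3 h4.1 h4.2, ← hk α β h3 h4.1 h4.2, Nat.cast_inj]
      refine Set.ncard_congr (fun z _ => z.2) ?_ ?_ ?_
      · rintro ⟨⟨a, b⟩, z⟩ ⟨⟨hz, -⟩, h6⟩
        obtain ⟨rfl, rfl⟩ : a = α ∧ b = β := by simpa using h6
        exact hz.2
      · rintro ⟨a, b⟩ ⟨c, d⟩ ⟨-, h6⟩ ⟨-, h7⟩ h8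
        exact Prod.ext (h6.trans h7.symm) h8
      · intro z hz
        exact ⟨((α, β), z), ⟨⟨⟨⟨h3, h4⟩, hz⟩, h5⟩, rfl⟩, rfl⟩
  have h3 := ncard_add_ncard_not hRfin fun z => z.1.1 = 0
  have h4 := ncard_add_ncard_not (hRfin.subset fun z (hz : z ∈ {z ∈ R | ¬ z.1.1 = 0}) => hz.1)
    fun z => z.1.2 = 0
  have h5 := hcl (fun α _ => α = 0) k₀ fun α β h _ _ _ => if_pos h
  have h6 := hcl (fun α β => α ≠ 0 ∧ β = 0) k₁ fun α β h _ _ _ => by rw [if_neg h.1, if_pos h.2]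
  have h7 := hcl (fun α β => α ≠ 0 ∧ β ≠ 0) k₂ fun α β h _ _ _ => by rw [if_neg h.1, if_neg h.2]
  rw [hn₀] at h5
  rw [hn₁] at h6
  rw [hn₂] at h7
  have h8 : {z | z ∈ {z ∈ R | ¬ z.1.1 = 0} ∧ z.1.2 = 0} = {z | z ∈ R ∧ z.1.1 ≠ 0 ∧ z.1.2 = 0} := by
    ext z
    exact and_assoc
  have h9 : {z | z ∈ {z ∈ R | ¬ z.1.1 = 0} ∧ ¬ z.1.2 = 0} =
      {z | z ∈ R ∧ z.1.1 ≠ 0 ∧ z.1.2 ≠ 0} := by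
    ext z
    exact and_assoc
  rw [h8, h9, h6, h7] at h4
  rw [h5, ← h4] at h3
  show (U.ncard : ℤ) = _
  rw [h1, ← h3]
  ring

end Counting

/-! ### Counting the parameters of transverse sextuples -/

section CountingLemmas

theorem ncard_zero_pair_neg {K : Type*} [Field K] (h2 : (2 : K) ≠ 0) {a : K} (ha : a ≠ 0) :
    ({0, a, -a} : Set K).ncard = 3 := by
  rw [Set.ncard_insert_of_notMem, Set.ncard_pair]
  · grind
  · simp
    grind

theorem ncard_mem_pair_neg {K : Type*} [Field K] (h2 : (2 : K) ≠ 0) {p : K → Prop}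
    (hp : ∀ z, p (-z) ↔ p z) {a : K} {A Z : ℕ} (hA : a ≠ 0 → p a ∧ A = 1 ∨ ¬ p a ∧ A = 0)
    (hZ : p 0 ∧ Z = 1 ∨ ¬ p 0 ∧ Z = 0) [Decidable (a = 0)] :
    {z | p z ∧ (z = a ∨ z = -a)}.ncard = if a = 0 then Z else 2 * A := by
  have key : ∀ {n : ℕ}, ({a, -a} : Set K).ncard = n → (p a ∧ A = 1 ∨ ¬ p a ∧ A = 0) →
      {z | p z ∧ (z = a ∨ z = -a)}.ncard = n * A := by
    rintro n hn (⟨h3, rfl⟩ | ⟨h3, rfl⟩)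
    · rw [← hn, mul_one]
      congr 1
      ext z
      simp only [Set.mem_ofPred_eq, Set.mem_insert_iff, Set.mem_singleton_iff]
      refine and_iff_right_of_imp ?_
      rintro (rfl | rfl)
      exacts [h3, (hp _).2 h3]
    · rw [mul_zero, ← Set.ncard_empty K]
      congr 1
      ext z
      simp only [Set.mem_ofPred_eq, Set.mem_empty_iff_false, iff_false]
      rintro ⟨h4, rfl | rfl⟩
      exacts [h3 h4, h3 ((hp _).1 h4)]
  split_ifs with h0
  · subst h0
    rw [neg_zero] at key ⊢
    simp only [or_self]
    rcases hZ with ⟨h3, rfl⟩ | ⟨h3, rfl⟩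
    · rw [← Set.ncard_singleton (0 : K)]
      congr 1
      ext z
      simp only [Set.mem_ofPred_eq, Set.mem_singleton_iff]
      exact and_iff_right_of_imp fun h => h ▸ h3
    · rw [← Set.ncard_empty K]
      congr 1
      ext z
      simp only [Set.mem_ofPred_eq, Set.mem_empty_iff_false, iff_false]
      rintro ⟨h4, rfl⟩
      exact h3 h4
  · exact key (Set.ncard_pair (by grind)) (hA h0)

/-- The elements of `{a, -a, b, -b}` with an even property, counted by the zeros among `a`, `b` and by
the property for `a` and `b`. -/
theorem ncard_mem_quadruple {K : Type*} [Field K] (h2 : (2 : K) ≠ 0) {p : K → Prop}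
    (hp : ∀ z, p (-z) ↔ p z) {a b : K} (hab : a + b ≠ 0) (hab' : a - b ≠ 0) {A B Z : ℕ}
    (hA : a ≠ 0 → p a ∧ A = 1 ∨ ¬ p a ∧ A = 0) (hB : b ≠ 0 → p b ∧ B = 1 ∨ ¬ p b ∧ B = 0)
    (hZ : p 0 ∧ Z = 1 ∨ ¬ p 0 ∧ Z = 0) [Decidable (a = 0)] [Decidable (b = 0)] :
    {z | p z ∧ z ∈ ({a, -a, b, -b} : Set K)}.ncard =
      if a = 0 then Z + 2 * B else if b = 0 then Z + 2 * A else 2 * A + 2 * B := by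
  have hfin : ∀ a : K, {z | p z ∧ (z = a ∨ z = -a)}.Finite := fun a =>
    (Set.toFinite ({a, -a} : Set K)).subset fun z hz => hz.2
  have h3 : {z | p z ∧ z ∈ ({a, -a, b, -b} : Set K)} =
      {z | p z ∧ (z = a ∨ z = -a)} ∪ {z | p z ∧ (z = b ∨ z = -b)} := by
    ext z
    simp only [Set.mem_ofPred_eq, Set.mem_insert_iff, Set.mem_singleton_iff, Set.mem_union]
    tauto
  rw [h3, Set.ncard_union_eq (Set.disjoint_left.2 fun z hz hz' => by
    obtain ⟨-, h4⟩ := hz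
    obtain ⟨-, h5⟩ := hz'
    grind) (hfin a) (hfin b), ncard_mem_pair_neg h2 hp hA hZ, ncard_mem_pair_neg h2 hp hB hZ]
  have h4 : a = 0 → b ≠ 0 := fun h h' => hab (by rw [h, h', add_zero])
  split_ifs with h5 h6 h6
  · exact absurd h6 (h4 h5)
  · rfl
  · rw [add_comm]
  · rfl

theorem ncard_zero_or_mem_quadruple {K : Type*} [Field K] (h2 : (2 : K) ≠ 0) {p : K → Prop}
    (hp : ∀ z, p (-z) ↔ p z) {a b : K} (hab : a + b ≠ 0) (hab' : a - b ≠ 0) {A B : ℕ}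
    (hA : a ≠ 0 → p a ∧ A = 1 ∨ ¬ p a ∧ A = 0) (hB : b ≠ 0 → p b ∧ B = 1 ∨ ¬ p b ∧ B = 0)
    (h0 : p 0) [Decidable (a = 0)] [Decidable (b = 0)] :
    {z | p z ∧ (z = 0 ∨ z ∈ ({a, -a, b, -b} : Set K))}.ncard =
      if a = 0 then 1 + 2 * B else if b = 0 then 1 + 2 * A else 1 + (2 * A + 2 * B) := by
  have h3 := ncard_mem_quadruple h2 hp hab hab' hA hB (Z := 1) (.inl ⟨h0, rfl⟩)
  have h4 : ∀ S : Set K, 0 ∈ S → {z | p z ∧ (z = 0 ∨ z ∈ S)} = {z | p z ∧ z ∈ S} := fun S hS =>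
    Set.ext fun z => and_congr_right fun _ => or_iff_right_of_imp fun h => h ▸ hS
  by_cases ha : a = 0
  · rw [if_pos ha, h4 _ (by simp [ha]), h3, if_pos ha]
  by_cases hb : b = 0
  · rw [if_neg ha, if_pos hb, h4 _ (by simp [hb]), h3, if_neg ha, if_pos hb]
  · rw [if_neg ha, if_neg hb] at h3 ⊢
    have h5 : {z | p z ∧ (z = 0 ∨ z ∈ ({a, -a, b, -b} : Set K))} =
        insert 0 {z | p z ∧ z ∈ ({a, -a, b, -b} : Set K)} := by
      ext z
      simp only [Set.mem_ofPred_eq, Set.mem_insert_iff]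
      refine ⟨fun h => h.2.imp id fun h' => ⟨h.1, h'⟩, ?_⟩
      rintro (rfl | h)
      exacts [⟨h0, .inl rfl⟩, ⟨h.1, .inr h.2⟩]
    rw [h5, Set.ncard_insert_of_notMem (fun h => ?_) ((Set.toFinite _).subset fun z hz => hz.2), h3,
      add_comm]
    have := h.2
    simp only [Set.mem_insert_iff, Set.mem_singleton_iff] at this
    grind

theorem neg_mem_quadruple {K : Type*} [Field K] {a b : K} (z : K) :
    -z ∈ ({a, -a, b, -b} : Set K) ↔ z ∈ ({a, -a, b, -b} : Set K) := by
  simp only [Set.mem_insert_iff, Set.mem_singleton_iff]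
  grind

theorem ncard_and_not {α : Type*} {A : Set α} (hA : A.Finite) (p : α → Prop) :
    ({a | a ∈ A ∧ ¬ p a}.ncard : ℤ) = A.ncard - {a | a ∈ A ∧ p a}.ncard := by
  have := ncard_add_ncard_not hA p
  linarith

theorem finite_of_ncard_card_pow (F : Type*) [Fintype F] [Nonempty F] {α : Type*} {S : Set α} {n : ℕ}
    (h : S.ncard = Fintype.card F ^ n) : S.Finite :=
  Set.finite_of_ncard_pos (h ▸ pow_pos Fintype.card_pos n)

theorem finite_of_ncard_card (F : Type*) [Fintype F] [Nonempty F] {α : Type*} {S : Set α}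
    (h : S.ncard = Fintype.card F) : S.Finite :=
  Set.finite_of_ncard_pos (h ▸ Fintype.card_pos)

/-- Third blocks with vanishing sum are pairs `(z, -z)`, where `z` is taken from the set `D`. -/
theorem ncard_opposite_pairs (F : Type*) [Fintype F] [Nonempty F] {K : Type*} [Field K]
    (h2 : (2 : K) ≠ 0) {S : Set K} (hS : ∀ z, -z ∈ S ↔ z ∈ S) (D : Set K)
    (hD : D.ncard = Fintype.card F) (E : K → K → Prop) (hE : ∀ z, E z (-z) ↔ z ∈ D) {s : ℕ}
    (hs : {z | z ∈ D ∧ (z = 0 ∨ z ∈ S)}.ncard = s) :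
    ({z : K × K | E z.1 z.2 ∧ z.1 ≠ z.2 ∧ (z.1 ∉ S ∧ z.2 ∉ S) ∧ z.1 + z.2 = 0}.ncard : ℤ) =
      (Fintype.card F : ℤ) - s := by
  have h1 := ncard_and_not (finite_of_ncard_card F hD) fun z => z = 0 ∨ z ∈ S
  rw [hD, hs] at h1
  rw [← h1, Nat.cast_inj]
  symm
  refine Set.ncard_congr (fun z _ => (z, -z)) ?_ ?_ ?_
  · rintro z ⟨hz, hzS⟩
    push Not at hzS
    refine ⟨(hE z).2 hz, fun h => hzS.1 ?_, ⟨hzS.2, fun h => hzS.2 ((hS z).1 h)⟩, add_neg_cancel z⟩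
    have h : z = -z := h
    grind
  · intro z w _ _ h
    exact congrArg Prod.fst h
  · rintro ⟨x, y⟩ ⟨h3, h4, h5, h6⟩
    obtain rfl : y = -x := by
      have h6 : x + y = 0 := h6
      linear_combination h6
    refine ⟨x, ⟨(hE x).1 h3, ?_⟩, rfl⟩
    rintro (rfl | h)
    · exact h4 neg_zero.symm
    · exact h5.1 h

/-- The numbers of pairs `(α, β)` related by `M`, with `α ≠ ± β`, for which `α` vanishes, only `β`
vanishes, and neither vanishes. -/
def PairCounts {K : Type*} [Field K] (M : K → K → Prop) (n₀ n₁ n₂ : ℤ) : Prop :=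
  ({z : K × K | M z.1 z.2 ∧ (z.1 + z.2 ≠ 0 ∧ z.1 - z.2 ≠ 0) ∧ z.1 = 0}.ncard : ℤ) = n₀ ∧
    ({z : K × K | M z.1 z.2 ∧ (z.1 + z.2 ≠ 0 ∧ z.1 - z.2 ≠ 0) ∧ z.1 ≠ 0 ∧ z.2 = 0}.ncard : ℤ) = n₁ ∧
    ({z : K × K | M z.1 z.2 ∧ (z.1 + z.2 ≠ 0 ∧ z.1 - z.2 ≠ 0) ∧ z.1 ≠ 0 ∧ z.2 ≠ 0}.ncard : ℤ) = n₂

/-- Pairs of elements of two sets, each containing zero, classified by the vanishing of their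
entries. -/
theorem pairCounts_of_sets (F : Type*) [Fintype F] [Nonempty F] {K : Type*} [Field K] {D D' : Set K}
    (hD : D.ncard = Fintype.card F)
    (hD' : D'.ncard = Fintype.card F) (h0 : (0 : K) ∈ D) (h0' : (0 : K) ∈ D')
    {s : ℕ}
    (hs : ∀ x ∈ D, x ≠ 0 → {y | y ∈ D' ∧ (y = 0 ∨ x + y = 0 ∨ x - y = 0)}.ncard = s) :
    PairCounts (fun x y => x ∈ D ∧ y ∈ D') (Fintype.card F - 1) (Fintype.card F - 1)
      ((Fintype.card F - 1) * (Fintype.card F - s)) := by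
  have hfin := finite_of_ncard_card F hD
  have hfin' := finite_of_ncard_card F hD'
  have e1 := Set.ncard_sdiff_singleton_add_one h0 hfin
  have e2 := Set.ncard_sdiff_singleton_add_one h0' hfin'
  rw [hD] at e1
  rw [hD'] at e2
  refine ⟨?_, ?_, ?_⟩
  · rw [← e2]
    push_cast
    rw [add_sub_cancel_right, Nat.cast_inj]
    symm
    refine Set.ncard_congr (fun y _ => (0, y)) ?_ ?_ ?_
    · rintro y ⟨hy, hy0⟩
      have hy0 : y ≠ 0 := hy0
      exact ⟨⟨h0, hy⟩, ⟨by simpa using hy0, by simpa using hy0⟩, rfl⟩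
    · intro y y' _ _ h
      exact congrArg Prod.snd h
    · rintro ⟨x, y⟩ ⟨h1, h2, h3⟩
      obtain rfl : x = 0 := h3
      refine ⟨y, ⟨h1.2, ?_⟩, rfl⟩
      simpa using h2.1
  · rw [← e1]
    push_cast
    rw [add_sub_cancel_right, Nat.cast_inj]
    symm
    refine Set.ncard_congr (fun x _ => (x, 0)) ?_ ?_ ?_
    · rintro x ⟨hx, hx0⟩
      have hx0 : x ≠ 0 := hx0
      exact ⟨⟨hx, h0'⟩, ⟨by simpa using hx0, by simpa using hx0⟩, hx0, rfl⟩
    · intro y y' _ _ h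
      exact congrArg Prod.fst h
    · rintro ⟨x, y⟩ ⟨h1, h2, h3, h4⟩
      obtain rfl : y = 0 := h4
      exact ⟨x, ⟨h1.1, h3⟩, rfl⟩
  · have h1 := FrobeniusPlane.ncard_pairs (hfin.subset (Set.sdiff_subset (t := {0}))) hfin'
      (fun x y => ¬ (y = 0 ∨ x + y = 0 ∨ x - y = 0)) (k := (Fintype.card F : ℤ) - s) (by
        rintro x ⟨hx, hx0⟩
        rw [ncard_and_not hfin', hD', hs x hx hx0])
    rw [← e1] at h1 ⊢
    push_cast at h1 ⊢
    rw [add_sub_cancel_right, ← h1]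
    congr 2
    ext z
    simp only [Set.mem_ofPred_eq, Set.mem_prod, Set.mem_sdiff, Set.mem_singleton_iff]
    tauto

/-- The pairs `(α, -F α)` with `F (F α) = c α`. -/
theorem pairCounts_conjugate (F : Type*) {K : Type*} [Field F] [Fintype F] [Field K] [Algebra F K]
    (c : K) :
    PairCounts (fun α β : K => frobHom F 1 α = -β ∧ frobHom F 1 β = -(c * α)) 0 0
      {z : K | frobHom F 1 (frobHom F 1 z) = c * z + 0 ∧
        ¬ (frobHom F 1 z = z ∨ frobHom F 1 z = -z)}.ncard := by
  refine ⟨?_, ?_, ?_⟩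
  · rw [Nat.cast_eq_zero, ← Set.ncard_empty (K × K)]
    congr 1
    ext ⟨x, y⟩
    simp only [Set.mem_ofPred_eq, Set.mem_empty_iff_false, iff_false]
    rintro ⟨⟨h3, -⟩, h4, rfl⟩
    rw [map_zero] at h3
    grind
  · rw [Nat.cast_eq_zero, ← Set.ncard_empty (K × K)]
    congr 1
    ext ⟨x, y⟩
    simp only [Set.mem_ofPred_eq, Set.mem_empty_iff_false, iff_false]
    rintro ⟨⟨h3, -⟩, -, h5, rfl⟩
    rw [neg_zero, map_eq_zero] at h3
    exact h5 h3
  · rw [Nat.cast_inj]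
    symm
    refine Set.ncard_congr (fun z _ => (z, -frobHom F 1 z)) ?_ ?_ ?_
    · rintro z ⟨hz, hz0⟩
      push Not at hz0
      have h0 : z ≠ 0 := by
        rintro rfl
        exact hz0.1 (map_zero _)
      refine ⟨⟨(neg_neg _).symm, by rw [map_neg, hz, add_zero]⟩, ⟨fun h => hz0.1 ?_,
        fun h => hz0.2 ?_⟩, h0, fun h => h0 ?_⟩
      · have h : z + -frobHom F 1 z = 0 := h
        linear_combination -h
      · have h : z - -frobHom F 1 z = 0 := h
        linear_combination h
      · have h : -frobHom F 1 z = 0 := h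
        rwa [neg_eq_zero, map_eq_zero] at h
    · intro z w _ _ h
      exact congrArg Prod.fst h
    · rintro ⟨x, y⟩ ⟨⟨h3, h4⟩, ⟨h5, h6⟩, -⟩
      simp only at h3 h4 h5 h6
      refine ⟨x, ⟨?_, ?_⟩, Prod.ext rfl ?_⟩
      · rw [h3, map_neg, h4]
        ring
      · rintro (h | h)
        · exact h5 (by linear_combination h3 - h)
        · exact h6 (by linear_combination h - h3)
      · show -frobHom F 1 x = y
        rw [h3, neg_neg]

variable (F : Type*) {K : Type*} [Field F] [Fintype F] [Field K] [Algebra F K] [IsAlgClosed K]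

local notation "φ" => frobHom F 1

theorem ncard_frobHom_one_fixed : {z : K | φ z = z}.ncard = Fintype.card F := by
  rw [ncard_frobHom_fixed F 1 one_pos, pow_one]

theorem ncard_frobHom_frobHom_fixed :
    {z : K | φ (φ z) = z}.ncard = Fintype.card F ^ 2 := by
  simpa using ncard_frobHom_frobHom_eq F (1 : K) one_ne_zero 0

/-- Third blocks with both entries fixed by Frobenius. -/
theorem ncard_rational_pairs {S : Set K} {s : ℕ} (hs : {z | φ z = z ∧ z ∈ S}.ncard = s) :
    ({z : K × K | (φ z.1 = z.1 ∧ φ z.2 = z.2) ∧ z.1 ≠ z.2 ∧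
      (z.1 ∉ S ∧ z.2 ∉ S) ∧ True}.ncard : ℤ) =
        ((Fintype.card F : ℤ) - s) * (Fintype.card F - s - 1) := by
  have hfin := finite_of_ncard_card F (ncard_frobHom_one_fixed F (K := K))
  have h1 := ncard_and_not hfin fun z => z ∈ S
  rw [ncard_frobHom_one_fixed, show {z | z ∈ {z : K | φ z = z} ∧ z ∈ S}.ncard = s from hs]
    at h1
  have hG : {z | z ∈ {z : K | φ z = z} ∧ z ∉ S}.Finite := hfin.subset fun z hz => hz.1
  have h2 := FrobeniusPlane.ncard_pairs hG hG (fun x y => x ≠ y) (k := (Fintype.card F : ℤ) - s - 1) (by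
    intro x hx
    rw [← h1]
    have h3 : {y | y ∈ {z | z ∈ {z : K | φ z = z} ∧ z ∉ S} ∧ x ≠ y} =
        {z | z ∈ {z : K | φ z = z} ∧ z ∉ S} \ {x} := by
      ext y
      simp only [Set.mem_ofPred_eq, Set.mem_sdiff, Set.mem_singleton_iff, ne_eq, eq_comm]
    rw [h3, ← Set.ncard_sdiff_singleton_add_one hx hG]
    push_cast
    ring)
  rw [h1] at h2
  rw [← h2]
  congr 2
  ext z
  simp only [Set.mem_ofPred_eq, Set.mem_prod]
  tauto

/-- Third blocks with entries exchanged by Frobenius. -/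
theorem ncard_swapped_pairs {S : Set K} (hS : ∀ z ∈ S, φ z ∈ S) {s : ℕ}
    (hs : {z | φ (φ z) = z ∧ φ z ≠ z ∧ z ∈ S}.ncard = s) :
    ({z : K × K | (φ z.1 = z.2 ∧ φ z.2 = z.1) ∧ z.1 ≠ z.2 ∧
      (z.1 ∉ S ∧ z.2 ∉ S) ∧ True}.ncard : ℤ) =
        (Fintype.card F : ℤ) ^ 2 - Fintype.card F - s := by
  have hc := ncard_frobHom_frobHom_fixed F (K := K)
  have hfin := finite_of_ncard_card_pow F hc
  have h1 := ncard_and_not hfin fun z => φ z = z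
  rw [hc, show {z | z ∈ {z : K | φ (φ z) = z} ∧ φ z = z} =
    {z : K | φ z = z} from Set.ext fun z => ⟨fun h => h.2, fun h => ⟨by
      have h : φ z = z := h
      show φ (φ z) = z
      rw [h, h], h⟩⟩, ncard_frobHom_one_fixed] at h1
  have h3 := ncard_and_not (hfin.subset fun z
    (hz : z ∈ {z | z ∈ {z : K | φ (φ z) = z} ∧ ¬ φ z = z}) => hz.1)
    fun z => z ∈ S
  rw [h1, show {z | z ∈ {z | z ∈ {z : K | φ (φ z) = z} ∧ ¬ φ z = z} ∧
    z ∈ S} = {z | φ (φ z) = z ∧ φ z ≠ z ∧ z ∈ S} from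
      Set.ext fun z => and_assoc, hs] at h3
  push_cast at h3
  rw [← h3, Nat.cast_inj]
  symm
  refine Set.ncard_congr (fun z _ => (z, φ z)) ?_ ?_ ?_
  · rintro z ⟨⟨hz, hz'⟩, hzS⟩
    refine ⟨⟨rfl, hz⟩, fun h => hz' h.symm, ⟨hzS, fun h => hzS ?_⟩, trivial⟩
    have := hS _ h
    rwa [show φ (φ z) = z from hz] at this
  · intro z w _ _ h
    exact congrArg Prod.fst h
  · rintro ⟨x, y⟩ ⟨⟨h3, h3'⟩, h4, h5, -⟩
    obtain rfl : φ x = y := h3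
    exact ⟨x, ⟨⟨h3', fun h => h4 h.symm⟩, h5.1⟩, rfl⟩

/-- The possible first entries `(u₀, u₂)` of the first two blocks, if Frobenius permutes these blocks. -/
theorem ncard_frobHom_chain (c : K) :
    {z : K × K | φ z.1 = z.2 ∧ φ z.2 = z.1 + c}.ncard = Fintype.card F ^ 2 := by
  have h := ncard_frobHom_frobHom_eq F (1 : K) one_ne_zero c
  rw [← h]
  symm
  refine Set.ncard_congr (fun z _ => (z, φ z)) ?_ ?_ ?_
  · intro z hz
    refine ⟨rfl, ?_⟩
    have hz : φ (φ z) = 1 * z + c := hz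
    rwa [one_mul] at hz
  · intro z w _ _ h
    exact congrArg Prod.fst h
  · rintro ⟨x, y⟩ ⟨h1, h2⟩
    obtain rfl : φ x = y := h1
    refine ⟨x, ?_, rfl⟩
    show _ = _
    rw [one_mul]
    exact h2

theorem ncard_frobHom_shifts (c d : K) :
    {z : K × K | φ z.1 = z.1 + c ∧ φ z.2 = z.2 + d}.ncard =
      Fintype.card F ^ 2 := by
  rw [pow_two]
  exact ncard_prod_eq (ncard_frobHom_eq_add F _) (ncard_frobHom_eq_add F _)

variable (K) in
/-- The numbers of transverse sextuples permuted by Frobenius according to `ρ`, without a condition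
and with vanishing sum, are `q ^ 2 * (q - 1)` times the values of `k` and `v` at `q`. -/
def TransverseCounts (ρ : Perm (Fin 6)) (k v : ℤ → ℤ) : Prop :=
  transverseCount F ρ (fun _ : K => True) =
      (Fintype.card F : ℤ) ^ 2 * (Fintype.card F - 1) * k (Fintype.card F) ∧
    transverseCount F ρ (fun s : K => s = 0) =
      (Fintype.card F : ℤ) ^ 2 * (Fintype.card F - 1) * v (Fintype.card F)

open Classical in
/-- The counts of transverse sextuples with rational third block. The numbers `A` and `B` record
whether the differences `α` and `β` of the first two blocks are rational. -/
theorem transverseCounts_rational (h2 : (2 : K) ≠ 0) {ρ : Perm (Fin 6)} {r : Fin 6 → Fin 6}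
    (hρ : ⇑ρ = r) (Z : K → K → K × K → Prop) (a b : K → K → K) {n₀ n₁ n₂ : ℤ} {k v : ℤ → ℤ}
    (hn : PairCounts (fun α β => φ α = a α β ∧ φ β = b α β) n₀ n₁ n₂)
    (A B : ℕ) (hZ : ∀ α β, {z | Z α β z}.ncard = Fintype.card F ^ 2)
    (h : ∀ u₀ u₂ α β x y, (∀ i, φ (sextupleOf u₀ u₂ α β x y i) =
        sextupleOf u₀ u₂ α β x y (r i)) ↔ Z α β (u₀, u₂) ∧
        (φ α = a α β ∧ φ β = b α β) ∧ φ x = x ∧ φ y = y := by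
      intros
      simp only [Fin.forall_fin_succ, sextupleOf, Fin.isValue, Matrix.cons_val,
        Fin.succ_zero_eq_one, Fin.succ_one_eq_two, Fin.reduceSucc, map_add, map_sub,
        IsEmpty.forall_iff]
      grind)
    (hM : ∀ α β, φ α = a α β ∧ φ β = b α β →
        φ^[4] α = α ∧ φ^[4] β = β := by
      rintro α β ⟨h3, h4⟩
      simp [h3, h4])
    (hAB : ∀ α β, φ α = a α β ∧ φ β = b α β → α + β ≠ 0 → α - β ≠ 0 →
        (α ≠ 0 → φ α = α ∧ A = 1 ∨ ¬ φ α = α ∧ A = 0) ∧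
        (β ≠ 0 → φ β = β ∧ B = 1 ∨ ¬ φ β = β ∧ B = 0) := by
      intros
      grind)
    (hk : ∀ q : ℤ, q = Fintype.card F →
        n₀ * ((q - (1 + 2 * B : ℕ)) * (q - (1 + 2 * B : ℕ) - 1)) +
          n₁ * ((q - (1 + 2 * A : ℕ)) * (q - (1 + 2 * A : ℕ) - 1)) +
          n₂ * ((q - (2 * A + 2 * B : ℕ)) * (q - (2 * A + 2 * B : ℕ) - 1)) = (q - 1) * k q ∧
        n₀ * (q - (1 + 2 * B : ℕ)) + n₁ * (q - (1 + 2 * A : ℕ)) +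
          n₂ * (q - (1 + (2 * A + 2 * B) : ℕ)) = (q - 1) * v q := by
      rintro q rfl
      constructor <;> push_cast <;> ring) :
    TransverseCounts F K ρ k v := by
  have hp : ∀ z : K, φ (-z) = -z ↔ φ z = z := fun z => by
    rw [map_neg, neg_inj]
  subst hρ
  rw [TransverseCounts, mul_assoc, mul_assoc, ← (hk _ rfl).1, ← (hk _ rfl).2]
  refine ⟨transverseCount_eq F h2 ρ _ Z _ _ h (fun α β _ => hZ α β) hM hn.1 hn.2.1 hn.2.2
    fun α β h1 h3 h4 => ?_, transverseCount_eq F h2 ρ _ Z _ _ h (fun α β _ => hZ α β) hM hn.1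
    hn.2.1 hn.2.2 fun α β h1 h3 h4 => ?_⟩
  · rw [ncard_rational_pairs F (ncard_mem_quadruple h2
      (p := fun z : K => φ z = z) hp h3 h4 (hAB α β h1 h3 h4).1
      (hAB α β h1 h3 h4).2 (.inl ⟨map_zero _, rfl⟩))]
    split_ifs <;> rfl
  · rw [ncard_opposite_pairs F h2 neg_mem_quadruple _ (ncard_frobHom_one_fixed F)
      (fun x y => φ x = x ∧ φ y = y) (fun z => by
        simp only [map_neg, neg_inj, and_self, Set.mem_ofPred_eq])
        (ncard_zero_or_mem_quadruple h2 (p := fun z : K => φ z = z) hp h3 h4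
        (hAB α β h1 h3 h4).1 (hAB α β h1 h3 h4).2 (map_zero _))]
    split_ifs <;> rfl

open Classical in
/-- The counts of transverse sextuples with conjugate third block. The numbers `A` and `B` record
whether the differences `α` and `β` of the first two blocks are negated by Frobenius. -/
theorem transverseCounts_swapped (h2 : (2 : K) ≠ 0) {ρ : Perm (Fin 6)} {r : Fin 6 → Fin 6}
    (hρ : ⇑ρ = r) (Z : K → K → K × K → Prop) (a b : K → K → K) {n₀ n₁ n₂ : ℤ} {k v : ℤ → ℤ}
    (hn : PairCounts (fun α β => φ α = a α β ∧ φ β = b α β) n₀ n₁ n₂)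
    (A B : ℕ) (hZ : ∀ α β, {z | Z α β z}.ncard = Fintype.card F ^ 2)
    (h : ∀ u₀ u₂ α β x y, (∀ i, φ (sextupleOf u₀ u₂ α β x y i) =
        sextupleOf u₀ u₂ α β x y (r i)) ↔ Z α β (u₀, u₂) ∧
        (φ α = a α β ∧ φ β = b α β) ∧ φ x = y ∧ φ y = x := by
      intros
      simp only [Fin.forall_fin_succ, sextupleOf, Fin.isValue, Matrix.cons_val,
        Fin.succ_zero_eq_one, Fin.succ_one_eq_two, Fin.reduceSucc, map_add, map_sub,
        IsEmpty.forall_iff]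
      grind)
    (hM : ∀ α β, φ α = a α β ∧ φ β = b α β →
        φ^[4] α = α ∧ φ^[4] β = β := by
      rintro α β ⟨h3, h4⟩
      simp [h3, h4])
    (hS : ∀ α β, φ α = a α β ∧ φ β = b α β → ∀ z ∈ ({α, -α, β, -β} : Set K),
        φ z ∈ ({α, -α, β, -β} : Set K) := by
      rintro α β ⟨h3, h4⟩ z hz
      simp only [Set.mem_insert_iff, Set.mem_singleton_iff] at hz ⊢
      rcases hz with rfl | rfl | rfl | rfl <;> simp [h3, h4])
    (hAB : ∀ α β, φ α = a α β ∧ φ β = b α β → α + β ≠ 0 → α - β ≠ 0 →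
        (α ≠ 0 → (φ (φ α) = α ∧ φ α ≠ α) ∧
            φ α = -α ∧ A = 1 ∨
          ¬ (φ (φ α) = α ∧ φ α ≠ α) ∧ ¬ φ α = -α ∧ A = 0) ∧
        (β ≠ 0 → (φ (φ β) = β ∧ φ β ≠ β) ∧
            φ β = -β ∧ B = 1 ∨
          ¬ (φ (φ β) = β ∧ φ β ≠ β) ∧ ¬ φ β = -β ∧ B = 0) := by
      rintro α β ⟨h3, h4⟩ h5 h6
      have h8 := map_neg (frobHom F 1) α
      have h9 := map_neg (frobHom F 1) β
      constructor <;> grind)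
    (hk : ∀ q : ℤ, q = Fintype.card F →
        n₀ * (q ^ 2 - q - (0 + 2 * B : ℕ)) + n₁ * (q ^ 2 - q - (0 + 2 * A : ℕ)) +
          n₂ * (q ^ 2 - q - (2 * A + 2 * B : ℕ)) = (q - 1) * k q ∧
        n₀ * (q - (1 + 2 * B : ℕ)) + n₁ * (q - (1 + 2 * A : ℕ)) +
          n₂ * (q - (1 + (2 * A + 2 * B) : ℕ)) = (q - 1) * v q := by
      rintro q rfl
      constructor <;> push_cast <;> ring) :
    TransverseCounts F K ρ k v := by
  have hp : ∀ z : K, φ (φ (-z)) = -z ∧ φ (-z) ≠ -z ↔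
      φ (φ z) = z ∧ φ z ≠ z := fun z => by
    simp only [map_neg, neg_inj, ne_eq]
  have hp' : ∀ z : K, φ (-z) = - -z ↔ φ z = -z := fun z => by
    rw [map_neg, neg_inj]
  subst hρ
  rw [TransverseCounts, mul_assoc, mul_assoc, ← (hk _ rfl).1, ← (hk _ rfl).2]
  refine ⟨transverseCount_eq F h2 ρ _ Z _ _ h (fun α β _ => hZ α β) hM hn.1 hn.2.1 hn.2.2
    fun α β h1 h3 h4 => ?_, transverseCount_eq F h2 ρ _ Z _ _ h (fun α β _ => hZ α β) hM hn.1
    hn.2.1 hn.2.2 fun α β h1 h3 h4 => ?_⟩ <;> obtain ⟨hA, hB⟩ := hAB α β h1 h3 h4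
  · rw [ncard_swapped_pairs F (hS α β h1) ((congrArg Set.ncard (Set.ext fun z =>
      and_assoc.symm)).trans (ncard_mem_quadruple h2
      (p := fun z : K => φ (φ z) = z ∧ φ z ≠ z) hp h3 h4
      (fun h => (hA h).imp (And.imp_right And.right) (And.imp_right And.right))
      (fun h => (hB h).imp (And.imp_right And.right) (And.imp_right And.right))
      (.inr ⟨fun h => h.2 (map_zero _), rfl⟩)))]
    split_ifs <;> rfl
  · rw [ncard_opposite_pairs F h2 neg_mem_quadruple _ (ncard_frobHom_eq_neg F)
      (fun x y => φ x = y ∧ φ y = x) (fun z => by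
        rw [map_neg, neg_eq_iff_eq_neg, and_self, Set.mem_ofPred_eq])
        (ncard_zero_or_mem_quadruple h2 (p := fun z : K => φ z = -z) hp' h3 h4
        (fun h => (hA h).imp And.right And.right) (fun h => (hB h).imp And.right And.right)
        (by simp))]
    split_ifs <;> rfl

theorem pairCounts_fixed (h2 : (2 : K) ≠ 0) :
    PairCounts (fun α β : K => φ α = α ∧ φ β = β) (Fintype.card F - 1)
      (Fintype.card F - 1) ((Fintype.card F - 1) * (Fintype.card F - 3)) := by
  refine pairCounts_of_sets F (ncard_frobHom_one_fixed F) (ncard_frobHom_one_fixed F) (map_zero _)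
    (map_zero _) (s := 3) fun x hx hx0 => ?_
  rw [← ncard_zero_pair_neg h2 hx0]
  congr 1
  ext y
  simp only [Set.mem_ofPred_eq, Set.mem_insert_iff, Set.mem_singleton_iff] at hx ⊢
  grind

theorem pairCounts_negated (h2 : (2 : K) ≠ 0) :
    PairCounts (fun α β : K => φ α = -α ∧ φ β = -β) (Fintype.card F - 1)
      (Fintype.card F - 1) ((Fintype.card F - 1) * (Fintype.card F - 3)) := by
  refine pairCounts_of_sets F (ncard_frobHom_eq_neg F) (ncard_frobHom_eq_neg F) (by simp)
    (by simp) (s := 3) fun x hx hx0 => ?_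
  rw [← ncard_zero_pair_neg h2 hx0]
  congr 1
  ext y
  simp only [Set.mem_ofPred_eq, Set.mem_insert_iff, Set.mem_singleton_iff] at hx ⊢
  grind

theorem pairCounts_mixed (h2 : (2 : K) ≠ 0) :
    PairCounts (fun α β : K => φ α = α ∧ φ β = -β) (Fintype.card F - 1)
      (Fintype.card F - 1) ((Fintype.card F - 1) * (Fintype.card F - 1)) := by
  have h := pairCounts_of_sets F (ncard_frobHom_one_fixed F (K := K)) (ncard_frobHom_eq_neg F)
    (map_zero _) (by simp) (s := 1) fun x hx hx0 => ?_
  · exact_mod_cast h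
  refine (congrArg Set.ncard (Set.ext fun y => ?_)).trans (Set.ncard_singleton (0 : K))
  have hn : φ (-x) = -φ x := map_neg _ _
  simp only [Set.mem_ofPred_eq, Set.mem_singleton_iff] at hx ⊢
  constructor
  · rintro ⟨h3, h4 | h4 | h4⟩
    · exact h4
    · have : y = -x := by linear_combination h4
      grind
    · have : y = x := by linear_combination -h4
      grind
  · rintro rfl
    simp

/-- The sum and the difference of the entries are an anti-invariant and an invariant element. -/
theorem pairCounts_exchanged (h2 : (2 : K) ≠ 0) :
    PairCounts (fun α β : K => φ α = -β ∧ φ β = -(1 * α)) 0 0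
      ((Fintype.card F - 1) ^ 2) := by
  refine ⟨(pairCounts_conjugate F 1).1, (pairCounts_conjugate F 1).2.1,
    (pairCounts_conjugate F 1).2.2.trans ?_⟩
  have h0 := ncard_frobHom_frobHom_eq F (1 : K) one_ne_zero 0
  have h1 := ncard_and_not (finite_of_ncard_card_pow F h0)
    fun z : K => φ z = z ∨ φ z = -z
  refine h1.trans ?_
  have hfin := finite_of_ncard_card F (ncard_frobHom_one_fixed F (K := K))
  have hfin' := finite_of_ncard_card F (ncard_frobHom_eq_neg F (K := K))
  have h3 : {z : K | z ∈ {z : K | φ (φ z) = 1 * z + 0} ∧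
      (φ z = z ∨ φ z = -z)} =
        {z : K | φ z = z} ∪ {z : K | φ z = -z} := by
    ext z
    simp only [Set.mem_ofPred_eq, Set.mem_union, one_mul, add_zero]
    refine and_iff_right_of_imp ?_
    rintro (h | h)
    · rw [h, h]
    · rw [h, map_neg, h, neg_neg]
  have h4 : {z : K | φ z = z} ∩ {z : K | φ z = -z} = {0} := by
    ext z
    simp only [Set.mem_inter_iff, Set.mem_ofPred_eq, Set.mem_singleton_iff]
    constructor
    · rintro ⟨h, h'⟩
      grind
    · rintro rfl
      simp
  have h5 := Set.ncard_union_add_ncard_inter _ _ hfin hfin'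
  rw [h4, Set.ncard_singleton, ncard_frobHom_one_fixed, ncard_frobHom_eq_neg] at h5
  rw [h0, h3]
  zify at h5
  push_cast
  linear_combination -h5

theorem pairCounts_quartic (h2 : (2 : K) ≠ 0) :
    PairCounts (fun α β : K => φ α = -β ∧ φ β = -(-1 * α)) 0 0
      ((Fintype.card F : ℤ) ^ 2 - 1) := by
  refine ⟨(pairCounts_conjugate F (-1)).1, (pairCounts_conjugate F (-1)).2.1,
    (pairCounts_conjugate F (-1)).2.2.trans ?_⟩
  have h0 := ncard_frobHom_frobHom_eq F (-1 : K) (by simp) 0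
  have h1 := ncard_and_not (finite_of_ncard_card_pow F h0)
    fun z : K => φ z = z ∨ φ z = -z
  refine h1.trans ?_
  rw [h0, Nat.cast_pow]
  refine congrArg _ (congrArg Nat.cast ((congrArg Set.ncard (Set.ext fun z => ?_)).trans
    (Set.ncard_singleton (0 : K))))
  simp only [Set.mem_ofPred_eq, Set.mem_singleton_iff]
  constructor
  · rintro ⟨h, h' | h'⟩
    · rw [h', h'] at h
      grind
    · rw [h', map_neg, h'] at h
      grind
  · rintro rfl
    simp

end CountingLemmas

/-! ### Transverse sextuples for permutations preserving the third block -/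

section Forms

variable (F : Type*) {K : Type*} [Field F] [Fintype F] [Field K] [Algebra F K] [IsAlgClosed K]
  {ρ : Perm (Fin 6)}

local notation "φ" => frobHom F 1

theorem transverseCounts_id (h2 : (2 : K) ≠ 0) (hρ : ⇑ρ = ![0, 1, 2, 3, 4, 5]) :
    TransverseCounts F K ρ (fun q => (q - 3) ^ 2 * (q - 4))
      (fun q => (q - 3) ^ 2) :=
  transverseCounts_rational F h2 hρ
    (fun _ _ z => φ z.1 = z.1 + 0 ∧ φ z.2 = z.2 + 0)
    (fun α _ => α) (fun _ β => β) (pairCounts_fixed F h2) 1 1 (fun _ _ => ncard_frobHom_shifts F _ _)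

theorem transverseCounts_swap (h2 : (2 : K) ≠ 0) (hρ : ⇑ρ = ![1, 0, 2, 3, 4, 5]) :
    TransverseCounts F K ρ (fun q => (q - 1) ^ 2 * q)
      (fun q => (q - 1) ^ 2) :=
  transverseCounts_rational F h2 hρ
    (fun α β z => φ z.1 = z.1 + (α + β) ∧ φ z.2 = z.2 + 0)
    (fun _ β => -β) (fun α _ => -(1 * α)) (pairCounts_exchanged F h2) 0 0 (fun _ _ => ncard_frobHom_shifts F _ _)

theorem transverseCounts_swap_swap (h2 : (2 : K) ≠ 0) (hρ : ⇑ρ = ![1, 0, 3, 2, 4, 5]) :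
    TransverseCounts F K ρ (fun q => (q - 3) * q * (q - 1) + 2 * (q - 1) * (q - 2))
      (fun q => (q - 1) ^ 2) :=
  transverseCounts_rational F h2 hρ
    (fun α β z => φ z.1 = z.1 + (α + β) ∧ φ z.2 = z.2 + (α - β))
    (fun α _ => -α) (fun _ β => -β) (pairCounts_negated F h2) 0 0 (fun _ _ => ncard_frobHom_shifts F _ _)

theorem transverseCounts_exchange (h2 : (2 : K) ≠ 0) (hρ : ⇑ρ = ![2, 3, 0, 1, 4, 5]) :
    TransverseCounts F K ρ (fun q => (q - 1) * (q - 2) * (q - 3) + (q - 3) * (q - 4) + (q - 1) * (q - 2))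
      (fun q => (q - 1) * (q - 3) + (q - 3) + (q - 1)) :=
  transverseCounts_rational F h2 hρ
    (fun _ _ z => φ z.1 = z.2 ∧ φ z.2 = z.1 + 0)
    (fun α _ => α) (fun _ β => -β) (pairCounts_mixed F h2) 1 0 (fun _ _ => ncard_frobHom_chain F _)

theorem transverseCounts_swap_swap_swap (h2 : (2 : K) ≠ 0) (hρ : ⇑ρ = ![1, 0, 3, 2, 5, 4]) :
    TransverseCounts F K ρ (fun q => (q - 3) * (q ^ 2 - q - 4) + 2 * (q ^ 2 - q - 2))
      (fun q => (q - 3) ^ 2) :=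
  transverseCounts_swapped F h2 hρ
    (fun α β z => φ z.1 = z.1 + (α + β) ∧ φ z.2 = z.2 + (α - β))
    (fun α _ => -α) (fun _ β => -β) (pairCounts_negated F h2) 1 1 (fun _ _ => ncard_frobHom_shifts F _ _)

theorem transverseCounts_exchange_swap (h2 : (2 : K) ≠ 0) (hρ : ⇑ρ = ![2, 3, 0, 1, 5, 4]) :
    TransverseCounts F K ρ (fun q => (q - 1) * (q ^ 2 - q - 2) + (q ^ 2 - q) + (q ^ 2 - q - 2))
      (fun q => (q - 1) * (q - 3) + (q - 3) + (q - 1)) :=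
  transverseCounts_swapped F h2 hρ
    (fun _ _ z => φ z.1 = z.2 ∧ φ z.2 = z.1 + 0)
    (fun α _ => α) (fun _ β => -β) (pairCounts_mixed F h2) 0 1 (fun _ _ => ncard_frobHom_chain F _)

theorem transverseCounts_quartic (h2 : (2 : K) ≠ 0) (hρ : ⇑ρ = ![2, 3, 1, 0, 4, 5]) :
    TransverseCounts F K ρ (fun q => (q + 1) * q * (q - 1))
      (fun q => (q + 1) * (q - 1)) :=
  transverseCounts_rational F h2 hρ
    (fun α β z => φ z.1 = z.2 ∧ φ z.2 = z.1 + (α + β))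
    (fun _ β => -β) (fun α _ => -(-1 * α)) (pairCounts_quartic F h2) 0 0 (fun _ _ => ncard_frobHom_chain F _)

theorem transverseCounts_quartic_swap (h2 : (2 : K) ≠ 0) (hρ : ⇑ρ = ![2, 3, 1, 0, 5, 4]) :
    TransverseCounts F K ρ (fun q => (q + 1) * (q ^ 2 - q))
      (fun q => (q + 1) * (q - 1)) :=
  transverseCounts_swapped F h2 hρ
    (fun α β z => φ z.1 = z.2 ∧ φ z.2 = z.1 + (α + β))
    (fun _ β => -β) (fun α _ => -(-1 * α)) (pairCounts_quartic F h2) 0 0 (fun _ _ => ncard_frobHom_chain F _)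

end Forms

/-! ### Transverse sextuples for cycles of length three and six -/

section Cyclic

theorem ncard_shifts {K : Type*} [Field K] (h2 : (2 : K) ≠ 0) {t : K} (ht : t ≠ 0) (x : K) :
    ({x, x - t, x - t / 2} : Set K).ncard = 3 := by
  have h3 : t / 2 ≠ 0 := div_ne_zero ht h2
  have h4 : t / 2 ≠ t := fun h => by
    field_simp at h
    exact one_ne_zero (α := K) (by linear_combination -h)
  rw [Set.ncard_insert_of_notMem, Set.ncard_pair]
  · simpa using h4.symm
  · simp only [Set.mem_insert_iff, Set.mem_singleton_iff, not_or]
    exact ⟨fun h => ht (by linear_combination h), fun h => h3 (by linear_combination h)⟩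

/-- The conditions on a transverse sextuple formed by two cycles of length three. -/
theorem isTransverse_three_three {K : Type*} [Field K] (h2 : (2 : K) ≠ 0) {φ : K →+* K} {x y : K}
    (hx : φ (φ (φ x)) = x) (hy : φ (φ (φ y)) = y) :
    IsTransverse ![x, y, φ x, φ y, φ (φ x), φ (φ y)] ↔ x + φ x + φ (φ x) ≠ 0 ∧
      ¬ (y + φ y + φ (φ y) = 0 ∨ y = x ∨ y = x - (x + φ x + φ (φ x)) ∨
        y = x - (x + φ x + φ (φ x)) / 2) := by
  have inj : ∀ a b, φ a = φ b ↔ a = b := fun a b => φ.injective.eq_iff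
  have inj0 : ∀ a, φ a = 0 ↔ a = 0 := fun a => map_eq_zero φ
  have e1 : x + φ y + φ (φ x) = 0 ↔ y + φ x + φ (φ x) = 0 := by
    rw [← inj0 (y + _ + _), map_add, map_add, hx]
    grind
  have e2 : x + φ x + φ (φ y) = 0 ↔ y + φ x + φ (φ x) = 0 := by
    rw [← inj0 (x + φ x + _), map_add, map_add, hy]
    rw [add_comm, ← add_assoc]
  have e3 : y + φ x + φ (φ y) = 0 ↔ x + φ y + φ (φ y) = 0 := by
    rw [← inj0 (x + _ + _), map_add, map_add, hy]
    grind
  have e4 : y + φ y + φ (φ x) = 0 ↔ x + φ y + φ (φ y) = 0 := by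
    rw [← inj0 (y + φ y + _), map_add, map_add, hx]
    rw [add_comm, ← add_assoc]
  have e5 : y + φ x + φ (φ x) = 0 ↔ y = x - (x + φ x + φ (φ x)) := by grind
  have e6 : x + φ y + φ (φ y) = 0 ↔ y = x - (x + φ x + φ (φ x)) / 2 := by
    constructor
    · intro h
      have h3 := congrArg φ h
      rw [map_add, map_add, hy, map_zero] at h3
      have h4 := congrArg φ h3
      rw [map_add, map_add, hy, map_zero] at h4
      field_simp
      linear_combination -h + h3 + h4
    · intro h
      have h3 : 2 * y = x - φ x - φ (φ x) := by rw [h]; field_simp; ring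
      have h4 := congrArg φ h3
      rw [map_mul, map_ofNat, map_sub, map_sub, hx] at h4
      have h5 := congrArg φ h4
      rw [map_mul, map_ofNat, map_sub, map_sub, hx] at h5
      refine mul_left_cancel₀ h2 ?_
      linear_combination h4 + h5
  rw [isTransverse_iff]
  simp only [Matrix.cons_val, ne_eq, inj, e1, e2, e3, e4, ← e5, ← e6, not_or]
  constructor
  · rintro ⟨⟨h1, -⟩, ⟨h3, h4, -⟩, -, h5, -, h6⟩
    exact ⟨h3, h6, Ne.symm h1, h4, h5⟩
  · rintro ⟨h3, h6, h1, h4, h5⟩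
    exact ⟨⟨Ne.symm h1, Ne.symm h1, Ne.symm h1⟩, ⟨h3, h4, h4, h5⟩, h4, h5, h5, h6⟩

variable (F : Type*) {K : Type*} [Field F] [Fintype F] [Field K] [Algebra F K] [IsAlgClosed K]

theorem ncard_trace_three_eq (c : K) :
    {z : K | z + frobHom F 1 z + frobHom F 1 (frobHom F 1 z) = c}.ncard = Fintype.card F ^ 2 := by
  rw [← ncard_frobHom_eq F (K := K) 2 two_pos (fun _ => 1) one_ne_zero c]
  congr 1
  ext z
  simp [sum_range_succ]
  grind

theorem ncard_trace_four_eq_zero :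
    {z : K | z + (frobHom F 1)^[2] z + (frobHom F 1)^[4] z = 0}.ncard = Fintype.card F ^ 4 := by
  rw [← ncard_frobHom_eq F (K := K) 4 (by norm_num) (fun i => if i = 0 ∨ i = 2 then 1 else 0)
    (by simp) 0]
  congr 1
  ext z
  simp [sum_range_succ]
  grind

theorem ncard_trace_six_eq_zero :
    {z : K | ∑ i ∈ range 6, (frobHom F 1)^[i] z = 0}.ncard = Fintype.card F ^ 5 := by
  rw [← ncard_frobHom_eq F (K := K) 5 (by norm_num) (fun _ => 1) one_ne_zero 0]
  congr 1
  ext z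
  simp only [sum_range_succ, Set.mem_ofPred_eq, one_mul]
  grind

theorem ncard_frobHom_iterate_fixed (d : ℕ) (hd : 0 < d) :
    {z : K | (frobHom F 1)^[d] z = z}.ncard = Fintype.card F ^ d := by
  simp only [frobHom_one_iterate]
  exact ncard_frobHom_fixed F d hd

/-- Frobenius permutes the indices in two cycles of length three. -/
theorem transverseCounts_three_three (h2 : (2 : K) ≠ 0) {ρ : Perm (Fin 6)}
    (hρ : ⇑ρ = ![2, 3, 4, 5, 0, 1]) :
    TransverseCounts F K ρ (fun q => q ^ 3 - q ^ 2 - 3) (fun q => q ^ 2) := by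
  set φ : K →+* K := frobHom F 1 with hφ
  set A : Set K := {z | φ^[3] z = z} with hA
  have hAc : A.ncard = Fintype.card F ^ 3 := ncard_frobHom_iterate_fixed F 3 (by norm_num)
  have hAfin := finite_of_ncard_card_pow F hAc
  have hA' : ∀ z, z ∈ A ↔ φ (φ (φ z)) = z := fun z => Iff.rfl
  have htr : ∀ z ∈ A, φ (z + φ z + φ (φ z)) = z + φ z + φ (φ z) := by
    intro z hz
    rw [map_add, map_add, (hA' z).1 hz]
    ring
  have hmem : ∀ c : K, φ c = c → ∀ z, z + φ z + φ (φ z) = c → z ∈ A := by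
    intro c hc z hz
    have := congrArg φ hz
    rw [map_add, map_add, hc] at this
    rw [hA']
    linear_combination this - hz
  have hA1 : ({x | x ∈ A ∧ ¬ x + φ x + φ (φ x) = 0}.ncard : ℤ) =
      (Fintype.card F : ℤ) ^ 3 - Fintype.card F ^ 2 := by
    rw [ncard_and_not hAfin, hAc]
    have : {x | x ∈ A ∧ x + φ x + φ (φ x) = 0} = {x | x + φ x + φ (φ x) = 0} :=
      Set.ext fun x => ⟨fun h => h.2, fun h => ⟨hmem 0 (map_zero _) x h, h⟩⟩
    rw [this, ncard_trace_three_eq]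
    push_cast
    rfl
  have hA1fin : {x | x ∈ A ∧ ¬ x + φ x + φ (φ x) = 0}.Finite := hAfin.subset fun x hx => hx.1
  have key : ∀ p : K → Prop, transverseCount F ρ p =
      {z | z ∈ {x | x ∈ A ∧ ¬ x + φ x + φ (φ x) = 0} ×ˢ A ∧
        (¬ (z.2 + φ z.2 + φ (φ z.2) = 0 ∨ z.2 = z.1 ∨ z.2 = z.1 - (z.1 + φ z.1 + φ (φ z.1)) ∨
          z.2 = z.1 - (z.1 + φ z.1 + φ (φ z.1)) / 2) ∧
          p (z.1 + φ z.1 + φ (φ z.1) + (z.2 + φ z.2 + φ (φ z.2))))}.ncard := by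
    intro p
    rw [transverseCount, Nat.cast_inj]
    have hs : ∀ x y : K, ∑ j, (![x, y, φ x, φ y, φ (φ x), φ (φ y)] : Fin 6 → K) j =
        x + φ x + φ (φ x) + (y + φ y + φ (φ y)) := by
      intro x y
      simp only [Fin.sum_univ_six, Matrix.cons_val]
      ring
    refine Set.ncard_congr (fun u _ => (u 0, u 1)) ?_ ?_ ?_
    · rintro u ⟨hu, h3, h4⟩
      have hu : ∀ i, φ (u i) = u (ρ i) := hu
      simp only [hρ] at hu
      have e2 : φ (u 0) = u 2 := hu 0
      have e3 : φ (u 1) = u 3 := hu 1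
      have e4 : φ (u 2) = u 4 := hu 2
      have e5 : φ (u 3) = u 5 := hu 3
      have e0 : φ (u 4) = u 0 := hu 4
      have e1 : φ (u 5) = u 1 := hu 5
      have hx : u 0 ∈ A := by rw [hA', e2, e4, e0]
      have hy : u 1 ∈ A := by rw [hA', e3, e5, e1]
      have hueq : u = ![u 0, u 1, φ (u 0), φ (u 1), φ (φ (u 0)), φ (φ (u 1))] := by
        rw [e2, e3, e4, e5]
        funext j
        fin_cases j <;> rfl
      rw [hueq, isTransverse_three_three h2 hx hy] at h3
      rw [hueq, hs] at h4
      exact ⟨⟨⟨hx, h3.1⟩, hy⟩, h3.2, h4⟩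
    · rintro u u' ⟨hu, -⟩ ⟨hu', -⟩ h
      obtain ⟨h0, h1⟩ := Prod.mk.inj h
      have hu : ∀ i, φ (u i) = u (ρ i) := hu
      have hu' : ∀ i, φ (u' i) = u' (ρ i) := hu'
      simp only [hρ] at hu hu'
      have h3 : u 2 = u' 2 := by rw [← show φ (u 0) = u 2 from hu 0, h0]; exact hu' 0
      have h4 : u 3 = u' 3 := by rw [← show φ (u 1) = u 3 from hu 1, h1]; exact hu' 1
      have h5 : u 4 = u' 4 := by rw [← show φ (u 2) = u 4 from hu 2, h3]; exact hu' 2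
      have h6 : u 5 = u' 5 := by rw [← show φ (u 3) = u 5 from hu 3, h4]; exact hu' 3
      funext j
      fin_cases j <;> assumption
    · rintro ⟨x, y⟩ ⟨⟨⟨hx, h3⟩, hy⟩, h4, h5⟩
      refine ⟨![x, y, φ x, φ y, φ (φ x), φ (φ y)], ⟨?_, ?_, ?_⟩, rfl⟩
      · intro j
        rw [hρ]
        fin_cases j
        exacts [rfl, rfl, rfl, rfl, hx, hy]
      · exact (isTransverse_three_three h2 hx hy).2 ⟨h3, h4⟩
      · rw [hs]
        exact h5
  simp only [TransverseCounts]
  constructor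
  · rw [key, FrobeniusPlane.ncard_pairs hA1fin hAfin (fun x y => ¬ (y + φ y + φ (φ y) = 0 ∨ y = x ∨
      y = x - (x + φ x + φ (φ x)) ∨ y = x - (x + φ x + φ (φ x)) / 2) ∧ True)
      (k := (Fintype.card F : ℤ) ^ 3 - Fintype.card F ^ 2 - 3), hA1]
    · ring
    rintro x ⟨hx, hx0⟩
    simp only [and_true]
    rw [ncard_and_not hAfin, hAc]
    have ht := htr x hx
    have ht2 : φ ((x + φ x + φ (φ x)) / 2) = (x + φ x + φ (φ x)) / 2 := by
      rw [map_div₀, ht, map_ofNat]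
    set t := x + φ x + φ (φ x) with htdef
    have hU : {y | y ∈ A ∧ (y + φ y + φ (φ y) = 0 ∨ y = x ∨ y = x - t ∨ y = x - t / 2)} =
        {y | y + φ y + φ (φ y) = 0} ∪ {x, x - t, x - t / 2} := by
      ext y
      simp only [Set.mem_ofPred_eq, Set.mem_union, Set.mem_insert_iff, Set.mem_singleton_iff]
      refine ⟨fun h => h.2, fun h => ⟨?_, h⟩⟩
      rcases h with h | rfl | rfl | rfl
      · exact hmem 0 (map_zero _) _ h
      · exact hx
      · rw [hA']
        simp only [map_sub, ht, (hA' x).1 hx]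
      · rw [hA']
        simp only [map_sub, ht2, (hA' x).1 hx]
    have hc3 := ncard_shifts h2 hx0 x
    rw [hU, Set.ncard_union_eq ?_ (finite_of_ncard_card_pow F (ncard_trace_three_eq F 0)),
      ncard_trace_three_eq, hc3]
    · push_cast
      ring
    · rw [Set.disjoint_right]
      intro y hy h
      simp only [Set.mem_ofPred_eq, Set.mem_insert_iff, Set.mem_singleton_iff] at hy h
      rcases hy with rfl | rfl | rfl
      · exact hx0 h
      · have h : x - t + φ (x - t) + φ (φ (x - t)) = 0 := h
        rw [map_sub, ht, map_sub, ht] at h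
        refine hx0 (mul_left_cancel₀ h2 ?_)
        linear_combination -h - htdef
      · have h : x - t / 2 + φ (x - t / 2) + φ (φ (x - t / 2)) = 0 := h
        rw [map_sub, ht2, map_sub, ht2] at h
        have h5 : t / 2 * 2 = t := div_mul_cancel₀ _ h2
        have h4 : t / 2 = 0 := by linear_combination -h - htdef - h5
        exact hx0 ((div_eq_zero_iff.1 h4).resolve_right h2)
  · rw [key, FrobeniusPlane.ncard_pairs hA1fin hAfin (fun x y => ¬ (y + φ y + φ (φ y) = 0 ∨ y = x ∨
      y = x - (x + φ x + φ (φ x)) ∨ y = x - (x + φ x + φ (φ x)) / 2) ∧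
        x + φ x + φ (φ x) + (y + φ y + φ (φ y)) = 0)
      (k := (Fintype.card F : ℤ) ^ 2), hA1]
    · ring
    rintro x ⟨hx, hx0⟩
    have ht := htr x hx
    have ht2 : φ ((x + φ x + φ (φ x)) / 2) = (x + φ x + φ (φ x)) / 2 := by
      rw [map_div₀, ht, map_ofNat]
    set t := x + φ x + φ (φ x) with htdef
    rw [← Nat.cast_pow, Nat.cast_inj, ← ncard_trace_three_eq F (-t)]
    congr 1
    ext y
    simp only [Set.mem_ofPred_eq]
    constructor
    · rintro ⟨-, -, h⟩
      linear_combination h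
    · intro h
      refine ⟨hmem (-t) (by rw [map_neg, ht]) y h, ?_, by linear_combination h⟩
      rintro (h3 | rfl | rfl | rfl)
      · exact hx0 (by linear_combination h - h3)
      · refine hx0 (mul_left_cancel₀ h2 ?_)
        linear_combination h + htdef
      · have h : x - t + φ (x - t) + φ (φ (x - t)) = -t := h
        rw [map_sub, ht, map_sub, ht] at h
        exact hx0 (by linear_combination -h - htdef)
      · have h : x - t / 2 + φ (x - t / 2) + φ (φ (x - t / 2)) = -t := h
        rw [map_sub, ht2, map_sub, ht2] at h
        have h5 : t / 2 * 2 = t := div_mul_cancel₀ _ h2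
        have h4 : t / 2 = 0 := by linear_combination h + htdef + 2 * h5
        exact hx0 ((div_eq_zero_iff.1 h4).resolve_right h2)

/-- The conditions on a transverse sextuple formed by a cycle of length six. -/
theorem isTransverse_six {K : Type*} [Field K] {φ : K →+* K} {z : K}
    (hz : φ (φ (φ (φ (φ (φ z))))) = z) :
    IsTransverse ![z, φ (φ (φ z)), φ z, φ (φ (φ (φ z))), φ (φ z), φ (φ (φ (φ (φ z))))] ↔
      ¬ (φ (φ (φ z)) = z ∨ z + φ (φ z) + φ (φ (φ (φ z))) = 0) := by
  have inj : ∀ a b, φ a = φ b ↔ a = b := fun a b => φ.injective.eq_iff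
  have inj0 : ∀ a, φ a = 0 ↔ a = 0 := fun a => map_eq_zero φ
  rw [isTransverse_iff]
  simp only [Matrix.cons_val, ne_eq, inj, not_or]
  set z₁ := φ z
  set z₂ := φ z₁
  set z₃ := φ z₂
  set z₄ := φ z₃
  set z₅ := φ z₄
  have s : ∀ a b c, φ a + φ b + φ c = 0 ↔ a + b + c = 0 := fun a b c => by
    rw [← map_add, ← map_add, inj0]
  -- the two orbits of transversals
  have e1 : z₃ + z₁ + z₅ = 0 ↔ z + z₂ + z₄ = 0 := by
    rw [← s z z₂ z₄, add_comm (φ z)]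
  have e2 : z₁ + z₂ + z₃ = 0 ↔ z + z₁ + z₂ = 0 := s z z₁ z₂
  have e3 : z₂ + z₃ + z₄ = 0 ↔ z + z₁ + z₂ = 0 := (s z₁ z₂ z₃).trans e2
  have e4 : z₃ + z₄ + z₅ = 0 ↔ z + z₁ + z₂ = 0 := (s z₂ z₃ z₄).trans e3
  have e5 : z₄ + z₅ + z = 0 ↔ z + z₁ + z₂ = 0 := by
    rw [← e4, ← s z₃ z₄ z₅, hz]
  have e6 : z₅ + z + z₁ = 0 ↔ z + z₁ + z₂ = 0 := by
    rw [← e5, ← s z₄ z₅ z, hz]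
  have e7 : z + z₁ + z₂ = 0 → z₃ = z := fun h => by
    have := e2.2 h
    linear_combination this - h
  have p1 : z + z₄ + z₂ = z + z₂ + z₄ := by ring
  have p2 : z₃ + z₁ + z₂ = z₁ + z₂ + z₃ := by ring
  have p3 : z₃ + z₄ + z₂ = z₂ + z₃ + z₄ := by ring
  have p4 : z + z₁ + z₅ = z₅ + z + z₁ := by ring
  have p5 : z + z₄ + z₅ = z₄ + z₅ + z := by ring
  rw [p1, p2, p3, p4, p5, e1, e2, e3, e4, e5, e6, eq_comm (a := z)]
  constructor
  · rintro ⟨⟨h1, -⟩, ⟨-, h2, -⟩, -⟩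
    exact ⟨h1, h2⟩
  · rintro ⟨h1, h2⟩
    have h3 : ¬ z + z₁ + z₂ = 0 := fun h => h1 (e7 h)
    exact ⟨⟨h1, h1, h1⟩, ⟨h3, h2, h3, h3⟩, h3, h3, h2, h3⟩

/-- Frobenius permutes the indices cyclically. -/
theorem transverseCounts_six {ρ : Perm (Fin 6)} (h2 : (2 : K) ≠ 0)
    (hρ : ⇑ρ = ![2, 3, 4, 5, 1, 0]) :
    TransverseCounts F K ρ (fun q => q ^ 3 + q ^ 2 - 1) (fun q => q ^ 2) := by
  set φ : K →+* K := frobHom F 1 with hφ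
  have key : ∀ p : K → Prop, transverseCount F ρ p =
      {z : K | (φ^[6] z = z ∧ p (∑ i ∈ range 6, φ^[i] z)) ∧
        ¬ (φ (φ (φ z)) = z ∨ z + φ (φ z) + φ (φ (φ (φ z))) = 0)}.ncard := by
    intro p
    rw [transverseCount, Nat.cast_inj]
    have hs : ∀ z : K, ∑ j, (![z, φ (φ (φ z)), φ z, φ (φ (φ (φ z))), φ (φ z),
        φ (φ (φ (φ (φ z))))] : Fin 6 → K) j = ∑ i ∈ range 6, φ^[i] z := by
      intro z
      simp only [Fin.sum_univ_six, Matrix.cons_val, sum_range_succ, sum_range_zero,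
        iterate_succ_apply', iterate_zero, id_eq]
      ring
    refine Set.ncard_congr (fun u _ => u 0) ?_ ?_ ?_
    · rintro u ⟨hu, h3, h4⟩
      have hu : ∀ i, φ (u i) = u (ρ i) := hu
      simp only [hρ] at hu
      have e2 : φ (u 0) = u 2 := hu 0
      have e3 : φ (u 1) = u 3 := hu 1
      have e4 : φ (u 2) = u 4 := hu 2
      have e5 : φ (u 3) = u 5 := hu 3
      have e1 : φ (u 4) = u 1 := hu 4
      have e0 : φ (u 5) = u 0 := hu 5
      have hz : φ (φ (φ (φ (φ (φ (u 0)))))) = u 0 := by rw [e2, e4, e1, e3, e5, e0]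
      have hueq : u = ![u 0, φ (φ (φ (u 0))), φ (u 0), φ (φ (φ (φ (u 0)))), φ (φ (u 0)),
          φ (φ (φ (φ (φ (u 0)))))] := by
        rw [e2, e4, e1, e3, e5]
        funext j
        fin_cases j <;> rfl
      rw [hueq, isTransverse_six hz] at h3
      rw [hueq, hs] at h4
      exact ⟨⟨hz, h4⟩, h3⟩
    · rintro u u' ⟨hu, -⟩ ⟨hu', -⟩ h0
      have hu : ∀ i, φ (u i) = u (ρ i) := hu
      have hu' : ∀ i, φ (u' i) = u' (ρ i) := hu'
      simp only [hρ] at hu hu'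
      have h0 : u 0 = u' 0 := h0
      have h3 : u 2 = u' 2 := by rw [← show φ (u 0) = u 2 from hu 0, h0]; exact hu' 0
      have h5 : u 4 = u' 4 := by rw [← show φ (u 2) = u 4 from hu 2, h3]; exact hu' 2
      have h1 : u 1 = u' 1 := by rw [← show φ (u 4) = u 1 from hu 4, h5]; exact hu' 4
      have h4 : u 3 = u' 3 := by rw [← show φ (u 1) = u 3 from hu 1, h1]; exact hu' 1
      have h6 : u 5 = u' 5 := by rw [← show φ (u 3) = u 5 from hu 3, h4]; exact hu' 3
      funext j
      fin_cases j <;> assumption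
    · rintro z ⟨⟨hz, h4⟩, h5⟩
      refine ⟨![z, φ (φ (φ z)), φ z, φ (φ (φ (φ z))), φ (φ z), φ (φ (φ (φ (φ z))))],
        ⟨?_, ?_, ?_⟩, rfl⟩
      · intro j
        rw [hρ]
        fin_cases j
        exacts [rfl, rfl, rfl, rfl, rfl, hz]
      · exact (isTransverse_six hz).2 h5
      · rw [hs]
        exact h4
  have hC : ∀ z, z + φ (φ z) + φ (φ (φ (φ z))) = 0 →
      φ z + φ (φ (φ z)) + φ (φ (φ (φ (φ z)))) = 0 := fun z hz => by
    rw [← map_add, ← map_add, hz, map_zero]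
  have hC6 : ∀ z, z + φ (φ z) + φ (φ (φ (φ z))) = 0 → φ^[6] z = z := fun z hz => by
    have h3 := hC _ (hC z hz)
    show φ (φ (φ (φ (φ (φ z))))) = z
    linear_combination h3 - hz
  have hA : {z : K | φ (φ (φ z)) = z}.ncard = Fintype.card F ^ 3 :=
    ncard_frobHom_iterate_fixed F 3 (by norm_num)
  have hCc : {z : K | z + φ (φ z) + φ (φ (φ (φ z))) = 0}.ncard = Fintype.card F ^ 4 :=
    ncard_trace_four_eq_zero F
  have hAC : {z : K | φ (φ (φ z)) = z} ∩ {z : K | z + φ (φ z) + φ (φ (φ (φ z))) = 0} =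
      {z | z + φ z + φ (φ z) = 0} := by
    ext z
    simp only [Set.mem_inter_iff, Set.mem_ofPred_eq]
    constructor
    · rintro ⟨h3, h4⟩
      rw [h3] at h4
      linear_combination h4
    · intro h
      have h3 : φ (z + φ z + φ (φ z)) = 0 := by rw [h, map_zero]
      rw [map_add, map_add] at h3
      have h4 : φ (φ (φ z)) = z := by linear_combination h3 - h
      exact ⟨h4, by rw [h4]; linear_combination h⟩
  simp only [TransverseCounts]
  constructor
  · have h6 := ncard_frobHom_iterate_fixed F (K := K) 6 (by norm_num)
    rw [key]
    simp only [and_true]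
    have h7 := ncard_and_not (finite_of_ncard_card_pow F h6)
      fun z => φ (φ (φ z)) = z ∨ z + φ (φ z) + φ (φ (φ (φ z))) = 0
    refine h7.trans ?_
    have h8 : {z | z ∈ {z : K | (frobHom F 1)^[6] z = z} ∧
        (φ (φ (φ z)) = z ∨ z + φ (φ z) + φ (φ (φ (φ z))) = 0)} =
        {z : K | φ (φ (φ z)) = z} ∪ {z : K | z + φ (φ z) + φ (φ (φ (φ z))) = 0} := by
      ext z
      refine ⟨fun h => h.2, fun h => ⟨?_, h⟩⟩
      rcases h with h | h
      · have h : φ (φ (φ z)) = z := h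
        show φ (φ (φ (φ (φ (φ z))))) = z
        rw [h, h]
      · exact hC6 z h
    have h9 := Set.ncard_union_add_ncard_inter {z : K | φ (φ (φ z)) = z}
      {z : K | z + φ (φ z) + φ (φ (φ (φ z))) = 0} (finite_of_ncard_card_pow F hA)
      (finite_of_ncard_card_pow F hCc)
    rw [hAC, ncard_trace_three_eq, hA, hCc] at h9
    rw [h8, h6]
    zify at h9
    push_cast
    linear_combination -h9
  · have h5 := ncard_trace_six_eq_zero F (K := K)
    have hfin := finite_of_ncard_card_pow F h5
    have h7 := ncard_and_not hfin fun z => z + φ (φ z) + φ (φ (φ (φ z))) = 0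
    have h8 : {z | z ∈ {z : K | ∑ i ∈ range 6, (frobHom F 1)^[i] z = 0} ∧
        z + φ (φ z) + φ (φ (φ (φ z))) = 0} = {z : K | z + φ (φ z) + φ (φ (φ (φ z))) = 0} := by
      ext z
      refine ⟨fun h => h.2, fun h => ⟨?_, h⟩⟩
      have h : z + φ (φ z) + φ (φ (φ (φ z))) = 0 := h
      simp only [sum_range_succ, sum_range_zero, Set.mem_ofPred_eq,
        iterate_succ_apply', iterate_zero, id_eq]
      linear_combination h + hC z h
    rw [h8, h5, hCc] at h7
    rw [key]
    have h9 : {z : K | (φ^[6] z = z ∧ ∑ i ∈ range 6, φ^[i] z = 0) ∧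
        ¬ (φ (φ (φ z)) = z ∨ z + φ (φ z) + φ (φ (φ (φ z))) = 0)} =
        {z | z ∈ {z : K | ∑ i ∈ range 6, (frobHom F 1)^[i] z = 0} ∧
          ¬ z + φ (φ z) + φ (φ (φ (φ z))) = 0} := by
      ext z
      simp only [Set.mem_ofPred_eq, not_or]
      constructor
      · rintro ⟨⟨-, h10⟩, -, h11⟩
        exact ⟨h10, h11⟩
      · rintro ⟨h10, h11⟩
        have h10' := h10
        simp only [sum_range_succ, sum_range_zero, iterate_succ_apply',
          iterate_zero, id_eq] at h10'
        refine ⟨⟨?_, h10⟩, fun h12 => h11 ?_, h11⟩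
        · have h12 := congrArg φ h10'
          simp only [map_add, map_zero] at h12
          show φ (φ (φ (φ (φ (φ z))))) = z
          linear_combination h12 - h10'
        · have h10' : 0 + z + φ z + φ (φ z) + φ (φ (φ z)) + φ (φ (φ (φ z))) +
            φ (φ (φ (φ (φ z)))) = 0 := h10'
          simp only [h12] at h10' ⊢
          refine mul_left_cancel₀ h2 ?_
          linear_combination h10'
    rw [h9, h7]
    push_cast
    ring

end Cyclic

/-! ### Coordinates for three concurrent lines carrying two points each -/

section Frame

variable {K : Type*} [Field K]

open Projectivization Matrix

theorem linearIndependent_iff_det_ne_zero (v : Fin 3 → Fin 3 → K) :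
    LinearIndependent K v ↔ (Matrix.of v).det ≠ 0 := by
  rw [show LinearIndependent K v ↔ IsUnit (Matrix.of v) from
    Matrix.linearIndependent_rows_iff_isUnit (A := Matrix.of v), Matrix.isUnit_iff_isUnit_det,
    isUnit_iff_ne_zero]

theorem exists_dotProduct_eq {v : Fin 3 → Fin 3 → K} (hv : LinearIndependent K v)
    (s : Fin 3 → K) : ∃ x, ∀ i, v i ⬝ᵥ x = s i := by
  have h : IsUnit (Matrix.of v) := Matrix.linearIndependent_rows_iff_isUnit.1 hv
  obtain ⟨x, hx⟩ := (Matrix.mulVec_surjective_iff_isUnit.2 h) s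
  exact ⟨x, congrFun hx⟩

theorem block_cases : ∀ i j k : Fin 6, i ≠ j → i ≠ k → j ≠ k →
    (block i = block j ∧ block i ≠ block k) ∨ (block i = block k ∧ block i ≠ block j) ∨
      (block j = block k ∧ block j ≠ block i) ∨
      (block i = 0 ∧ block j = 1 ∧ block k = 2) ∨ (block i = 0 ∧ block j = 2 ∧ block k = 1) ∨
      (block i = 1 ∧ block j = 0 ∧ block k = 2) ∨ (block i = 1 ∧ block j = 2 ∧ block k = 0) ∨
      (block i = 2 ∧ block j = 0 ∧ block k = 1) ∨ (block i = 2 ∧ block j = 1 ∧ block k = 0) := by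
  decide +kernel

/-- Vectors `w 0`, `w 1`, `w 2` with sum zero which together with `o` span the space: three lines
through the point `o` are spanned by `o` and one of the `w b` each. -/
structure IsFrame (o : Fin 3 → K) (w : Fin 3 → Fin 3 → K) : Prop where
  sum_eq : w 0 + w 1 + w 2 = 0
  linearIndependent : LinearIndependent K ![w 0, w 1, o]

namespace IsFrame

variable {o : Fin 3 → K} {w : Fin 3 → Fin 3 → K} (h : IsFrame o w)
include h

theorem sum_dotProduct (x : Fin 3 → K) : w 0 ⬝ᵥ x + w 1 ⬝ᵥ x + w 2 ⬝ᵥ x = 0 := by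
  rw [← add_dotProduct, ← add_dotProduct, h.sum_eq, zero_dotProduct]

theorem eq_zero {b c : Fin 3} (hbc : b ≠ c) {x : Fin 3 → K} (hb : w b ⬝ᵥ x = 0)
    (hc : w c ⬝ᵥ x = 0) (ho : o ⬝ᵥ x = 0) : x = 0 := by
  have h1 := h.sum_dotProduct x
  have h2 : w 0 ⬝ᵥ x = 0 ∧ w 1 ⬝ᵥ x = 0 := by
    fin_cases b <;> fin_cases c <;> simp_all
  exact (linearIndependent_iff_dotProduct _).1 h.linearIndependent x fun i => by
    fin_cases i <;> simp [h2.1, h2.2, ho]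

theorem linearIndependent_of_ne {b c : Fin 3} (hbc : b ≠ c) :
    LinearIndependent K ![w b, w c, o] := by
  rw [linearIndependent_iff_dotProduct]
  intro x hx
  exact h.eq_zero hbc (hx 0) (hx 1) (hx 2)

theorem pair (b : Fin 3) : LinearIndependent K ![w b, o] := by
  obtain ⟨c, hc⟩ := exists_ne b
  have := h.linearIndependent_of_ne hc
  rw [Fintype.linearIndependent_iff] at this
  rw [LinearIndependent.pair_iff]
  intro s t hst
  have h1 := this ![0, s, t] (by simpa [Fin.sum_univ_three] using hst)
  exact ⟨h1 1, h1 2⟩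

theorem ne_zero (b : Fin 3) (z : K) : w b + z • o ≠ 0 := fun h0 => by
  have := (LinearIndependent.pair_iff.1 (h.pair b)) 1 z (by simpa using h0)
  exact one_ne_zero this.1

theorem add_smul_injective {b : Fin 3} {z z' s : K} (h0 : w b + z • o = s • (w b + z' • o)) :
    z = z' := by
  have := (LinearIndependent.pair_iff.1 (h.pair b)) (1 - s) (z - s * z') (by
    rw [sub_smul, sub_smul, one_smul, mul_smul]
    rw [smul_add] at h0
    linear_combination (exp := 1) h0)
  obtain rfl : s = 1 := (sub_eq_zero.1 this.1).symm
  simpa [sub_eq_zero] using this.2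

omit h in
/-- Six points on the three lines of a frame, two on each line, other than the common point. -/
def point (h : IsFrame o w) (u : Fin 6 → K) (j : Fin 6) : Plane K :=
  Projectivization.mk K (w (block j) + u j • o) (h.ne_zero _ _)

theorem point_orthogonal {u : Fin 6 → K} {j : Fin 6} {x : Fin 3 → K} (hx : x ≠ 0) :
    (h.point u j).orthogonal (Projectivization.mk K x hx) ↔ w (block j) ⬝ᵥ x + u j * (o ⬝ᵥ x) = 0 := by
  rw [point, orthogonal_mk, add_dotProduct, smul_dotProduct, smul_eq_mul]

theorem point_injective : Injective h.point := by
  intro u u' hu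
  funext j
  have := congrFun hu j
  rw [point, point, mk_eq_mk_iff'] at this
  obtain ⟨s, hs⟩ := this
  exact h.add_smul_injective hs.symm

/-- Three of the six points on different lines of the frame are collinear if and only if the sum of
their coordinates vanishes. -/
theorem arc_point_iff (u : Fin 6 → K) : (Injective (h.point u) ∧
    ∀ (l : Plane K) (i j k : Fin 6), i ≠ j → i ≠ k → j ≠ k → (h.point u i).orthogonal l →
      (h.point u j).orthogonal l → ¬ (h.point u k).orthogonal l) ↔ IsTransverse u := by
  constructor
  · rintro ⟨h1, h2⟩
    refine ⟨fun i j hij hb hu => hij (h1 ?_), fun i j k hi hj hk hsum => ?_⟩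
    · simp only [point, hb, hu]
    · obtain ⟨x, hx⟩ := exists_dotProduct_eq h.linearIndependent ![-u i, -u j, 1]
      have h3 := h.sum_dotProduct x
      have hx0 : w 0 ⬝ᵥ x = -u i := hx 0
      have hx1 : w 1 ⬝ᵥ x = -u j := hx 1
      have hx2 : o ⬝ᵥ x = 1 := hx 2
      have hne : x ≠ 0 := by
        rintro rfl
        simp at hx2
      refine h2 (Projectivization.mk K x hne) i j k ?_ ?_ ?_ ((h.point_orthogonal hne).2 ?_)
        ((h.point_orthogonal hne).2 ?_) ((h.point_orthogonal hne).2 ?_)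
      · rintro rfl; rw [hi] at hj; exact absurd hj (by decide)
      · rintro rfl; rw [hi] at hk; exact absurd hk (by decide)
      · rintro rfl; rw [hj] at hk; exact absurd hk (by decide)
      · rw [hi, hx0, hx2]; ring
      · rw [hj, hx1, hx2]; ring
      · rw [hk, hx2]
        rw [hx0, hx1] at h3
        linear_combination h3 + hsum
  · rintro ⟨h1, h2⟩
    constructor
    · intro i j hij
      by_contra hne
      rw [point, point, mk_eq_mk_iff'] at hij
      obtain ⟨s, hs⟩ := hij
      by_cases hb : block i = block j
      · rw [← hb] at hs
        exact h1 i j hne hb (h.add_smul_injective hs.symm)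
      · have := (Fintype.linearIndependent_iff.1 (h.linearIndependent_of_ne hb)) ![-1, s, s * u j - u i] (by
          simp only [Fin.sum_univ_three, cons_val_zero, cons_val_one, Matrix.cons_val]
          rw [sub_smul, neg_smul, one_smul, mul_smul]
          rw [smul_add] at hs
          linear_combination (exp := 1) hs) 0
        simp at this
    · intro l i j k hij hik hjk
      obtain ⟨x, hx, rfl⟩ := exists_rep l
      rw [h.point_orthogonal, h.point_orthogonal, h.point_orthogonal]
      intro e1 e2 e3
      have key : ∀ {i j k : Fin 6}, i ≠ j → block i = block j → block i ≠ block k →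
          w (block i) ⬝ᵥ x + u i * (o ⬝ᵥ x) = 0 → w (block j) ⬝ᵥ x + u j * (o ⬝ᵥ x) = 0 →
          w (block k) ⬝ᵥ x + u k * (o ⬝ᵥ x) = 0 → False := by
        intro i j k hij hb hbk e1 e2 e3
        rw [← hb] at e2
        have ho : o ⬝ᵥ x = 0 := (mul_eq_zero.1 (show (u i - u j) * (o ⬝ᵥ x) = 0 by
          linear_combination e1 - e2)).resolve_left (sub_ne_zero.2 (h1 i j hij hb))
        rw [ho, mul_zero, add_zero] at e1 e3
        exact hx (h.eq_zero hbk e1 e3 ho)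
      have key2 : ∀ {i j k : Fin 6}, block i = 0 → block j = 1 → block k = 2 →
          w (block i) ⬝ᵥ x + u i * (o ⬝ᵥ x) = 0 → w (block j) ⬝ᵥ x + u j * (o ⬝ᵥ x) = 0 →
          w (block k) ⬝ᵥ x + u k * (o ⬝ᵥ x) = 0 → False := by
        intro i j k hi hj hk e1 e2 e3
        have h3 := h.sum_dotProduct x
        rw [hi] at e1
        rw [hj] at e2
        rw [hk] at e3
        have ho : o ⬝ᵥ x = 0 := (mul_eq_zero.1 (show (u i + u j + u k) * (o ⬝ᵥ x) = 0 by
          linear_combination e1 + e2 + e3 - h3)).resolve_left (h2 i j k hi hj hk)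
        rw [ho, mul_zero, add_zero] at e1 e2
        exact hx (h.eq_zero (by decide) e1 e2 ho)
      rcases block_cases i j k hij hik hjk with ⟨h3, h4⟩ | ⟨h3, h4⟩ | ⟨h3, h4⟩ | ⟨h3, h4, h5⟩ |
        ⟨h3, h4, h5⟩ | ⟨h3, h4, h5⟩ | ⟨h3, h4, h5⟩ | ⟨h3, h4, h5⟩ | ⟨h3, h4, h5⟩
      · exact key hij h3 h4 e1 e2 e3
      · exact key hik h3 h4 e1 e3 e2
      · exact key hjk h3 h4 e2 e3 e1
      · exact key2 h3 h4 h5 e1 e2 e3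
      · exact key2 h3 h5 h4 e1 e3 e2
      · exact key2 h4 h3 h5 e2 e1 e3
      · exact key2 h5 h3 h4 e3 e1 e2
      · exact key2 h4 h5 h3 e2 e3 e1
      · exact key2 h5 h4 h3 e3 e2 e1

/-- On the line spanned by `w b` and `o`, a conic through two points cuts out coordinates with sum
determined by the polar form; as the `w b` add up to zero, so do the coordinates of the six points
on a conic. Conversely the conic is written down in the coordinates given by the frame. -/
theorem onConic_point_iff {u : Fin 6 → K} (hu : IsTransverse u) :
    (∃ c, ¬ ContainsLine c ∧ ∀ j, h.point u j ∈ zeroSet c) ↔ ∑ j, u j = 0 := by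
  simp only [point, mk_mem_zeroSet]
  constructor
  · rintro ⟨c, hc, hT⟩
    have h1 : ∀ j, quad c (w (block j)) + u j * (o ⬝ᵥ quadPolar c (w (block j))) +
        u j ^ 2 * quad c o = 0 := fun j => by
      have := quad_combination c 1 (u j) (w (block j)) o
      rw [one_smul, hT j] at this
      linear_combination -this
    have h2 : ∀ i j, i ≠ j → block i = block j →
        o ⬝ᵥ quadPolar c (w (block i)) = -(u i + u j) * quad c o := by
      intro i j hij hb
      have e1 := h1 i
      have e2 := h1 j
      rw [← hb] at e2
      have h3 := sub_ne_zero.2 (hu.1 i j hij hb)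
      refine mul_left_cancel₀ h3 ?_
      linear_combination e1 - e2
    have e1 : w 0 ⬝ᵥ quadPolar c o = _ := (dotProduct_quadPolar_comm _ _ _).trans
      (h2 0 1 (by decide) rfl)
    have e2 : w 1 ⬝ᵥ quadPolar c o = _ := (dotProduct_quadPolar_comm _ _ _).trans
      (h2 2 3 (by decide) rfl)
    have e3 : w 2 ⬝ᵥ quadPolar c o = _ := (dotProduct_quadPolar_comm _ _ _).trans
      (h2 4 5 (by decide) rfl)
    have h3 := h.sum_dotProduct (quadPolar c o)
    rw [e1, e2, e3] at h3
    have h4 : quad c o ≠ 0 := by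
      intro h0
      have e4 := h2 0 1 (by decide) rfl
      have e5 := h1 0
      rw [h0, mul_zero] at e4
      rw [e4, h0, mul_zero, mul_zero, add_zero, add_zero] at e5
      exact hc (containsLine_of_polar_eq_zero (h.pair _) e5 h0 e4)
    refine (mul_eq_zero.1 (show (∑ j, u j) * quad c o = 0 from ?_)).resolve_right h4
    rw [Fin.sum_univ_six]
    linear_combination -h3
  · intro hsum
    rw [Fin.sum_univ_six] at hsum
    obtain ⟨x, hx⟩ := exists_dotProduct_eq h.linearIndependent ![1, 0, 0]
    obtain ⟨y, hy⟩ := exists_dotProduct_eq h.linearIndependent ![0, 1, 0]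
    obtain ⟨z, hz⟩ := exists_dotProduct_eq h.linearIndependent ![0, 0, 1]
    have x0 : w 0 ⬝ᵥ x = 1 := hx 0
    have x1 : w 1 ⬝ᵥ x = 0 := hx 1
    have x2 : o ⬝ᵥ x = 0 := hx 2
    have y0 : w 0 ⬝ᵥ y = 0 := hy 0
    have y1 : w 1 ⬝ᵥ y = 1 := hy 1
    have y2 : o ⬝ᵥ y = 0 := hy 2
    have z0 : w 0 ⬝ᵥ z = 0 := hz 0
    have z1 : w 1 ⬝ᵥ z = 0 := hz 1
    have z2 : o ⬝ᵥ z = 1 := hz 2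
    have x3 : w 2 ⬝ᵥ x = -1 := by linear_combination h.sum_dotProduct x - x0 - x1
    have y3 : w 2 ⬝ᵥ y = -1 := by linear_combination h.sum_dotProduct y - y0 - y1
    have z3 : w 2 ⬝ᵥ z = 0 := by linear_combination h.sum_dotProduct z - z0 - z1
    set c := (u 0 * u 1) • quadMul x x + (u 2 * u 3) • quadMul y y +
      (u 4 * u 5 - u 0 * u 1 - u 2 * u 3) • quadMul x y + (-(u 0 + u 1)) • quadMul x z +
      (-(u 2 + u 3)) • quadMul y z + quadMul z z with hcdef
    have hval : ∀ j, quad c (w (block j) + u j • o) = 0 := by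
      intro j
      simp only [hcdef, quad_add_left, quad_smul_left, quad_quadMul, add_dotProduct, smul_dotProduct,
        smul_eq_mul, x2, y2, z2]
      fin_cases j <;> simp [block, x0, x1, x3, y0, y1, y3, z0, z1, z3]
      · ring
      · ring
      · ring
      · ring
      · linear_combination u 4 * hsum
      · linear_combination u 5 * hsum
    refine ⟨c, ?_, hval⟩
    have hc : c ≠ 0 := by
      intro h0
      have : quad c o = 1 := by
        simp [hcdef, quad_add_left, quad_smul_left, quad_quadMul, x2, y2, z2]
      rw [h0] at this
      simp [quad] at this
    have hinj := Fin.castSucc_injective 5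
    exact not_containsLine_of_arc hc (T := fun i => h.point u i.castSucc)
      (fun l i j k hij hik hjk => ((h.arc_point_iff u).2 hu).2 l _ _ _ (hinj.ne hij) (hinj.ne hik)
        (hinj.ne hjk)) fun i => (mk_mem_zeroSet _).2 (hval _)

end IsFrame

end Frame

section FrameExists

open Projectivization Matrix

theorem det_crossProduct {K : Type*} [Field K] {A B e o : Fin 3 → K} :
    (Matrix.of ![A ⨯₃ e, B ⨯₃ e, o]).det = (o ⬝ᵥ e) * (Matrix.of ![A, B, e]).det := by
  rw [det_fin_three, det_fin_three]
  simp [cross_apply, dotProduct, Fin.sum_univ_three]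
  ring

/-- Scalars proportional to those of a relation among three vectors spanning a plane. -/
theorem eq_of_relation {K : Type*} [Field K] {n : Fin 3 → Fin 3 → K} (h01 : LinearIndependent K ![n 0, n 1])
    (hn : n 0 + n 1 + n 2 = 0) {c : Fin 3 → K} (hc : c 0 • n 0 + c 1 • n 1 + c 2 • n 2 = 0) :
    ∀ b, c b = c 2 := by
  have h : (c 0 - c 2) • n 0 + (c 1 - c 2) • n 1 =
      (c 0 • n 0 + c 1 • n 1 + c 2 • n 2) - c 2 • (n 0 + n 1 + n 2) := by module
  rw [hc, hn, smul_zero, sub_zero] at h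
  obtain ⟨h1, h2⟩ := LinearIndependent.pair_iff.1 h01 _ _ h
  intro b
  fin_cases b
  · exact sub_eq_zero.1 h1
  · exact sub_eq_zero.1 h2
  · rfl

variable (F : Type*) {K : Type*} [Field F] [Fintype F] [Field K] [Algebra F K]

theorem frobeniusVec_apply (v : Fin 3 → K) (i : Fin 3) :
    frobeniusVec F v i = frobHom F 1 (v i) := by
  rw [frobHom_apply, pow_one]
  rfl

theorem frobeniusVec_crossProduct (v w : Fin 3 → K) :
    frobeniusVec F (v ⨯₃ w) = frobeniusVec F v ⨯₃ frobeniusVec F w := by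
  funext i
  rw [frobeniusVec_apply]
  fin_cases i <;> simp [cross_apply, frobeniusVec_apply]

variable [IsAlgClosed K]

/-- The frame of three concurrent lines permuted by Frobenius can be chosen compatibly with
Frobenius: the coordinate vectors of the lines are determined up to a common factor by the
condition that their sum vanishes, and the factor can be adjusted as `K` is algebraically closed. -/
theorem exists_isFrame {β : Perm (Fin 3)} {ℓ : Fin 3 → Plane K}
    (hℓ : ∀ b, frobenius F (ℓ b) = ℓ (β b)) (hinj : Injective ℓ) {a : Plane K}
    (ha : frobenius F a = a) (hinc : ∀ b, a.orthogonal (ℓ b)) :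
    ∃ o w, IsFrame o w ∧ frobeniusVec F o = o ∧ (∀ b, frobeniusVec F (w b) = w (β b)) ∧
      ∀ b, ∃ x hx, ℓ b = mk K x hx ∧ o ⬝ᵥ x = 0 ∧ w b ⬝ᵥ x = 0 := by
  have hq : 1 < Fintype.card F := Fintype.one_lt_card
  obtain ⟨o, ho, rfl, hfix⟩ := exists_fixed_rep F (d := 1) (a := a) ha
  have hfix' : frobeniusVec F o = o := funext fun i => by
    rw [frobeniusVec_apply, hfix]
  have hv : ∀ b, ∃ v, ∃ hv : v ≠ 0, ℓ b = mk K v hv := fun b => exists_rep _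
  choose v hv0 hv using hv
  have hov : ∀ b, v b ⬝ᵥ o = 0 := fun b => by
    have := hinc b
    rw [hv, orthogonal_mk] at this
    rwa [dotProduct_comm]
  have hli : ∀ {b c}, b ≠ c → LinearIndependent K ![v b, v c] := fun hbc =>
    linearIndependent_of_ne (hv0 _) (hv0 _) (by rw [← hv, ← hv]; exact hinj.ne hbc)
  obtain ⟨s, t, hst⟩ := exists_eq_combination ho (hli (b := 0) (c := 1) (by decide)) (hov 0) (hov 1)
    (hov 2)
  have hs : s ≠ 0 := by
    rintro rfl
    exact one_ne_zero (LinearIndependent.pair_iff.1 (hli (b := 2) (c := 1) (by decide)) 1 (-t)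
      (by rw [hst]; simp)).1
  have ht : t ≠ 0 := by
    rintro rfl
    exact one_ne_zero (LinearIndependent.pair_iff.1 (hli (b := 2) (c := 0) (by decide)) 1 (-s)
      (by rw [hst]; simp)).1
  obtain ⟨n, hn0, hn, hsum⟩ : ∃ n : Fin 3 → Fin 3 → K, ∃ hn0 : ∀ b, n b ≠ 0,
      (∀ b, ℓ b = mk K (n b) (hn0 b)) ∧ n 0 + n 1 + n 2 = 0 := by
    set k : Fin 3 → K := ![s, t, -1] with hk
    have hk0 : ∀ b, k b ≠ 0 := fun b => by fin_cases b <;> simp [hk, hs, ht]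
    refine ⟨fun b => k b • v b, fun b => smul_ne_zero (hk0 b) (hv0 b), fun b => ?_, ?_⟩
    · rw [hv, mk_eq_mk_iff']
      exact ⟨(k b)⁻¹, by rw [smul_smul, inv_mul_cancel₀ (hk0 b), one_smul]⟩
    · simp only [hk, hst, cons_val_zero, cons_val_one, Matrix.cons_val]
      module
  have hon : ∀ b, n b ⬝ᵥ o = 0 := fun b => by
    have := hinc b
    rw [hn, orthogonal_mk] at this
    rwa [dotProduct_comm]
  have hlin : ∀ {b c}, b ≠ c → LinearIndependent K ![n b, n c] := fun hbc =>
    linearIndependent_of_ne (hn0 _) (hn0 _) (by rw [← hn, ← hn]; exact hinj.ne hbc)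
  have hF : ∀ b, ∃ c : K, frobeniusVec F (n b) = c • n (β b) := fun b => by
    have := hℓ b
    rw [hn, hn, frobenius_mk, mk_eq_mk_iff'] at this
    obtain ⟨c, hc⟩ := this
    exact ⟨c, hc.symm⟩
  choose c hc using hF
  obtain ⟨r, hr⟩ : ∃ r, ∀ b, frobeniusVec F (n b) = r • n (β b) := by
    have h1 : c (β.symm 0) • n 0 + c (β.symm 1) • n 1 + c (β.symm 2) • n 2 = 0 := by
      have h2 := congrArg (frobeniusVec F) hsum
      rw [map_add, map_add, map_zero, hc, hc, hc, ← Fin.sum_univ_three fun b => c b • n (β b),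
        ← Equiv.sum_comp β.symm, Fin.sum_univ_three] at h2
      simpa using h2
    have h2 := eq_of_relation (hlin (b := 0) (c := 1) (by decide)) hsum (c := fun b => c (β.symm b)) h1
    refine ⟨c (β.symm 2), fun b => ?_⟩
    rw [hc]
    have := h2 (β b)
    simp only [Equiv.symm_apply_apply] at this
    rw [this]
  have hr0 : r ≠ 0 := by
    rintro rfl
    have := hr 0
    rw [zero_smul] at this
    exact frobeniusVec_ne_zero F (hn0 0) this
  obtain ⟨k, hk⟩ := IsAlgClosed.exists_pow_nat_eq r⁻¹ (show 0 < Fintype.card F - 1 by omega)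
  have hk0 : k ≠ 0 := by
    rintro rfl
    rw [zero_pow (by omega)] at hk
    exact inv_ne_zero hr0 hk.symm
  have hkq : k ^ Fintype.card F * r = k := by
    rw [← Nat.sub_add_cancel hq.le, pow_succ, hk]
    field_simp
  obtain ⟨i, hi⟩ := ne_iff.1 ho
  set e : Fin 3 → K := Pi.single i 1 with he
  have hoe : o ⬝ᵥ e = o i := by simp [he]
  have hFe : frobeniusVec F e = e := by
    funext j
    show e j ^ Fintype.card F = e j
    by_cases hj : j = i
    · simp [he, hj]
    · simp [he, hj, Fintype.card_ne_zero]
  refine ⟨o, fun b => (k • n b) ⨯₃ e, ⟨?_, ?_⟩, hfix', fun b => ?_, fun b =>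
    ⟨n b, hn0 b, hn b, by rw [dotProduct_comm]; exact hon b, ?_⟩⟩
  · rw [← LinearMap.add_apply, ← map_add, ← LinearMap.add_apply, ← map_add, ← smul_add, ← smul_add,
      hsum, smul_zero, map_zero, LinearMap.zero_apply]
  · rw [linearIndependent_iff_det_ne_zero, det_crossProduct]
    refine mul_ne_zero (by rw [hoe]; exact hi) ((linearIndependent_iff_det_ne_zero _).1 ?_)
    rw [Fintype.linearIndependent_iff]
    intro g hg
    simp only [Fin.sum_univ_three, cons_val_zero, cons_val_one, Matrix.cons_val] at hg
    have h1 := congrArg (fun x => x ⬝ᵥ o) hg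
    simp only [add_dotProduct, smul_dotProduct, hon, smul_eq_mul, mul_zero, zero_add,
      zero_dotProduct, dotProduct_comm e o, hoe] at h1
    have h2 : g 2 = 0 := (mul_eq_zero.1 h1).resolve_right hi
    rw [h2, zero_smul, add_zero, smul_smul, smul_smul] at hg
    obtain ⟨h3, h4⟩ := LinearIndependent.pair_iff.1 (hlin (b := 0) (c := 1) (by decide)) _ _ hg
    intro j
    fin_cases j
    · exact (mul_eq_zero.1 h3).resolve_right hk0
    · exact (mul_eq_zero.1 h4).resolve_right hk0
    · exact h2
  · rw [frobeniusVec_crossProduct, hFe, map_smulₛₗ, hr, smul_smul]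
    congr 3
  · dsimp only
    rw [map_smul, LinearMap.smul_apply, smul_dotProduct, dotProduct_comm, dot_self_cross, smul_zero]

end FrameExists

/-! ### Arcs of six points with three concurrent joining lines -/

section Concurrent

variable {F K : Type*} [Field F] [Fintype F] [Field K] [Algebra F K]

open Projectivization Matrix

theorem IsFrame.point_twisted_iff {o : Fin 3 → K} {w : Fin 3 → Fin 3 → K} (h : IsFrame o w)
    {ρ : Perm (Fin 6)} {β : Perm (Fin 3)} (hβ : ∀ j, block (ρ j) = β (block j))
    (ho : frobeniusVec F o = o) (hw : ∀ b, frobeniusVec F (w b) = w (β b)) (u : Fin 6 → K) :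
    h.point u ∈ Twisted (frobenius F (K := K)) ρ ↔ u ∈ Twisted (frobHom F 1 : K → K) ρ := by
  have key : ∀ j, frobeniusVec F (w (block j) + u j • o) =
      w (β (block j)) + frobHom F 1 (u j) • o := fun j => by
    rw [map_add, map_smulₛₗ, hw, ho]
    congr 2
  refine forall_congr' fun j => ?_
  rw [point, point, frobenius_mk, mk_eq_mk_iff', key, hβ]
  constructor
  · rintro ⟨s, hs⟩
    exact h.add_smul_injective hs.symm
  · intro hu
    exact ⟨1, by rw [one_smul, hu]⟩

theorem IsFrame.exists_eq_point {o : Fin 3 → K} {w : Fin 3 → Fin 3 → K} (h : IsFrame o w)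
    {ℓ : Fin 3 → Plane K} (hℓ : ∀ b, ∃ x hx, ℓ b = Projectivization.mk K x hx ∧ o ⬝ᵥ x = 0 ∧ w b ⬝ᵥ x = 0)
    {T : Fin 6 → Plane K} (hT : ∀ j, (T j).orthogonal (ℓ (block j)))
    (hne : ∀ j b, b ≠ block j → ¬ (T j).orthogonal (ℓ b)) : ∃ u, T = h.point u := by
  have h1 : ∀ j, ∃ z : K, ∃ hz, T j = Projectivization.mk K (w (block j) + z • o) hz := by
    intro j
    obtain ⟨x, hx, hxl, hox, hwx⟩ := hℓ (block j)
    obtain ⟨t, ht, htT⟩ := exists_rep (T j)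
    have h2 := hT j
    rw [hxl, htT, orthogonal_mk] at h2
    obtain ⟨s, r, rfl⟩ := exists_eq_combination hx (h.pair (block j)) hwx hox h2
    have hs : s ≠ 0 := by
      rintro rfl
      obtain ⟨b, hb⟩ := exists_ne (block j)
      obtain ⟨y, hy, hyl, hoy, -⟩ := hℓ b
      refine hne j b hb ?_
      rw [hyl, htT, orthogonal_mk]
      simp [hoy]
    refine ⟨s⁻¹ * r, h.ne_zero _ _, ?_⟩
    rw [htT, mk_eq_mk_iff']
    exact ⟨s, by rw [smul_add, smul_smul, mul_inv_cancel_left₀ hs]⟩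
  choose u hu0 hu using h1
  exact ⟨u, funext hu⟩

variable [IsAlgClosed K]

/-- The syntheme consisting of the three blocks. -/
def blockSyntheme : Finset (Finset (Fin 6)) := {{0, 1}, {2, 3}, {4, 5}}

theorem concurrent_blockSyntheme_iff {P L : Type*} (π : FrobeniusPlane P L) (T : Fin 6 → P) :
    π.Concurrent T blockSyntheme ↔
      ∃ a, ∃ ℓ : Fin 3 → L, (∀ b, π.inc a (ℓ b)) ∧ ∀ j, π.inc (T j) (ℓ (block j)) := by
  simp only [FrobeniusPlane.Concurrent, FrobeniusPlane.OnLineOf, blockSyntheme, mem_insert,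
    mem_singleton, forall_eq_or_imp, forall_eq]
  refine exists_congr fun a => ⟨?_, ?_⟩
  · rintro ⟨⟨l, hl, h0, h1⟩, ⟨m, hm, h2, h3⟩, n, hn, h4, h5⟩
    refine ⟨![l, m, n], fun b => ?_, fun j => ?_⟩
    · fin_cases b <;> assumption
    · fin_cases j <;> assumption
  · rintro ⟨ℓ, h1, h2⟩
    exact ⟨⟨_, h1 0, h2 0, h2 1⟩, ⟨_, h1 1, h2 2, h2 3⟩, _, h1 2, h2 4, h2 5⟩

theorem card_lines_through (hodd : Odd (Fintype.card F)) (a : Plane K) (ha : frobenius F a = a) (β : Perm (Fin 3)) :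
    ({ℓ ∈ Twisted (frobenius F (K := K)) β | Injective ℓ ∧
      ∀ b, a.orthogonal (ℓ b)}.ncard : ℤ) = (Fintype.card F : ℤ) ^ 3 - Fintype.card F := by
  set π := projectivePlane F K hodd with hπ
  obtain ⟨q, hq⟩ : ∃ q : ℤ, q = (Fintype.card F : ℤ) := ⟨_, rfl⟩
  rw [← hq]
  have key : ∀ l : List ℕ, (∀ d ∈ l, 0 < d ∧ d ≤ 7) →
      ({ℓ ∈ Twisted (frobenius F (K := K)) (rot l) | Injective ℓ ∧
        ∀ b, a.orthogonal (ℓ b)}.ncard : ℤ) = confCount (exactCount fun n => q ^ n + 1) l := by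
    intro l hl
    refine ncard_twisted_injective_mem (C := {m : Plane K | a.orthogonal m}) (fun x hx => ?_)
      (fun d hd => (π.finite_lines d hd).subset fun x hx => hx.1) _ l (fun d hd => (hl d hd).1)
      fun d hd => ?_
    · have := (orthogonal_frobenius F).2 hx
      rwa [ha] at this
    · refine ncard_exactPeriod (fun e he => (π.finite_lines e he).subset fun x hx => hx.1)
        (fun e he => ?_) (hl d hd).1 (hl d hd).2
      have h1 : π.frob^[e] a = a := iterate_fixed ha e
      have h2 := π.ncard_lines_on e he a h1
      have h3 : ({x | π.frobL^[e] x = x ∧ π.inc a x}.ncard : ℤ) = q ^ e + 1 := by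
        rw [h2, hq]; push_cast; rfl
      exact h3
  have hβ : ∀ β : Perm (Fin 3), (∃ e : Fin 3 ≃ Fin ([1, 1, 1] : List ℕ).sum, ∀ i, e (β i) = rot [1, 1, 1] (e i)) ∨
      (∃ e : Fin 3 ≃ Fin ([1, 2] : List ℕ).sum, ∀ i, e (β i) = rot [1, 2] (e i)) ∨
      (∃ e : Fin 3 ≃ Fin ([3] : List ℕ).sum, ∀ i, e (β i) = rot [3] (e i)) := by
    decide +kernel
  have hc : ∀ l : List ℕ, (∀ d ∈ l, 0 < d ∧ d ≤ 7) → ∀ e : Fin 3 ≃ Fin l.sum,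
      (∀ i, e (β i) = rot l (e i)) → ({ℓ ∈ Twisted (frobenius F (K := K)) β | Injective ℓ ∧
      ∀ b, a.orthogonal (ℓ b)}.ncard : ℤ) = confCount (exactCount fun n => q ^ n + 1) l := by
    intro l hl e he
    rw [← key l hl, Nat.cast_inj]
    refine Twisted.ncard_congr e he _ _ fun T => ?_
    rw [e.injective_comp]
    exact and_congr_right fun _ => e.forall_congr_left.trans (by simp)
  rcases hβ β with ⟨e, he⟩ | ⟨e, he⟩ | ⟨e, he⟩
  · rw [hc [1, 1, 1] (by simp) e he]
    simp [confCount, exactCount]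
    ring
  · rw [hc [1, 2] (by simp) e he]
    simp [confCount, exactCount]
    ring
  · rw [hc [3] (by simp) e he]
    simp [confCount, exactCount]

/-- The common point is fixed by Frobenius, and its pencil of lines is a projective line. The number of
triples of lines permuted according to `β` is `q ^ 3 - q` for each of the three cycle types. -/
theorem card_concurrent_lines (hodd : Odd (Fintype.card F)) (β : Perm (Fin 3)) :
    ({ℓ ∈ Twisted (frobenius F (K := K)) β | Injective ℓ ∧
      ∃ a : Plane K, ∀ b, a.orthogonal (ℓ b)}.ncard : ℤ) =
        ((Fintype.card F : ℤ) ^ 2 + Fintype.card F + 1) *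
          ((Fintype.card F : ℤ) ^ 3 - Fintype.card F) := by
  set π := projectivePlane F K hodd with hπ
  have h1 : ∀ ℓ : Fin 3 → Plane K, ∃ a : Plane K, (∃ a : Plane K, ∀ b, a.orthogonal (ℓ b)) →
      ∀ b, a.orthogonal (ℓ b) := fun ℓ => by
    by_cases h : ∃ a : Plane K, ∀ b, a.orthogonal (ℓ b)
    · exact ⟨h.choose, fun _ => h.choose_spec⟩
    · exact ⟨ℓ 0, fun h' => absurd h' h⟩
  choose f hf using h1
  have huniq : ∀ {ℓ : Fin 3 → Plane K} {a a' : Plane K}, Injective ℓ →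
      (∀ b, a.orthogonal (ℓ b)) → (∀ b, a'.orthogonal (ℓ b)) → a = a' := fun hi ha ha' =>
    π.point_eq (hi.ne (show (0 : Fin 3) ≠ 1 by decide)) (ha 0) (ha' 0) (ha 1) (ha' 1)
  have hR : {a : Plane K | frobenius F a = a}.Finite := π.finite_points 1 one_pos
  have h2 := ncard_eq_mul_of_fiber (A := {ℓ ∈ Twisted (frobenius F (K := K)) β |
      Injective ℓ ∧ ∃ a : Plane K, ∀ b, a.orthogonal (ℓ b)})
      (B := {a : Plane K | frobenius F a = a})
    ((Twisted.finite (φ := frobenius F) π.finite_lines β).subset fun T hT => hT.1) hR f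
    (by
      rintro ℓ ⟨h1, h2, h3⟩
      refine huniq h2 (fun b => ?_) (hf ℓ h3)
      have := (orthogonal_frobenius F).2 (hf ℓ h3 (β.symm b))
      rwa [h1, Equiv.apply_symm_apply] at this)
    (k := (Fintype.card F : ℤ) ^ 3 - Fintype.card F) (by
      intro a ha
      rw [← card_lines_through hodd a ha β]
      congr 2
      ext ℓ
      constructor
      · rintro ⟨⟨h1, h2, h3⟩, h4⟩
        exact ⟨h1, h2, h4 ▸ hf ℓ h3⟩
      · rintro ⟨h1, h2, h3⟩
        exact ⟨⟨h1, h2, a, h3⟩, huniq h2 (hf ℓ ⟨a, h3⟩) h3⟩)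
  rw [h2]
  congr 1
  have h3 : ({a : Plane K | frobenius F a = a}.ncard) = _ := π.ncard_points 1 one_pos
  rw [h3]
  simp [hπ, projectivePlane]

/-- Six points on three concurrent lines, permuted by Frobenius, are given by the common point and
the lines, and by a sextuple of scalars permuted by Frobenius. -/
theorem concCount_blockSyntheme (hodd : Odd (Fintype.card F)) {ρ : Perm (Fin 6)} {β : Perm (Fin 3)}
    (hβ : ∀ j, block (ρ j) = β (block j)) (C : (Fin 6 → Plane K) → Prop) (p : K → Prop)
    (hC : ∀ {o w} (h : IsFrame (K := K) o w) {u}, IsTransverse u → (C (h.point u) ↔ p (∑ j, u j))) :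
    (projectivePlane F K hodd).concCount ρ C blockSyntheme =
      ((Fintype.card F : ℤ) ^ 2 + Fintype.card F + 1) *
          ((Fintype.card F : ℤ) ^ 3 - Fintype.card F) * transverseCount F ρ p := by
  set π := projectivePlane F K hodd with hπ
  have h1 : ∀ T : Fin 6 → Plane K, ∃ ℓ : Fin 3 → Plane K, π.Concurrent T blockSyntheme →
      (∃ a : Plane K, ∀ b, a.orthogonal (ℓ b)) ∧ ∀ j, (T j).orthogonal (ℓ (block j)) := fun T => by
    by_cases h : π.Concurrent T blockSyntheme
    · obtain ⟨a, ℓ, h1, h2⟩ := (concurrent_blockSyntheme_iff π T).1 h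
      exact ⟨ℓ, fun _ => ⟨⟨a, h1⟩, h2⟩⟩
    · exact ⟨fun _ => T 0, fun h' => absurd h' h⟩
  choose g hg using h1
  have hpair : ∀ b : Fin 3, ∃ i j, i ≠ j ∧ block i = b ∧ block j = b := by decide
  have hout : ∀ {T : Fin 6 → Plane K} {ℓ : Fin 3 → Plane K}, π.Arc T →
      (∀ j, (T j).orthogonal (ℓ (block j))) → ∀ j b, b ≠ block j → ¬ (T j).orthogonal (ℓ b) := by
    intro T ℓ hT hℓ j b hb
    obtain ⟨i, k, hik, rfl, hk⟩ := hpair b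
    exact hT.2 (ℓ (block i)) i k j hik (fun h => hb (by rw [h])) (fun h => hb (by rw [← hk, h]))
      (hℓ i) (by rw [← hk]; exact hℓ k)
  have huniq : ∀ {T : Fin 6 → Plane K} {ℓ ℓ' : Fin 3 → Plane K}, Injective T →
      (∀ j, (T j).orthogonal (ℓ (block j))) → (∀ j, (T j).orthogonal (ℓ' (block j))) → ℓ = ℓ' := by
    intro T ℓ ℓ' hT h1 h2
    funext b
    obtain ⟨i, j, hij, rfl, hj⟩ := hpair b
    exact π.line_eq (hT.ne hij) (h1 i) (hj ▸ h1 j) (h2 i) (hj ▸ h2 j)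
  rw [← card_concurrent_lines (K := K) hodd β]
  refine ncard_eq_mul_of_fiber ((Twisted.finite π.finite_points ρ).subset fun T hT => hT.1)
    ((Twisted.finite (φ := frobenius F) π.finite_lines β).subset fun T hT => hT.1) g ?_ ?_
  · rintro T ⟨hT, ⟨hA, -⟩, hc⟩
    obtain ⟨h1, h2⟩ := hg T hc
    refine ⟨?_, fun b c hbc => ?_, h1⟩
    · have h3 : ∀ j, (T j).orthogonal (frobenius F (g T (β.symm (block j)))) := fun j => by
        have h4 := (orthogonal_frobenius F).2 (h2 (ρ.symm j))
        have h5 : block (ρ.symm j) = β.symm (block j) := by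
          rw [Equiv.eq_symm_apply, ← hβ, Equiv.apply_symm_apply]
        rw [h5, show frobenius F (T (ρ.symm j)) = T (ρ (ρ.symm j)) from hT _,
          Equiv.apply_symm_apply] at h4
        exact h4
      have h4 := huniq (ℓ := fun b => frobenius F (g T (β.symm b))) hA.1 h3 h2
      intro b
      have h5 := congrFun h4 (β b)
      rwa [Equiv.symm_apply_apply] at h5
    · by_contra hne
      obtain ⟨i, j, hij, rfl, -⟩ := hpair b
      exact hout hA h2 i c (Ne.symm hne) (hbc ▸ h2 i)
  · rintro ℓ ⟨hℓ, hinj, a, ha⟩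
    have hfix : frobenius F a = a := by
      have h3 : ∀ b, (frobenius F a).orthogonal (ℓ b) := fun b => by
        have := (orthogonal_frobenius F).2 (ha (β.symm b))
        rwa [show frobenius F (ℓ (β.symm b)) = ℓ (β (β.symm b)) from hℓ _,
          Equiv.apply_symm_apply] at this
      exact π.point_eq (hinj.ne (show (0 : Fin 3) ≠ 1 by decide)) (h3 0) (ha 0) (h3 1) (ha 1)
    obtain ⟨o, w, h, ho, hw, hl⟩ := exists_isFrame F hℓ hinj hfix ha
    rw [transverseCount, Nat.cast_inj]
    symm
    have hon : ∀ u j, (h.point u j).orthogonal (ℓ (block j)) := fun u j => by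
      obtain ⟨x, hx, hxl, hox, hwx⟩ := hl (block j)
      rw [hxl, h.point_orthogonal, hwx, hox, mul_zero, add_zero]
    refine Set.ncard_congr (fun u _ => h.point u) ?_ (fun u u' _ _ he => h.point_injective he) ?_
    · rintro u ⟨h1, h2, h3⟩
      have hA : π.Arc (h.point u) := (h.arc_point_iff u).2 h2
      have hc : π.Concurrent (h.point u) blockSyntheme :=
        (concurrent_blockSyntheme_iff π _).2 ⟨a, ℓ, ha, hon u⟩
      exact ⟨⟨(h.point_twisted_iff hβ ho hw u).2 h1, ⟨hA, (hC h h2).2 h3⟩, hc⟩,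
        huniq hA.1 (hg _ hc).2 (hon u)⟩
    · rintro T ⟨⟨hT, ⟨hA, hCT⟩, hc⟩, rfl⟩
      obtain ⟨u, rfl⟩ := h.exists_eq_point hl (hg T hc).2 (hout hA (hg T hc).2)
      have h2 : IsTransverse u := (h.arc_point_iff u).1 hA
      exact ⟨u, ⟨(h.point_twisted_iff hβ ho hw u).1 hT, h2, (hC h h2).1 hCT⟩, rfl⟩

theorem concCount_blockSyntheme_true (hodd : Odd (Fintype.card F)) {ρ : Perm (Fin 6)} {β : Perm (Fin 3)}
    (hβ : ∀ j, block (ρ j) = β (block j)) :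
    (projectivePlane F K hodd).concCount ρ (fun _ => True) blockSyntheme =
      ((Fintype.card F : ℤ) ^ 2 + Fintype.card F + 1) * ((Fintype.card F : ℤ) ^ 3 - Fintype.card F) *
        transverseCount F ρ (fun _ : K => True) :=
  concCount_blockSyntheme hodd hβ _ _ fun _ _ _ => Iff.rfl

theorem concCount_blockSyntheme_onConic (hodd : Odd (Fintype.card F)) {ρ : Perm (Fin 6)} {β : Perm (Fin 3)}
    (hβ : ∀ j, block (ρ j) = β (block j)) :
    (projectivePlane F K hodd).concCount ρ (planeConics K F hodd).OnConic blockSyntheme =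
      ((Fintype.card F : ℤ) ^ 2 + Fintype.card F + 1) * ((Fintype.card F : ℤ) ^ 3 - Fintype.card F) *
        transverseCount F ρ (fun s : K => s = 0) := by
  refine concCount_blockSyntheme hodd hβ _ _ fun h u hu => ?_
  rw [← h.onConic_point_iff hu]
  constructor
  · rintro ⟨_, ⟨c, rfl, hc⟩, hT⟩
    exact ⟨c, hc, hT⟩
  · rintro ⟨c, hc, hT⟩
    exact ⟨_, ⟨c, rfl, hc⟩, hT⟩

end Concurrent

/-! ### The synthemes preserved by a permutation of six indices -/

theorem FrobeniusPlane.concurrent_comp_iff {P L ι : Type*} [DecidableEq ι] (π : FrobeniusPlane P L)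
    (e : Fin 6 ≃ ι) (T : ι → P) : π.Concurrent (T ∘ e) blockSyntheme ↔
      π.Concurrent T {{e 0, e 1}, {e 2, e 3}, {e 4, e 5}} := by
  simp only [FrobeniusPlane.Concurrent, FrobeniusPlane.OnLineOf, blockSyntheme, mem_insert,
    mem_singleton, forall_eq_or_imp, forall_eq, comp_apply]

section SynthemeSums

/-- The syntheme of six indices with a given labelling. -/
def synthemeOf (f : Fin 6 → Fin 6) : Finset (Finset (Fin 6)) :=
  {{f 0, f 1}, {f 2, f 3}, {f 4, f 5}}

/-- A labelling of each of the fifteen synthemes of six indices. -/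
def standardLabels : Fin 15 → Fin 6 → Fin 6 :=
  ![![0, 1, 2, 3, 4, 5], ![0, 1, 2, 4, 3, 5], ![0, 1, 2, 5, 3, 4],
    ![0, 2, 1, 3, 4, 5], ![0, 2, 1, 4, 3, 5], ![0, 2, 1, 5, 3, 4],
    ![0, 3, 1, 2, 4, 5], ![0, 3, 1, 4, 2, 5], ![0, 3, 1, 5, 2, 4],
    ![0, 4, 1, 2, 3, 5], ![0, 4, 1, 3, 2, 5], ![0, 4, 1, 5, 2, 3],
    ![0, 5, 1, 2, 3, 4], ![0, 5, 1, 3, 2, 4], ![0, 5, 1, 4, 2, 3]]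

theorem mapSet_eq_image {ρ : Perm (Fin 6)} {r : Fin 6 → Fin 6} (hr : ∀ i, ρ i = r i)
    (d : Finset (Fin 6)) : mapSet ρ d = d.image r := by
  rw [← show ⇑ρ = r from funext hr]
  exact map_eq_image _ _

set_option maxRecDepth 100000 in
theorem mem_synthemes_iff {ρ : Perm (Fin 6)} {r : Fin 6 → Fin 6} (hr : ∀ i, ρ i = r i)
    (E : Finset (Finset (Fin 6))) :
    E ∈ synthemes ρ ↔ (∃ k, E = synthemeOf (standardLabels k)) ∧ ∀ d ∈ E, d.image r ∈ E := by
  have h : ((duads (Fin 6)).powersetCard 3).filter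
      (fun E => ∀ d ∈ E, ∀ e ∈ E, d ≠ e → Disjoint d e) =
        univ.image fun k => synthemeOf (standardLabels k) := by
    decide +kernel
  have h2 : E ∈ ((duads (Fin 6)).powersetCard 3).filter
      (fun E => ∀ d ∈ E, ∀ e ∈ E, d ≠ e → Disjoint d e) ↔
        ∃ k, E = synthemeOf (standardLabels k) := by
    rw [h, mem_image]
    simp only [mem_univ, true_and, eq_comm]
  rw [← h2, synthemes, mem_filter, mem_filter, and_assoc]
  refine and_congr_right fun _ => and_comm.trans (and_congr_right fun _ => ?_)
  simp only [mapSet_eq_image hr]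

variable {F K : Type*} [Field F] [Fintype F] [Field K] [Algebra F K] [IsAlgClosed K]

/-- The signed counts of concurrent synthemes, over all arcs permuted by Frobenius according to `ρ`
and over those on conics, are `(q ^ 2 + q + 1) * (q ^ 3 - q) * (q ^ 2 * (q - 1))` times the values of
`s` and `t` at `q`. -/
def ConcSums (K : Type*) [Field K] [Algebra F K] [IsAlgClosed K] (hodd : Odd (Fintype.card F))
    {n : ℕ} (ρ : Perm (Fin n)) (s t : ℤ → ℤ) : Prop :=
  ∀ q : ℤ, q = Fintype.card F → (projectivePlane F K hodd).concSum ρ (fun _ => True) =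
      (q ^ 2 + q + 1) * (q ^ 3 - q) * (q ^ 2 * (q - 1)) * s q ∧
    (projectivePlane F K hodd).concSum ρ (planeConics K F hodd).OnConic =
      (q ^ 2 + q + 1) * (q ^ 3 - q) * (q ^ 2 * (q - 1)) * t q

/-- The permutation of six indices with a given table of values and inverse table. -/
abbrev tablePerm (f g : Fin 6 → Fin 6) (hfg : ∀ i, g (f i) = i ∧ f (g i) = i := by decide) :
    Perm (Fin 6) := ⟨f, g, fun i => (hfg i).1, fun i => (hfg i).2⟩

/-- The signed count of concurrent synthemes, when all preserved synthemes are obtained by relabelling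
from the standard one with the permutation `ρ₁` or `ρ₂` of six indices, according to the sign. -/
theorem concSums_of_transverseCounts (hodd : Odd (Fintype.card F)) {ρ : Perm (Fin 6)}
    {n : ℕ} (r : Fin 6 → Fin 6) (W : Fin n → Fin 6 → Fin 6) {ρ₁ ρ₂ : Perm (Fin 6)}
    (m₁ m₂ : ℕ) {k₁ v₁ k₂ v₂ s t : ℤ → ℤ} (hk₁ : TransverseCounts F K ρ₁ k₁ v₁)
    (hk₂ : TransverseCounts F K ρ₂ k₂ v₂) (hr : ∀ i, ρ i = r i := by decide +kernel)
    (h₁ : ∃ β : Perm (Fin 3), ∀ j, block (ρ₁ j) = β (block j) := by decide)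
    (h₂ : ∃ β : Perm (Fin 3), ∀ j, block (ρ₂ j) = β (block j) := by decide)
    (hE : ∀ k, (∀ d ∈ synthemeOf (standardLabels k), d.image r ∈ synthemeOf (standardLabels k)) →
      ∃ i, synthemeOf (standardLabels k) = synthemeOf (W i) ∧ Injective (W i) ∧
        ((concurrencySign (synthemeOf (W i)) (image r) = 1 ∧ ∀ j, W i (ρ₁ j) = r (W i j)) ∨
          (concurrencySign (synthemeOf (W i)) (image r) = -1 ∧
            ∀ j, W i (ρ₂ j) = r (W i j))) := by decide +kernel)
    (hm₁ : {E ∈ univ.image fun k => synthemeOf (standardLabels k) | (∀ d ∈ E, d.image r ∈ E) ∧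
      concurrencySign E (image r) = 1}.card = m₁ := by decide +kernel)
    (hm₂ : {E ∈ univ.image fun k => synthemeOf (standardLabels k) | (∀ d ∈ E, d.image r ∈ E) ∧
      concurrencySign E (image r) = -1}.card = m₂ := by decide +kernel)
    (hs : ∀ q, s q = m₁ * k₁ q - m₂ * k₂ q := by intro q; push_cast; ring)
    (ht : ∀ q, t q = m₁ * v₁ q - m₂ * v₂ q := by intro q; push_cast; ring) :
    ConcSums K hodd ρ s t := by
  obtain ⟨β₁, hβ₁⟩ := h₁
  obtain ⟨β₂, hβ₂⟩ := h₂
  have hmap : mapSet ρ = image r := funext fun d => mapSet_eq_image hr d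
  have hsyn : synthemes ρ = {E ∈ univ.image fun k => synthemeOf (standardLabels k) |
      ∀ d ∈ E, d.image r ∈ E} := by
    ext E
    rw [mem_synthemes_iff hr, mem_filter, mem_image]
    simp only [mem_univ, true_and, eq_comm]
  have key : ∀ (C : (Fin 6 → Plane K) → Prop) (C' : (Fin 6 → Plane K) → Prop) (k₁ k₂ : ℤ),
      (∀ (e : Fin 6 ≃ Fin 6) (T : Fin 6 → Plane K), C' (T ∘ e) ↔ C T) →
      (projectivePlane F K hodd).concCount ρ₁ C' blockSyntheme = k₁ →
      (projectivePlane F K hodd).concCount ρ₂ C' blockSyntheme = k₂ →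
      (projectivePlane F K hodd).concSum ρ C = m₁ * k₁ - m₂ * k₂ := by
    intro C C' k₁ k₂ hC hk₁ hk₂
    have hcongr : ∀ (ρ' : Perm (Fin 6)) (e : Fin 6 ≃ Fin 6), (∀ i, e (ρ' i) = ρ (e i)) →
        (projectivePlane F K hodd).concCount ρ C (synthemeOf e) =
          (projectivePlane F K hodd).concCount ρ' C' blockSyntheme := by
      intro ρ' e he
      refine congrArg Nat.cast (Twisted.ncard_congr e he _ _ fun T => ?_).symm
      rw [FrobeniusPlane.arc_comp_iff, hC, FrobeniusPlane.concurrent_comp_iff]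
      rfl
    have h : ∀ E ∈ synthemes ρ, concurrencySign E (mapSet ρ) *
        (projectivePlane F K hodd).concCount ρ C E =
        (if concurrencySign E (mapSet ρ) = 1 then k₁ else 0) -
          (if concurrencySign E (mapSet ρ) = -1 then k₂ else 0) := by
      intro E hE'
      obtain ⟨⟨k, rfl⟩, hst⟩ := (mem_synthemes_iff hr E).1 hE'
      obtain ⟨i, he, hf, h⟩ := hE k hst
      obtain ⟨e, hew⟩ : ∃ e : Fin 6 ≃ Fin 6, ⇑e = W i :=
        ⟨Equiv.ofBijective _ (Finite.injective_iff_bijective.1 hf), rfl⟩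
      rw [hmap, he]
      simp only [← hew] at h ⊢
      rcases h with ⟨hs, hρ⟩ | ⟨hs, hρ⟩
      · rw [hs, hcongr ρ₁ e fun i => (hρ i).trans (hr _).symm, hk₁]
        simp
      · rw [hs, hcongr ρ₂ e fun i => (hρ i).trans (hr _).symm, hk₂]
        simp
    rw [FrobeniusPlane.concSum, sum_congr rfl h, sum_sub_distrib, ← sum_filter,
      ← sum_filter, sum_const, sum_const, nsmul_eq_mul, nsmul_eq_mul, hmap,
      hsyn, filter_filter, filter_filter, hm₁, hm₂]
  rintro q rfl
  rw [hs, ht]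
  constructor
  · rw [key (fun _ => True) (fun _ => True) _ _ (fun _ _ => Iff.rfl)
      (concCount_blockSyntheme_true hodd hβ₁) (concCount_blockSyntheme_true hodd hβ₂), hk₁.1, hk₂.1]
    ring
  · rw [key _ _ _ _ ((planeConics K F hodd).onConic_comp_iff)
      (concCount_blockSyntheme_onConic hodd hβ₁) (concCount_blockSyntheme_onConic hodd hβ₂), hk₁.2,
      hk₂.2]
    ring

/-- Permutations that preserve no syntheme. -/
theorem concSums_zero (hodd : Odd (Fintype.card F)) {ρ : Perm (Fin 6)}
    (r : Fin 6 → Fin 6) (hr : ∀ i, ρ i = r i := by decide +kernel)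
    (hE : ∀ k, ¬ ∀ d ∈ synthemeOf (standardLabels k), d.image r ∈ synthemeOf (standardLabels k) := by
      decide +kernel) :
    ConcSums K hodd ρ (fun _ => 0) (fun _ => 0) := by
  have h : ∀ C, (projectivePlane F K hodd).concSum ρ C = 0 := fun C => ?_
  · exact fun q _ => by simp [h]
  refine sum_eq_zero fun E hE' => ?_
  obtain ⟨⟨k, rfl⟩, hst⟩ := (mem_synthemes_iff hr E).1 hE'
  exact absurd hst (hE k)

theorem concSums_one_one_one_one_one_one (hodd : Odd (Fintype.card F)) :
    ConcSums K hodd (rot [1, 1, 1, 1, 1, 1])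
      (fun q => 15 * (q - 3) ^ 2 * (q - 4))
      (fun q => 15 * (q - 3) ^ 2) :=
  have h := transverseCounts_id F (two_ne_zero_of_odd K hodd)
    (ρ := tablePerm ![0, 1, 2, 3, 4, 5] ![0, 1, 2, 3, 4, 5]) rfl
  concSums_of_transverseCounts hodd ![0, 1, 2, 3, 4, 5]
    standardLabels 15 0 h h

theorem concSums_one_one_one_one_two (hodd : Odd (Fintype.card F)) :
    ConcSums K hodd (rot [1, 1, 1, 1, 2])
      (fun q => 3 * (q - 1) ^ 2 * q)
      (fun q => 3 * (q - 1) ^ 2) :=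
  have h := transverseCounts_swap F (two_ne_zero_of_odd K hodd)
    (ρ := tablePerm ![1, 0, 2, 3, 4, 5] ![1, 0, 2, 3, 4, 5]) rfl
  concSums_of_transverseCounts hodd ![0, 1, 2, 3, 5, 4]
    ![![4, 5, 0, 1, 2, 3], ![4, 5, 0, 2, 1, 3], ![4, 5, 0, 3, 1, 2]] 3 0 h h

theorem concSums_one_one_two_two (hodd : Odd (Fintype.card F)) :
    ConcSums K hodd (rot [1, 1, 2, 2])
      (fun q => ((q - 3) * q * (q - 1) + 2 * (q - 1) * (q - 2)) - 2 * ((q - 1) * (q - 2) * (q - 3) + (q - 3) * (q - 4) + (q - 1) * (q - 2)))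
      (fun q => (q - 1) ^ 2 - 2 * ((q - 1) * (q - 3) + (q - 3) + (q - 1))) :=
  concSums_of_transverseCounts hodd ![0, 1, 3, 2, 5, 4]
    ![![2, 3, 4, 5, 0, 1], ![2, 4, 3, 5, 0, 1], ![2, 5, 3, 4, 0, 1]] 1 2
    (transverseCounts_swap_swap F (two_ne_zero_of_odd K hodd)
      (ρ := tablePerm ![1, 0, 3, 2, 4, 5] ![1, 0, 3, 2, 4, 5]) rfl)
    (transverseCounts_exchange F (two_ne_zero_of_odd K hodd)
      (ρ := tablePerm ![2, 3, 0, 1, 4, 5] ![2, 3, 0, 1, 4, 5]) rfl)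

theorem concSums_two_two_two (hodd : Odd (Fintype.card F)) :
    ConcSums K hodd (rot [2, 2, 2])
      (fun q => ((q - 3) * (q ^ 2 - q - 4) + 2 * (q ^ 2 - q - 2)) - 6 * ((q - 1) * (q ^ 2 - q - 2) + (q ^ 2 - q) + (q ^ 2 - q - 2)))
      (fun q => (q - 3) ^ 2 - 6 * ((q - 1) * (q - 3) + (q - 3) + (q - 1))) :=
  concSums_of_transverseCounts hodd ![1, 0, 3, 2, 5, 4]
    ![![0, 1, 2, 3, 4, 5], ![2, 4, 3, 5, 0, 1], ![2, 5, 3, 4, 0, 1],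
      ![0, 2, 1, 3, 4, 5], ![0, 3, 1, 2, 4, 5], ![0, 4, 1, 5, 2, 3], ![0, 5, 1, 4, 2, 3]] 1 6
    (transverseCounts_swap_swap_swap F (two_ne_zero_of_odd K hodd)
      (ρ := tablePerm ![1, 0, 3, 2, 5, 4] ![1, 0, 3, 2, 5, 4]) rfl)
    (transverseCounts_exchange_swap F (two_ne_zero_of_odd K hodd)
      (ρ := tablePerm ![2, 3, 0, 1, 5, 4] ![2, 3, 0, 1, 5, 4]) rfl)

theorem concSums_one_one_four (hodd : Odd (Fintype.card F)) :
    ConcSums K hodd (rot [1, 1, 4])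
      (fun q => -(q + 1) * q * (q - 1))
      (fun q => -(q + 1) * (q - 1)) :=
  have h := transverseCounts_quartic F (two_ne_zero_of_odd K hodd)
    (ρ := tablePerm ![2, 3, 1, 0, 4, 5] ![3, 2, 0, 1, 4, 5]) rfl
  concSums_of_transverseCounts hodd ![0, 1, 3, 4, 5, 2]
    ![![2, 4, 3, 5, 0, 1]] 0 1 h h

theorem concSums_two_four (hodd : Odd (Fintype.card F)) :
    ConcSums K hodd (rot [2, 4])
      (fun q => -(q + 1) * (q ^ 2 - q))
      (fun q => -(q + 1) * (q - 1)) :=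
  have h := transverseCounts_quartic_swap F (two_ne_zero_of_odd K hodd)
    (ρ := tablePerm ![2, 3, 1, 0, 5, 4] ![3, 2, 0, 1, 5, 4]) rfl
  concSums_of_transverseCounts hodd ![1, 0, 3, 4, 5, 2]
    ![![2, 4, 3, 5, 0, 1]] 0 1 h h

theorem concSums_three_three (hodd : Odd (Fintype.card F)) :
    ConcSums K hodd (rot [3, 3])
      (fun q => 3 * (q ^ 3 - q ^ 2 - 3))
      (fun q => 3 * q ^ 2) :=
  have h := transverseCounts_three_three F (two_ne_zero_of_odd K hodd)
    (ρ := tablePerm ![2, 3, 4, 5, 0, 1] ![4, 5, 0, 1, 2, 3]) rfl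
  concSums_of_transverseCounts hodd ![1, 2, 0, 4, 5, 3]
    ![![0, 3, 1, 4, 2, 5], ![0, 4, 1, 5, 2, 3], ![0, 5, 1, 3, 2, 4]] 3 0 h h

theorem concSums_six (hodd : Odd (Fintype.card F)) :
    ConcSums K hodd (rot [6])
      (fun q => (q ^ 3 + q ^ 2 - 1))
      (fun q => q ^ 2) :=
  have h := transverseCounts_six F (two_ne_zero_of_odd K hodd)
    (ρ := tablePerm ![2, 3, 4, 5, 1, 0] ![5, 4, 0, 1, 2, 3]) rfl
  concSums_of_transverseCounts hodd ![1, 2, 3, 4, 5, 0]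
    ![![0, 3, 1, 4, 2, 5]] 1 0 h h

theorem concSums_one_five (hodd : Odd (Fintype.card F)) :
    ConcSums K hodd (rot [1, 5]) (fun _ => 0) (fun _ => 0) :=
  concSums_zero hodd ![0, 2, 3, 4, 5, 1]

theorem concSums_one_two_three (hodd : Odd (Fintype.card F)) :
    ConcSums K hodd (rot [1, 2, 3]) (fun _ => 0) (fun _ => 0) :=
  concSums_zero hodd ![0, 2, 1, 4, 5, 3]

theorem concSums_one_one_one_three (hodd : Odd (Fintype.card F)) :
    ConcSums K hodd (rot [1, 1, 1, 3]) (fun _ => 0) (fun _ => 0) :=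
  concSums_zero hodd ![0, 1, 2, 4, 5, 3]

end SynthemeSums

/-! ### Lang's theorem and the action of the projective linear group -/

section Lang

variable (F : Type*) {K : Type*} [Field F] [Fintype F] [Field K] [Algebra F K]

open Matrix

/-- The orbit of a vector under a semilinear injective map stays within the vectors over a finite
field, hence is periodic. -/
theorem mem_periodicPts_frobeniusVec_vecMul [Algebra.IsAlgebraic F K] (G : GL (Fin 3) K)
    (v : Fin 3 → K) : v ∈ periodicPts fun w => frobeniusVec F w ᵥ* G.1 := by
  let S : Set K := Set.range (fun p : Fin 3 × Fin 3 => G.1 p.1 p.2) ∪ Set.range v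
  let L := IntermediateField.adjoin F S
  have : FiniteDimensional F L :=
    IntermediateField.finiteDimensional_adjoin fun x _ => Algebra.IsIntegral.isIntegral x
  have : Finite L := Module.finite_of_finite F
  have hG : ∀ i j, G.1 i j ∈ L := fun i j =>
    IntermediateField.subset_adjoin F S (.inl ⟨(i, j), rfl⟩)
  let A := {w : Fin 3 → K // ∀ i, w i ∈ L}
  have hA : Finite A := Finite.of_injective (fun (w : A) i => (⟨w.1 i, w.2 i⟩ : L)) fun w w' h =>
    Subtype.ext (funext fun i => congrArg Subtype.val (congrFun h i))
  let ψ : A → A := fun w => ⟨frobeniusVec F w.1 ᵥ* G.1, fun i => by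
    rw [vecMul, dotProduct]
    exact sum_mem fun j _ => mul_mem (pow_mem (w.2 j) (Fintype.card F)) (hG j i)⟩
  have hψ : Injective ψ := fun w w' h => Subtype.ext (frobeniusVec_injective F
    (Matrix.vecMul_injective_of_isUnit G.isUnit (congrArg Subtype.val h)))
  obtain ⟨n, hn, h⟩ := hψ.mem_periodicPts
    ⟨v, fun i => IntermediateField.subset_adjoin F S (.inr ⟨i, rfl⟩)⟩
  refine ⟨n, hn, ?_⟩
  have hs : Semiconj (Subtype.val : A → Fin 3 → K) ψ
      fun w => frobeniusVec F w ᵥ* G.1 := fun w => rfl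
  exact h.map hs

/-- The traces `∑ t ^ q ^ i • φ^[i] e` of the multiples of a vector of period `M` are fixed vectors, and
a polynomial of degree less than `q ^ M` has fewer than `q ^ M` zeros. -/
theorem eq_zero_of_fixed_dotProduct [IsAlgClosed K] [Algebra.IsAlgebraic F K] (G : GL (Fin 3) K)
    {x : Fin 3 → K} (hx : ∀ v, frobeniusVec F v ᵥ* G.1 = v → v ⬝ᵥ x = 0) : x = 0 := by
  funext j
  set φ : (Fin 3 → K) → Fin 3 → K := fun w => frobeniusVec F w ᵥ* G.1 with hφ
  obtain ⟨M, hM, he⟩ := mem_periodicPts_frobeniusVec_vecMul F G (Pi.single j 1)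
  set e : Fin 3 → K := Pi.single j 1
  have he : φ^[M] e = e := he
  set q := Fintype.card F
  have hq : 1 < q := Fintype.one_lt_card
  have hroot : ∀ t : K, t ^ q ^ M = t →
      ∑ i ∈ range M, t ^ q ^ i * (φ^[i] e ⬝ᵥ x) = 0 := by
    intro t ht
    have h := hx (∑ i ∈ range M, t ^ q ^ i • φ^[i] e) ?_
    · rw [sum_dotProduct] at h
      simpa only [smul_dotProduct, smul_eq_mul] using h
    · have h1 : ∀ i, frobeniusVec F (t ^ q ^ i • φ^[i] e) ᵥ* G.1 = t ^ q ^ (i + 1) • φ^[i + 1] e := by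
        intro i
        rw [LinearMap.map_smulₛₗ, smul_vecMul, iterate_succ_apply', pow_succ q i, pow_mul]
        rfl
      rw [map_sum, Matrix.sum_vecMul, sum_congr rfl fun i _ => h1 i]
      have h2 := sum_range_succ (fun i => t ^ q ^ i • φ^[i] e) M
      rw [sum_range_succ'] at h2
      rw [pow_zero, pow_one, iterate_zero_apply, ht, he] at h2
      exact add_right_cancel h2
  set c : ℕ → K := fun i => φ^[i] e ⬝ᵥ x
  let p : Polynomial K := ∑ i ∈ range M, Polynomial.C (c i) * Polynomial.X ^ q ^ i
  have hS := ncard_frobHom_fixed F (K := K) M hM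
  have hfin : {z : K | frobHom F M z = z}.Finite :=
    Set.finite_of_ncard_pos (hS ▸ pow_pos Fintype.card_pos M)
  have hp : p = 0 := by
    refine Polynomial.eq_zero_of_natDegree_lt_card_of_eval_eq_zero' p hfin.toFinset (fun t ht => ?_) ?_
    · have ht : frobHom F M t = t := by simpa using ht
      rw [frobHom_apply] at ht
      rw [Polynomial.eval_finsetSum, ← hroot t ht]
      exact sum_congr rfl fun i _ => by
        rw [Polynomial.eval_C_mul, Polynomial.eval_X_pow, mul_comm]
    · rw [← Set.ncard_eq_toFinset_card _ hfin, hS]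
      have h3 : p.natDegree ≤ q ^ (M - 1) := by
        refine Polynomial.natDegree_sum_le_of_forall_le _ _ fun i hi => ?_
        refine (Polynomial.natDegree_C_mul_X_pow_le _ _).trans
          (Nat.pow_le_pow_right (by omega) ?_)
        have := mem_range.1 hi
        omega
      exact h3.trans_lt (Nat.pow_lt_pow_right hq (by omega))
  have h4 : p.coeff 1 = c 0 := by
    rw [Polynomial.finsetSum_coeff, sum_eq_single_of_mem 0 (mem_range.2 hM)]
    · simp
    · intro i _ hi
      rw [Polynomial.coeff_C_mul_X_pow, if_neg]
      exact (Nat.one_lt_pow hi hq).ne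
  rw [hp, Polynomial.coeff_zero] at h4
  have h5 : c 0 = x j := by simp [c, e]
  rw [← h5, ← h4]
  rfl

/-- Lang's theorem for `GL(3)`. -/
theorem exists_map_mul_eq [IsAlgClosed K] [Algebra.IsAlgebraic F K] (G : GL (Fin 3) K) :
    ∃ H : GL (Fin 3) K,
      GeneralLinearGroup.map (FiniteField.frobeniusAlgHom F K : K →+* K) H * G = H := by
  -- The rows of `H` are vectors fixed by the semilinear map `v ↦ F v * G`; such vectors span the space.
  set S : Set (Fin 3 → K) := {v | frobeniusVec F v ᵥ* G.1 = v}
  have hspan : Submodule.span K S = ⊤ := by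
    by_contra h
    obtain ⟨f, hf, hle⟩ := Submodule.exists_le_ker_of_lt_top _ (lt_top_iff_ne_top.2 h)
    have hfx : ∀ v, f v = v ⬝ᵥ fun i => f (Pi.single i 1) := fun v => by
      conv_lhs => rw [pi_eq_sum_univ' v, map_sum]
      exact sum_congr rfl fun i _ => by
        rw [map_smul, smul_eq_mul]
    have hx := eq_zero_of_fixed_dotProduct F G (x := fun i => f (Pi.single i 1)) fun v hv => by
      rw [← hfx]
      exact hle (Submodule.subset_span hv)
    exact hf (LinearMap.ext fun v => by rw [hfx, hx, dotProduct_zero, LinearMap.zero_apply])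
  obtain ⟨f, hf, -, hli⟩ := Submodule.exists_fun_fin_finrank_span_eq K S
  have h3 : Module.finrank K (Submodule.span K S) = 3 := by rw [hspan, finrank_top]; simp
  let e : Fin 3 ≃ Fin (Module.finrank K (Submodule.span K S)) := finCongr h3.symm
  have hdet := (linearIndependent_iff_det_ne_zero _).1 (hli.comp e e.injective)
  refine ⟨GeneralLinearGroup.mkOfDetNeZero _ hdet, Units.ext (funext fun i => ?_)⟩
  exact hf (e i)

end Lang

section Torsor

variable (F : Type*) {K : Type*} [Field F] [Fintype F] [Field K] [Algebra F K]

open Matrix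

theorem frobenius_mk_smul (G : GL (Fin 3) K) (P : Plane K) :
    frobenius F (ProjGenLinGroup.mk G • P) = ProjGenLinGroup.mk (GeneralLinearGroup.map
      (FiniteField.frobeniusAlgHom F K : K →+* K) G) • frobenius F P := by
  induction P using Projectivization.ind with
  | h v hv =>
    have key : frobeniusVec F (G • v) = GeneralLinearGroup.map
        (FiniteField.frobeniusAlgHom F K : K →+* K) G • frobeniusVec F v := by
      funext i
      exact RingHom.map_mulVec (FiniteField.frobeniusAlgHom F K : K →+* K) G.1 v i
    simp only [frobenius, Projectivization.PGL.mk_smul_mk, Projectivization.map_mk, key]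

theorem frobeniusPerm_mk_smul (σ : Perm (Fin 7)) (G : GL (Fin 3) K) (T : Septuple K) :
    frobeniusPerm F σ (ProjGenLinGroup.mk G • T) = ProjGenLinGroup.mk (GeneralLinearGroup.map
      (FiniteField.frobeniusAlgHom F K : K →+* K) G) • frobeniusPerm F σ T :=
  funext fun i => frobenius_mk_smul F G (T (σ i))

theorem LieOnCurve.of_smul [Infinite K] {d : ℕ} {G : GL (Fin 3) K} {T : Septuple K}
    {S : Finset (Fin 7)} (h : LieOnCurve d (ProjGenLinGroup.mk G • T) S) : LieOnCurve d T S := by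
  obtain ⟨f, hf, hd, hS⟩ := h
  let g : Fin 3 → MvPolynomial (Fin 3) K := fun i => ∑ j, MvPolynomial.C (G.1 i j) * MvPolynomial.X j
  have hg : ∀ v, MvPolynomial.eval v (MvPolynomial.aeval g f) = MvPolynomial.eval (G.1 *ᵥ v) f := by
    intro v
    have h : (MvPolynomial.eval v).comp (MvPolynomial.aeval g : MvPolynomial (Fin 3) K →ₐ[K] _).toRingHom =
        MvPolynomial.eval (G.1 *ᵥ v) := by
      refine MvPolynomial.ringHom_ext (fun c => by simp) fun i => ?_
      simp [g, mulVec, dotProduct]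
    exact RingHom.congr_fun h f
  have hd' : (MvPolynomial.aeval g f).IsHomogeneous d := by
    have := hd.aeval g (n := 1) fun i => MvPolynomial.IsHomogeneous.sum _ _ _ fun j _ => by
      simpa using (MvPolynomial.isHomogeneous_C (Fin 3) (G.1 i j)).mul (MvPolynomial.isHomogeneous_X K j)
    rwa [one_mul] at this
  refine ⟨MvPolynomial.aeval g f, fun h0 => hf (MvPolynomial.funext fun v => ?_), hd', fun i hi => ?_⟩
  · have h1 := hg (G⁻¹.1 *ᵥ v)
    rw [mulVec_mulVec, ← Units.val_mul, mul_inv_cancel, Units.val_one, one_mulVec, h0] at h1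
    rw [← h1, map_zero, map_zero]
  · have h1 := hS i hi
    rw [Pi.smul_apply] at h1
    obtain ⟨v, hv, hT⟩ := exists_rep (T i)
    rw [hT] at h1 ⊢
    rw [Projectivization.PGL.mk_smul_mk, passesThrough_mk hd] at h1
    rw [passesThrough_mk hd', hg]
    exact h1

theorem inGeneralPosition_smul [Infinite K] {T : Septuple K} (hT : InGeneralPosition T)
    (g : PGL(3, K)) : InGeneralPosition (g • T) := by
  induction g using ProjGenLinGroup.induction_on with
  | mk G => exact ⟨fun S hS h => hT.1 S hS h.of_smul, fun S hS h => hT.2 S hS h.of_smul⟩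

/-- A collineation fixing four points, no three of them collinear, is the identity. -/
theorem eq_one_of_smul_eq [IsAlgClosed K] (hodd : Odd (Fintype.card F)) {T : Septuple K}
    (hT : InGeneralPosition T) {g : PGL(3, K)} (h : g • T = T) : g = 1 := by
  have harc := (((inGeneralPosition_iff F hodd).1 hT).1).2
  induction g using ProjGenLinGroup.induction_on with
  | mk G =>
    choose v hv hTv using fun i => exists_rep (T i)
    have hl : ∀ i, ∃ c, c • v i = G.1 *ᵥ v i := fun i => by
      have h1 := congrFun h i
      rw [Pi.smul_apply, hTv, Projectivization.PGL.mk_smul_mk, Projectivization.mk_eq_mk_iff'] at h1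
      exact h1
    choose c hc using hl
    have hno : ∀ x : Fin 3 → K, x ≠ 0 → ∀ i j k, i ≠ j → i ≠ k → j ≠ k → v i ⬝ᵥ x = 0 →
        v j ⬝ᵥ x = 0 → v k ⬝ᵥ x ≠ 0 := by
      intro x hx i j k hij hik hjk hi hj hk
      refine harc (Projectivization.mk K x hx) i j k hij hik hjk ?_ ?_ ?_ <;>
      · rw [hTv]
        first
          | exact (Projectivization.orthogonal_mk (hv i) hx).2 hi
          | exact (Projectivization.orthogonal_mk (hv j) hx).2 hj
          | exact (Projectivization.orthogonal_mk (hv k) hx).2 hk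
    have hli : LinearIndependent K ![v 0, v 1, v 2] := by
      rw [linearIndependent_iff_dotProduct]
      intro x hx
      by_contra hx0
      exact hno x hx0 0 1 2 (by decide) (by decide) (by decide) (hx 0) (hx 1) (hx 2)
    obtain ⟨a, ha⟩ := exists_eq_of_linearIndependent hli (v 3)
    simp only [Matrix.cons_val] at ha
    have key : ∀ j, a j ≠ 0 ∧ a j * c 3 = a j * (![c 0, c 1, c 2] j) := by
      intro j
      obtain ⟨x, hx⟩ := exists_dotProduct_eq hli (Pi.single j 1)
      have hx0 : x ≠ 0 := by
        rintro rfl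
        simpa using hx j
      have h3 := congrArg (G.1 *ᵥ ·) ha
      simp only [mulVec_add, mulVec_smul, ← hc] at h3
      have h4 := congrArg (· ⬝ᵥ x) h3
      have h5 := congrArg (· ⬝ᵥ x) ha
      have e0 := hx 0
      have e1 := hx 1
      have e2 := hx 2
      simp only [Matrix.cons_val] at e0 e1 e2
      simp only [add_dotProduct, smul_dotProduct, smul_eq_mul, e0, e1, e2] at h4 h5
      fin_cases j
      · simp at e0 e1 e2 h4 h5 ⊢
        exact ⟨fun h6 => hno x hx0 1 2 3 (by decide) (by decide) (by decide) e1 e2 (h5.trans h6),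
          mul_eq_mul_left_iff.1 (by rw [← h4, h5, mul_comm])⟩
      · simp at e0 e1 e2 h4 h5 ⊢
        exact ⟨fun h6 => hno x hx0 0 2 3 (by decide) (by decide) (by decide) e0 e2 (h5.trans h6),
          mul_eq_mul_left_iff.1 (by rw [← h4, h5, mul_comm])⟩
      · simp at e0 e1 e2 h4 h5 ⊢
        exact ⟨fun h6 => hno x hx0 0 1 3 (by decide) (by decide) (by decide) e0 e1 (h5.trans h6),
          mul_eq_mul_left_iff.1 (by rw [← h4, h5, mul_comm])⟩
    have hc' : ∀ j, ![c 0, c 1, c 2] j = c 3 := fun j => (mul_left_cancel₀ (key j).1 (key j).2).symm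
    have hG : ∀ y, G.1 *ᵥ y = c 3 • y := fun y => by
      obtain ⟨b, rfl⟩ := exists_eq_of_linearIndependent hli y
      have e0 := hc' 0
      have e1 := hc' 1
      have e2 := hc' 2
      simp only [Matrix.cons_val] at e0 e1 e2 ⊢
      simp only [mulVec_add, mulVec_smul, ← hc, e0, e1, e2, smul_add, smul_comm (c 3)]
    have hc3 : c 3 ≠ 0 := fun h0 => by
      have h1 := congrArg (G⁻¹.1 *ᵥ ·) (hG (v 3))
      simp only [h0, zero_smul, mulVec_zero, mulVec_mulVec, ← Units.val_mul, inv_mul_cancel,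
        Units.val_one, one_mulVec] at h1
      exact hv 3 h1
    rw [show G = GeneralLinearGroup.scalar (Fin 3) (Units.mk0 _ hc3) from Units.ext
      (ext_of_mulVec_single fun i => by
        rw [hG, ← Pi.single_smul, smul_eq_mul, mul_one]
        simp), ProjGenLinGroup.mk_scalar]

theorem setOf_pow_card_eq [IsAlgClosed K] :
    {z : K | z ^ Fintype.card F = z} = Set.range (algebraMap F K) := by
  have h1 : {z : K | z ^ Fintype.card F = z} = {z : K | frobHom F 1 z = z} := by
    ext z
    rw [Set.mem_ofPred_eq, Set.mem_ofPred_eq, frobHom_apply, pow_one]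
  have h2 := ncard_frobHom_one_fixed F (K := K)
  rw [h1]
  refine (Set.eq_of_subset_of_ncard_le ?_ ?_ (finite_of_ncard_card F h2)).symm
  · rintro _ ⟨a, rfl⟩
    exact (frobHom_apply F 1 _).trans (by rw [pow_one, ← map_pow, FiniteField.pow_card])
  · rw [h2, Set.ncard_range_of_injective (algebraMap F K).injective, Nat.card_eq_fintype_card]

theorem map_algebraMap_injective (F : Type*) {K : Type*} [Field F] [Field K] [Algebra F K] :
    Injective (ProjGenLinGroup.map (algebraMap F K) : PGL(3, F) → PGL(3, K)) := by
  rw [injective_iff_map_eq_one]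
  intro g
  induction g using ProjGenLinGroup.induction_on with
  | mk G =>
    intro h
    rw [ProjGenLinGroup.map_mk, ← ProjGenLinGroup.mk_one, eq_comm, ProjGenLinGroup.mk_eq_mk_iff] at h
    obtain ⟨u, hu⟩ := h
    have h1 : ∀ i j, algebraMap F K (G.1 i j) = if i = j then u.1 else 0 := fun i j => by
      have := congrArg (fun M : GL (Fin 3) K => M.1 i j) hu
      simpa [Matrix.diagonal_apply] using this.symm
    have h00 : algebraMap F K (G.1 0 0) = u := by simpa using h1 0 0
    have hne : G.1 0 0 ≠ 0 := fun h0 => u.ne_zero (by rw [← h00, h0, map_zero])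
    rw [show G = GeneralLinearGroup.scalar (Fin 3) (Units.mk0 _ hne) from Units.ext
      (Matrix.ext fun i j => (algebraMap F K).injective (by
        rw [h1, ← h00]
        by_cases hij : i = j <;> simp [hij])), ProjGenLinGroup.mk_scalar]

/-- A collineation commuting with Frobenius has rational coordinates. -/
theorem exists_map_algebraMap_eq [IsAlgClosed K] {H : GL (Fin 3) K}
    (h : ProjGenLinGroup.mk (GeneralLinearGroup.map (FiniteField.frobeniusAlgHom F K : K →+* K) H) =
      ProjGenLinGroup.mk H) :
    ∃ g : PGL(3, F), ProjGenLinGroup.map (algebraMap F K) g = ProjGenLinGroup.mk H := by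
  obtain ⟨u, hu⟩ := ProjGenLinGroup.mk_eq_mk_iff.1 h.symm
  have hF : ∀ i j, H.1 i j ^ Fintype.card F = H.1 i j * u := fun i j => by
    have := congrArg (fun M : GL (Fin 3) K => M.1 i j) hu
    simpa using this.symm
  obtain ⟨j, hj⟩ : ∃ j, H.1 0 j ≠ 0 := by
    by_contra! h0
    exact (H.isUnit.map detMonoidHom).ne_zero (det_eq_zero_of_row_eq_zero 0 h0)
  have hmem : ∀ k l, ∃ a : F, algebraMap F K a = H.1 k l / H.1 0 j := fun k l => by
    have h1 : H.1 k l / H.1 0 j ∈ {z : K | z ^ Fintype.card F = z} := by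
      rw [Set.mem_ofPred_eq, div_pow, hF, hF, mul_div_mul_right _ _ u.ne_zero]
    rwa [setOf_pow_card_eq F] at h1
  choose a ha using hmem
  have hA : (Matrix.of a).map (algebraMap F K) = (H.1 0 j)⁻¹ • H.1 := by
    ext k l
    simp [ha, div_eq_inv_mul]
  have hdet : (Matrix.of a).det ≠ 0 := fun h0 => by
    have h1 := congrArg det hA
    rw [← RingHom.mapMatrix_apply, ← RingHom.map_det, h0, map_zero, det_smul, eq_comm, mul_eq_zero] at h1
    exact h1.elim (pow_ne_zero _ (inv_ne_zero hj)) (H.isUnit.map detMonoidHom).ne_zero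
  refine ⟨ProjGenLinGroup.mk (GeneralLinearGroup.mkOfDetNeZero _ hdet), ?_⟩
  rw [ProjGenLinGroup.map_mk, ProjGenLinGroup.mk_eq_mk_iff]
  refine ⟨Units.mk0 _ hj, Units.ext (Matrix.ext fun k l => ?_)⟩
  have h2 : algebraMap F K (a k l) * H.1 0 j = H.1 k l := by rw [ha, div_mul_cancel₀ _ hj]
  simpa [GeneralLinearGroup.mkOfDetNeZero] using h2

theorem card_PGL : (Nat.card PGL(3, F) : ℤ) = ((Fintype.card F : ℤ) ^ 2 + Fintype.card F + 1) *
    ((Fintype.card F : ℤ) ^ 3 - Fintype.card F) *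
      ((Fintype.card F : ℤ) ^ 2 * (Fintype.card F - 1)) := by
  have h1 := Subgroup.card_eq_card_quotient_mul_card_subgroup (Subgroup.center (GL (Fin 3) F))
  have h2 : Nat.card (Subgroup.center (GL (Fin 3) F)) = Fintype.card F - 1 := by
    rw [GeneralLinearGroup.center_eq_range_scalar]
    have hinj : Injective (GeneralLinearGroup.scalar (Fin 3) : Fˣ → GL (Fin 3) F) := by
      intro u u' h
      have := congrArg (fun M : GL (Fin 3) F => M.1 0 0) h
      exact Units.ext (by simpa using this)
    rw [← Nat.card_congr (MonoidHom.ofInjective hinj).toEquiv, Nat.card_units,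
      Nat.card_eq_fintype_card]
  have h3 := Matrix.card_GL_field (𝔽 := F) 3
  rw [h1, h2, Fin.prod_univ_three] at h3
  set q := Fintype.card F
  have hq : 1 < q := Fintype.one_lt_card
  have hpow : ∀ i < 3, q ^ i ≤ q ^ 3 := fun i hi => Nat.pow_le_pow_right (by omega) hi.le
  rw [← Nat.cast_inj (R := ℤ)] at h3
  simp only [Nat.cast_mul, Fin.val_zero, Fin.val_one, Fin.val_two, Nat.cast_sub (hpow 0 (by omega)),
    Nat.cast_sub (hpow 1 (by omega)), Nat.cast_sub (hpow 2 (by omega)), Nat.cast_sub hq.le,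
    Nat.cast_pow, Nat.cast_one] at h3
  have hq' : (q : ℤ) - 1 ≠ 0 := by
    have : (1 : ℤ) < q := by exact_mod_cast hq
    linarith
  refine mul_right_cancel₀ hq' ((h3 : (Nat.card PGL(3, F) : ℤ) * _ = _).trans ?_)
  ring

/-- Every fixed class contains a fixed septuple by Lang's theorem, and the fixed septuples in a fixed class
form a torsor under `PGL(3, F)`. -/
theorem ncard_fixedSeptuples_eq [IsAlgClosed K] [Algebra.IsAlgebraic F K]
    (hodd : Odd (Fintype.card F)) (σ : Perm (Fin 7)) :
    (fixedClasses F K σ).Finite ∧ ((fixedSeptuples F K σ).ncard : ℤ) =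
      (fixedClasses F K σ).ncard * Nat.card PGL(3, F) := by
  have : Infinite K := IsAlgClosed.instInfinite
  have hfin := finite_fixedSeptuples F (K := K) hodd σ
  have hrep : ∀ x ∈ fixedClasses F K σ, ∃ T ∈ fixedSeptuples F K σ, Quotient.mk _ T = x := by
    rintro x ⟨⟨T, hT, rfl⟩, hx⟩
    obtain ⟨g, hg⟩ := Quotient.exact hx
    replace hg : g • T = frobeniusPerm F σ T := hg
    induction g using ProjGenLinGroup.induction_on with
    | mk G =>
      obtain ⟨H, hH⟩ := exists_map_mul_eq F G
      -- The Frobenius image of `H` times `G` is `H`, so `H • T` is fixed.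
      refine ⟨ProjGenLinGroup.mk H • T, ⟨inGeneralPosition_smul hT _, ?_⟩,
        Quotient.sound ⟨ProjGenLinGroup.mk H, rfl⟩⟩
      rw [frobeniusPerm_mk_smul, ← hg, smul_smul, ← map_mul, hH]
  have hmaps : ∀ T ∈ fixedSeptuples F K σ, (Quotient.mk _ T : SeptupleClass K) ∈ fixedClasses F K σ :=
    fun T hT => ⟨⟨T, hT.1, rfl⟩, congrArg (Quotient.mk _) hT.2⟩
  have hB : (fixedClasses F K σ).Finite := (hfin.image (Quotient.mk _)).subset fun x hx => by
    obtain ⟨T, hT, rfl⟩ := hrep x hx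
    exact ⟨T, hT, rfl⟩
  refine ⟨hB, ncard_eq_mul_of_fiber hfin hB (Quotient.mk _) hmaps fun x hx => ?_⟩
  obtain ⟨T, hT, rfl⟩ := hrep x hx
  rw [Nat.cast_inj]
  have hrat : ∀ g : PGL(3, F), frobeniusPerm F σ (ProjGenLinGroup.map (algebraMap F K) g • T) =
      ProjGenLinGroup.map (algebraMap F K) g • T := fun g => by
    induction g using ProjGenLinGroup.induction_on with
    | mk g =>
      rw [ProjGenLinGroup.map_mk, frobeniusPerm_mk_smul, hT.2]
      congr 2
      ext i j
      simp only [GeneralLinearGroup.map_apply]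
      exact (FiniteField.frobeniusAlgHom F K).commutes _
  have hinj : Injective fun g : PGL(3, F) => ProjGenLinGroup.map (algebraMap F K) g • T := by
    intro g g' h
    refine map_algebraMap_injective F (inv_mul_eq_one.1 (eq_one_of_smul_eq F hodd hT.1 ?_)).symm
    rw [mul_smul, inv_smul_eq_iff]
    exact h
  rw [← Set.ncard_range_of_injective hinj]
  congr 1
  ext T'
  constructor
  · rintro ⟨hT', h⟩
    obtain ⟨g, rfl⟩ := Quotient.exact h
    induction g using ProjGenLinGroup.induction_on with
    | mk H =>
      have h1 : frobeniusPerm F σ (ProjGenLinGroup.mk H • T) = ProjGenLinGroup.mk H • T := hT'.2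
      rw [frobeniusPerm_mk_smul, hT.2] at h1
      obtain ⟨g, hg⟩ := exists_map_algebraMap_eq F (H := H) <| by
        refine (inv_mul_eq_one.1 (eq_one_of_smul_eq F hodd hT.1 ?_)).symm
        rw [mul_smul, inv_smul_eq_iff]
        exact h1
      exact ⟨g, congrArg (· • T) hg⟩
  · rintro ⟨g, rfl⟩
    exact ⟨⟨inGeneralPosition_smul hT.1 _, hrat g⟩, Quotient.sound ⟨_, rfl⟩⟩

end Torsor

/-! ### Arc counts and the table of point counts -/

namespace FrobeniusPlane

variable {P L : Type*} (π : FrobeniusPlane P L)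

/-- Adding a fixed point to the permutation, for given secant data. -/
theorem arcCount_rot_one_cons {l : List ℕ} {x y : ℤ} (a b c d e : ℕ) (hx : π.arcCount (rot l) = x)
    (hs : secantData (rot l) = (a, b, c, d, e) := by decide +kernel)
    (hy : 2 * y = x * (2 * (π.q ^ 2 + π.q + 1) - (2 * a + 2 * (b * (π.q + 1) - c) - d + e)) := by
      push_cast; ring)
    (h2 : 2 ≤ l.sum := by decide) (h5 : l.sum ≤ 5 := by decide) :
    π.arcCount (rot (1 :: l)) = y := by
  have h := π.two_mul_arcCount_addCycle_one (rot l) (by simpa using h2) (by simpa using h5)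
  rw [← arcCount_rot_cons, secantCount_of_data hs, hx] at h
  linarith

/-- Adding a cycle of length two to the permutation, for given secant data. -/
theorem arcCount_rot_two_cons {l : List ℕ} {x y : ℤ} (a b c d e a' b' c' d' e' : ℕ)
    (hx : π.arcCount (rot l) = x) (hl : ∀ i, rot l i ≠ i := by decide +kernel)
    (hs : secantData (rot l) = (a, b, c, d, e) := by decide +kernel)
    (hs' : secantData (rot l ^ 2) = (a', b', c', d', e') := by decide +kernel)
    (hy : 2 * y = x * (2 * (π.q ^ 4 - π.q) -
      (2 * a' + 2 * (b' * (π.q ^ 2 + 1) - c') - d' + e') +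
      (2 * a + 2 * (b * (π.q + 1) - c) - d + e)) := by push_cast; ring)
    (h2 : 2 ≤ l.sum := by decide) (h5 : l.sum ≤ 5 := by decide) :
    π.arcCount (rot (2 :: l)) = y := by
  have h := π.two_mul_arcCount_addCycle_two (rot l) hl (by simpa using h2) (by simpa using h5)
  rw [← arcCount_rot_cons, secantCount_of_data hs, secantCount_of_data hs', hx] at h
  linarith

theorem arcCount_rot_three_cons {l : List ℕ} {x : ℤ} (hx : π.arcCount (rot l) = x)
    (hl : ∀ i, (rot l ^ 3) i ≠ i := by decide +kernel)
    (hl' : ∀ i j, i ≠ j → ((rot l ^ 3) i = rot l i ∧ (rot l ^ 3) j = rot l j) ∨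
      ((rot l ^ 3) i = rot l j ∧ (rot l ^ 3) j = rot l i) ∨
      ((rot l ^ 3) i = j ∧ (rot l ^ 3) j ≠ i) ∨ ((rot l ^ 3) j = i ∧ (rot l ^ 3) i ≠ j) := by decide +kernel)
    (h2 : 2 ≤ l.sum := by decide) :
    π.arcCount (rot (3 :: l)) = x * (π.q ^ 3 * (π.q - 1) ^ 2 * (π.q + 1)) := by
  rw [arcCount_rot_cons, π.arcCount_addCycle_three (rot l) (by simpa using h2) hl hl', hx,
    arcCount_three]

theorem arcCount_rot_of_sum_eq_two {l : List ℕ} (hl : ∀ d ∈ l, 0 < d ∧ d ≤ 7) (h2 : l.sum = 2) :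
    π.arcCount (rot l) =
      confCount (exactCount fun d => (π.q : ℤ) ^ (2 * d) + (π.q : ℤ) ^ d + 1) l := by
  rw [← ncard_twisted_injective_mem (φ := π.frob) (C := Set.univ) (fun _ _ => trivial)
    (fun d hd => (π.finite_points d hd).subset fun x hx => hx.1) _ l (fun d hd => (hl d hd).1)
    fun d hd => by
      simpa using π.ncard_exactPeriod_points (hl d hd).1 (hl d hd).2, arcCount]
  congr 2
  ext T
  refine and_congr_right fun _ => ⟨fun h => ⟨h.1, fun _ => trivial⟩, fun h =>
    ⟨h.1, fun _ i j k hij hik hjk => ?_⟩⟩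
  have := card_le_univ ({i, j, k} : Finset (Fin l.sum))
  rw [card_eq_three.2 ⟨i, j, k, hij, hik, hjk, rfl⟩, Fintype.card_fin] at this
  omega

theorem arcCount_one_one : π.arcCount (rot [1, 1]) = (π.q ^ 2 + π.q + 1) * (π.q ^ 2 + π.q) := by
  rw [π.arcCount_rot_of_sum_eq_two (by decide) rfl]
  simp [confCount, exactCount]

theorem arcCount_two : π.arcCount (rot [2]) = π.q ^ 4 - π.q := by
  rw [π.arcCount_rot_of_sum_eq_two (by decide) rfl]
  simp [confCount, exactCount]
  ring

theorem arcCount_four : π.arcCount (rot [4]) = π.q ^ 3 * (π.q ^ 3 - 1) * (π.q ^ 2 - 1) := by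
  rw [π.arcCount_rot_singleton_of_trivial (n := 3) (by norm_num) (by norm_num)
    (fun x l _ S _ => (by decide +kernel : ∀ S : Finset (Fin 4), 3 ≤ S.card →
      (∀ m, 2 ≤ (S ∩ S.image (· + m)).card → S.image (· + m) = S) → S = univ) S)]
  simp only [exactCount]
  ring

theorem arcCount_one_one_one : π.arcCount (rot [1, 1, 1]) =
    (π.q ^ 2 + π.q + 1) * (π.q ^ 2 + π.q) * (π.q ^ 2) :=
  π.arcCount_rot_one_cons 2 1 2 0 0 π.arcCount_one_one

theorem arcCount_one_one_one_one : π.arcCount (rot [1, 1, 1, 1]) =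
    π.q ^ 3 * (π.q ^ 3 - 1) * (π.q ^ 2 - 1) :=
  π.arcCount_rot_one_cons 3 3 6 0 0 π.arcCount_one_one_one

theorem arcCount_one_one_one_one_one : π.arcCount (rot [1, 1, 1, 1, 1]) =
    π.q ^ 3 * (π.q ^ 3 - 1) * (π.q ^ 2 - 1) * ((π.q - 2) * (π.q - 3)) :=
  π.arcCount_rot_one_cons 4 6 12 6 0 π.arcCount_one_one_one_one

theorem arcCount_one_one_one_one_one_one : π.arcCount (rot [1, 1, 1, 1, 1, 1]) =
    π.q ^ 3 * (π.q ^ 3 - 1) * (π.q ^ 2 - 1) * ((π.q - 2) * (π.q - 3)) * (π.q ^ 2 - 9 * π.q + 21) :=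
  π.arcCount_rot_one_cons 5 10 20 30 0 π.arcCount_one_one_one_one_one

theorem arcCount_one_two : π.arcCount (rot [1, 2]) =
    (π.q ^ 4 - π.q) * (π.q ^ 2) :=
  π.arcCount_rot_one_cons 0 1 0 0 0 π.arcCount_two

theorem arcCount_one_one_two : π.arcCount (rot [1, 1, 2]) =
    π.q ^ 3 * (π.q ^ 3 - 1) * (π.q ^ 2 - 1) :=
  π.arcCount_rot_one_cons 1 1 0 0 0 π.arcCount_one_two

theorem arcCount_one_one_one_two : π.arcCount (rot [1, 1, 1, 2]) =
    π.q ^ 3 * (π.q ^ 3 - 1) * (π.q ^ 2 - 1) * (π.q ^ 2 - π.q) :=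
  π.arcCount_rot_one_cons 2 2 2 2 0 π.arcCount_one_one_two

theorem arcCount_one_one_one_one_two : π.arcCount (rot [1, 1, 1, 1, 2]) =
    π.q ^ 3 * (π.q ^ 3 - 1) * (π.q ^ 2 - 1) * (π.q ^ 2 - π.q) * (π.q ^ 2 - 3 * π.q + 3) :=
  π.arcCount_rot_one_cons 3 4 6 6 0 π.arcCount_one_one_one_two

theorem arcCount_two_two : π.arcCount (rot [2, 2]) =
    π.q ^ 3 * (π.q ^ 3 - 1) * (π.q ^ 2 - 1) :=
  π.arcCount_rot_two_cons 0 1 0 0 0 2 1 2 0 0 π.arcCount_two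

theorem arcCount_one_two_two : π.arcCount (rot [1, 2, 2]) =
    π.q ^ 3 * (π.q ^ 3 - 1) * (π.q ^ 2 - 1) * (π.q ^ 2 - π.q - 2) :=
  π.arcCount_rot_one_cons 0 2 0 2 4 π.arcCount_two_two

theorem arcCount_one_one_two_two : π.arcCount (rot [1, 1, 2, 2]) =
    π.q ^ 3 * (π.q ^ 3 - 1) * (π.q ^ 2 - 1) * (π.q ^ 2 - π.q - 2) * (π.q ^ 2 - π.q - 3) :=
  π.arcCount_rot_one_cons 1 2 0 2 4 π.arcCount_one_two_two

theorem arcCount_two_two_two : π.arcCount (rot [2, 2, 2]) =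
    π.q ^ 3 * (π.q ^ 3 - 1) * (π.q ^ 2 - 1) * (π.q ^ 4 - 6 * π.q ^ 2 + π.q + 8) :=
  π.arcCount_rot_two_cons 0 2 0 2 4 4 6 12 6 0 π.arcCount_two_two

theorem arcCount_one_three : π.arcCount (rot [1, 3]) =
    π.q ^ 3 * (π.q ^ 3 - 1) * (π.q ^ 2 - 1) :=
  π.arcCount_rot_one_cons 0 0 0 0 0 π.arcCount_three

theorem arcCount_one_one_three : π.arcCount (rot [1, 1, 3]) =
    π.q ^ 3 * (π.q ^ 3 - 1) * (π.q ^ 2 - 1) * (π.q ^ 2 + π.q) :=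
  π.arcCount_rot_one_cons 1 0 0 0 0 π.arcCount_one_three

theorem arcCount_one_one_one_three : π.arcCount (rot [1, 1, 1, 3]) =
    π.q ^ 3 * (π.q ^ 3 - 1) * (π.q ^ 2 - 1) * (π.q ^ 2 + π.q) * (π.q ^ 2) :=
  π.arcCount_rot_one_cons 2 1 2 0 0 π.arcCount_one_one_three

theorem arcCount_two_three : π.arcCount (rot [2, 3]) =
    π.q ^ 3 * (π.q - 1) ^ 2 * (π.q + 1) * (π.q ^ 4 - π.q) :=
  π.arcCount_rot_two_cons 0 0 0 0 0 0 0 0 0 0 π.arcCount_three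

theorem arcCount_one_two_three : π.arcCount (rot [1, 2, 3]) =
    π.q ^ 3 * (π.q - 1) ^ 2 * (π.q + 1) * (π.q ^ 4 - π.q) * (π.q ^ 2) :=
  π.arcCount_rot_one_cons 0 1 0 0 0 π.arcCount_two_three

theorem arcCount_one_four : π.arcCount (rot [1, 4]) =
    π.q ^ 3 * (π.q ^ 3 - 1) * (π.q ^ 2 - 1) * (π.q ^ 2 + π.q) :=
  π.arcCount_rot_one_cons 0 0 0 0 2 π.arcCount_four

theorem arcCount_one_one_four : π.arcCount (rot [1, 1, 4]) =
    π.q ^ 3 * (π.q ^ 3 - 1) * (π.q ^ 2 - 1) * (π.q ^ 2 + π.q) * (π.q ^ 2 + π.q - 1) :=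
  π.arcCount_rot_one_cons 1 0 0 0 2 π.arcCount_one_four

theorem arcCount_two_four : π.arcCount (rot [2, 4]) =
    π.q ^ 3 * (π.q ^ 3 - 1) * (π.q ^ 2 - 1) * (π.q ^ 4 - 2 * π.q ^ 2 - π.q - 2) :=
  π.arcCount_rot_two_cons 0 0 0 0 2 0 2 0 2 4 π.arcCount_four

theorem arcCount_one_five : π.arcCount (rot [1, 5]) =
    π.q ^ 3 * (π.q ^ 3 - 1) * (π.q ^ 4 - 1) * (π.q ^ 2 + π.q + 1) :=
  π.arcCount_rot_one_cons 0 0 0 0 0 π.arcCount_five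

theorem arcCount_two_five : π.arcCount (rot [2, 5]) =
    π.q ^ 3 * (π.q ^ 3 - 1) * (π.q ^ 4 - 1) * (π.q ^ 4 - π.q) :=
  π.arcCount_rot_two_cons 0 0 0 0 0 0 0 0 0 0 π.arcCount_five

theorem arcCount_three_four : π.arcCount (rot [3, 4]) =
    π.q ^ 3 * (π.q ^ 3 - 1) * (π.q ^ 2 - 1) * (π.q ^ 3 * (π.q - 1) ^ 2 * (π.q + 1)) :=
  π.arcCount_rot_three_cons π.arcCount_four

theorem arcCount_three_two_two : π.arcCount (rot [3, 2, 2]) =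
    π.q ^ 3 * (π.q ^ 3 - 1) * (π.q ^ 2 - 1) * (π.q ^ 3 * (π.q - 1) ^ 2 * (π.q + 1)) :=
  π.arcCount_rot_three_cons π.arcCount_two_two

end FrobeniusPlane

namespace ConicSystem

variable {P L : Type*} {π : FrobeniusPlane P L} (Γ : ConicSystem π)

theorem goodCount_rot_of_forall_ne {l : List ℕ} (hl : ∀ i, rot l i ≠ i) {x : ℤ}
    (hx : π.arcCount (rot l) = x) (h7 : l.sum = 7 := by decide)
    (hd : ∀ d ∈ l, 0 < d ∧ d ≤ 7 := by decide) :
    Γ.goodCount (rot l) = x - π.q ^ 2 * (π.q ^ 3 - 1) * conicConfCount π.q l := by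
  rw [Γ.goodCount_eq (by simpa using h7), hx, filter_false_of_mem fun i _ => hl i,
    sum_empty, sub_zero, Γ.ncard_arc_onConic l hd (Fin.castLEEmb (by omega)), ncard_rational]

/-- Septuples consisting of a fixed point and six points in cycles of lengths `l`, for given secant data and
given signed counts of concurrent synthemes. -/
theorem two_mul_goodCount_rot_one_cons {l : List ℕ} {x s t : ℤ} {n b c d e : ℕ}
    (hs : secantData (rot l) = (n, b, c, d, e)) (hx : π.arcCount (rot l) = x)
    (hS : π.concSum (rot l) (fun _ => True) = s) (hT : π.concSum (rot l) Γ.OnConic = t)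
    (h6 : l.sum = 6 := by decide) (hd : ∀ d ∈ l, 0 < d ∧ d ≤ 7 := by decide) :
    2 * Γ.goodCount (rot (1 :: l)) =
      (x - (n + 1) * (π.q ^ 2 * (π.q ^ 3 - 1) * conicConfCount π.q l)) *
          (2 * (π.q ^ 2 + π.q + 1) - (2 * n + 2 * (b * (π.q + 1) - c) - d + e)) - 2 * s +
        2 * (n + 1) * t + 2 * n * (π.q ^ 2 * (π.q ^ 3 - 1) * conicConfCount π.q (1 :: l)) := by
  have h7 := Γ.ncard_arc_onConic (1 :: l) (by simpa using hd)
    (Fin.castLEEmb (by rw [List.sum_cons]; omega))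
  have h8 := Γ.ncard_arc_onConic l hd (Fin.castLEEmb (by omega))
  rw [ncard_rational] at h7 h8
  have h9 : {T ∈ Twisted π.frob (addCycle 1 (rot l)) | π.Arc T ∧ Γ.OnConic T}.ncard =
      {T ∈ Twisted π.frob (rot (1 :: l)) | π.Arc T ∧ Γ.OnConic T}.ncard :=
    Twisted.ncard_congr (blockEquiv 1 l) (rot_cons_apply 1 l) _ _ fun T => by
      rw [π.arc_comp_iff, Γ.onConic_comp_iff]
  have h := Γ.goodCount_addCycle_one (by simpa using h6) (rot l) (congrArg Prod.fst hs) h8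
    ((congrArg Nat.cast h9).trans h7)
  rw [secantCount_of_data hs, hx, hS, hT,
    Γ.goodCount_congr (blockEquiv 1 l) (rot_cons_apply 1 l)] at h
  dsimp only at h
  linear_combination h

end ConicSystem

section PointCounts

variable {F K : Type*} [Field F] [Fintype F] [Field K] [Algebra F K] [IsAlgClosed K]

theorem projectivePlane_q (hodd : Odd (Fintype.card F)) :
    (projectivePlane F K hodd).q = Fintype.card F := rfl

/-- Entries of the table without a part `1`: septuples with exactly six points on a conic do not exist. -/
theorem exists_goodCount_eq_of_forall_ne {hodd : Odd (Fintype.card F)} {l : List ℕ}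
    {x : FrobeniusPlane (Plane K) (Plane K) → ℤ}
    {m : Multiset ℕ} {y : Polynomial ℤ} (hx : ∀ π, π.arcCount (rot l) = x π)
    (h7 : l.sum = 7 := by decide) (hm : (rot l).partition.parts = m := by decide +kernel)
    (hl : ∀ i, rot l i ≠ i := by decide +kernel) (hd : ∀ d ∈ l, 0 < d ∧ d ≤ 7 := by decide)
    (hy : ∀ q : ℤ, q = Fintype.card F → x (projectivePlane F K hodd) - q ^ 2 * (q ^ 3 - 1) * ConicSystem.conicConfCount q l =
      (q ^ 2 + q + 1) * (q ^ 3 - q) * (q ^ 2 * (q - 1)) * y.eval q := by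
      intro q hq
      simp [ConicSystem.conicConfCount, confCount, exactCount, projectivePlane_q, ← hq]
      ring) :
    ∃ ρ : Perm (Fin 7), ρ.partition.parts = m ∧ (planeConics K F hodd).goodCount ρ =
      ((Fintype.card F : ℤ) ^ 2 + Fintype.card F + 1) * ((Fintype.card F : ℤ) ^ 3 - Fintype.card F) *
        ((Fintype.card F : ℤ) ^ 2 * (Fintype.card F - 1)) * y.eval (Fintype.card F : ℤ) := by
  rw [← h7]
  exact ⟨rot l, hm, ((planeConics K F hodd).goodCount_rot_of_forall_ne hl (hx _) h7 hd).trans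
    (hy _ rfl)⟩

/-- Entries of the table with a part `1`. -/
theorem exists_goodCount_eq_of_one_cons {hodd : Odd (Fintype.card F)} {l : List ℕ}
    {x : FrobeniusPlane (Plane K) (Plane K) → ℤ}
    {s t : ℤ → ℤ} {m : Multiset ℕ} {y : Polynomial ℤ} (n b c d e : ℕ)
    (hx : ∀ π, π.arcCount (rot l) = x π)
    (hc : ConcSums K hodd (rot l) s t) (h6 : l.sum = 6 := by decide)
    (hm : (rot (1 :: l)).partition.parts = m := by decide +kernel)
    (hs : secantData (rot l) = (n, b, c, d, e) := by decide +kernel)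
    (hd : ∀ d ∈ l, 0 < d ∧ d ≤ 7 := by decide)
    (hy : ∀ q : ℤ, q = Fintype.card F →
      2 * ((q ^ 2 + q + 1) * (q ^ 3 - q) * (q ^ 2 * (q - 1)) * y.eval q) =
        (x (projectivePlane F K hodd) - (n + 1) * (q ^ 2 * (q ^ 3 - 1) * ConicSystem.conicConfCount q l)) *
            (2 * (q ^ 2 + q + 1) - (2 * n + 2 * (b * (q + 1) - c) - d + e)) -
          2 * ((q ^ 2 + q + 1) * (q ^ 3 - q) * (q ^ 2 * (q - 1)) * s q) +
          2 * (n + 1) * ((q ^ 2 + q + 1) * (q ^ 3 - q) * (q ^ 2 * (q - 1)) * t q) +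
          2 * n * (q ^ 2 * (q ^ 3 - 1) * ConicSystem.conicConfCount q (1 :: l)) := by
      intro q hq
      simp [ConicSystem.conicConfCount, confCount, exactCount, projectivePlane_q, ← hq]
      ring) :
    ∃ ρ : Perm (Fin 7), ρ.partition.parts = m ∧ (planeConics K F hodd).goodCount ρ =
      ((Fintype.card F : ℤ) ^ 2 + Fintype.card F + 1) * ((Fintype.card F : ℤ) ^ 3 - Fintype.card F) *
        ((Fintype.card F : ℤ) ^ 2 * (Fintype.card F - 1)) * y.eval (Fintype.card F : ℤ) := by
  rw [show 7 = (1 :: l).sum by rw [List.sum_cons, h6]]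
  exact ⟨rot (1 :: l), hm, mul_left_cancel₀ two_ne_zero
    (((planeConics K F hodd).two_mul_goodCount_rot_one_cons hs (hx _) (hc _ rfl).1 (hc _ rfl).2 h6
      hd).trans (hy _ rfl).symm)⟩

open FrobeniusPlane in
/-- Each entry of the table gives the number of septuples for some permutation of its cycle type. The first
three factors are the order of `PGL(3, F)`. -/
theorem exists_goodCount_eq (hodd : Odd (Fintype.card F)) : ∀ y ∈ pointCountTable,
    ∃ ρ : Perm (Fin 7), ρ.partition.parts = y.1 ∧ (planeConics K F hodd).goodCount ρ =
      ((Fintype.card F : ℤ) ^ 2 + Fintype.card F + 1) * ((Fintype.card F : ℤ) ^ 3 - Fintype.card F) *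
        ((Fintype.card F : ℤ) ^ 2 * (Fintype.card F - 1)) * y.2.eval (Fintype.card F : ℤ) := by
  simp only [pointCountTable, List.forall_mem_cons, List.not_mem_nil, false_implies, implies_true,
    and_true]
  exact ⟨exists_goodCount_eq_of_forall_ne arcCount_seven,
    exists_goodCount_eq_of_one_cons 0 0 0 0 0 arcCount_six (concSums_six hodd),
    exists_goodCount_eq_of_forall_ne arcCount_two_five,
    exists_goodCount_eq_of_one_cons 1 0 0 0 0 arcCount_one_five (concSums_one_five hodd),
    exists_goodCount_eq_of_forall_ne arcCount_three_four,
    exists_goodCount_eq_of_one_cons 0 1 0 0 2 arcCount_two_four (concSums_two_four hodd),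
    exists_goodCount_eq_of_one_cons 2 1 2 0 2 arcCount_one_one_four (concSums_one_one_four hodd),
    exists_goodCount_eq_of_one_cons 0 0 0 0 0 arcCount_three_three (concSums_three_three hodd),
    exists_goodCount_eq_of_forall_ne arcCount_three_two_two,
    exists_goodCount_eq_of_one_cons 1 1 0 0 0 arcCount_one_two_three (concSums_one_two_three hodd),
    exists_goodCount_eq_of_one_cons 3 3 6 0 0 arcCount_one_one_one_three (concSums_one_one_one_three hodd),
    exists_goodCount_eq_of_one_cons 0 3 0 6 12 arcCount_two_two_two (concSums_two_two_two hodd),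
    exists_goodCount_eq_of_one_cons 2 3 2 6 4 arcCount_one_one_two_two (concSums_one_one_two_two hodd),
    exists_goodCount_eq_of_one_cons 4 7 12 18 0 arcCount_one_one_one_one_two (concSums_one_one_one_one_two hodd),
    exists_goodCount_eq_of_one_cons 6 15 30 90 0 arcCount_one_one_one_one_one_one (concSums_one_one_one_one_one_one hodd)⟩

theorem monic_and_natDegree_of_mem_pointCountTable :
    ∀ y ∈ pointCountTable, y.2.Monic ∧ y.2.natDegree = 6 := by
  simp only [pointCountTable, List.forall_mem_cons, List.not_mem_nil, false_implies, implies_true,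
    and_true]
  refine ⟨?_, ?_, ?_, ?_, ?_, ?_, ?_, ?_, ?_, ?_, ?_, ?_, ?_, ?_, ?_⟩ <;>
    exact ⟨by monicity!, by compute_degree!⟩

/-- All multisets of at most `m` positive integers with sum at most `n`, possibly with
repetitions in the list. -/
def positiveMultisets : ℕ → ℕ → List (Multiset ℕ)
  | 0, _ => [0]
  | m + 1, n => 0 :: (List.range n).flatMap fun k => (positiveMultisets m k).map ((n - k) ::ₘ ·)

theorem mem_positiveMultisets : ∀ (m n : ℕ) (s : Multiset ℕ), (∀ x ∈ s, 0 < x) → s.sum = n →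
    n ≤ m → s ∈ positiveMultisets m n := by
  intro m
  induction m with
  | zero =>
    intro n s hs hn hm
    have : s = 0 := Multiset.eq_zero_of_forall_notMem fun x hx => by
      have := Multiset.single_le_sum (by simp) x hx
      have := hs x hx
      omega
    simp [positiveMultisets, this]
  | succ m ih =>
    intro n s hs hn hm
    rw [positiveMultisets, List.mem_cons, List.mem_flatMap]
    rcases s.empty_or_exists_mem with h | ⟨a, ha⟩
    · exact .inl h
    · obtain ⟨t, rfl⟩ := Multiset.exists_cons_of_mem ha
      have h0 := hs a ha
      rw [Multiset.sum_cons] at hn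
      refine .inr ⟨t.sum, List.mem_range.2 (by omega), List.mem_map.2 ⟨t, ih _ t (fun x hx =>
        hs x (Multiset.mem_cons_of_mem hx)) rfl (by omega), ?_⟩⟩
      rw [← hn, Nat.add_sub_cancel]

theorem exists_mem_pointCountTable (p : Nat.Partition 7) : ∃ y ∈ pointCountTable, p.parts = y.1 := by
  have h : p.parts ∈ pointCountTable.map Prod.fst :=
    (by decide +kernel : ∀ s ∈ positiveMultisets 7 7, s.sum = 7 →
      s ∈ ([{7}, {6, 1}, {5, 2}, {5, 1, 1}, {4, 3}, {4, 2, 1}, {4, 1, 1, 1}, {3, 3, 1}, {3, 2, 2},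
        {3, 2, 1, 1}, {3, 1, 1, 1, 1}, {2, 2, 2, 1}, {2, 2, 1, 1, 1}, {2, 1, 1, 1, 1, 1},
        {1, 1, 1, 1, 1, 1, 1}] : List (Multiset ℕ))) _
      (mem_positiveMultisets 7 7 _ (fun _ => p.parts_pos) p.parts_sum le_rfl) p.parts_sum
  obtain ⟨y, hy, h⟩ := List.mem_map.1 h
  exact ⟨y, hy, h.symm⟩

/-- The number of septuples in general position depends only on the cycle type. -/
theorem ncard_fixedSeptuples_of_mem (hodd : Odd (Fintype.card F)) {σ : Perm (Fin 7)}
    {y : Multiset ℕ × Polynomial ℤ} (hy : y ∈ pointCountTable) (hσ : σ.partition.parts = y.1) :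
    ((fixedSeptuples F K σ).ncard : ℤ) = Nat.card PGL(3, F) * y.2.eval (Fintype.card F : ℤ) := by
  obtain ⟨ρ, hρ, h⟩ := exists_goodCount_eq (K := K) hodd y hy
  obtain ⟨c, hc⟩ := isConj_iff.1 (Equiv.Perm.partition_eq_of_isConj.2 (Nat.Partition.ext
    (show ρ.partition.parts = σ⁻¹.partition.parts by
      rw [hρ, ← hσ, Equiv.Perm.parts_partition, Equiv.Perm.parts_partition, Equiv.Perm.cycleType_inv,
        Equiv.Perm.support_inv])))
  rw [ncard_fixedSeptuples F hodd, card_PGL, ← h]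
  exact ((planeConics K F hodd).goodCount_congr c fun i => by simp [← hc]).symm

end PointCounts

end PlaneSeptuples

theorem mainTheorem5 (F K : Type*) [Field F] [Fintype F] [Field K] [Algebra F K]
    [IsAlgClosure F K] (hodd : Odd (Fintype.card F)) (σ : Equiv.Perm (Fin 7)) :
    ∃ P : Polynomial ℤ, (σ.partition.parts, P) ∈ PlaneSeptuples.pointCountTable ∧
      P.Monic ∧ P.natDegree = 6 ∧
      (PlaneSeptuples.fixedSeptuples F K σ).Finite ∧
      ((PlaneSeptuples.fixedSeptuples F K σ).ncard : ℚ) / (Nat.card PGL(3, F) : ℚ) =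
        ((P.eval (Fintype.card F : ℤ) : ℤ) : ℚ) ∧
      (PlaneSeptuples.fixedClasses F K σ).Finite ∧
      ((PlaneSeptuples.fixedClasses F K σ).ncard : ℤ) = P.eval (Fintype.card F : ℤ) := by
  have := IsAlgClosure.isAlgClosed F (K := K)
  have := IsAlgClosure.isAlgebraic (R := F) (K := K)
  obtain ⟨y, hy, hσ⟩ := PlaneSeptuples.exists_mem_pointCountTable σ.partition
  obtain ⟨hmonic, hdeg⟩ := PlaneSeptuples.monic_and_natDegree_of_mem_pointCountTable y hy
  have h1 := PlaneSeptuples.ncard_fixedSeptuples_of_mem (K := K) hodd hy hσ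
  obtain ⟨hfin, h2⟩ := PlaneSeptuples.ncard_fixedSeptuples_eq F (K := K) hodd σ
  have hpos : (Nat.card PGL(3, F) : ℤ) ≠ 0 := by
    have : Finite PGL(3, F) := Finite.of_surjective _ Matrix.ProjGenLinGroup.mk_surjective
    exact_mod_cast Nat.card_pos.ne'
  refine ⟨y.2, hσ ▸ hy, hmonic, hdeg, PlaneSeptuples.finite_fixedSeptuples F hodd σ, ?_, hfin, ?_⟩
  · rw [div_eq_iff (by exact_mod_cast hpos), mul_comm]
    exact_mod_cast h1
  · rw [h2, mul_comm] at h1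
    exact mul_left_cancel₀ hpos h1
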